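/- Let $N\ge 1$ be an integer and let $\zeta:[0,\infty)\to[0,1]$ be smooth with $\zeta=1$ on $[0,3/2]$ and $\operatorname{supp}\zeta\subset[0,5/3)$. On $\mathbf R^N$ put $\varphi_{(0)}(\xi)=\zeta(|\xi|)$ and $\varphi_j(\xi)=\zeta(2^{-j}|\xi|)-\zeta(2^{1-j}|\xi|)$ for $j\in\mathbf Z$. For $1\le q\le p<\infty$ let $$\|f\,|\,M^p_q\|=\sup_{x\in\mathbf R^N,\ 0<\rho\le 1}\rho^{N/p-N/q}\|f\|_{L^q(B(x,\rho))},$$ and let $N^s_{p,q,\infty}$ be the space of tempered distributions $\varphi$ on $\mathbf R^N$ with $$\|\mathcal F^{-1}\varphi_{(0)}\mathcal F\varphi\,|\,M^p_q\|+\sup_{j\ge1}2^{sj}\|\mathcal F^{-1}\varphi_j\mathcal F\varphi\,|\,M^p_q\|<\infty .$$ For $\theta>1$ let $S(t)=\mathcal F^{-1}e^{-t|\xi|^\theta}\mathcal F$. On functions $S(t)$ acts by convolution with $\mathcal F^{-1}e^{-t|\xi|^\theta}$. For $\varphi\in N^s_{p,q,\infty}$, $$S(t)\varphi=S(t)\big(\mathcal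 F^{-1}\varphi_{(0)}\mathcal F\varphi\big)+\mathcal F^{-1}(1-\varphi_{(0)})e^{-t|\xi|^\theta}\mathcal F\varphi ,$$ which is a continuous function for $t>0$. For $\varphi\in N^s_{p,q,\infty}$ and $T>0$, a complex-valued function $u$ on $\mathbf R^N\times(0,T)$ is called a solution on $\mathbf R^N\times[0,T)$ of $$\partial_tu+(-\Delta)^{\theta/2}u=|\nabla u|^\gamma,\qquad u(\cdot,0)=\varphi, \tag{HJ}$$ if, for every $\tau\in(0,T)$, both $u$ and $\nabla u$ are bounded and continuous on $\mathbf R^N\times(\tau,T)$, and for all $x\in\mathbf R^N$ and $t\in(0,T)$ $$u(x,t)=[S(t)\varphi](x)+\int_0^t\big[S(t-\tau)|\nabla u(\cdot,\tau)|^\gamma\big](x)\,d\tau ,$$ where the integral converges absolutely. **Theorem.** Let $1<\gamma<\theta$, $\gamma\le q\le p<\infty$, $p>N(\gamma-1)/(\theta-1)$, $1-\theta/\gamma<s<0$ and $s\ge N/p+(\gamma-\theta)/(\gamma-1)$. Then there exist $\delta>0$ and $M>0$ such that for every $\varphi\in N^s_{p,q,\infty}$ with $$\limsup_{j\to\infty}2^{sj}\|\mathcal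 F^{-1}\varphi_j\mathcal F\varphi\,|\,M^p_q\|<\delta$$ there is a $T>0$ for which (HJ) has exactly one solution $u$ on $\mathbf R^N\times[0,T)$ satisfying $$\sup_{0<t<T}t^{-s/\theta}\|u(\cdot,t)\,|\,M^p_q\|\le M\quad\text{and}\quad \sup_{0<t<T}t^{(1-s)/\theta}\|\nabla u(\cdot,t)\,|\,M^p_q\|\le M .$$ If $\varphi$ is real (takes real values on real test functions), then $u$ is real-valued. -/

import Mathlib

noncomputable section

namespace BesovMorrey

open MeasureTheory Set Filter
open scoped ENNReal SchwartzMap FourierTransform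

/-- Euclidean space of dimension `N`. -/
abbrev Sp (N : ℕ) := EuclideanSpace ℝ (Fin N)

/-! ### Local Morrey spaces -/

/-- The local Morrey norm
`‖f | M^p_q‖ = sup_{x, 0 < ρ ≤ 1} ρ^(N/p - N/q) ‖f | L^q(B(x,ρ))‖`, with values in `[0, ∞]`. -/
def morreyNorm {N : ℕ} {F : Type*} [NormedAddCommGroup F] (p q : ℝ) (f : Sp N → F) : ℝ≥0∞ :=
  ⨆ (x : Sp N) (ρ : ℝ) (_ : 0 < ρ) (_ : ρ ≤ 1),
    ENNReal.ofReal (ρ ^ ((N : ℝ) / p - (N : ℝ) / q)) *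
      eLpNorm f (ENNReal.ofReal q) (volume.restrict (Metric.ball x ρ))

/-- The tempered distribution `v` is (integration against) the function `f`. -/
def Represents {N : ℕ} (v : 𝓢'(Sp N, ℂ)) (f : Sp N → ℂ) : Prop :=
  ∀ ψ : 𝓢(Sp N, ℂ), Integrable (fun x => ψ x * f x) ∧ v ψ = ∫ x, ψ x * f x

/-- The local Morrey norm of a tempered distribution: the norm of the measurable function that
represents it, and `∞` if there is none. (Two representing functions agree almost everywhere, so
the infimum runs over equal numbers.) -/
def distMorreyNorm {N : ℕ} (p q : ℝ) (v : 𝓢'(Sp N, ℂ)) : ℝ≥0∞ :=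
  ⨅ (f : Sp N → ℂ) (_ : AEStronglyMeasurable f volume) (_ : Represents v f), morreyNorm p q f

/-! ### Littlewood–Paley decomposition and Besov–Morrey spaces -/

/-- `ζ` is smooth on `[0, ∞)`, `0 ≤ ζ ≤ 1`, `ζ = 1` on `[0, 3/2]` and
`supp ζ ⊂ [0, 5/3)`. (Values at negative arguments are never used.) -/
structure IsCutoff (ζ : ℝ → ℝ) : Prop where
  smooth : ContDiffOn ℝ ((⊤ : ℕ∞) : WithTop ℕ∞) ζ (Ici 0)
  mem_Icc : ∀ t, 0 ≤ t → ζ t ∈ Icc (0 : ℝ) 1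
  eq_one : ∀ t ∈ Icc (0 : ℝ) (3 / 2), ζ t = 1
  supp : closure {t | 0 ≤ t ∧ ζ t ≠ 0} ⊆ Ico (0 : ℝ) (5 / 3)

/-- The operator `𝓕⁻¹ m 𝓕` on tempered distributions for the classical Fourier transform
`∫ e^{-i x·ξ} f(x) dx`, for which `∂_j` has the symbol `i ξ_j`. Mathlib's transform is
`∫ e^{-2πi x·ξ} f(x) dx`, hence the dilation by `2π`. Meaningful for smooth `m` of temperate
growth. -/
def multiplier {N : ℕ} (m : Sp N → ℝ) (v : 𝓢'(Sp N, ℂ)) : 𝓢'(Sp N, ℂ) :=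
  TemperedDistribution.fourierMultiplierCLM ℂ
    (fun ξ : Sp N => ((m ((2 * Real.pi) • ξ) : ℝ) : ℂ)) v

/-- `φ_(0)(ξ) = ζ(|ξ|)`. -/
def lowSymbol {N : ℕ} (ζ : ℝ → ℝ) (ξ : Sp N) : ℝ := ζ ‖ξ‖

/-- `φ_j(ξ) = ζ(2^{-j}|ξ|) - ζ(2^{1-j}|ξ|)`. -/
def dyadicSymbol {N : ℕ} (ζ : ℝ → ℝ) (j : ℤ) (ξ : Sp N) : ℝ :=
  ζ ((2 : ℝ) ^ (-j) * ‖ξ‖) - ζ ((2 : ℝ) ^ (1 - j) * ‖ξ‖)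

/-- The weighted block norm `2^{sj} ‖𝓕⁻¹ φ_j 𝓕 φ | M^p_q‖`. -/
def weightedBlock {N : ℕ} (ζ : ℝ → ℝ) (p q s : ℝ) (φ : 𝓢'(Sp N, ℂ)) (j : ℕ) : ℝ≥0∞ :=
  ENNReal.ofReal ((2 : ℝ) ^ (s * j)) *
    distMorreyNorm p q (multiplier (dyadicSymbol ζ (j : ℤ)) φ)

/-- The norm of the inhomogeneous Besov–Morrey space `N^s_{p,q,∞}`. -/
def besovMorreyNorm {N : ℕ} (ζ : ℝ → ℝ) (p q s : ℝ) (φ : 𝓢'(Sp N, ℂ)) : ℝ≥0∞ :=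
  distMorreyNorm p q (multiplier (lowSymbol ζ) φ) +
    ⨆ (j : ℕ) (_ : 1 ≤ j), weightedBlock ζ p q s φ j

/-- Membership in `N^s_{p,q,∞}`. -/
def MemBesovMorrey {N : ℕ} (ζ : ℝ → ℝ) (p q s : ℝ) (φ : 𝓢'(Sp N, ℂ)) : Prop :=
  besovMorreyNorm ζ p q s φ < ∞

/-! ### The semigroup `S(t) = 𝓕⁻¹ exp(-t|ξ|^θ) 𝓕` -/

/-- The symbol `exp(-t|ξ|^θ)`. -/
def heatSymbol {N : ℕ} (θ t : ℝ) (ξ : Sp N) : ℝ := Real.exp (-t * ‖ξ‖ ^ θ)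

/-- The kernel `𝓕⁻¹ exp(-t|ξ|^θ) = (2π)^{-N} ∫ e^{i x·ξ} exp(-t|ξ|^θ) dξ`. -/
def heatKernel {N : ℕ} (θ t : ℝ) : Sp N → ℂ :=
  𝓕⁻ (fun ξ : Sp N => ((heatSymbol θ t ((2 * Real.pi) • ξ) : ℝ) : ℂ))

/-- `S(t) f` for a function `f`: convolution with the kernel. -/
def heatFun {N : ℕ} (θ t : ℝ) (f : Sp N → ℂ) (x : Sp N) : ℂ :=
  ∫ y, heatKernel θ t (x - y) * f y

/-- The continuous function `g` is `S(t)φ`, for a tempered distribution `φ`. Since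
`exp(-t|ξ|^θ)` need not be smooth at the origin, the product `exp(-t|ξ|^θ) 𝓕φ` is split by
`1 = φ_(0) + (1 - φ_(0))`: away from the origin the symbol `(1 - φ_(0)) exp(-t|ξ|^θ)` is smooth
with bounded derivatives and acts on all tempered distributions; the low-frequency part
`𝓕⁻¹ φ_(0) 𝓕 φ` is a function, on which `S(t)` acts by convolution. -/
def IsHeatEvolution {N : ℕ} (ζ : ℝ → ℝ) (θ t : ℝ) (φ : 𝓢'(Sp N, ℂ)) (g : Sp N → ℂ) : Prop :=
  Continuous g ∧ ∃ f₀ : Sp N → ℂ,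
    Represents (multiplier (lowSymbol ζ) φ) f₀ ∧
    (∀ x, Integrable (fun y => heatKernel θ t (x - y) * f₀ y)) ∧
    Represents (multiplier (fun ξ => (1 - lowSymbol ζ ξ) * heatSymbol θ t ξ) φ)
      (fun x => g x - heatFun θ t f₀ x)

/-! ### Solutions of the viscous Hamilton–Jacobi equation -/

/-- The spatial gradient `(∂_1 f, …, ∂_N f)`. -/
def grad {N : ℕ} (f : Sp N → ℂ) (x : Sp N) : EuclideanSpace ℂ (Fin N) :=
  WithLp.toLp 2 fun j => fderiv ℝ f x (EuclideanSpace.single j 1)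

/-- `w ∈ BC(ℝ^N × (τ, T))` (bounded and continuous); the time variable comes first. -/
def IsBC {N : ℕ} {F : Type*} [NormedAddCommGroup F] (τ T : ℝ) (w : ℝ → Sp N → F) : Prop :=
  ContinuousOn (fun z : ℝ × Sp N => w z.1 z.2) (Ioo τ T ×ˢ univ) ∧
    ∃ C : ℝ, ∀ t ∈ Ioo τ T, ∀ x, ‖w t x‖ ≤ C

/-- `u` (with `u t x` the value at time `t ∈ (0,T)` and position `x`) is a solution on
`ℝ^N × [0,T)` of `∂_t u + (-Δ)^{θ/2} u = |∇u|^γ`, `u(·,0) = φ`: `u` and `∇u` are bounded and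
continuous on `ℝ^N × (τ,T)` for all `τ ∈ (0,T)`, and
`u(x,t) = [S(t)φ](x) + ∫_0^t [S(t-τ)|∇u(·,τ)|^γ](x) dτ`, the integral being absolutely
convergent. -/
structure IsSolution {N : ℕ} (ζ : ℝ → ℝ) (θ γ T : ℝ) (φ : 𝓢'(Sp N, ℂ))
    (u : ℝ → Sp N → ℂ) : Prop where
  differentiable : ∀ t ∈ Ioo 0 T, Differentiable ℝ (u t)
  bc : ∀ τ ∈ Ioo 0 T, IsBC τ T u
  bc_grad : ∀ τ ∈ Ioo 0 T, IsBC τ T (fun t => grad (u t))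
  duhamel : ∀ t ∈ Ioo 0 T, ∃ g : Sp N → ℂ, IsHeatEvolution ζ θ t φ g ∧ ∀ x,
    IntervalIntegrable
      (fun τ => heatFun θ (t - τ) (fun y => ((‖grad (u τ) y‖ ^ γ : ℝ) : ℂ)) x) volume 0 t ∧
    u t x = g x +
      ∫ τ in (0 : ℝ)..t, heatFun θ (t - τ) (fun y => ((‖grad (u τ) y‖ ^ γ : ℝ) : ℂ)) x

/-- `sup_{0<t<T} t^{-s/θ} ‖u(t) | M^p_q‖ ≤ M` and
`sup_{0<t<T} t^{(1-s)/θ} ‖∇u(t) | M^p_q‖ ≤ M`. -/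
def MorreyBound {N : ℕ} (θ p q s T M : ℝ) (u : ℝ → Sp N → ℂ) : Prop :=
  ∀ t ∈ Ioo 0 T,
    ENNReal.ofReal (t ^ (-s / θ)) * morreyNorm p q (u t) ≤ ENNReal.ofReal M ∧
    ENNReal.ofReal (t ^ ((1 - s) / θ)) * morreyNorm p q (grad (u t)) ≤ ENNReal.ofReal M

/-- A tempered distribution is real if it takes real values on real test functions. -/
def IsRealDist {N : ℕ} (φ : 𝓢'(Sp N, ℂ)) : Prop :=
  ∀ ψ : 𝓢(Sp N, ℂ), (∀ x, (ψ x).im = 0) → (φ ψ).im = 0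

end BesovMorrey

end

noncomputable section

namespace BesovMorrey

open MeasureTheory Set Filter Metric
open scoped ENNReal SchwartzMap FourierTransform Topology

/-! ### Minkowski's integral inequality and Morrey norms of nonnegative functions -/

/-! Only the gradient of u enters the nonlinearity, so w = ∇u satisfies a closed fixed-point
equation: w is the gradient of S(t)φ plus the gradient of the Duhamel integral of |w|^γ. Once w is
known, Duhamel's formula gives u. The equation for w is solved on (0, T), T ≤ 1, by Picard iteration
among continuous fields for which t^{(1-s)/θ} ‖w(t) | M^p_q‖ and t^{(1-s+N/p)/θ} sup |w(t)| are at
most M.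

Smoothing. The kernel of S(1) and its gradient are bounded by a multiple of (1+|x|)^{-(N+1)}
(`exists_isKernel_heatKernel`). By self-similarity S(t) and t^{1/θ}∇S(t) are dominated by
convolution with an integrable weight at length scale t^{1/θ}. Comparing this weight with its means
over balls of that radius gives the bound t^{-N/(pθ)} from M^p_q to L^∞ (`exists_wconv_le`);
interpolation gives t^{-N(γ-1)/(pθ)} from M^{p/γ}_{q/γ} to M^p_q (`exists_mor_wconv_le`).

Contraction. By Hölder's inequality |w|^γ lies in M^{p/γ}_{q/γ} with norm O(t^{-(1-s)γ/θ}), and the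
Duhamel term is governed by a beta integral. It converges at τ = 0 because s > 1 - θ/γ, and at τ = t
because p > N(γ-1)/(θ-1); the lower bound s ≥ N/p + (γ-θ)/(γ-1) says that the resulting power of t
is no worse than the one started with. The map therefore has Lipschitz constant K M^{γ-1}
(`exists_gradDuhamel_bounds`), which is at most 1/2 for small M.

Linear part. The heat kernel localized to frequency 2^j carries a factor (1 + t 2^{jθ})^{-L}, so the
dyadic blocks of φ sum to the rate t^{s/θ}. The limsup condition makes all but finitely many
weighted blocks at most δ. The remaining blocks and the low-frequency part are more regular and gain
a factor t^{-s/θ}, which tends to 0 since s < 0. Hence the linear evolution has weighted norm at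
most Cδ on a short interval, with C independent of φ (`exists_linearEvolution`).

Uniqueness. A competing solution comes with Morrey bounds but with no rate for its supremum as t →
0. The Morrey half of the contraction estimate does not need such a rate, so a bound for the
difference of two gradients can be halved indefinitely (`eq_of_fixed`). Reality of u follows because
the symbols are real and even. -/

theorem lintegral_rpow_lintegral_le {X S : Type*} [MeasurableSpace X] [MeasurableSpace S]
    {μ : Measure X} [IsFiniteMeasure μ] {ν : Measure S} [SFinite ν] {q : ℝ} (hq : 1 ≤ q)
    {f : S → X → ℝ≥0∞} (hf : Measurable (Function.uncurry f)) :
    (∫⁻ x, (∫⁻ s, f s x ∂ν) ^ q ∂μ) ^ (1 / q) ≤ ∫⁻ s, (∫⁻ x, f s x ^ q ∂μ) ^ (1 / q) ∂ν := by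
  rcases eq_or_lt_of_le hq with rfl | hq1
  · simp only [ENNReal.rpow_one, div_one]
    rw [lintegral_lintegral_swap]
    exact (hf.comp measurable_swap).aemeasurable
  have hq0 : 0 < q := by linarith
  have hpq : (q / (q - 1)).HolderConjugate q := (Real.HolderConjugate.conjExponent hq1).symm
  set F : X → ℝ≥0∞ := fun x => ∫⁻ s, f s x ∂ν with hF
  have hFm : Measurable F := hf.lintegral_prod_left
  set A : ℝ≥0∞ := ∫⁻ s, (∫⁻ x, f s x ^ q ∂μ) ^ (1 / q) ∂ν with hA
  -- Truncating F at n makes I finite, since μ is finite, so the factor I^{1-1/q} produced by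
  -- Hölder's inequality can be cancelled. The limit n → ∞ is monotone convergence.
  have key : ∀ n : ℕ, ∫⁻ x, (min (F x) n) ^ q ∂μ ≤ A ^ q := by
    intro n
    set I := ∫⁻ x, (min (F x) n) ^ q ∂μ with hI
    have hmn : Measurable fun x => min (F x) (n : ℝ≥0∞) := hFm.min measurable_const
    have hItop : I ≠ ⊤ := by
      have : I ≤ ∫⁻ x, (n : ℝ≥0∞) ^ q ∂μ :=
        lintegral_mono fun x => ENNReal.rpow_le_rpow (min_le_right _ _) hq0.le
      refine ne_top_of_le_ne_top ?_ this
      rw [lintegral_const]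
      exact ENNReal.mul_ne_top (ENNReal.rpow_ne_top_of_nonneg hq0.le (by simp)) (measure_ne_top _ _)
    have h1 : I ≤ I ^ (1 / (q / (q - 1))) * A := by
      calc I ≤ ∫⁻ x, (min (F x) n) ^ (q - 1) * F x ∂μ := by
            refine lintegral_mono fun x => ?_
            calc (min (F x) (n : ℝ≥0∞)) ^ q = (min (F x) (n : ℝ≥0∞)) ^ (q - 1) * min (F x) n := by
                  rw [show q = (q - 1) + 1 by ring,
                    ENNReal.rpow_add_of_nonneg _ _ (by linarith) zero_le_one, ENNReal.rpow_one]
                  ring_nf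
              _ ≤ _ := by gcongr; exact min_le_left _ _
        _ = ∫⁻ x, ∫⁻ s, (min (F x) n) ^ (q - 1) * f s x ∂ν ∂μ := by
            refine lintegral_congr fun x => ?_
            rw [lintegral_const_mul]
            exact hf.of_uncurry_right
        _ = ∫⁻ s, ∫⁻ x, (min (F x) n) ^ (q - 1) * f s x ∂μ ∂ν := by
            rw [lintegral_lintegral_swap]
            refine Measurable.aemeasurable ?_
            exact ((hmn.comp measurable_fst).pow_const _).mul (hf.comp measurable_swap)
        _ ≤ ∫⁻ s, I ^ (1 / (q / (q - 1))) * (∫⁻ x, f s x ^ q ∂μ) ^ (1 / q) ∂ν := by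
            refine lintegral_mono fun s => ?_
            have := ENNReal.lintegral_mul_le_Lp_mul_Lq μ hpq
              (f := fun x => (min (F x) (n : ℝ≥0∞)) ^ (q - 1)) (g := fun x => f s x)
              (hmn.pow_const _).aemeasurable (hf.of_uncurry_left).aemeasurable
            refine this.trans_eq ?_
            simp only [← ENNReal.rpow_mul]
            rw [show (q - 1) * (q / (q - 1)) = q by field_simp [(by linarith : q - 1 ≠ 0)]]
        _ = _ := by
            rw [lintegral_const_mul']
            exact ENNReal.rpow_ne_top_of_nonneg hpq.one_div_nonneg hItop
    rcases eq_or_ne I 0 with h0 | h0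
    · rw [h0]; exact zero_le
    have h2 : I ^ (1 / q) ≤ A := by
      have e : I = I ^ (1 / (q / (q - 1))) * I ^ (1 / q) := by
        rw [← ENNReal.rpow_add _ _ h0 hItop]
        have : 1 / (q / (q - 1)) + 1 / q = 1 := by
          have := hpq.inv_add_inv_eq_one
          simpa [one_div] using this
        rw [this, ENNReal.rpow_one]
      have hne : I ^ (1 / (q / (q - 1))) ≠ 0 := by
        simp [ENNReal.rpow_eq_zero_iff, h0, hItop]
      have hnt : I ^ (1 / (q / (q - 1))) ≠ ⊤ :=
        ENNReal.rpow_ne_top_of_nonneg hpq.one_div_nonneg hItop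
      rw [e] at h1
      nth_rewrite 2 [← e] at h1
      exact (ENNReal.mul_le_mul_iff_right hne hnt).1 h1
    calc I = (I ^ (1 / q)) ^ q := by rw [← ENNReal.rpow_mul]; field_simp; simp
      _ ≤ A ^ q := ENNReal.rpow_le_rpow h2 hq0.le
  have hsup : ∫⁻ x, F x ^ q ∂μ ≤ A ^ q := by
    have : ∀ x, F x ^ q = ⨆ n : ℕ, (min (F x) n) ^ q := by
      intro x
      have hlim : Tendsto (fun n : ℕ => (min (F x) (n : ℝ≥0∞)) ^ q) atTop (𝓝 (F x ^ q)) := by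
        refine (ENNReal.continuous_rpow_const.tendsto _).comp ?_
        have := (tendsto_const_nhds (x := F x)).min ENNReal.tendsto_nat_nhds_top
        simpa using this
      refine (tendsto_nhds_unique hlim (tendsto_atTop_iSup ?_))
      intro m n hmn
      exact ENNReal.rpow_le_rpow (min_le_min le_rfl (by exact_mod_cast hmn)) hq0.le
    simp_rw [this]
    rw [lintegral_iSup]
    · exact iSup_le key
    · exact fun n => (hFm.min measurable_const).pow_const _
    · intro m n hmn x
      exact ENNReal.rpow_le_rpow (min_le_min le_rfl (by exact_mod_cast hmn)) hq0.le
  calc _ ≤ (A ^ q) ^ (1 / q) := ENNReal.rpow_le_rpow hsup (by positivity)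
    _ = A := by rw [← ENNReal.rpow_mul]; field_simp; simp

variable {N : ℕ}

/-- The local Morrey norm of a nonnegative function. -/
def mor (p q : ℝ) (f : Sp N → ℝ≥0∞) : ℝ≥0∞ :=
  ⨆ (x : Sp N) (ρ : ℝ) (_ : 0 < ρ) (_ : ρ ≤ 1),
    ENNReal.ofReal (ρ ^ ((N : ℝ) / p - (N : ℝ) / q)) * (∫⁻ y in ball x ρ, f y ^ q) ^ (1 / q)

theorem morreyNorm_eq_mor {F : Type*} [NormedAddCommGroup F] {p q : ℝ} (hq : 0 < q)
    (f : Sp N → F) : morreyNorm p q f = mor p q (fun x => ‖f x‖ₑ) := by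
  simp only [morreyNorm, mor]
  have h1 : ENNReal.ofReal q ≠ 0 := by simpa using hq
  simp only [eLpNorm_eq_lintegral_rpow_enorm_toReal h1 ENNReal.ofReal_ne_top,
    ENNReal.toReal_ofReal hq.le]

theorem le_mor (p q : ℝ) (f : Sp N → ℝ≥0∞) (x : Sp N) {ρ : ℝ} (h0 : 0 < ρ) (h1 : ρ ≤ 1) :
    ENNReal.ofReal (ρ ^ ((N : ℝ) / p - (N : ℝ) / q)) * (∫⁻ y in ball x ρ, f y ^ q) ^ (1 / q)
      ≤ mor p q f :=
  le_iSup_of_le x (le_iSup_of_le ρ (le_iSup_of_le h0 (le_iSup_of_le h1 le_rfl)))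

theorem mor_le {p q : ℝ} {f : Sp N → ℝ≥0∞} {B : ℝ≥0∞}
    (h : ∀ (x : Sp N) (ρ : ℝ), 0 < ρ → ρ ≤ 1 →
      ENNReal.ofReal (ρ ^ ((N : ℝ) / p - (N : ℝ) / q)) *
        (∫⁻ y in ball x ρ, f y ^ q) ^ (1 / q) ≤ B) : mor p q f ≤ B :=
  iSup_le fun x => iSup_le fun ρ => iSup_le fun h0 => iSup_le fun h1 => h x ρ h0 h1

theorem mor_mono {p q : ℝ} (hq : 0 ≤ q) {f g : Sp N → ℝ≥0∞} (h : ∀ x, f x ≤ g x) :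
    mor p q f ≤ mor p q g := by
  refine mor_le fun x ρ h0 h1 => le_trans ?_ (le_mor p q g x h0 h1)
  gcongr
  exact h _

theorem mor_congr_ae {p q : ℝ} {f g : Sp N → ℝ≥0∞} (h : f =ᵐ[volume] g) :
    mor p q f = mor p q g := by
  simp only [mor]
  refine iSup_congr fun x => iSup_congr fun ρ => iSup_congr fun _ => iSup_congr fun _ => ?_
  congr 2
  refine lintegral_congr_ae (ae_restrict_of_ae ?_)
  filter_upwards [h] with y hy
  rw [hy]

theorem mor_const_mul_le {p q : ℝ} (hq : 0 < q) {c : ℝ≥0∞} (hc : c ≠ ⊤) (f : Sp N → ℝ≥0∞) :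
    mor p q (fun x => c * f x) ≤ c * mor p q f := by
  refine mor_le fun x ρ h0 h1 => ?_
  calc _ = c * (ENNReal.ofReal (ρ ^ ((N : ℝ) / p - (N : ℝ) / q)) *
        (∫⁻ y in ball x ρ, f y ^ q) ^ (1 / q)) := by
        simp_rw [ENNReal.mul_rpow_of_nonneg _ _ hq.le]
        rw [lintegral_const_mul' _ _ (ENNReal.rpow_ne_top_of_nonneg hq.le hc),
          ENNReal.mul_rpow_of_nonneg _ _ (by positivity), ← ENNReal.rpow_mul,
          mul_one_div_cancel hq.ne', ENNReal.rpow_one]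
        ring
    _ ≤ _ := by gcongr; exact le_mor p q f x h0 h1

/-- The Morrey norm is a supremum of weighted L^q norms over balls of finite measure, so Minkowski's
inequality passes through it. -/
theorem mor_lintegral_le {S : Type*} [MeasurableSpace S] {ν : Measure S} [SFinite ν] {p q : ℝ}
    (hq : 1 ≤ q) {f : S → Sp N → ℝ≥0∞} (hf : Measurable (Function.uncurry f)) :
    mor p q (fun x => ∫⁻ s, f s x ∂ν) ≤ ∫⁻ s, mor p q (f s) ∂ν := by
  refine mor_le fun x ρ h0 h1 => ?_
  have : IsFiniteMeasure (volume.restrict (ball x ρ)) := ⟨by simp [measure_ball_lt_top]⟩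
  refine (mul_le_mul_right (lintegral_rpow_lintegral_le hq hf) _).trans ?_
  rw [← lintegral_const_mul' _ _ ENNReal.ofReal_ne_top]
  exact lintegral_mono fun s => le_mor p q (f s) x h0 h1

/-- Minkowski's inequality for the counting measure on ℕ. -/
theorem mor_tsum_le {p q : ℝ} (hq : 1 ≤ q) {f : ℕ → Sp N → ℝ≥0∞} (hf : ∀ n, Measurable (f n)) :
    mor p q (fun x => ∑' n, f n x) ≤ ∑' n, mor p q (f n) := by
  have := mor_lintegral_le (ν := Measure.count) (p := p) hq (f := f)
    (measurable_from_prod_countable_right hf)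
  simpa [lintegral_count] using this

theorem mor_add_le {p q : ℝ} (hq : 1 ≤ q) {f g : Sp N → ℝ≥0∞} (hf : Measurable f)
    (hg : Measurable g) : mor p q (fun x => f x + g x) ≤ mor p q f + mor p q g := by
  refine mor_le fun x ρ h0 h1 => ?_
  calc _ ≤ ENNReal.ofReal (ρ ^ ((N : ℝ) / p - (N : ℝ) / q)) *
        ((∫⁻ y in ball x ρ, f y ^ q) ^ (1 / q) + (∫⁻ y in ball x ρ, g y ^ q) ^ (1 / q)) := by
        gcongr
        exact ENNReal.lintegral_Lp_add_le hf.aemeasurable hg.aemeasurable hq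
    _ ≤ _ := by
        rw [mul_add]
        exact add_le_add (le_mor p q f x h0 h1) (le_mor p q g x h0 h1)

theorem mor_comp_sub_le (p q : ℝ) (f : Sp N → ℝ≥0∞) (z : Sp N) :
    mor p q (fun x => f (x - z)) ≤ mor p q f := by
  refine mor_le fun x ρ h0 h1 => le_trans (le_of_eq ?_) (le_mor p q f (x - z) h0 h1)
  congr 2
  have := (measurePreserving_sub_right (volume : Measure (Sp N)) z).setLIntegral_comp_preimage_emb
    (MeasurableEquiv.subRight z).measurableEmbedding (fun y => f y ^ q) (ball (x - z) ρ)
  rw [← this]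
  congr 2
  ext y
  simp [dist_eq_norm]

/-- Hölder's inequality for Morrey norms with exponents `γ/(γ-1)` and `γ`. -/
theorem mor_rpow_mul_le {p q γ : ℝ} (hγ : 1 < γ) (hq : 0 < q) {f g : Sp N → ℝ≥0∞}
    (hf : Measurable f) (hg : Measurable g) :
    mor (p / γ) (q / γ) (fun x => f x ^ (γ - 1) * g x) ≤
      mor p q f ^ (γ - 1) * mor p q g := by
  have hγ0 : 0 < γ := by linarith
  refine mor_le fun x ρ h0 h1 => ?_
  have hpq : (γ / (γ - 1)).HolderConjugate γ := (Real.HolderConjugate.conjExponent hγ).symm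
  set If := ∫⁻ y in ball x ρ, f y ^ q
  set Ig := ∫⁻ y in ball x ρ, g y ^ q
  have h : (∫⁻ y in ball x ρ, (f y ^ (γ - 1) * g y) ^ (q / γ)) ^ (1 / (q / γ)) ≤
      (If ^ (1 / q)) ^ (γ - 1) * Ig ^ (1 / q) := by
    have h' := ENNReal.lintegral_mul_le_Lp_mul_Lq (volume.restrict (ball x ρ)) hpq
      (f := fun y => (f y ^ (γ - 1)) ^ (q / γ)) (g := fun y => g y ^ (q / γ))
      ((hf.pow_const _).pow_const _).aemeasurable (hg.pow_const _).aemeasurable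
    simp only [Pi.mul_apply, ← ENNReal.rpow_mul] at h'
    have e1 : (γ - 1) * (q / γ) * (γ / (γ - 1)) = q := by
      have : γ - 1 ≠ 0 := by linarith
      field_simp
    have e2 : q / γ * γ = q := by field_simp
    rw [e1, e2] at h'
    simp_rw [ENNReal.mul_rpow_of_nonneg _ _ (div_nonneg hq.le hγ0.le), ← ENNReal.rpow_mul]
    refine (ENNReal.rpow_le_rpow h' (by positivity)).trans_eq ?_
    rw [ENNReal.mul_rpow_of_nonneg _ _ (by positivity), ← ENNReal.rpow_mul, ← ENNReal.rpow_mul]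
    congr 2
    · have : γ - 1 ≠ 0 := by linarith
      field_simp
    · field_simp
  refine (mul_le_mul_right h _).trans ?_
  have e : ENNReal.ofReal (ρ ^ ((N : ℝ) / (p / γ) - (N : ℝ) / (q / γ))) =
      ENNReal.ofReal (ρ ^ ((N : ℝ) / p - (N : ℝ) / q)) ^ (γ - 1) *
        ENNReal.ofReal (ρ ^ ((N : ℝ) / p - (N : ℝ) / q)) := by
    rw [ENNReal.ofReal_rpow_of_pos (by positivity), ← Real.rpow_mul h0.le,
      ← ENNReal.ofReal_mul (by positivity), ← Real.rpow_add h0]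
    congr 2
    rw [div_div_eq_mul_div, div_div_eq_mul_div]
    ring
  rw [e]
  calc _ = (ENNReal.ofReal (ρ ^ ((N : ℝ) / p - (N : ℝ) / q)) * If ^ (1 / q)) ^ (γ - 1) *
        (ENNReal.ofReal (ρ ^ ((N : ℝ) / p - (N : ℝ) / q)) * Ig ^ (1 / q)) := by
        rw [ENNReal.mul_rpow_of_nonneg _ _ (by linarith)]; ring
    _ ≤ _ := by
        gcongr
        · exact le_mor p q f x h0 h1
        · exact le_mor p q g x h0 h1

theorem mor_rpow_le {p q γ : ℝ} (hγ : 1 < γ) (hq : 0 < q) {f : Sp N → ℝ≥0∞}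
    (hf : Measurable f) :
    mor (p / γ) (q / γ) (fun x => f x ^ γ) ≤ mor p q f ^ γ := by
  have := mor_rpow_mul_le (p := p) hγ hq hf hf
  have e : ∀ a : ℝ≥0∞, a ^ γ = a ^ (γ - 1) * a := fun a => by
    nth_rewrite 1 [show γ = (γ - 1) + 1 by ring]
    rw [ENNReal.rpow_add_of_nonneg _ _ (by linarith) zero_le_one, ENNReal.rpow_one]
  simp_rw [e]
  exact this

/-- Interpolation between a Morrey norm and the supremum. -/
theorem mor_le_of_le_const {p q γ : ℝ} (hγ : 1 < γ) (hq : 0 < q) {f : Sp N → ℝ≥0∞}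
    {S : ℝ≥0∞} (hS : S ≠ ⊤) (h : ∀ x, f x ≤ S) :
    mor p q f ≤ S ^ (1 - 1 / γ) * mor (p / γ) (q / γ) f ^ (1 / γ) := by
  have hγ0 : 0 < γ := by linarith
  have hd : 0 ≤ q - q / γ := by
    rw [sub_nonneg]; exact div_le_self hq.le hγ.le
  refine mor_le fun x ρ h0 h1 => ?_
  have h2 : ∫⁻ y in ball x ρ, f y ^ q ≤
      S ^ (q - q / γ) * ∫⁻ y in ball x ρ, f y ^ (q / γ) := by
    rw [← lintegral_const_mul' _ _ (ENNReal.rpow_ne_top_of_nonneg hd hS)]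
    refine lintegral_mono fun y => ?_
    calc f y ^ q = f y ^ (q - q / γ) * f y ^ (q / γ) := by
          rw [← ENNReal.rpow_add_of_nonneg _ _ hd (by positivity)]; ring_nf
      _ ≤ _ := by gcongr; exact h y
  calc _ ≤ ENNReal.ofReal (ρ ^ ((N : ℝ) / p - (N : ℝ) / q)) *
        (S ^ (q - q / γ) * ∫⁻ y in ball x ρ, f y ^ (q / γ)) ^ (1 / q) := by gcongr
    _ = S ^ (1 - 1 / γ) * (ENNReal.ofReal (ρ ^ ((N : ℝ) / (p / γ) - (N : ℝ) / (q / γ))) *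
        (∫⁻ y in ball x ρ, f y ^ (q / γ)) ^ (1 / (q / γ))) ^ (1 / γ) := by
        rw [ENNReal.mul_rpow_of_nonneg _ _ (by positivity : 0 ≤ 1 / q), ← ENNReal.rpow_mul,
          ENNReal.mul_rpow_of_nonneg _ _ (by positivity : 0 ≤ 1 / γ), ← ENNReal.rpow_mul,
          ENNReal.ofReal_rpow_of_pos (by positivity), ← Real.rpow_mul h0.le]
        have e1 : (q - q / γ) * (1 / q) = 1 - 1 / γ := by field_simp
        have e2 : 1 / (q / γ) * (1 / γ) = 1 / q := by field_simp
        have e3 : ((N : ℝ) / (p / γ) - N / (q / γ)) * (1 / γ) = N / p - N / q := by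
          rw [div_div_eq_mul_div, div_div_eq_mul_div]
          field_simp
        rw [e1, e2, e3]
        ring
    _ ≤ _ := by
        gcongr
        exact le_mor _ _ f x h0 h1

/-- A Morrey norm controls integrals over balls. -/
theorem setLIntegral_ball_le_mor {p q : ℝ} (hq : 1 ≤ q) {f : Sp N → ℝ≥0∞} (hf : Measurable f)
    (x : Sp N) {ρ : ℝ} (h0 : 0 < ρ) (h1 : ρ ≤ 1) :
    ∫⁻ y in ball x ρ, f y ≤
      volume (ball (0 : Sp N) 1) ^ (1 - 1 / q) * ENNReal.ofReal (ρ ^ ((N : ℝ) - N / p)) *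
        mor p q f := by
  have hq0 : 0 < q := by linarith
  have hvol : volume (ball x ρ) = ENNReal.ofReal (ρ ^ (N : ℝ)) * volume (ball (0 : Sp N) 1) := by
    rw [Measure.addHaar_ball_of_pos _ _ h0]; simp
  have hH : ∫⁻ y in ball x ρ, f y ≤
      volume (ball x ρ) ^ (1 - 1 / q) * (∫⁻ y in ball x ρ, f y ^ q) ^ (1 / q) := by
    rcases eq_or_lt_of_le hq with rfl | hq1
    · simp
    have hpq : (q / (q - 1)).HolderConjugate q := (Real.HolderConjugate.conjExponent hq1).symm
    have := ENNReal.lintegral_mul_le_Lp_mul_Lq (volume.restrict (ball x ρ)) hpq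
      (f := fun _ => 1) (g := f) aemeasurable_const hf.aemeasurable
    simp only [Pi.mul_apply, one_mul, ENNReal.one_rpow, lintegral_const, Measure.restrict_apply,
      MeasurableSet.univ, univ_inter] at this
    convert this using 3
    field_simp
  refine hH.trans ?_
  have key : volume (ball x ρ) ^ (1 - 1 / q) =
      volume (ball (0 : Sp N) 1) ^ (1 - 1 / q) * ENNReal.ofReal (ρ ^ ((N : ℝ) - N / p)) *
        ENNReal.ofReal (ρ ^ ((N : ℝ) / p - (N : ℝ) / q)) := by
    rw [hvol, ENNReal.mul_rpow_of_nonneg _ _ (by rw [sub_nonneg, div_le_one hq0]; exact hq),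
      ENNReal.ofReal_rpow_of_pos (by positivity), ← Real.rpow_mul h0.le, mul_assoc,
      ← ENNReal.ofReal_mul (by positivity), ← Real.rpow_add h0, mul_comm]
    congr 3
    ring
  rw [key, mul_assoc]
  gcongr
  exact le_mor p q f x h0 h1

end BesovMorrey

end

noncomputable section

namespace BesovMorrey

open MeasureTheory Set Filter Metric
open scoped ENNReal SchwartzMap FourierTransform Topology

variable {N : ℕ}

/-! ### Convolution with the polynomial weight -/

/-- The weight `(1 + |x|)^{-(N+1)}`. -/
def wt (x : Sp N) : ℝ := ((1 + ‖x‖) ^ (N + 1))⁻¹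

/-- The dilated weight `R^N (1 + R|x|)^{-(N+1)}`. -/
def dwt (R : ℝ) (x : Sp N) : ℝ := R ^ N * wt (R • x)

/-- Convolution with the dilated weight. -/
def wconv (R : ℝ) (f : Sp N → ℝ≥0∞) (x : Sp N) : ℝ≥0∞ :=
  ∫⁻ y, ENNReal.ofReal (dwt R (x - y)) * f y

/-- The integral of the weight. -/
def wtMass (N : ℕ) : ℝ≥0∞ := ∫⁻ y : Sp N, ENNReal.ofReal (wt y)

theorem wt_pos (x : Sp N) : 0 < wt x := by unfold wt; positivity

theorem continuous_wt : Continuous (wt : Sp N → ℝ) := by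
  unfold wt
  refine ((continuous_const.add continuous_norm).pow _).inv₀ fun x => ?_
  have : 0 < 1 + ‖x‖ := by linarith [norm_nonneg x]
  exact (pow_pos this _).ne'

theorem dwt_nonneg {R : ℝ} (hR : 0 ≤ R) (x : Sp N) : 0 ≤ dwt R x :=
  mul_nonneg (by positivity) (wt_pos _).le

theorem continuous_dwt : Continuous fun z : ℝ × Sp N => dwt z.1 z.2 := by
  unfold dwt
  exact (continuous_fst.pow _).mul (continuous_wt.comp (continuous_fst.smul continuous_snd))

theorem wt_neg (x : Sp N) : wt (-x) = wt x := by simp [wt]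

/-- A unit shift changes 1 + |x| by at most a factor 2, hence the constant 2^{N+1}. After dilation,
`dwt R` is nearly constant on balls of radius 1/R. -/
theorem wt_le_of_norm_sub_le {x y : Sp N} (h : ‖x - y‖ ≤ 1) : wt x ≤ 2 ^ (N + 1) * wt y := by
  unfold wt
  rw [← div_eq_mul_inv, inv_eq_one_div, div_le_div_iff₀ (by positivity) (by positivity), one_mul,
    ← mul_pow]
  refine pow_le_pow_left₀ (by positivity) ?_ _
  have : ‖y‖ ≤ ‖x‖ + ‖x - y‖ := by
    have := norm_sub_le x (x - y); simpa using this
  linarith [norm_nonneg x]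

theorem integrable_wt : Integrable (wt : Sp N → ℝ) := by
  have := integrable_one_add_norm (E := Sp N) (μ := volume) (r := (N : ℝ) + 1) (by simp)
  refine this.congr (Eventually.of_forall fun x => ?_)
  simp only [wt]
  rw [Real.rpow_neg (by positivity), ← Real.rpow_natCast]
  push_cast
  rfl

theorem wtMass_lt_top : wtMass N < ⊤ := by
  have := (integrable_wt (N := N)).lintegral_lt_top
  exact this

/-- The factor R^N preserves the integral, which is what makes the convolution bounds uniform in R.
-/
theorem lintegral_dwt {R : ℝ} (hR : 0 < R) :
    ∫⁻ y : Sp N, ENNReal.ofReal (dwt R y) = wtMass N := by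
  have h1 : Integrable (dwt R : Sp N → ℝ) :=
    ((integrable_comp_smul_iff volume (wt : Sp N → ℝ) hR.ne').2 integrable_wt).const_mul _
  rw [wtMass, ← ofReal_integral_eq_lintegral_ofReal h1 (Eventually.of_forall fun x => dwt_nonneg hR.le x),
    ← ofReal_integral_eq_lintegral_ofReal integrable_wt (Eventually.of_forall fun x => (wt_pos x).le)]
  congr 1
  simp only [dwt]
  rw [integral_const_mul, Measure.integral_comp_smul_of_nonneg _ _ _ (hR := hR.le)]
  simp only [finrank_euclideanSpace, Fintype.card_fin, smul_eq_mul]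
  field_simp

theorem wconv_eq (R : ℝ) (f : Sp N → ℝ≥0∞) (x : Sp N) :
    wconv R f x = ∫⁻ z, ENNReal.ofReal (dwt R z) * f (x - z) := by
  rw [wconv, ← lintegral_sub_left_eq_self _ x]
  simp

theorem wconv_const_le {R : ℝ} (hR : 0 < R) {f : Sp N → ℝ≥0∞} {B : ℝ≥0∞} (h : ∀ x, f x ≤ B)
    (x : Sp N) : wconv R f x ≤ wtMass N * B := by
  rw [wconv_eq, ← lintegral_dwt hR, ← lintegral_mul_const]
  · exact lintegral_mono fun z => mul_le_mul_right (h _) _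
  · exact (continuous_dwt.comp (continuous_const.prodMk continuous_id)).measurable.ennreal_ofReal

/-- Convolution is an average of translates, and translation does not increase the Morrey norm; what
remains is the total mass of the weight. -/
theorem mor_wconv_le {p q : ℝ} (hq : 1 ≤ q) {R : ℝ} (hR : 0 < R) {f : Sp N → ℝ≥0∞}
    (hf : Measurable f) : mor p q (wconv R f) ≤ wtMass N * mor p q f := by
  have hd : Measurable fun z : Sp N => ENNReal.ofReal (dwt R z) :=
    (continuous_dwt.comp (continuous_const.prodMk continuous_id)).measurable.ennreal_ofReal
  have h := mor_lintegral_le (ν := (volume : Measure (Sp N))) (p := p) hq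
    (f := fun z x => ENNReal.ofReal (dwt R z) * f (x - z))
    ((hd.comp measurable_fst).mul (hf.comp (measurable_snd.sub measurable_fst)))
  have e : wconv R f = fun x => ∫⁻ z, ENNReal.ofReal (dwt R z) * f (x - z) :=
    funext (wconv_eq R f)
  rw [e]
  refine h.trans ?_
  rw [← lintegral_dwt hR, ← lintegral_mul_const _ hd]
  refine lintegral_mono fun z => ?_
  refine (mor_const_mul_le (by linarith) ENNReal.ofReal_ne_top _).trans ?_
  gcongr
  exact mor_comp_sub_le p q f z

/-! ### Smoothing estimates for weighted convolutions -/

theorem lintegral_setLIntegral_ball_comm (r : ℝ) {f g : Sp N → ℝ≥0∞} (hg : Measurable g)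
    (hf : Measurable f) :
    ∫⁻ y, (∫⁻ z in ball y r, g z) * f y = ∫⁻ z, g z * ∫⁻ y in ball z r, f y := by
  set χ : Sp N → ℝ≥0∞ := (ball (0 : Sp N) r).indicator (fun _ => (1 : ℝ≥0∞)) with hχ
  have hm : Measurable χ := measurable_const.indicator measurableSet_ball
  have e1 : ∀ y : Sp N, ∫⁻ z in ball y r, g z = ∫⁻ z, χ (z - y) * g z := by
    intro y
    rw [← lintegral_indicator measurableSet_ball]
    refine lintegral_congr fun z => ?_
    by_cases h : z ∈ ball y r
    · have h' : z - y ∈ ball (0 : Sp N) r := by simpa [dist_eq_norm] using h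
      simp only [hχ, indicator_of_mem h, indicator_of_mem h', one_mul]
    · have h' : z - y ∉ ball (0 : Sp N) r := by simpa [dist_eq_norm] using h
      simp only [hχ, indicator_of_notMem h, indicator_of_notMem h', zero_mul]
  have e2 : ∀ z : Sp N, ∫⁻ y in ball z r, f y = ∫⁻ y, χ (z - y) * f y := by
    intro z
    rw [← lintegral_indicator measurableSet_ball]
    refine lintegral_congr fun y => ?_
    by_cases h : y ∈ ball z r
    · have h' : z - y ∈ ball (0 : Sp N) r := by
        rw [mem_ball_zero_iff, norm_sub_rev]; simpa [dist_eq_norm] using h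
      simp only [hχ, indicator_of_mem h, indicator_of_mem h', one_mul]
    · have h' : z - y ∉ ball (0 : Sp N) r := by
        rw [mem_ball_zero_iff, norm_sub_rev]; simpa [dist_eq_norm] using h
      simp only [hχ, indicator_of_notMem h, indicator_of_notMem h', zero_mul]
  have hsub : Measurable fun z : Sp N × Sp N => χ (z.2 - z.1) :=
    hm.comp (measurable_snd.sub measurable_fst)
  calc _ = ∫⁻ y, ∫⁻ z, χ (z - y) * g z * f y := by
        refine lintegral_congr fun y => ?_
        have : Measurable fun z => χ (z - y) * g z := (hm.comp (measurable_id.sub_const y)).mul hg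
        rw [e1, ← lintegral_mul_const _ this]
    _ = ∫⁻ z, ∫⁻ y, χ (z - y) * g z * f y := by
        rw [lintegral_lintegral_swap]
        exact ((hsub.mul (hg.comp measurable_snd)).mul (hf.comp measurable_fst)).aemeasurable
    _ = _ := by
        refine lintegral_congr fun z => ?_
        have : Measurable fun y => χ (z - y) * f y :=
          (hm.comp (measurable_const.sub measurable_id)).mul hf
        rw [e2, ← lintegral_const_mul _ this]
        refine lintegral_congr fun y => ?_
        ring

/-- On a ball of radius 1/R the weight is bounded by its own mean, up to a constant. This brings in
ball integrals, which are what a Morrey norm controls. -/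
theorem ball_average_dwt {R : ℝ} (hR0 : 0 < R) (x y : Sp N) :
    ENNReal.ofReal (R⁻¹ ^ (N : ℝ)) * volume (ball (0 : Sp N) 1) * ENNReal.ofReal (dwt R (x - y)) ≤
      2 ^ (N + 1) * ∫⁻ z in ball y R⁻¹, ENNReal.ofReal (dwt R (x - z)) := by
  have hvol : volume (ball y R⁻¹) =
      ENNReal.ofReal (R⁻¹ ^ (N : ℝ)) * volume (ball (0 : Sp N) 1) := by
    rw [Measure.addHaar_ball_of_pos _ _ (inv_pos.2 hR0)]; simp
  rw [← hvol, ← lintegral_const_mul' _ _ (by simp), mul_comm, ← setLIntegral_const]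
  refine setLIntegral_mono' measurableSet_ball fun z hz => ?_
  have h2 : (2 : ℝ≥0∞) ^ (N + 1) = ENNReal.ofReal (2 ^ (N + 1)) := by
    rw [ENNReal.ofReal_pow (by norm_num)]; simp
  rw [h2, ← ENNReal.ofReal_mul (by positivity)]
  refine ENNReal.ofReal_le_ofReal ?_
  unfold dwt
  have : wt (R • (x - y)) ≤ 2 ^ (N + 1) * wt (R • (x - z)) := by
    refine wt_le_of_norm_sub_le ?_
    rw [← smul_sub, norm_smul, Real.norm_of_nonneg hR0.le]
    have : ‖(x - y) - (x - z)‖ < R⁻¹ := by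
      rw [sub_sub_sub_cancel_left, ← dist_eq_norm]; exact hz
    calc R * _ ≤ R * R⁻¹ := by gcongr
      _ = 1 := mul_inv_cancel₀ hR0.ne'
  calc _ ≤ R ^ N * (2 ^ (N + 1) * wt (R • (x - z))) := by gcongr
    _ = _ := by ring

/-- Tonelli's theorem moves the ball integral from the weight onto f. -/
theorem mul_wconv_le {R : ℝ} (hR : 0 < R) {f : Sp N → ℝ≥0∞} (hf : Measurable f) (x : Sp N) :
    ENNReal.ofReal (R⁻¹ ^ (N : ℝ)) * volume (ball (0 : Sp N) 1) * wconv R f x ≤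
      2 ^ (N + 1) * ∫⁻ z, ENNReal.ofReal (dwt R (x - z)) * ∫⁻ y in ball z R⁻¹, f y := by
  have hmd : Measurable fun z : Sp N => ENNReal.ofReal (dwt R (x - z)) :=
    (continuous_dwt.comp (continuous_const.prodMk
      (continuous_const.sub continuous_id))).measurable.ennreal_ofReal
  rw [← lintegral_setLIntegral_ball_comm R⁻¹ hmd hf, wconv]
  have hk : ENNReal.ofReal (R⁻¹ ^ (N : ℝ)) * volume (ball (0 : Sp N) 1) ≠ ⊤ :=
    ENNReal.mul_ne_top ENNReal.ofReal_ne_top measure_ball_lt_top.ne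
  have h2 : (2 : ℝ≥0∞) ^ (N + 1) ≠ ⊤ := ENNReal.pow_ne_top ENNReal.ofNat_ne_top
  rw [← lintegral_const_mul' _ _ hk, ← lintegral_const_mul' _ _ h2]
  refine lintegral_mono fun y => ?_
  have := mul_le_mul_left (ball_average_dwt hR x y) (f y)
  simpa only [mul_assoc] using this

/-- Smoothing from M^p_q to L^∞: means of f over balls of radius 1/R are O(R^{N/p}) times the norm.
The restriction 1 ≤ R is due to the local Morrey norm, which sees only radii up to 1. -/
theorem exists_wconv_le (N : ℕ) {p q : ℝ} (hq : 1 ≤ q) :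
    ∃ C : ℝ, 0 < C ∧ ∀ (R : ℝ), 1 ≤ R → ∀ f : Sp N → ℝ≥0∞, Measurable f → ∀ x,
      wconv R f x ≤ ENNReal.ofReal C * ENNReal.ofReal (R ^ ((N : ℝ) / p)) * mor p q f := by
  set ω := volume (ball (0 : Sp N) 1) with hω
  have hω0 : ω ≠ 0 := (measure_ball_pos _ _ one_pos).ne'
  have hωt : ω ≠ ⊤ := measure_ball_lt_top.ne
  have hq1 : 0 ≤ 1 - 1 / q := by
    rw [sub_nonneg, div_le_one (by linarith)]; exact hq
  obtain ⟨C₀, hC₀⟩ : ∃ C₀ : ℝ≥0∞, C₀ = ω⁻¹ * (2 ^ (N + 1) * (wtMass N * ω ^ (1 - 1 / q))) :=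
    ⟨_, rfl⟩
  have h2 : (2 : ℝ≥0∞) ^ (N + 1) ≠ ⊤ := by simp
  have hC₀t : C₀ ≠ ⊤ := by
    rw [hC₀]
    exact ENNReal.mul_ne_top (ENNReal.inv_ne_top.2 hω0) (ENNReal.mul_ne_top h2
      (ENNReal.mul_ne_top wtMass_lt_top.ne (ENNReal.rpow_ne_top_of_nonneg hq1 hωt)))
  refine ⟨C₀.toReal + 1, add_pos_of_nonneg_of_pos ENNReal.toReal_nonneg one_pos,
    fun R hR f hf x => ?_⟩
  have hR0 : 0 < R := by linarith
  have hρ0 : 0 < R⁻¹ := inv_pos.2 hR0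
  have hρ1 : R⁻¹ ≤ 1 := inv_le_one_of_one_le₀ hR
  have hC : C₀ ≤ ENNReal.ofReal (C₀.toReal + 1) := by
    rw [ENNReal.ofReal_add ENNReal.toReal_nonneg zero_le_one, ENNReal.ofReal_toReal hC₀t]
    exact le_self_add
  suffices h : wconv R f x ≤ C₀ * ENNReal.ofReal (R ^ ((N : ℝ) / p)) * mor p q f from
    h.trans (by gcongr)
  have hmd : Measurable fun z : Sp N => ENNReal.ofReal (dwt R (x - z)) :=
    (continuous_dwt.comp (continuous_const.prodMk
      (continuous_const.sub continuous_id))).measurable.ennreal_ofReal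
  have step2 := mul_wconv_le hR0 hf x
  have step3 : ∫⁻ z, ENNReal.ofReal (dwt R (x - z)) * ∫⁻ y in ball z R⁻¹, f y ≤
      wtMass N * (ω ^ (1 - 1 / q) * ENNReal.ofReal (R⁻¹ ^ ((N : ℝ) - N / p)) * mor p q f) := by
    have : ∫⁻ z, ENNReal.ofReal (dwt R (x - z)) = wtMass N := by
      rw [← lintegral_dwt hR0, ← lintegral_sub_left_eq_self _ x]
      simp
    rw [← this, ← lintegral_mul_const _ hmd]
    exact lintegral_mono fun z => mul_le_mul_right (setLIntegral_ball_le_mor hq hf z hρ0 hρ1) _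
  have hρN0 : ENNReal.ofReal (R⁻¹ ^ (N : ℝ)) ≠ 0 := by
    simp only [ne_eq, ENNReal.ofReal_eq_zero, not_le]; positivity
  have hk : ENNReal.ofReal (R⁻¹ ^ (N : ℝ)) * ω ≠ 0 := mul_ne_zero hρN0 hω0
  have hkt : ENNReal.ofReal (R⁻¹ ^ (N : ℝ)) * ω ≠ ⊤ := ENNReal.mul_ne_top ENNReal.ofReal_ne_top hωt
  refine (ENNReal.mul_le_mul_iff_right hk hkt).1 (step2.trans ?_)
  refine (mul_le_mul_right step3 _).trans_eq ?_
  have e3 : ENNReal.ofReal (R⁻¹ ^ ((N : ℝ) - N / p)) =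
      ENNReal.ofReal (R⁻¹ ^ (N : ℝ)) * ENNReal.ofReal (R ^ ((N : ℝ) / p)) := by
    rw [← ENNReal.ofReal_mul (by positivity), Real.rpow_sub hρ0, Real.inv_rpow hR0.le (↑N / p)]
    congr 1
    field_simp
  rw [e3, hC₀]
  calc _ = (ω * ω⁻¹) * (2 ^ (N + 1) * (wtMass N * (ω ^ (1 - 1 / q) *
        (ENNReal.ofReal (R⁻¹ ^ (N : ℝ)) * ENNReal.ofReal (R ^ ((N : ℝ) / p))) * mor p q f))) := by
        rw [ENNReal.mul_inv_cancel hω0 hωt, one_mul]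
    _ = _ := by ring

/-- Smoothing from M^{p/γ}_{q/γ} to M^p_q, by interpolation. The L^∞ bound costs R^{Nγ/p} and enters
with the power 1 - 1/γ; the bound in M^{p/γ}_{q/γ} itself costs no power of R. The product of
exponents is N(γ-1)/p. -/
theorem exists_mor_wconv_le (N : ℕ) {p q γ : ℝ} (hγ : 1 < γ) (hq : γ ≤ q) (hp : 0 < p) :
    ∃ C : ℝ, 0 < C ∧ ∀ (R : ℝ), 1 ≤ R → ∀ f : Sp N → ℝ≥0∞, Measurable f →
      mor p q (wconv R f) ≤ ENNReal.ofReal C * ENNReal.ofReal (R ^ ((N : ℝ) * (γ - 1) / p)) *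
        mor (p / γ) (q / γ) f := by
  have hγ0 : 0 < γ := by linarith
  have hq1 : 1 ≤ q / γ := by rwa [one_le_div hγ0]
  obtain ⟨C₁, hC₁, h₁⟩ := exists_wconv_le N (p := p / γ) hq1
  have hθ : 0 ≤ 1 - 1 / γ := by rw [sub_nonneg, div_le_one hγ0]; exact hγ.le
  set C₂ := ENNReal.ofReal C₁ ^ (1 - 1 / γ) * wtMass N ^ (1 / γ) with hC₂
  have hC₂t : C₂ ≠ ⊤ := ENNReal.mul_ne_top (ENNReal.rpow_ne_top_of_nonneg hθ ENNReal.ofReal_ne_top)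
    (ENNReal.rpow_ne_top_of_nonneg (by positivity) wtMass_lt_top.ne)
  refine ⟨C₂.toReal + 1, by positivity, fun R hR f hf => ?_⟩
  have hR0 : 0 < R := by linarith
  have hC : C₂ ≤ ENNReal.ofReal (C₂.toReal + 1) := by
    rw [ENNReal.ofReal_add (by positivity) zero_le_one, ENNReal.ofReal_toReal hC₂t]
    exact le_self_add
  refine le_trans ?_ (mul_le_mul_left (mul_le_mul_left hC _) _)
  set m := mor (p / γ) (q / γ) f
  -- The interpolation needs a finite supremum. If the norm is infinite, so is the right-hand side,
  -- because its constants do not vanish.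
  rcases eq_or_ne m ⊤ with hm | hm
  · rw [hm, ENNReal.mul_top]
    · exact le_top
    · refine mul_ne_zero (mul_ne_zero ?_ ?_) ?_
      · simp [ENNReal.rpow_eq_zero_iff, hC₁]
      · have : wtMass N ≠ 0 := by
          intro h0
          have := (lintegral_eq_zero_iff continuous_wt.measurable.ennreal_ofReal).1 h0
          obtain ⟨x, hx⟩ := this.exists
          simp only [Pi.zero_apply, ENNReal.ofReal_eq_zero] at hx
          exact absurd (wt_pos x) (not_lt.2 hx)
        simp [ENNReal.rpow_eq_zero_iff, this, wtMass_lt_top.ne]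
      · simp only [ne_eq, ENNReal.ofReal_eq_zero, not_le]; positivity
  have hS := mor_le_of_le_const (p := p) hγ (by linarith : 0 < q)
    (S := ENNReal.ofReal C₁ * ENNReal.ofReal (R ^ ((N : ℝ) / (p / γ))) * m)
    (ENNReal.mul_ne_top (ENNReal.mul_ne_top ENNReal.ofReal_ne_top ENNReal.ofReal_ne_top) hm)
    (h₁ R hR f hf)
  refine hS.trans ((mul_le_mul_right (ENNReal.rpow_le_rpow (mor_wconv_le hq1 hR0 hf)
    (by positivity)) _).trans_eq ?_)
  rw [ENNReal.mul_rpow_of_nonneg _ _ hθ, ENNReal.mul_rpow_of_nonneg _ _ hθ,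
    ENNReal.mul_rpow_of_nonneg _ _ (by positivity : 0 ≤ 1 / γ),
    ENNReal.ofReal_rpow_of_pos (p := 1 - 1 / γ) (x := R ^ ((N : ℝ) / (p / γ))) (by positivity), ← Real.rpow_mul hR0.le]
  have e1 : (N : ℝ) / (p / γ) * (1 - 1 / γ) = N * (γ - 1) / p := by field_simp
  have e2 : m = m ^ (1 - 1 / γ) * m ^ (1 / γ) := by
    rw [← ENNReal.rpow_add_of_nonneg _ _ hθ (by positivity)]; simp
  rw [e1]
  have e3 : mor (p / γ) (q / γ) f = m := rfl
  rw [e3]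
  conv_rhs => rw [e2, hC₂]
  ring

end BesovMorrey

end

noncomputable section

namespace BesovMorrey

open MeasureTheory Set Filter Metric
open scoped ENNReal SchwartzMap FourierTransform Topology ContDiff Nat

variable {N : ℕ}

/-! ### Radial cutoffs -/

/-- The radial cutoff `ζ(r|ξ|)`. -/
def cut (ζ : ℝ → ℝ) (r : ℝ) (ξ : Sp N) : ℝ := ζ (r * ‖ξ‖)

section Cut

variable {ζ : ℝ → ℝ} (hζ : IsCutoff ζ)
include hζ

theorem IsCutoff.eq_zero {t : ℝ} (ht : 5 / 3 ≤ t) : ζ t = 0 := by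
  by_contra h
  have : t ∈ closure {t | 0 ≤ t ∧ ζ t ≠ 0} := subset_closure ⟨by linarith, h⟩
  exact absurd (hζ.supp this).2 (not_lt.2 ht)

theorem cut_eq_one {r : ℝ} (hr : 0 ≤ r) {ξ : Sp N} (h : r * ‖ξ‖ ≤ 3 / 2) : cut ζ r ξ = 1 :=
  hζ.eq_one _ ⟨by positivity, h⟩

theorem cut_eq_zero {r : ℝ} {ξ : Sp N} (h : 5 / 3 ≤ r * ‖ξ‖) : cut ζ r ξ = 0 :=
  hζ.eq_zero h

theorem cut_mem_Icc {r : ℝ} (hr : 0 ≤ r) (ξ : Sp N) : cut ζ r ξ ∈ Icc (0 : ℝ) 1 :=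
  hζ.mem_Icc _ (by positivity)

/-- The norm is smooth away from the origin, and near the origin the cutoff is identically 1. -/
theorem contDiff_cut {r : ℝ} (hr : 0 < r) : ContDiff ℝ ∞ (cut ζ r : Sp N → ℝ) := by
  rw [contDiff_iff_contDiffAt]
  intro ξ
  rcases lt_or_ge (r * ‖ξ‖) (3 / 2) with h | h
  · have : (cut ζ r : Sp N → ℝ) =ᶠ[𝓝 ξ] fun _ => 1 := by
      have : ∀ᶠ η in 𝓝 ξ, r * ‖η‖ < 3 / 2 :=
        (continuous_const.mul continuous_norm).continuousAt.eventually_lt continuousAt_const h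
      filter_upwards [this] with η hη
      exact cut_eq_one hζ hr.le hη.le
    exact contDiffAt_const.congr_of_eventuallyEq this
  · have hξ : ξ ≠ 0 := by
      rintro rfl
      norm_num at h
    have h1 : ContDiffAt ℝ ∞ ζ (r * ‖ξ‖) := by
      refine hζ.smooth.contDiffAt (Ici_mem_nhds ?_)
      linarith
    exact h1.comp ξ (contDiffAt_const.mul (contDiffAt_norm ℝ hξ))

theorem hasCompactSupport_cut {r : ℝ} (hr : 0 < r) :
    HasCompactSupport (cut ζ r : Sp N → ℝ) := by
  refine HasCompactSupport.intro (isCompact_closedBall 0 (5 / 3 / r)) fun ξ hξ => ?_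
  refine cut_eq_zero hζ ?_
  simp only [mem_closedBall, dist_zero_right, not_le] at hξ
  rw [div_lt_iff₀ hr] at hξ
  linarith

omit hζ in
theorem lowSymbol_two_pi_smul (ξ : Sp N) :
    lowSymbol ζ ((2 * Real.pi) • ξ) = cut ζ (2 * Real.pi) ξ := by
  simp [lowSymbol, cut, norm_smul, abs_of_pos Real.pi_pos]

omit hζ in
theorem dyadicSymbol_two_pi_smul (j : ℤ) (ξ : Sp N) :
    dyadicSymbol ζ j ((2 * Real.pi) • ξ) =
      cut ζ (2 ^ (-j) * (2 * Real.pi)) ξ - cut ζ (2 ^ (1 - j) * (2 * Real.pi)) ξ := by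
  simp [dyadicSymbol, cut, norm_smul, abs_of_pos Real.pi_pos, mul_assoc]

omit hζ in
theorem cut_smul {r R : ℝ} (hR : 0 ≤ R) (ξ : Sp N) : cut ζ r (R • ξ) = cut ζ (r * R) ξ := by
  simp [cut, norm_smul, abs_of_nonneg hR, mul_assoc]

end Cut

/-! ### Decay of inverse Fourier transforms -/

/-- `K` is continuously differentiable and `K`, `∇K` are bounded by `A` times the weight. -/
structure IsKernel (A : ℝ) (K : Sp N → ℂ) : Prop where
  contDiff : ContDiff ℝ 1 K
  norm_le : ∀ x, ‖K x‖ ≤ A * wt x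
  norm_fderiv_le : ∀ x, ‖fderiv ℝ K x‖ ≤ A * wt x

theorem IsKernel.mono {A B : ℝ} {K : Sp N → ℂ} (h : IsKernel A K) (hAB : A ≤ B) :
    IsKernel B K :=
  ⟨h.contDiff, fun x => (h.norm_le x).trans (mul_le_mul_of_nonneg_right hAB (wt_pos x).le),
    fun x => (h.norm_fderiv_le x).trans (mul_le_mul_of_nonneg_right hAB (wt_pos x).le)⟩

theorem exists_iteratedFDeriv_bound {F : Type*} [NormedAddCommGroup F] [NormedSpace ℝ F]
    {f : Sp N → F} (hf : ContDiff ℝ ∞ f) {K : Set (Sp N)} (hK : IsCompact K) (m : ℕ) :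
    ∃ C : ℝ, 1 ≤ C ∧ ∀ i ≤ m, ∀ x ∈ K, ‖iteratedFDeriv ℝ i f x‖ ≤ C := by
  have h : ∀ i : ℕ, ∃ C, ∀ x ∈ K, ‖iteratedFDeriv ℝ i f x‖ ≤ C := fun i =>
    hK.exists_bound_of_continuousOn
      (hf.continuous_iteratedFDeriv (mod_cast le_top)).continuousOn
  choose C hC using h
  refine ⟨1 + ∑ i ∈ Finset.range (m + 1), |C i|, ?_, fun i hi x hx => ?_⟩
  · have : 0 ≤ ∑ i ∈ Finset.range (m + 1), |C i| := Finset.sum_nonneg fun _ _ => abs_nonneg _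
    linarith
  · have : |C i| ≤ ∑ i ∈ Finset.range (m + 1), |C i| :=
      Finset.single_le_sum (f := fun i => |C i|) (fun _ _ => abs_nonneg _)
        (Finset.mem_range.2 (by omega))
    linarith [hC i x hx, le_abs_self (C i)]

/-- The constant depends only on ψ, h and m; g enters solely through the bound ε on its derivatives
along h. One constant thus serves a whole family of exponentials. -/
theorem exists_iteratedFDeriv_mul_comp_bound {ψ h : Sp N → ℝ} (hψ : ContDiff ℝ ∞ ψ)
    (hc : HasCompactSupport ψ) (hh : ContDiff ℝ ∞ h) (m : ℕ) :
    ∃ C : ℝ, 0 < C ∧ ∀ (g : ℝ → ℝ) (ε : ℝ), 0 ≤ ε → ContDiff ℝ ∞ g →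
      (∀ i ≤ m, ∀ ξ ∈ tsupport ψ, |iteratedDeriv i g (h ξ)| ≤ ε) →
      ∀ n ≤ m, ∀ ξ, ‖iteratedFDeriv ℝ n (fun ξ => ψ ξ * g (h ξ)) ξ‖ ≤ C * ε := by
  obtain ⟨P, hP1, hP⟩ := exists_iteratedFDeriv_bound hψ hc m
  obtain ⟨D, hD1, hD⟩ := exists_iteratedFDeriv_bound hh hc m
  refine ⟨∑ n ∈ Finset.range (m + 1), ∑ i ∈ Finset.range (n + 1),
    (n.choose i : ℝ) * P * ((n - i)! * D ^ (n - i)) + 1, by positivity, ?_⟩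
  intro g ε hε hg hgε n hn ξ
  have hnn : ∀ n : ℕ, 0 ≤ ∑ i ∈ Finset.range (n + 1),
      (n.choose i : ℝ) * P * ((n - i)! * D ^ (n - i)) := fun n => by positivity
  have hgh : ContDiff ℝ ∞ fun ξ => g (h ξ) := hg.comp hh
  by_cases hξ : ξ ∈ tsupport ψ
  · have h1 := norm_iteratedFDeriv_mul_le hψ hgh ξ (n := n) (mod_cast le_top)
    have h2 : ∀ i ∈ Finset.range (n + 1), (n.choose i : ℝ) * ‖iteratedFDeriv ℝ i ψ ξ‖ *
        ‖iteratedFDeriv ℝ (n - i) (fun ξ => g (h ξ)) ξ‖ ≤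
        (n.choose i : ℝ) * P * ((n - i)! * D ^ (n - i)) * ε := by
      intro i hi
      have hi' : i ≤ n := by simpa [Nat.lt_succ_iff] using hi
      have h3 : ‖iteratedFDeriv ℝ (n - i) (g ∘ h) ξ‖ ≤ (n - i)! * ε * D ^ (n - i) := by
        have hle : ∀ k : ℕ, (k : ℕ∞ω) ≤ (∞ : ℕ∞ω) := fun k => mod_cast le_top
        refine norm_iteratedFDeriv_comp_le hg hh (hle _) ξ ?_ ?_
        · intro k hk
          rw [norm_iteratedFDeriv_eq_norm_iteratedDeriv]
          exact hgε k (by omega) ξ hξ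
        · intro k hk1 hk2
          exact (hD k (by omega) ξ hξ).trans (le_self_pow₀ hD1 (by omega))
      calc _ ≤ (n.choose i : ℝ) * P * ((n - i)! * ε * D ^ (n - i)) := by
            gcongr
            · exact hP i (by omega) ξ hξ
            · exact h3
        _ = _ := by ring
    refine h1.trans ((Finset.sum_le_sum h2).trans ?_)
    rw [← Finset.sum_mul]
    gcongr
    have := Finset.single_le_sum (f := fun n => ∑ i ∈ Finset.range (n + 1),
      (n.choose i : ℝ) * P * ((n - i)! * D ^ (n - i))) (fun n _ => hnn n)
      (Finset.mem_range.2 (by omega : n < m + 1))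
    have h4 : ∀ n ∈ Finset.range (m + 1), ∑ i ∈ Finset.range (n + 1),
      (n.choose i : ℝ) * P * ((n - i)! * D ^ (n - i)) ≤ ∑ i ∈ Finset.range (n + 1),
      (n.choose i : ℝ) * P * ((n - i)! * D ^ (n - i)) + 1 := fun n _ => by linarith
    linarith [Finset.sum_le_sum h4]
  · have : ξ ∉ tsupport (fun ξ => ψ ξ * g (h ξ)) := fun h' =>
      hξ (tsupport_mul_subset_left h')
    have h0 : iteratedFDeriv ℝ n (fun ξ => ψ ξ * g (h ξ)) ξ = 0 := by
      by_contra hne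
      exact this (support_iteratedFDeriv_subset n hne)
    rw [h0, norm_zero]
    positivity

theorem one_add_pow_le (a : ℝ) (ha : 0 ≤ a) (n : ℕ) : (1 + a) ^ n ≤ 2 ^ n * (1 + a ^ n) := by
  have h : 1 + a ≤ 2 * max 1 a := by
    have := le_max_left 1 a; have := le_max_right 1 a; linarith
  calc (1 + a) ^ n ≤ (2 * max 1 a) ^ n := pow_le_pow_left₀ (by linarith) h _
    _ = 2 ^ n * (max 1 a) ^ n := mul_pow _ _ _
    _ ≤ _ := by
      gcongr
      rcases max_cases 1 a with ⟨h, _⟩ | ⟨h, _⟩ <;> rw [h]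
      · simp; positivity
      · simp

/-- A compactly supported symbol with small derivatives has a small, integrable kernel. -/
theorem exists_isKernel_fourierInv {T : Set (Sp N)} (hT : IsCompact T) :
    ∃ A : ℝ, 0 < A ∧ ∀ (f : Sp N → ℂ) (ε : ℝ), 0 ≤ ε → ContDiff ℝ ∞ f → tsupport f ⊆ T →
      (∀ n ≤ N + 1, ∀ ξ, ‖iteratedFDeriv ℝ n f ξ‖ ≤ ε) → IsKernel (A * ε) (𝓕⁻ f) := by
  set I : ℝ := ∫ v in T, (1 + ‖v‖) with hI
  have hI0 : 0 ≤ I := by positivity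
  have hint : IntegrableOn (fun v : Sp N => 1 + ‖v‖) T :=
    (continuous_const.add continuous_norm).continuousOn.integrableOn_compact hT
  -- In the decay estimate for Fourier transforms, with k ≤ 1 and n ≤ N + 1, the factor (2π)^k
  -- (2k+2)^n is at most 2π · 4^{N+1}, and there are at most 2(N+2) summands.
  set c : ℝ := (2 * Real.pi) * 4 ^ (N + 1) * (2 * (N + 2)) with hc
  have hc0 : 0 < c := by positivity
  refine ⟨2 ^ (N + 2) * (c * (I + 1)), by positivity, fun f ε hε hf hs hb => ?_⟩
  have hcs : HasCompactSupport f := hT.of_isClosed_subset (isClosed_tsupport f) hs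
  have hDint : ∀ k n : ℕ, Integrable fun v => ‖v‖ ^ k * ‖iteratedFDeriv ℝ n f v‖ := fun k n =>
    (((continuous_norm.pow k).mul
      (hf.continuous_iteratedFDeriv (mod_cast le_top)).norm)).integrable_of_hasCompactSupport
        ((hcs.iteratedFDeriv n).norm.mul_left)
  have hInt : ∀ k ≤ 1, ∀ n ≤ N + 1, ∫ v, ‖v‖ ^ k * ‖iteratedFDeriv ℝ n f v‖ ≤ ε * I := by
    intro k hk n hn
    have h0 : ∀ v ∉ T, ‖v‖ ^ k * ‖iteratedFDeriv ℝ n f v‖ = 0 := by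
      intro v hv
      have : iteratedFDeriv ℝ n f v = 0 := by
        by_contra hne
        exact hv (hs (support_iteratedFDeriv_subset n hne))
      simp [this]
    rw [← setIntegral_eq_integral_of_forall_compl_eq_zero h0, hI, ← integral_const_mul]
    refine setIntegral_mono_on (hDint k n).integrableOn (hint.const_mul _) hT.measurableSet
      fun v _ => ?_
    rw [mul_comm]
    have : ‖v‖ ^ k ≤ 1 + ‖v‖ := by
      interval_cases k
      · simp
      · simp
    gcongr
    exact hb n hn v
  have hmain : ∀ k ≤ 1, ∀ n ≤ N + 1, ∀ x : Sp N,
      ‖x‖ ^ n * ‖iteratedFDeriv ℝ k (𝓕 f) x‖ ≤ c * (ε * I) := by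
    intro k hk n hn x
    have h1 := Real.pow_mul_norm_iteratedFDeriv_fourier_le (K := ⊤) (N := ⊤) hf
      (fun k n _ _ => hDint k n) (k := k) (n := n) le_top le_top x
    have h2 : ∑ p ∈ Finset.range (k + 1) ×ˢ Finset.range (n + 1),
        ∫ v, ‖v‖ ^ p.1 * ‖iteratedFDeriv ℝ p.2 f v‖ ≤ (2 * (N + 2)) * (ε * I) := by
      calc _ ≤ ∑ p ∈ Finset.range (k + 1) ×ˢ Finset.range (n + 1), ε * I := by
            refine Finset.sum_le_sum fun p hp => ?_
            simp only [Finset.mem_product, Finset.mem_range] at hp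
            exact hInt _ (by omega) _ (by omega)
        _ = ((k + 1 : ℕ) * (n + 1 : ℕ) : ℝ) * (ε * I) := by
            rw [Finset.sum_const, Finset.card_product, Finset.card_range, Finset.card_range]
            simp
        _ ≤ _ := by
            gcongr
            · exact_mod_cast (by omega : k + 1 ≤ 2)
            · exact_mod_cast (by omega : n + 1 ≤ N + 2)
    have h3 : (2 * Real.pi) ^ k * (2 * k + 2) ^ n ≤ (2 * Real.pi) * 4 ^ (N + 1) := by
      have hpi : 1 ≤ 2 * Real.pi := by linarith [Real.pi_gt_three]
      have a1 : (2 * Real.pi) ^ k ≤ 2 * Real.pi := by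
        calc _ ≤ (2 * Real.pi) ^ 1 := pow_le_pow_right₀ hpi hk
          _ = _ := pow_one _
      have a2 : (2 * (k : ℝ) + 2) ^ n ≤ 4 ^ (N + 1) := by
        have : (k : ℝ) ≤ 1 := by exact_mod_cast hk
        calc _ ≤ (4 : ℝ) ^ n := pow_le_pow_left₀ (by positivity) (by linarith) _
          _ ≤ _ := pow_le_pow_right₀ (by norm_num) hn
      exact mul_le_mul a1 a2 (by positivity) (by positivity)
    have h4 : 0 ≤ ∑ p ∈ Finset.range (k + 1) ×ˢ Finset.range (n + 1),
        ∫ v, ‖v‖ ^ p.1 * ‖iteratedFDeriv ℝ p.2 f v‖ :=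
      Finset.sum_nonneg fun p _ => by positivity
    calc _ ≤ _ := h1
      _ ≤ ((2 * Real.pi) * 4 ^ (N + 1)) * ((2 * (N + 2)) * (ε * I)) :=
        mul_le_mul h3 h2 h4 (by positivity)
      _ = _ := by rw [hc]; ring
  -- The powers 0 and N + 1 of |x| together give the decay of `wt`; k = 0 and k = 1 are the kernel
  -- and its gradient.
  have hdecay : ∀ k ≤ 1, ∀ x : Sp N, ‖iteratedFDeriv ℝ k (𝓕 f) x‖ ≤
      2 ^ (N + 2) * (c * (I + 1)) * ε * wt x := by
    intro k hk x
    have a1 := hmain k hk 0 (by omega) x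
    have a2 := hmain k hk (N + 1) le_rfl x
    have a3 := one_add_pow_le ‖x‖ (norm_nonneg x) (N + 1)
    rw [wt, ← div_eq_mul_inv, le_div_iff₀ (by positivity)]
    set y := ‖iteratedFDeriv ℝ k (𝓕 f) x‖
    have hy : 0 ≤ y := norm_nonneg _
    calc y * (1 + ‖x‖) ^ (N + 1) ≤ y * (2 ^ (N + 1) * (1 + ‖x‖ ^ (N + 1))) := by gcongr
      _ = 2 ^ (N + 1) * (‖x‖ ^ 0 * y + ‖x‖ ^ (N + 1) * y) := by ring
      _ ≤ 2 ^ (N + 1) * (c * (ε * I) + c * (ε * I)) := by gcongr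
      _ = 2 ^ (N + 2) * (c * I) * ε := by ring
      _ ≤ _ := by gcongr; linarith
  have hFC : ContDiff ℝ 1 (𝓕 f) := by
    refine Real.contDiff_fourier (N := 1) fun n _ => ?_
    have := hDint n 0
    simpa using this
  have e : 𝓕⁻ f = 𝓕 f ∘ (LinearIsometryEquiv.neg ℝ : Sp N ≃ₗᵢ[ℝ] Sp N) := by
    ext x
    simp [Real.fourierInv_eq_fourier_neg]
  have hK : ∀ k ≤ 1, ∀ x : Sp N, ‖iteratedFDeriv ℝ k (𝓕⁻ f) x‖ ≤
      2 ^ (N + 2) * (c * (I + 1)) * ε * wt x := by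
    intro k hk x
    rw [e, LinearIsometryEquiv.norm_iteratedFDeriv_comp_right]
    refine (hdecay k hk _).trans_eq ?_
    simp [wt_neg]
  refine ⟨?_, fun x => ?_, fun x => ?_⟩
  · rw [e]
    exact hFC.comp (LinearIsometryEquiv.neg ℝ).contDiff
  · simpa using hK 0 (by omega) x
  · simpa [norm_iteratedFDeriv_one] using hK 1 le_rfl x

theorem contDiff_mul_comp_ofReal {ψ h : Sp N → ℝ} {g : ℝ → ℝ} (hψ : ContDiff ℝ ∞ ψ)
    (hh : ContDiff ℝ ∞ h) (hg : ContDiff ℝ ∞ g) :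
    ContDiff ℝ ∞ fun ξ => ((ψ ξ * g (h ξ) : ℝ) : ℂ) :=
  Complex.ofRealCLM.contDiff.comp (hψ.mul (hg.comp hh))

theorem exists_isKernel_mul_comp {ψ h : Sp N → ℝ} (hψ : ContDiff ℝ ∞ ψ)
    (hc : HasCompactSupport ψ) (hh : ContDiff ℝ ∞ h) :
    ∃ A : ℝ, 0 < A ∧ ∀ (g : ℝ → ℝ) (ε : ℝ), 0 ≤ ε → ContDiff ℝ ∞ g →
      (∀ i ≤ N + 1, ∀ ξ ∈ tsupport ψ, |iteratedDeriv i g (h ξ)| ≤ ε) →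
      IsKernel (A * ε) (𝓕⁻ fun ξ => ((ψ ξ * g (h ξ) : ℝ) : ℂ)) := by
  obtain ⟨A, hA, h1⟩ := exists_isKernel_fourierInv (N := N) hc
  obtain ⟨C, hC, h2⟩ := exists_iteratedFDeriv_mul_comp_bound hψ hc hh (N + 1)
  refine ⟨A * C, by positivity, fun g ε hε hg hgε => ?_⟩
  rw [mul_assoc]
  refine h1 _ (C * ε) (by positivity) (contDiff_mul_comp_ofReal hψ hh hg) ?_ ?_
  · refine closure_mono fun ξ hξ => ?_
    simp only [Function.mem_support] at hξ ⊢
    intro h0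
    simp [h0] at hξ
  · intro n hn ξ
    have := Complex.ofRealLI.norm_iteratedFDeriv_comp_left
      (f := fun ξ => ψ ξ * g (h ξ)) (x := ξ) (i := n) (n := ∞)
      ((hψ.mul (hg.comp hh)).contDiffAt) (mod_cast le_top)
    exact this.trans_le (h2 g ε hε hg hgε n hn ξ)

/-! ### Exponential symbols on compact sets where the phase is positive -/

theorem exists_one_add_pow_mul_exp_le (m : ℕ) {c : ℝ} (hc : 0 < c) :
    ∃ C : ℝ, 0 < C ∧ ∀ l : ℝ, 0 ≤ l → (1 + l) ^ m * Real.exp (-(l * c)) ≤ C := by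
  refine ⟨(1 + (m + 1) / c) ^ m, by positivity, fun l hl => ?_⟩
  have h1 : 1 + l ≤ (1 + (m + 1) / c) * Real.exp (l * c / (m + 1)) := by
    have : 1 + l * c / (m + 1) ≤ Real.exp (l * c / (m + 1)) := by
      linarith [Real.add_one_le_exp (l * c / (m + 1))]
    calc 1 + l ≤ (1 + (m + 1) / c) * (1 + l * c / (m + 1)) := by
          have e : (1 + (m + 1) / c) * (1 + l * c / (m + 1)) =
            1 + l + ((m + 1) / c + l * c / (m + 1)) := by field_simp; ring
          rw [e]
          have : 0 ≤ (m + 1) / c + l * c / (m + 1) := by positivity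
          linarith
      _ ≤ _ := by gcongr
  have h2 : (Real.exp (l * c / (m + 1))) ^ m ≤ Real.exp (l * c) := by
    rw [← Real.exp_nat_mul, Real.exp_le_exp, mul_div_assoc', div_le_iff₀ (by positivity)]
    have : 0 ≤ l * c := by positivity
    nlinarith
  calc (1 + l) ^ m * Real.exp (-(l * c))
      ≤ ((1 + (m + 1) / c) * Real.exp (l * c / (m + 1))) ^ m * Real.exp (-(l * c)) := by gcongr
    _ ≤ ((1 + (m + 1) / c) ^ m * Real.exp (l * c)) * Real.exp (-(l * c)) := by
        rw [mul_pow]; gcongr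
    _ = (1 + (m + 1) / c) ^ m := by
        rw [mul_assoc, ← Real.exp_add]; simp

theorem iteratedDeriv_exp_neg_mul (n : ℕ) (l z : ℝ) :
    iteratedDeriv n (fun z => Real.exp (-l * z)) z = (-l) ^ n * Real.exp (-l * z) := by
  rw [iteratedDeriv_exp_const_mul]

section Block

variable {ψ h : Sp N → ℝ} (hψ : ContDiff ℝ ∞ ψ) (hcs : HasCompactSupport ψ)
  (hh : ContDiff ℝ ∞ h) {c : ℝ} (hc : 0 < c) (hch : ∀ ξ ∈ tsupport ψ, c ≤ h ξ)
include hψ hcs hh hc hch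

/-- Each of the at most N + 1 derivatives of exp(-lz) costs a factor l, but z ≥ c > 0 on the
support, so exp(-lc) beats every power of l. The rate L is therefore arbitrary. -/
theorem exists_isKernel_block (L : ℕ) :
    ∃ A : ℝ, 0 < A ∧ ∀ l : ℝ, 0 ≤ l →
      IsKernel (A * ((1 + l) ^ L)⁻¹) (𝓕⁻ fun ξ => ((ψ ξ * Real.exp (-l * h ξ) : ℝ) : ℂ)) := by
  obtain ⟨A, hA, h1⟩ := exists_isKernel_mul_comp hψ hcs hh
  obtain ⟨C, hC, h2⟩ := exists_one_add_pow_mul_exp_le (L + (N + 1)) hc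
  refine ⟨A * C, by positivity, fun l hl => ?_⟩
  rw [mul_assoc]
  refine h1 (fun z => Real.exp (-l * z)) _ (by positivity)
    (Real.contDiff_exp.comp (contDiff_const.mul contDiff_id)) fun i hi ξ hξ => ?_
  rw [iteratedDeriv_exp_neg_mul, abs_mul, abs_pow, abs_neg, abs_of_nonneg hl, Real.abs_exp,
    ← div_eq_mul_inv, le_div_iff₀ (by positivity)]
  calc l ^ i * Real.exp (-l * h ξ) * (1 + l) ^ L
      ≤ (1 + l) ^ (N + 1) * Real.exp (-(l * c)) * (1 + l) ^ L := by
        gcongr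
        · calc l ^ i ≤ (1 + l) ^ i := pow_le_pow_left₀ hl (by linarith) _
            _ ≤ _ := pow_le_pow_right₀ (by linarith) hi
        · have := mul_le_mul_of_nonneg_left (hch ξ hξ) hl
          linarith
    _ = (1 + l) ^ (L + (N + 1)) * Real.exp (-(l * c)) := by ring
    _ ≤ C := h2 l hl

/-- For small l the symbol is O(l) together with its derivatives: 1 - e^{-x} ≤ x handles order zero,
l^i ≤ l the others. This smallness makes the low-frequency pieces of the heat kernel summable. -/
theorem exists_isKernel_block_sub_one :
    ∃ A : ℝ, 0 < A ∧ ∀ l : ℝ, 0 ≤ l → l ≤ 1 →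
      IsKernel (A * l) (𝓕⁻ fun ξ => ((ψ ξ * (Real.exp (-l * h ξ) - 1) : ℝ) : ℂ)) := by
  obtain ⟨A, hA, h1⟩ := exists_isKernel_mul_comp hψ hcs hh
  obtain ⟨H, hH⟩ := hcs.exists_bound_of_continuousOn hh.continuous.continuousOn
  refine ⟨A * (1 + |H|), by positivity, fun l hl hl1 => ?_⟩
  rw [mul_assoc]
  refine h1 (fun z => Real.exp (-l * z) - 1) _ (by positivity)
    ((Real.contDiff_exp.comp (contDiff_const.mul contDiff_id)).sub contDiff_const)
    fun i hi ξ hξ => ?_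
  have hpos : 0 ≤ h ξ := hc.le.trans (hch ξ hξ)
  have hle : Real.exp (-l * h ξ) ≤ 1 := by
    rw [Real.exp_le_one_iff]
    have := mul_nonneg hl hpos
    linarith
  have hlH : l ≤ (1 + |H|) * l := by nlinarith [abs_nonneg H]
  rcases Nat.eq_zero_or_pos i with rfl | hi0
  · rw [iteratedDeriv_zero, abs_sub_comm, abs_of_nonneg (by linarith)]
    have : 1 - Real.exp (-l * h ξ) ≤ l * h ξ := by
      linarith [Real.add_one_le_exp (-l * h ξ)]
    have h4 : h ξ ≤ |H| := by
      have := hH ξ hξ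
      rw [Real.norm_of_nonneg hpos] at this
      exact this.trans (le_abs_self H)
    nlinarith
  · have e : iteratedDeriv i (fun z => Real.exp (-l * z) - 1) (h ξ) =
        (-l) ^ i * Real.exp (-l * h ξ) := by
      rw [← iteratedDeriv_exp_neg_mul, show i = (i - 1) + 1 by omega]
      rw [iteratedDeriv_succ', iteratedDeriv_succ']
      congr 1
      ext z
      simp
    rw [e, abs_mul, abs_pow, abs_neg, abs_of_nonneg hl, Real.abs_exp]
    calc l ^ i * Real.exp (-l * h ξ) ≤ l * 1 := by
          gcongr
          exact pow_le_of_le_one hl hl1 (by omega)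
      _ ≤ _ := by linarith

end Block

end BesovMorrey

end

noncomputable section

namespace BesovMorrey

open MeasureTheory Set Filter Metric
open scoped ENNReal SchwartzMap FourierTransform Topology ContDiff Nat

variable {N : ℕ}

/-! ### Smooth versions of `|ξ|^θ` -/

/-- A bump equal to 1 on [c, 1] removes the singularity of w^r at 0. The intended argument is w =
|ξ|²/(1+|ξ|²), which stays in such an interval when ξ stays away from the origin. -/
theorem exists_smooth_rpow (r : ℝ) {c : ℝ} (hc : 0 < c) (hc1 : c < 1) :
    ∃ k : ℝ → ℝ, k.HasTemperateGrowth ∧ (∀ w, 0 ≤ k w) ∧ ∀ w ∈ Icc c 1, k w = w ^ r := by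
  let b : ContDiffBump (1 : ℝ) := ⟨1 - c, 1 - c / 2, by linarith, by linarith⟩
  have hb0 : ∀ w : ℝ, w ≤ c / 2 → b w = 0 := fun w hw => by
    refine b.zero_of_le_dist ?_
    rw [Real.dist_eq, abs_of_nonpos (by linarith)]
    change 1 - c / 2 ≤ _
    linarith
  have hb1 : ∀ w ∈ Icc c 1, b w = 1 := fun w hw => by
    refine b.one_of_mem_closedBall ?_
    rw [mem_closedBall, Real.dist_eq, abs_of_nonpos (by linarith [hw.2])]
    change _ ≤ 1 - c
    linarith [hw.1]
  have hsm : ContDiff ℝ ∞ fun w : ℝ => b w * w ^ r := by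
    rw [contDiff_iff_contDiffAt]
    intro w
    rcases lt_or_ge 0 w with hw | hw
    · exact b.contDiff.contDiffAt.mul (Real.contDiffAt_rpow_const_of_ne hw.ne')
    · have : (fun w : ℝ => b w * w ^ r) =ᶠ[𝓝 w] fun _ => 0 := by
        filter_upwards [Iio_mem_nhds (by linarith : w < c / 2)] with v hv
        rw [hb0 v (le_of_lt hv), zero_mul]
      exact contDiffAt_const.congr_of_eventuallyEq this
  refine ⟨fun w => b w * w ^ r, ?_, fun w => ?_, fun w hw => by simp only; rw [hb1 w hw, one_mul]⟩
  · exact HasCompactSupport.hasTemperateGrowth b.hasCompactSupport.mul_right hsm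
  · rcases lt_or_ge 0 w with hw | hw
    · exact mul_nonneg b.nonneg (by positivity)
    · simp only; rw [hb0 w (by linarith), zero_mul]

/-- A smooth function of temperate growth that equals `|2πξ|^θ` away from the origin. -/
theorem exists_temperate_norm_rpow (N : ℕ) (θ : ℝ) {c : ℝ} (hc : 0 < c) :
    ∃ h : Sp N → ℝ, h.HasTemperateGrowth ∧ (∀ ξ, 0 ≤ h ξ) ∧
      ∀ ξ, c ≤ ‖ξ‖ → h ξ = ‖(2 * Real.pi) • ξ‖ ^ θ := by
  have hd : 0 < 1 - (1 + c ^ 2)⁻¹ := by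
    rw [sub_pos]; exact inv_lt_one_of_one_lt₀ (by nlinarith)
  obtain ⟨k, hk, hk0, hk1⟩ := exists_smooth_rpow (θ / 2) hd
    (by rw [sub_lt_self_iff]; positivity)
  -- |ξ|^θ is factored as (1+|ξ|²)^{θ/2} w^{θ/2} with w = 1 - (1+|ξ|²)^{-1}. Real powers of 1+|ξ|²
  -- have temperate growth, and w lies in [1 - (1+c²)^{-1}, 1] for |ξ| ≥ c.
  refine ⟨fun ξ => (2 * Real.pi) ^ θ * ((1 + ‖ξ‖ ^ 2) ^ (θ / 2) *
    k (1 - (1 + ‖ξ‖ ^ 2) ^ (-1 : ℝ))), ?_, fun ξ => ?_, fun ξ hξ => ?_⟩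
  · have h1 : (fun ξ : Sp N => (1 + ‖ξ‖ ^ 2) ^ (θ / 2)).HasTemperateGrowth :=
      Function.hasTemperateGrowth_one_add_norm_sq_rpow _ _
    have h2 : (fun ξ : Sp N => 1 - (1 + ‖ξ‖ ^ 2) ^ (-1 : ℝ)).HasTemperateGrowth :=
      (Function.HasTemperateGrowth.const 1).sub
        (Function.hasTemperateGrowth_one_add_norm_sq_rpow _ _)
    exact (Function.HasTemperateGrowth.const _).mul (h1.mul (hk.comp h2))
  · exact mul_nonneg (by positivity) (mul_nonneg (by positivity) (hk0 _))
  · have hpos : 0 < ‖ξ‖ := hc.trans_le hξ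
    have hw : 1 - (1 + ‖ξ‖ ^ 2) ^ (-1 : ℝ) = ‖ξ‖ ^ 2 / (1 + ‖ξ‖ ^ 2) := by
      rw [Real.rpow_neg_one]; field_simp; ring
    beta_reduce
    rw [hk1]
    · rw [hw, ← Real.mul_rpow (by positivity) (by positivity), norm_smul,
        Real.norm_of_nonneg (by positivity : 0 ≤ 2 * Real.pi),
        Real.mul_rpow (x := 2 * Real.pi) (by positivity) (norm_nonneg ξ)]
      congr 1
      rw [mul_div_cancel₀ _ (by positivity : (1 + ‖ξ‖ ^ 2) ≠ 0), ← Real.rpow_natCast,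
        ← Real.rpow_mul (norm_nonneg _)]
      congr 1
      push_cast
      ring
    · constructor
      · rw [Real.rpow_neg_one]
        gcongr
      · rw [Real.rpow_neg_one, sub_le_self_iff]
        positivity

/-- On the whole line exp(-tz) is not of temperate growth, so the composition rule is applied on [0,
∞), where all its derivatives are bounded. -/
theorem hasTemperateGrowth_exp_neg {h : Sp N → ℝ} (hh : h.HasTemperateGrowth)
    (h0 : ∀ ξ, 0 ≤ h ξ) {t : ℝ} (ht : 0 ≤ t) :
    (fun ξ => Real.exp (-t * h ξ)).HasTemperateGrowth := by
  have hsm : ContDiff ℝ ∞ fun z : ℝ => Real.exp (-t * z) :=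
    Real.contDiff_exp.comp (contDiff_const.mul contDiff_id)
  refine Function.HasTemperateGrowth.comp' (g := fun z => Real.exp (-t * z)) (t := Ici 0)
    (by rintro _ ⟨ξ, rfl⟩; exact h0 ξ) (uniqueDiffOn_Ici 0) hsm.contDiffOn ?_ hh
  intro n
  refine ⟨0, (1 + t) ^ n, by positivity, fun m hm x hx => ?_⟩
  rw [iteratedFDerivWithin_eq_iteratedFDeriv (uniqueDiffOn_Ici 0)
    (hsm.contDiffAt.of_le (mod_cast le_top)) hx, norm_iteratedFDeriv_eq_norm_iteratedDeriv,
    iteratedDeriv_exp_neg_mul, Real.norm_eq_abs, abs_mul, abs_pow, abs_neg, abs_of_nonneg ht,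
    Real.abs_exp, pow_zero, mul_one]
  have h1 : Real.exp (-t * x) ≤ 1 := by
    rw [Real.exp_le_one_iff]
    have := mul_nonneg ht hx
    linarith
  calc t ^ m * Real.exp (-t * x) ≤ (1 + t) ^ n * 1 := by
        gcongr
        calc t ^ m ≤ (1 + t) ^ m := pow_le_pow_left₀ ht (by linarith) _
          _ ≤ _ := pow_le_pow_right₀ (by linarith) hm
    _ = _ := mul_one _

/-! ### Annular symbols -/

/-- The annular symbol `ζ(a|ξ|) - ζ(b|ξ|)`. -/
def ann (ζ : ℝ → ℝ) (a b : ℝ) (ξ : Sp N) : ℝ := cut ζ a ξ - cut ζ b ξ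

/-- The function `|2πξ|^θ`. -/
def nrm (θ : ℝ) (ξ : Sp N) : ℝ := ‖(2 * Real.pi) • ξ‖ ^ θ

theorem nrm_nonneg (θ : ℝ) (ξ : Sp N) : 0 ≤ nrm θ ξ := Real.rpow_nonneg (norm_nonneg _) _

theorem nrm_smul (θ : ℝ) {R : ℝ} (hR : 0 ≤ R) (ξ : Sp N) : nrm θ (R • ξ) = R ^ θ * nrm θ ξ := by
  rw [nrm, smul_comm, norm_smul, Real.mul_rpow (norm_nonneg _) (norm_nonneg _),
    Real.norm_of_nonneg hR, nrm]

theorem continuous_nrm {θ : ℝ} (hθ : 0 ≤ θ) : Continuous (nrm θ : Sp N → ℝ) :=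
  ((continuous_const_smul _).norm).rpow_const fun _ => Or.inr hθ

theorem heatSymbol_two_pi_smul (θ t : ℝ) (ξ : Sp N) :
    heatSymbol θ t ((2 * Real.pi) • ξ) = Real.exp (-t * nrm θ ξ) := rfl

section Ann

variable {ζ : ℝ → ℝ} (hζ : IsCutoff ζ)
include hζ

theorem contDiff_ann {a b : ℝ} (ha : 0 < a) (hb : 0 < b) :
    ContDiff ℝ ∞ (ann ζ a b : Sp N → ℝ) :=
  (contDiff_cut hζ ha).sub (contDiff_cut hζ hb)

theorem hasCompactSupport_ann {a b : ℝ} (ha : 0 < a) (hb : 0 < b) :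
    HasCompactSupport (ann ζ a b : Sp N → ℝ) :=
  (hasCompactSupport_cut hζ ha).sub (hasCompactSupport_cut hζ hb)

theorem le_of_mem_tsupport_ann {a b : ℝ} (ha : 0 < a) (hab : a ≤ b) {ξ : Sp N}
    (hξ : ξ ∈ tsupport (ann ζ a b : Sp N → ℝ)) : 3 / 2 ≤ b * ‖ξ‖ := by
  have hcl : IsClosed {ξ : Sp N | 3 / 2 ≤ b * ‖ξ‖} :=
    isClosed_le continuous_const (continuous_const.mul continuous_norm)
  refine closure_minimal (fun η hη => ?_) hcl hξ
  by_contra h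
  simp only [mem_ofPred_eq, not_le] at h
  refine hη ?_
  have h1 : a * ‖η‖ ≤ b * ‖η‖ := by gcongr
  rw [ann, cut_eq_one hζ ha.le (by linarith), cut_eq_one hζ (ha.le.trans hab) h.le, sub_self]

/-- The support of an annular symbol avoids the origin, so there |2πξ|^θ may be exchanged for an
everywhere smooth function under any outer function g. Compactness of the support yields the lower
bound c. -/
theorem exists_temperate_ann (θ : ℝ) {a b : ℝ} (ha : 0 < a) (hab : a ≤ b) :
    ∃ h : Sp N → ℝ, h.HasTemperateGrowth ∧
      (∃ c : ℝ, 0 < c ∧ ∀ ξ ∈ tsupport (ann ζ a b : Sp N → ℝ), c ≤ h ξ) ∧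
      ∀ ξ (g : ℝ → ℝ), ann ζ a b ξ * g (h ξ) = ann ζ a b ξ * g (nrm θ ξ) := by
  have hb : 0 < b := ha.trans_le hab
  obtain ⟨h, h1, h2, h3⟩ := exists_temperate_norm_rpow N θ (c := 3 / 2 / b) (by positivity)
  have hn : ∀ ξ ∈ tsupport (ann ζ a b : Sp N → ℝ), 3 / 2 / b ≤ ‖ξ‖ := fun ξ hξ => by
    rw [div_le_iff₀ hb, mul_comm]; exact le_of_mem_tsupport_ann hζ ha hab hξ
  have hcont : ContinuousOn h (tsupport (ann ζ a b : Sp N → ℝ)) := h1.1.continuous.continuousOn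
  refine ⟨h, h1, ?_, fun ξ g => ?_⟩
  · rcases (tsupport (ann ζ a b : Sp N → ℝ)).eq_empty_or_nonempty with he | he
    · exact ⟨1, one_pos, by simp [he]⟩
    · obtain ⟨ξ₀, hξ₀, hmin⟩ :=
        (hasCompactSupport_ann hζ ha hb : IsCompact _).exists_isMinOn he hcont
      refine ⟨h ξ₀, ?_, fun ξ hξ => hmin hξ⟩
      have hp : 0 < ‖ξ₀‖ := lt_of_lt_of_le (by positivity) (hn ξ₀ hξ₀)
      rw [h3 ξ₀ (hn ξ₀ hξ₀), norm_smul, Real.norm_of_nonneg (by positivity)]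
      positivity
  · by_cases hξ : ξ ∈ tsupport (ann ζ a b : Sp N → ℝ)
    · rw [h3 ξ (hn ξ hξ), nrm]
    · rw [image_eq_zero_of_notMem_tsupport hξ, zero_mul, zero_mul]

theorem exists_isKernel_ann (θ : ℝ) {a b : ℝ} (ha : 0 < a) (hab : a ≤ b) (L : ℕ) :
    ∃ A : ℝ, 0 < A ∧ ∀ l : ℝ, 0 ≤ l → IsKernel (A * ((1 + l) ^ L)⁻¹)
      (𝓕⁻ fun ξ : Sp N => ((ann ζ a b ξ * Real.exp (-l * nrm θ ξ) : ℝ) : ℂ)) := by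
  obtain ⟨h, h1, ⟨c, hc, h2⟩, h3⟩ := exists_temperate_ann (N := N) hζ θ ha hab
  obtain ⟨A, hA, h4⟩ := exists_isKernel_block (contDiff_ann hζ ha (ha.trans_le hab))
    (hasCompactSupport_ann hζ ha (ha.trans_le hab)) h1.1 hc h2 L
  refine ⟨A, hA, fun l hl => ?_⟩
  have := h4 l hl
  simp_rw [h3 _ fun z => Real.exp (-l * z)] at this
  exact this

theorem exists_isKernel_ann_sub_one (θ : ℝ) {a b : ℝ} (ha : 0 < a) (hab : a ≤ b) :
    ∃ A : ℝ, 0 < A ∧ ∀ l : ℝ, 0 ≤ l → l ≤ 1 → IsKernel (A * l)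
      (𝓕⁻ fun ξ : Sp N => ((ann ζ a b ξ * (Real.exp (-l * nrm θ ξ) - 1) : ℝ) : ℂ)) := by
  obtain ⟨h, h1, ⟨c, hc, h2⟩, h3⟩ := exists_temperate_ann (N := N) hζ θ ha hab
  obtain ⟨A, hA, h4⟩ := exists_isKernel_block_sub_one (contDiff_ann hζ ha (ha.trans_le hab))
    (hasCompactSupport_ann hζ ha (ha.trans_le hab)) h1.1 hc h2
  refine ⟨A, hA, fun l hl hl1 => ?_⟩
  have := h4 l hl hl1
  simp_rw [h3 _ fun z => Real.exp (-l * z) - 1] at this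
  exact this

theorem exists_isKernel_cut {a : ℝ} (ha : 0 < a) :
    ∃ A : ℝ, 0 < A ∧ IsKernel A (𝓕⁻ fun ξ : Sp N => ((cut ζ a ξ : ℝ) : ℂ)) := by
  obtain ⟨A, hA, h⟩ := exists_isKernel_mul_comp (contDiff_cut (N := N) hζ ha)
    (hasCompactSupport_cut hζ ha) (h := fun _ => 0) contDiff_const
  have := h (fun _ => 1) 1 zero_le_one contDiff_const fun i hi ξ hξ => by
    rw [iteratedDeriv_const]; split_ifs <;> simp
  exact ⟨A * 1, by positivity, by simpa using this⟩

end Ann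

/-! ### Dilations and sums of kernels -/

/-- The dilated function `R^N K(R x)`. -/
def dil {V : Type*} [SMul ℝ V] (R : ℝ) (K : Sp N → V) (x : Sp N) : V := R ^ N • K (R • x)

theorem fourierInv_comp_inv_smul (f : Sp N → ℂ) {R : ℝ} (hR : 0 < R) :
    (𝓕⁻ fun ξ => f (R⁻¹ • ξ)) = dil R (𝓕⁻ f) := by
  ext x
  rw [dil, Real.fourierInv_eq, Real.fourierInv_eq]
  have := Measure.integral_comp_inv_smul_of_nonneg (volume : Measure (Sp N))
    (fun v => Real.fourierChar (inner ℝ v (R • x)) • f v) (R := R) (hR := hR.le)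
  simp only [finrank_euclideanSpace, Fintype.card_fin] at this
  rw [← this]
  congr 1
  ext v
  congr 2
  rw [inner_smul_left, inner_smul_right]
  simp [hR.ne']

theorem hasFDerivAt_dil {K : Sp N → ℂ} (hK : ContDiff ℝ 1 K) (R : ℝ) (x : Sp N) :
    HasFDerivAt (dil R K) ((R ^ N * R) • fderiv ℝ K (R • x)) x := by
  have h1 : HasFDerivAt K (fderiv ℝ K (R • x)) (R • x) :=
    (hK.differentiable one_ne_zero _).hasFDerivAt
  have h2 : HasFDerivAt (fun y : Sp N => R • y) (R • ContinuousLinearMap.id ℝ (Sp N)) x :=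
    (hasFDerivAt_id x).const_smul R
  have := (h1.comp x h2).const_smul (R ^ N)
  refine this.congr_fderiv ?_
  ext v
  simp [mul_assoc]

theorem contDiff_dil {K : Sp N → ℂ} (hK : ContDiff ℝ 1 K) (R : ℝ) : ContDiff ℝ 1 (dil R K) :=
  (hK.comp (contDiff_id.const_smul R)).const_smul (R ^ N)

theorem norm_dil_le {A : ℝ} {K : Sp N → ℂ} (hK : IsKernel A K) {R : ℝ} (hR : 0 ≤ R) (x : Sp N) :
    ‖dil R K x‖ ≤ A * dwt R x := by
  rw [dil, norm_smul, Real.norm_of_nonneg (by positivity), dwt]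
  calc _ ≤ R ^ N * (A * wt (R • x)) := by gcongr; exact hK.norm_le _
    _ = _ := by ring

theorem norm_fderiv_dil_le {A : ℝ} {K : Sp N → ℂ} (hK : IsKernel A K) {R : ℝ} (hR : 0 ≤ R)
    (x : Sp N) : ‖fderiv ℝ (dil R K) x‖ ≤ A * R * dwt R x := by
  rw [(hasFDerivAt_dil hK.contDiff R x).fderiv, norm_smul,
    Real.norm_of_nonneg (by positivity), dwt]
  calc _ ≤ R ^ N * R * (A * wt (R • x)) := by gcongr; exact hK.norm_fderiv_le _
    _ = _ := by ring

theorem wt_smul_le_of_one_le {R : ℝ} (hR : 1 ≤ R) (x : Sp N) : wt (R • x) ≤ wt x := by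
  unfold wt
  rw [norm_smul, Real.norm_of_nonneg (by linarith)]
  gcongr
  nlinarith [norm_nonneg x]

theorem wt_smul_le_of_le_one {R : ℝ} (hR0 : 0 < R) (hR : R ≤ 1) (x : Sp N) :
    wt (R • x) ≤ (R ^ (N + 1))⁻¹ * wt x := by
  unfold wt
  rw [norm_smul, Real.norm_of_nonneg hR0.le, ← mul_inv, ← mul_pow]
  gcongr
  nlinarith [norm_nonneg x]

theorem IsKernel.nonneg {A : ℝ} {K : Sp N → ℂ} (hK : IsKernel A K) : 0 ≤ A := by
  have := (norm_nonneg _).trans (hK.norm_le 0)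
  exact nonneg_of_mul_nonneg_left this (wt_pos 0)

/-- For R ≥ 1 dilation lowers the weight, so only the factors R^N and, for the gradient, R^{N+1}
remain. -/
theorem IsKernel.dil_of_one_le {A : ℝ} {K : Sp N → ℂ} (hK : IsKernel A K) {R : ℝ} (hR : 1 ≤ R) :
    IsKernel (A * R ^ (N + 1)) (dil R K) := by
  have hA := hK.nonneg
  have hR0 : 0 ≤ R := by linarith
  refine ⟨contDiff_dil hK.contDiff R, fun x => (norm_dil_le hK hR0 x).trans ?_,
    fun x => (norm_fderiv_dil_le hK hR0 x).trans ?_⟩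
  · rw [dwt]
    calc _ ≤ A * (R ^ (N + 1) * wt x) := by
          gcongr
          · exact (wt_pos _).le
          · exact Nat.le_succ N
          · exact wt_smul_le_of_one_le hR x
      _ = _ := by ring
  · rw [dwt]
    calc _ ≤ A * R * (R ^ N * wt x) := by
          gcongr
          exact wt_smul_le_of_one_le hR x
      _ = _ := by ring

/-- For R ≤ 1 the weight grows by at most R^{-(N+1)}, which against R^N leaves R^{-1}. When θ > 1
this loss is affordable at low frequencies. -/
theorem IsKernel.dil_of_le_one {A : ℝ} {K : Sp N → ℂ} (hK : IsKernel A K) {R : ℝ} (hR0 : 0 < R)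
    (hR : R ≤ 1) : IsKernel (A * R⁻¹) (dil R K) := by
  have hA := hK.nonneg
  have h : ∀ x, dwt R x ≤ R⁻¹ * wt (x : Sp N) := fun x => by
    rw [dwt]
    calc _ ≤ R ^ N * ((R ^ (N + 1))⁻¹ * wt x) := by
          gcongr
          exact wt_smul_le_of_le_one hR0 hR x
      _ = _ := by rw [pow_succ]; field_simp
  have h1 : 1 ≤ R⁻¹ := (one_le_inv₀ hR0).2 hR
  refine ⟨contDiff_dil hK.contDiff R, fun x => (norm_dil_le hK hR0.le x).trans ?_,
    fun x => (norm_fderiv_dil_le hK hR0.le x).trans ?_⟩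
  · rw [mul_assoc]
    gcongr
    exact h x
  · calc _ ≤ A * R * (R⁻¹ * wt x) := by gcongr; exact h x
      _ = A * 1 * wt x := by field_simp
      _ ≤ A * R⁻¹ * wt x := by gcongr; exact (wt_pos x).le

theorem IsKernel.add {A B : ℝ} {K L : Sp N → ℂ} (hK : IsKernel A K) (hL : IsKernel B L) :
    IsKernel (A + B) (fun x => K x + L x) := by
  refine ⟨hK.contDiff.add hL.contDiff, fun x => ?_, fun x => ?_⟩
  · rw [add_mul]
    exact (norm_add_le _ _).trans (add_le_add (hK.norm_le x) (hL.norm_le x))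
  · rw [add_mul, fderiv_fun_add (hK.contDiff.differentiable one_ne_zero x)
      (hL.contDiff.differentiable one_ne_zero x)]
    exact (norm_add_le _ _).trans (add_le_add (hK.norm_fderiv_le x) (hL.norm_fderiv_le x))

theorem wt_le_one (x : Sp N) : wt x ≤ 1 := by
  unfold wt
  exact inv_le_one_of_one_le₀ (one_le_pow₀ (by linarith [norm_nonneg x]))

theorem IsKernel.tsum {A : ℕ → ℝ} {K : ℕ → Sp N → ℂ} (hK : ∀ i, IsKernel (A i) (K i))
    (hA : Summable A) : IsKernel (∑' i, A i) (fun x => ∑' i, K i x) := by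
  have hle : ∀ i (x : Sp N), A i * wt x ≤ A i := fun i x =>
    mul_le_of_le_one_right (hK i).nonneg (wt_le_one x)
  have hsum : ∀ x : Sp N, Summable fun i => K i x := fun x =>
    Summable.of_norm_bounded (hA.mul_right (wt x)) fun i => (hK i).norm_le x
  have hD : ∀ x, HasFDerivAt (fun x => ∑' i, K i x) (∑' i, fderiv ℝ (K i) x) x := fun x =>
    hasFDerivAt_tsum (𝕜 := ℝ) hA
      (fun i y => ((hK i).contDiff.differentiable one_ne_zero y).hasFDerivAt)
      (fun i y => ((hK i).norm_fderiv_le y).trans (hle i y)) (hsum 0) x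
  have hfd : fderiv ℝ (fun x => ∑' i, K i x) = fun x => ∑' i, fderiv ℝ (K i) x :=
    funext fun x => (hD x).fderiv
  refine ⟨?_, fun x => ?_, fun x => ?_⟩
  · rw [contDiff_one_iff_fderiv]
    refine ⟨fun x => (hD x).differentiableAt, ?_⟩
    rw [hfd]
    exact continuous_tsum (fun i => (hK i).contDiff.continuous_fderiv one_ne_zero) hA
      fun i y => ((hK i).norm_fderiv_le y).trans (hle i y)
  · rw [← tsum_mul_right]
    exact tsum_of_norm_bounded (hA.mul_right _).hasSum fun i => (hK i).norm_le x
  · rw [hfd, ← tsum_mul_right]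
    exact tsum_of_norm_bounded (hA.mul_right _).hasSum fun i => (hK i).norm_fderiv_le x

end BesovMorrey

end

noncomputable section

namespace BesovMorrey

open MeasureTheory Set Filter Metric
open scoped ENNReal SchwartzMap FourierTransform Topology ContDiff Nat

variable {N : ℕ}

/-! ### The heat kernel -/

theorem norm_le_norm_two_pi_smul (ξ : Sp N) : ‖ξ‖ ≤ ‖(2 * Real.pi) • ξ‖ := by
  rw [norm_smul, Real.norm_of_nonneg (by positivity)]
  have := Real.pi_gt_three
  nlinarith [norm_nonneg ξ]

theorem norm_sub_one_le_nrm {θ : ℝ} (hθ : 1 ≤ θ) (ξ : Sp N) : ‖ξ‖ - 1 ≤ nrm θ ξ := by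
  refine le_trans (sub_le_sub_right (norm_le_norm_two_pi_smul ξ) 1) ?_
  unfold nrm
  rcases le_or_gt 1 ‖(2 * Real.pi) • ξ‖ with h | h
  · have := Real.self_le_rpow_of_one_le h hθ
    linarith
  · have : 0 ≤ ‖(2 * Real.pi) • ξ‖ ^ θ := Real.rpow_nonneg (norm_nonneg _) _
    linarith

theorem integrable_exp_neg_nrm {θ : ℝ} (hθ : 1 ≤ θ) :
    Integrable fun ξ : Sp N => Real.exp (-1 * nrm θ ξ) := by
  obtain ⟨C, hC, h⟩ := exists_one_add_pow_mul_exp_le (N + 1) one_pos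
  refine Integrable.mono' (integrable_wt.const_mul (Real.exp 1 * C))
    (Real.continuous_exp.comp
      (continuous_const.mul (continuous_nrm (by linarith)))).aestronglyMeasurable
    (Eventually.of_forall fun ξ => ?_)
  rw [Real.norm_of_nonneg (Real.exp_nonneg _), wt, ← div_eq_mul_inv, le_div_iff₀ (by positivity)]
  have h1 : Real.exp (-1 * nrm θ ξ) ≤ Real.exp 1 * Real.exp (-(‖ξ‖ * 1)) := by
    rw [← Real.exp_add, Real.exp_le_exp]
    linarith [norm_sub_one_le_nrm hθ ξ]
  calc _ ≤ Real.exp 1 * Real.exp (-(‖ξ‖ * 1)) * (1 + ‖ξ‖) ^ (N + 1) := by gcongr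
    _ = Real.exp 1 * ((1 + ‖ξ‖) ^ (N + 1) * Real.exp (-(‖ξ‖ * 1))) := by ring
    _ ≤ _ := by gcongr; exact h _ (norm_nonneg _)

theorem integrable_fourierChar_smul {f : Sp N → ℂ} (hf : Integrable f) (x : Sp N) :
    Integrable fun v => Real.fourierChar (inner ℝ v x) • f v := by
  refine hf.mono (AEStronglyMeasurable.smul (Continuous.aestronglyMeasurable ?_) hf.1)
    (Eventually.of_forall fun v => by rw [Circle.norm_smul])
  exact continuous_subtype_val.comp <| Real.continuous_fourierChar.comp
    (f := fun v : Sp N => inner ℝ v x)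
    (continuous_id.inner continuous_const)

theorem fourierInv_sub_apply {f g : Sp N → ℂ} (hf : Integrable f) (hg : Integrable g)
    (x : Sp N) : (𝓕⁻ fun v => f v - g v) x = 𝓕⁻ f x - 𝓕⁻ g x := by
  simp only [Real.fourierInv_eq, smul_sub]
  exact integral_sub (integrable_fourierChar_smul hf x) (integrable_fourierChar_smul hg x)

theorem fourierInv_add_apply {f g : Sp N → ℂ} (hf : Integrable f) (hg : Integrable g)
    (x : Sp N) : (𝓕⁻ fun v => f v + g v) x = 𝓕⁻ f x + 𝓕⁻ g x := by
  simp only [Real.fourierInv_eq, smul_add]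
  exact integral_add (integrable_fourierChar_smul hf x) (integrable_fourierChar_smul hg x)

theorem fourierInv_sum_apply {f : ℕ → Sp N → ℂ} (hf : ∀ i, Integrable (f i)) (n : ℕ)
    (x : Sp N) : (𝓕⁻ fun v => ∑ i ∈ Finset.range n, f i v) x =
      ∑ i ∈ Finset.range n, 𝓕⁻ (f i) x := by
  simp only [Real.fourierInv_eq, Finset.smul_sum]
  exact integral_finsetSum _ fun i _ => integrable_fourierChar_smul (hf i) x

theorem heatKernel_eq (θ t : ℝ) : (heatKernel θ t : Sp N → ℂ) =
    𝓕⁻ fun ξ : Sp N => ((Real.exp (-t * nrm θ ξ) : ℝ) : ℂ) := rfl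

/-- Self-similarity of the symbol: every bound on the heat kernel reduces to time 1. -/
theorem heatKernel_eq_dil (θ : ℝ) (hθ : θ ≠ 0) {t : ℝ} (ht : 0 < t) :
    (heatKernel θ t : Sp N → ℂ) = dil (t ^ (-1 / θ)) (heatKernel θ 1) := by
  rw [heatKernel_eq, heatKernel_eq, ← fourierInv_comp_inv_smul _ (by positivity)]
  congr 1
  ext ξ
  rw [nrm_smul _ (by positivity), ← Real.rpow_neg ht.le, ← Real.rpow_mul ht.le]
  congr 2
  have : -(-1 / θ) * θ = 1 := by field_simp
  rw [this, Real.rpow_one]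
  ring_nf

/-- The dyadic pieces of `exp(-|2πξ|^θ) - ζ(|2πξ|)`. -/
def heatPiece (ζ : ℝ → ℝ) (θ : ℝ) (i : ℕ) (ξ : Sp N) : ℂ :=
  ((ann ζ (2 * Real.pi * 2 ^ i) (2 * Real.pi * 2 ^ (i + 1)) ξ *
      (Real.exp (-1 * nrm θ ξ) - 1) : ℝ) : ℂ) +
    ((ann ζ (2 * Real.pi * (2 ^ (i + 1))⁻¹) (2 * Real.pi * (2 ^ i)⁻¹) ξ *
      Real.exp (-1 * nrm θ ξ) : ℝ) : ℂ)

section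

variable {ζ : ℝ → ℝ} (hζ : IsCutoff ζ)
include hζ

omit hζ in
theorem ann_smul {a b R : ℝ} (hR : 0 ≤ R) (ξ : Sp N) :
    ann ζ a b (R • ξ) = ann ζ (a * R) (b * R) ξ := by
  rw [ann, ann, cut_smul hR, cut_smul hR]

omit hζ in
theorem fourierInv_ann_dil (θ a b : ℝ) (g : ℝ → ℝ) {R : ℝ} (hR : 0 < R) :
    (𝓕⁻ fun ξ : Sp N => ((ann ζ (a * R⁻¹) (b * R⁻¹) ξ * g (nrm θ ξ) : ℝ) : ℂ)) =
      dil R (𝓕⁻ fun ξ : Sp N => ((ann ζ a b ξ * g (R ^ θ * nrm θ ξ) : ℝ) : ℂ)) := by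
  rw [← fourierInv_comp_inv_smul _ hR]
  congr 1
  ext ξ
  rw [ann_smul (inv_nonneg.2 hR.le), nrm_smul _ (inv_nonneg.2 hR.le), ← mul_assoc,
    ← Real.mul_rpow hR.le (inv_nonneg.2 hR.le), mul_inv_cancel₀ hR.ne', Real.one_rpow, one_mul]

theorem integrable_ann_mul {a b : ℝ} (ha : 0 < a) (hb : 0 < b) {g : Sp N → ℝ}
    (hg : Continuous g) : Integrable fun ξ : Sp N => ((ann ζ a b ξ * g ξ : ℝ) : ℂ) := by
  refine Integrable.ofReal ?_
  exact ((contDiff_ann hζ ha hb).continuous.mul hg).integrable_of_hasCompactSupport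
    (hasCompactSupport_ann hζ ha hb).mul_right

theorem tendsto_cut_zero {ξ : Sp N} (hξ : ξ ≠ 0) :
    Tendsto (fun i : ℕ => cut ζ (2 * Real.pi * 2 ^ i) ξ) atTop (𝓝 0) := by
  refine tendsto_const_nhds.congr' ?_
  have h : Tendsto (fun i : ℕ => 2 * Real.pi * 2 ^ i * ‖ξ‖) atTop atTop :=
    ((tendsto_pow_atTop_atTop_of_one_lt (by norm_num : (1 : ℝ) < 2)).const_mul_atTop
      (by positivity)).atTop_mul_const (norm_pos_iff.2 hξ)
  filter_upwards [h.eventually_ge_atTop (5 / 3)] with i hi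
  exact (cut_eq_zero hζ hi).symm

theorem tendsto_cut_one (ξ : Sp N) :
    Tendsto (fun i : ℕ => cut ζ (2 * Real.pi * (2 ^ i)⁻¹) ξ) atTop (𝓝 1) := by
  refine tendsto_const_nhds.congr' ?_
  have h : Tendsto (fun i : ℕ => 2 * Real.pi * (2 ^ i)⁻¹ * ‖ξ‖) atTop
      (𝓝 (2 * Real.pi * 0 * ‖ξ‖)) :=
    ((tendsto_inv_atTop_zero.comp
      (tendsto_pow_atTop_atTop_of_one_lt (by norm_num : (1 : ℝ) < 2))).const_mul _).mul_const _
  have h' := h.eventually_le_const (show 2 * Real.pi * 0 * ‖ξ‖ < 3 / 2 by norm_num)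
  filter_upwards [h'] with i hi
  exact (cut_eq_one hζ (by positivity) hi).symm

/-- The low piece, at |ξ| about 2^{-i}, has size 2^{-iθ}, and bringing its kernel to that scale
costs 2^i; the product 2^{i(1-θ)} is summable because θ > 1. The high piece decays like
2^{-(i+1)θ(N+2)}, against a dilation cost of 2^{(i+1)(N+1)}. -/
theorem exists_isKernel_heat_pieces {θ : ℝ} (hθ : 1 < θ) :
    ∃ A : ℕ → ℝ, Summable A ∧ ∀ i : ℕ, IsKernel (A i) (𝓕⁻ (heatPiece ζ θ i : Sp N → ℂ)) := by
  have hπ := Real.pi_pos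
  have hab : 2 * Real.pi ≤ 4 * Real.pi := by linarith
  obtain ⟨A₁, hA₁, h₁⟩ := exists_isKernel_ann_sub_one (N := N) hζ θ (a := 2 * Real.pi)
    (b := 4 * Real.pi) (by positivity) hab
  obtain ⟨A₂, hA₂, h₂⟩ := exists_isKernel_ann (N := N) hζ θ (a := 2 * Real.pi)
    (b := 4 * Real.pi) (by positivity) hab (N + 2)
  have hcexp : Continuous fun ξ : Sp N => Real.exp (-1 * nrm θ ξ) :=
    Real.continuous_exp.comp (continuous_const.mul (continuous_nrm (by linarith)))
  refine ⟨fun i => A₁ * ((2 : ℝ) ^ (1 - θ)) ^ i + A₂ * (1 / 2) ^ (i + 1), ?_, fun i => ?_⟩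
  · refine Summable.add (Summable.mul_left _ (summable_geometric_of_lt_one (by positivity) ?_))
      (Summable.mul_left _ ?_)
    · exact Real.rpow_lt_one_of_one_lt_of_neg (by norm_num) (by linarith)
    · exact (summable_nat_add_iff 1).2 (summable_geometric_of_lt_one (by norm_num) (by norm_num))
  have hr0 : (0 : ℝ) < (2 ^ i)⁻¹ := by positivity
  have hr1 : ((2 : ℝ) ^ i)⁻¹ ≤ 1 := inv_le_one_of_one_le₀ (one_le_pow₀ (by norm_num))
  have hR1 : (1 : ℝ) ≤ 2 ^ (i + 1) := one_le_pow₀ (by norm_num)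
  have k₁ := ((h₁ (((2 : ℝ) ^ i)⁻¹ ^ θ) (by positivity)
    (Real.rpow_le_one hr0.le hr1 (by linarith))).dil_of_le_one hr0 hr1)
  have k₂ := (h₂ (((2 : ℝ) ^ (i + 1)) ^ θ) (by positivity)).dil_of_one_le hR1
  have e₁ := fourierInv_ann_dil (ζ := ζ) (N := N) θ (2 * Real.pi) (4 * Real.pi)
    (fun z => Real.exp (-1 * z) - 1) hr0
  have e₂ := fourierInv_ann_dil (ζ := ζ) (N := N) θ (2 * Real.pi) (4 * Real.pi)
    (fun z => Real.exp (-1 * z)) (by positivity : (0 : ℝ) < 2 ^ (i + 1))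
  have f₁ : ∀ c : ℝ, (fun ξ : Sp N => -1 * (c * nrm θ ξ)) = fun ξ => -c * nrm θ ξ := by
    intro c; ext ξ; ring
  have f₁' : ∀ (c : ℝ) (ξ : Sp N), -1 * (c * nrm θ ξ) = -c * nrm θ ξ := fun c ξ => by ring
  simp only [f₁'] at e₁ e₂
  rw [← e₁] at k₁
  rw [← e₂] at k₂
  have g₁ : 4 * Real.pi * ((2 : ℝ) ^ i)⁻¹⁻¹ = 2 * Real.pi * 2 ^ (i + 1) := by
    rw [inv_inv]; ring
  have g₂ : 4 * Real.pi * ((2 : ℝ) ^ (i + 1))⁻¹ = 2 * Real.pi * (2 ^ i)⁻¹ := by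
    rw [pow_succ]; field_simp; norm_num
  rw [g₁, inv_inv] at k₁
  rw [g₂] at k₂
  have k := (k₁.add k₂)
  have hsum : (fun x => (𝓕⁻ fun ξ : Sp N =>
        ((ann ζ (2 * Real.pi * 2 ^ i) (2 * Real.pi * 2 ^ (i + 1)) ξ *
          (Real.exp (-1 * nrm θ ξ) - 1) : ℝ) : ℂ)) x +
      (𝓕⁻ fun ξ : Sp N => ((ann ζ (2 * Real.pi * (2 ^ (i + 1))⁻¹) (2 * Real.pi * (2 ^ i)⁻¹) ξ *
          Real.exp (-1 * nrm θ ξ) : ℝ) : ℂ)) x) = 𝓕⁻ (heatPiece ζ θ i : Sp N → ℂ) := by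
    ext x
    unfold heatPiece
    rw [fourierInv_add_apply]
    · exact integrable_ann_mul hζ (by positivity) (by positivity) (hcexp.sub continuous_const)
    · exact integrable_ann_mul hζ (by positivity) (by positivity) hcexp
  rw [hsum] at k
  refine k.mono (add_le_add ?_ ?_)
  · rw [mul_assoc]
    gcongr
    rw [Real.inv_rpow (by positivity), Real.rpow_sub (by norm_num), Real.rpow_one,
      div_pow, ← Real.rpow_natCast _ i, ← Real.rpow_natCast _ i, ← Real.rpow_mul (by norm_num),
      ← Real.rpow_mul (by norm_num), mul_comm θ, ← div_eq_inv_mul]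
  · rw [mul_assoc]
    gcongr
    have h4 : (2 : ℝ) ^ (i + 1) ≤ 1 + (2 ^ (i + 1)) ^ θ := by
      have := Real.self_le_rpow_of_one_le hR1 hθ.le
      linarith
    calc _ ≤ (((2 : ℝ) ^ (i + 1)) ^ (N + 2))⁻¹ * (2 ^ (i + 1)) ^ (N + 1) := by gcongr
      _ = (1 / 2) ^ (i + 1) := by
        rw [pow_succ ((2 : ℝ) ^ (i + 1)) (N + 1), one_div, inv_pow]
        field_simp

/-- The partial sums of the symbols telescope, and dominated convergence carries their pointwise
limit over to the inverse Fourier transforms. -/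
theorem tendsto_fourierInv_heat_pieces {θ : ℝ} (hθ : 1 < θ) (x : Sp N) :
    Tendsto (fun n : ℕ => ∑ i ∈ Finset.range n, (𝓕⁻ (heatPiece ζ θ i : Sp N → ℂ)) x) atTop
      (𝓝 (heatKernel θ 1 x - (𝓕⁻ fun ξ : Sp N => ((cut ζ (2 * Real.pi) ξ : ℝ) : ℂ)) x)) := by
  have hπ := Real.pi_pos
  have hcexp : Continuous fun ξ : Sp N => Real.exp (-1 * nrm θ ξ) :=
    Real.continuous_exp.comp (continuous_const.mul (continuous_nrm (by linarith)))
  have hcut : Integrable fun ξ : Sp N => cut ζ (2 * Real.pi) ξ :=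
    (contDiff_cut hζ (by positivity)).continuous.integrable_of_hasCompactSupport
      (hasCompactSupport_cut hζ (by positivity))
  have hE := integrable_exp_neg_nrm (N := N) hθ.le
  have hE' : Integrable fun ξ : Sp N => ((Real.exp (-1 * nrm θ ξ) : ℝ) : ℂ) := hE.ofReal
  have hcut' : Integrable fun ξ : Sp N => ((cut ζ (2 * Real.pi) ξ : ℝ) : ℂ) := hcut.ofReal
  rw [heatKernel_eq, ← fourierInv_sub_apply hE' hcut']
  have hint : ∀ i : ℕ, Integrable (heatPiece ζ θ i : Sp N → ℂ) := fun i =>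
    (integrable_ann_mul hζ (by positivity) (by positivity) (hcexp.sub continuous_const)).add
      (integrable_ann_mul hζ (by positivity) (by positivity) hcexp)
  have htel : ∀ (n : ℕ) (ξ : Sp N), ∑ i ∈ Finset.range n,
      heatPiece ζ θ i ξ =
      (((cut ζ (2 * Real.pi) ξ - cut ζ (2 * Real.pi * 2 ^ n) ξ) *
        (Real.exp (-1 * nrm θ ξ) - 1) + (cut ζ (2 * Real.pi * (2 ^ n)⁻¹) ξ -
        cut ζ (2 * Real.pi) ξ) * Real.exp (-1 * nrm θ ξ) : ℝ) : ℂ) := by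
    intro n ξ
    have t₁ := Finset.sum_range_sub' (fun i => cut ζ (2 * Real.pi * 2 ^ i) ξ) n
    have t₂ := Finset.sum_range_sub (fun i => cut ζ (2 * Real.pi * (2 ^ i)⁻¹) ξ) n
    simp only [pow_zero, mul_one, inv_one] at t₁ t₂
    rw [← t₁, ← t₂, Finset.sum_mul, Finset.sum_mul, ← Finset.sum_add_distrib]
    push_cast
    simp only [heatPiece, ann]
    push_cast
    rfl
  simp_rw [← fourierInv_sum_apply hint, htel, Real.fourierInv_eq]
  refine tendsto_integral_of_dominated_convergence
    (fun ξ => (closedBall (0 : Sp N) 1).indicator (fun _ => (1 : ℝ)) ξ +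
      Real.exp (-1 * nrm θ ξ)) ?_ ?_ ?_ ?_
  · intro n
    refine (integrable_fourierChar_smul (Integrable.ofReal ?_) x).1
    have c1 : Integrable fun ξ : Sp N => ann ζ (2 * Real.pi) (2 * Real.pi * 2 ^ n) ξ *
        (Real.exp (-1 * nrm θ ξ) - 1) := by
      exact ((contDiff_ann hζ (by positivity) (by positivity)).continuous.mul
        (hcexp.sub continuous_const)).integrable_of_hasCompactSupport
        (hasCompactSupport_ann hζ (by positivity) (by positivity)).mul_right
    have c2 : Integrable fun ξ : Sp N => ann ζ (2 * Real.pi * (2 ^ n)⁻¹) (2 * Real.pi) ξ *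
        Real.exp (-1 * nrm θ ξ) := by
      exact ((contDiff_ann hζ (by positivity) (by positivity)).continuous.mul
        hcexp).integrable_of_hasCompactSupport
        (hasCompactSupport_ann hζ (by positivity) (by positivity)).mul_right
    exact c1.add c2
  · refine Integrable.add ?_ hE
    rw [integrable_indicator_iff measurableSet_closedBall]
    exact integrableOn_const (isCompact_closedBall _ _).measure_lt_top.ne
  · intro n
    refine Eventually.of_forall fun ξ => ?_
    rw [Circle.norm_smul, Complex.norm_real, Real.norm_eq_abs]
    have hn1 : (1 : ℝ) ≤ 2 ^ n := one_le_pow₀ (by norm_num)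
    have m1 := cut_mem_Icc (ξ := ξ) hζ (by positivity : 0 ≤ 2 * Real.pi)
    have m2 := cut_mem_Icc (ξ := ξ) hζ (by positivity : 0 ≤ 2 * Real.pi * 2 ^ n)
    have m3 := cut_mem_Icc (ξ := ξ) hζ (by positivity : 0 ≤ 2 * Real.pi * (2 ^ n)⁻¹)
    have he0 := Real.exp_nonneg (-1 * nrm θ ξ)
    have he1 : Real.exp (-1 * nrm θ ξ) ≤ 1 := by
      rw [Real.exp_le_one_iff]; linarith [nrm_nonneg θ ξ]
    refine (abs_add_le _ _).trans (add_le_add ?_ ?_)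
    · by_cases hξ : ξ ∈ closedBall (0 : Sp N) 1
      · rw [indicator_of_mem hξ, abs_mul]
        refine mul_le_one₀ ?_ (abs_nonneg _) ?_
        · rw [abs_le]; constructor <;> linarith [m1.1, m1.2, m2.1, m2.2]
        · rw [abs_le]; constructor <;> linarith
      · simp only [mem_closedBall, dist_zero_right, not_le] at hξ
        have h5 : 5 / 3 ≤ 2 * Real.pi * ‖ξ‖ := by
          nlinarith [Real.pi_gt_three]
        have h6 : 5 / 3 ≤ 2 * Real.pi * 2 ^ n * ‖ξ‖ := by
          have : 2 * Real.pi * ‖ξ‖ * 1 ≤ 2 * Real.pi * ‖ξ‖ * 2 ^ n := by gcongr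
          linarith
        rw [cut_eq_zero hζ h5, cut_eq_zero hζ h6]
        simp only [sub_self, zero_mul, abs_zero]
        exact indicator_nonneg (fun _ _ => zero_le_one) _
    · rw [abs_mul, abs_of_nonneg he0]
      refine mul_le_of_le_one_left he0 ?_
      rw [abs_le]; constructor <;> linarith [m1.1, m1.2, m3.1, m3.2]
  -- In dimension zero the origin is the whole space and cannot be discarded as a null set.
  · by_cases hN : N = 0
    · subst hN
      refine Eventually.of_forall fun ξ => ?_
      have hξ0 : ξ = 0 := Subsingleton.elim _ _
      have hc : ∀ r : ℝ, 0 ≤ r → cut ζ r ξ = 1 := fun r hr =>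
        cut_eq_one hζ hr (by simp [hξ0]; norm_num)
      have hn0 : nrm θ ξ = 0 := by
        simp [nrm, hξ0, Real.zero_rpow (by linarith : θ ≠ 0)]
      refine tendsto_const_nhds.congr fun n => ?_
      rw [hc _ (by positivity), hc _ (by positivity), hc _ (by positivity), hn0]
      simp
    · have : Nonempty (Fin N) := ⟨⟨0, Nat.pos_of_ne_zero hN⟩⟩
      have hae : ∀ᵐ ξ : Sp N, ξ ≠ 0 := by
        rw [ae_iff]; simp
      filter_upwards [hae] with ξ hξ
      refine Tendsto.const_smul ?_ _
      have l1 := ((tendsto_const_nhds (x := cut ζ (2 * Real.pi) ξ)).sub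
        (tendsto_cut_zero hζ hξ)).mul_const (Real.exp (-1 * nrm θ ξ) - 1)
      have l2 := ((tendsto_cut_one hζ ξ).sub_const (cut ζ (2 * Real.pi) ξ)).mul_const
        (Real.exp (-1 * nrm θ ξ))
      have l3 := (l1.add l2)
      have l4 := (Complex.continuous_ofReal.tendsto _).comp l3
      refine (l4.congr fun n => rfl).congr' (Eventually.of_forall fun n => rfl) |>.trans ?_
      rw [← Complex.ofReal_sub]
      apply le_of_eq
      congr 2
      ring

/-- For general θ the symbol is not smooth at the origin, so the decay cannot be read off from N + 1
of its derivatives. Instead the kernel is written as one smooth cutoff kernel plus a convergent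
series of dyadic kernels. -/
theorem exists_isKernel_heatKernel {θ : ℝ} (hθ : 1 < θ) :
    ∃ A : ℝ, 0 < A ∧ IsKernel A (heatKernel θ 1 : Sp N → ℂ) := by
  obtain ⟨A, hA, hK⟩ := exists_isKernel_heat_pieces (N := N) hζ hθ
  obtain ⟨B, hB, hL⟩ := exists_isKernel_cut (N := N) hζ (a := 2 * Real.pi) (by positivity)
  have hT := IsKernel.tsum hK hA
  have hsum : ∀ x, Summable fun i => (𝓕⁻ (heatPiece ζ θ i : Sp N → ℂ)) x := fun x =>
    Summable.of_norm_bounded (hA.mul_right (wt x)) fun i => (hK i).norm_le x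
  refine ⟨∑' i, A i + B, add_pos_of_nonneg_of_pos (tsum_nonneg fun i => (hK i).nonneg) hB, ?_⟩
  have e : (heatKernel θ 1 : Sp N → ℂ) = fun x => (∑' i, (𝓕⁻ (heatPiece ζ θ i : Sp N → ℂ)) x) +
      (𝓕⁻ fun ξ : Sp N => ((cut ζ (2 * Real.pi) ξ : ℝ) : ℂ)) x := by
    ext x
    rw [tendsto_nhds_unique (hsum x).hasSum.tendsto_sum_nat
      (tendsto_fourierInv_heat_pieces hζ hθ x)]
    ring
  rw [e]
  exact hT.add hL

end

end BesovMorrey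

end

noncomputable section

namespace BesovMorrey

open MeasureTheory Set Filter Metric
open scoped ENNReal SchwartzMap FourierTransform Topology ContDiff Nat

variable {N : ℕ} {V : Type*} [NormedAddCommGroup V] [NormedSpace ℂ V]

/-! ### Convolutions -/

/-- The convolution of a kernel with a function. -/
def conv (K : Sp N → V) (f : Sp N → ℂ) (x : Sp N) : V := ∫ y, f y • K (x - y)

theorem heatFun_eq_conv (θ t : ℝ) (f : Sp N → ℂ) (x : Sp N) :
    heatFun θ t f x = conv (heatKernel θ t) f x := by
  simp only [heatFun, conv, smul_eq_mul, mul_comm]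

/-- The function `f` is locally integrable and integrable against the translated weights. -/
structure Tame (f : Sp N → ℂ) : Prop where
  aesm : AEStronglyMeasurable f volume
  integrable : ∀ x, Integrable fun y => wt (x - y) * ‖f y‖

theorem dwt_one (x : Sp N) : dwt 1 x = wt x := by simp [dwt]

theorem Tame.of_wconv {f : Sp N → ℂ} (hf : AEStronglyMeasurable f volume)
    (h : ∀ x, wconv 1 (fun y => ‖f y‖ₑ) x < ⊤) : Tame f := by
  refine ⟨hf, fun x => ⟨?_, ?_⟩⟩
  · exact ((continuous_wt.comp (continuous_const.sub continuous_id)).aestronglyMeasurable).mul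
      hf.norm
  · refine lt_of_le_of_lt (lintegral_mono fun y => ?_) (h x)
    rw [enorm_mul, dwt_one, enorm_norm, Real.enorm_of_nonneg (wt_pos _).le]

theorem Tame.of_mor {f : Sp N → ℂ} (hf : Measurable f) {p q : ℝ} (hq : 1 ≤ q)
    (h : mor p q (fun x => ‖f x‖ₑ) < ⊤) : Tame f := by
  obtain ⟨C, hC, hw⟩ := exists_wconv_le N (p := p) hq
  refine Tame.of_wconv hf.aestronglyMeasurable fun x => ?_
  refine lt_of_le_of_lt (hw 1 le_rfl _ hf.enorm x) ?_
  exact ENNReal.mul_lt_top (ENNReal.mul_lt_top ENNReal.ofReal_lt_top ENNReal.ofReal_lt_top) h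

theorem Tame.of_bounded {f : Sp N → ℂ} (hf : AEStronglyMeasurable f volume) {C : ℝ}
    (h : ∀ x, ‖f x‖ ≤ C) : Tame f := by
  refine Tame.of_wconv hf fun x => ?_
  refine lt_of_le_of_lt (wconv_const_le one_pos (B := ENNReal.ofReal C) (fun y => ?_) x)
    (ENNReal.mul_lt_top wtMass_lt_top ENNReal.ofReal_lt_top)
  rw [← ofReal_norm]
  exact ENNReal.ofReal_le_ofReal (h y)

theorem conv_congr_ae {f g : Sp N → ℂ} (K : Sp N → V) (h : f =ᵐ[volume] g) (x : Sp N) :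
    conv K f x = conv K g x := by
  refine integral_congr_ae ?_
  filter_upwards [h] with y hy
  rw [hy]

theorem Tame.integrable_conv {f : Sp N → ℂ} (hf : Tame f) {K : Sp N → V} (hK : Continuous K)
    {A : ℝ} (hA : ∀ x, ‖K x‖ ≤ A * wt x) (x : Sp N) : Integrable fun y => f y • K (x - y) := by
  refine Integrable.mono' ((hf.integrable x).const_mul A)
    (hf.aesm.smul (hK.comp (continuous_const.sub continuous_id)).aestronglyMeasurable)
    (Eventually.of_forall fun y => ?_)
  rw [norm_smul]
  calc _ ≤ ‖f y‖ * (A * wt (x - y)) := by gcongr; exact hA _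
    _ = _ := by ring

theorem enorm_conv_le {K : Sp N → V} {A R : ℝ} (hA : 0 ≤ A)
    (hK : ∀ x, ‖K x‖ ≤ A * dwt R x) (f : Sp N → ℂ) (x : Sp N) :
    ‖conv K f x‖ₑ ≤ ENNReal.ofReal A * wconv R (fun y => ‖f y‖ₑ) x := by
  refine (enorm_integral_le_lintegral_enorm _).trans ?_
  rw [wconv, ← lintegral_const_mul' _ _ ENNReal.ofReal_ne_top]
  refine lintegral_mono fun y => ?_
  rw [enorm_smul, ← mul_assoc, mul_comm, ← ENNReal.ofReal_mul hA]
  gcongr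
  rw [← ofReal_norm]
  exact ENNReal.ofReal_le_ofReal (hK _)

theorem wt_sub_le {x x₀ y : Sp N} (h : ‖x - x₀‖ ≤ 1) :
    wt (x - y) ≤ 2 ^ (N + 1) * wt (x₀ - y) :=
  wt_le_of_norm_sub_le (by simpa using h)

/-- The weights centred at x and at x₀ are comparable for |x - x₀| ≤ 1, which supplies the
dominating function for joint continuity. -/
theorem continuousAt_conv {P : Type*} [TopologicalSpace P] [FirstCountableTopology P]
    {K : P → Sp N → V} {f : Sp N → ℂ} (hf : Tame f) {p₀ : P} {A : ℝ} (hA : 0 ≤ A)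
    (hc : ∀ z, ContinuousAt (fun w : P × Sp N => K w.1 w.2) (p₀, z))
    (hK : ∀ᶠ p in 𝓝 p₀, Continuous (K p) ∧ ∀ x, ‖K p x‖ ≤ A * wt x) (x₀ : Sp N) :
    ContinuousAt (fun w : P × Sp N => conv (K w.1) f w.2) (p₀, x₀) := by
  have h1 : ∀ᶠ w : P × Sp N in 𝓝 (p₀, x₀),
      (Continuous (K w.1) ∧ ∀ x, ‖K w.1 x‖ ≤ A * wt x) ∧ ‖w.2 - x₀‖ ≤ 1 := by
    rw [nhds_prod_eq]
    refine (hK.prod_mk (closedBall_mem_nhds x₀ one_pos)).mono fun w hw => ⟨hw.1, ?_⟩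
    rw [← dist_eq_norm]; exact hw.2
  refine continuousAt_of_dominated (bound := fun y => A * 2 ^ (N + 1) * (wt (x₀ - y) * ‖f y‖))
    ?_ ?_ ((hf.integrable x₀).const_mul _) ?_
  · filter_upwards [h1] with w hw
    exact (hf.integrable_conv hw.1.1 hw.1.2 w.2).1
  · filter_upwards [h1] with w hw
    refine Eventually.of_forall fun y => ?_
    rw [norm_smul]
    calc _ ≤ ‖f y‖ * (A * (2 ^ (N + 1) * wt (x₀ - y))) := by
          gcongr
          exact (hw.1.2 _).trans (by gcongr; exact wt_sub_le hw.2)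
      _ = _ := by ring
  · refine Eventually.of_forall fun y => ?_
    refine ContinuousAt.const_smul ?_ (f y)
    have : ContinuousAt (fun w : P × Sp N => (w.1, w.2 - y)) (p₀, x₀) := by fun_prop
    exact ContinuousAt.comp (f := fun w : P × Sp N => (w.1, w.2 - y))
      (g := fun w : P × Sp N => K w.1 w.2) (hc _) this

theorem continuous_conv {K : Sp N → V} {f : Sp N → ℂ} (hf : Tame f) (hK : Continuous K)
    {A : ℝ} (hA0 : 0 ≤ A) (hA : ∀ x, ‖K x‖ ≤ A * wt x) : Continuous (conv K f) := by
  rw [continuous_iff_continuousAt]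
  intro x
  have := continuousAt_conv (P := Unit) (K := fun _ => K) (p₀ := ()) hf hA0
    (fun z => (hK.comp continuous_snd).continuousAt) (Eventually.of_forall fun _ => ⟨hK, hA⟩) x
  exact ContinuousAt.comp (f := fun x : Sp N => ((), x)) (x := x) this
    (Continuous.continuousAt (by fun_prop))

theorem hasFDerivAt_conv {K : Sp N → ℂ} {f : Sp N → ℂ} (hf : Tame f) {A : ℝ}
    (hK : IsKernel A K) (x₀ : Sp N) :
    HasFDerivAt (conv K f) (conv (fderiv ℝ K) f x₀) x₀ := by
  have hA := hK.nonneg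
  refine hasFDerivAt_integral_of_dominated_of_fderiv_le (𝕜 := ℝ) (s := ball x₀ 1)
    (bound := fun y => A * 2 ^ (N + 1) * (wt (x₀ - y) * ‖f y‖))
    (F' := fun x y => f y • fderiv ℝ K (x - y)) (ball_mem_nhds x₀ one_pos)
    (Eventually.of_forall fun x =>
      (hf.integrable_conv hK.contDiff.continuous hK.norm_le x).1)
    (hf.integrable_conv hK.contDiff.continuous hK.norm_le x₀)
    (hf.integrable_conv (hK.contDiff.continuous_fderiv one_ne_zero) hK.norm_fderiv_le x₀).1
    (Eventually.of_forall fun y x hx => ?_) ((hf.integrable x₀).const_mul _)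
    (Eventually.of_forall fun y x hx => ?_)
  · rw [norm_smul]
    have hx' : ‖x - x₀‖ ≤ 1 := by rw [← dist_eq_norm]; exact (mem_ball.1 hx).le
    calc _ ≤ ‖f y‖ * (A * (2 ^ (N + 1) * wt (x₀ - y))) := by
          gcongr
          exact (hK.norm_fderiv_le _).trans (by gcongr; exact wt_sub_le hx')
      _ = _ := by ring
  · have h1 : HasFDerivAt K (fderiv ℝ K (x - y)) (x - y) :=
      (hK.contDiff.differentiable one_ne_zero _).hasFDerivAt
    have h2 : HasFDerivAt (fun x => K (x - y)) (fderiv ℝ K (x - y)) x := by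
      exact h1.comp (f := fun x => x - y) x ((hasFDerivAt_id x).sub_const y)
    exact h2.const_smul (f y)

/-- The dilation moves from the kernel to the argument of f. For bounded continuous f, dominated
convergence then works with a fixed kernel. -/
theorem conv_dil {K : Sp N → V} {f : Sp N → ℂ} {R : ℝ} (hR : 0 < R) (x : Sp N) :
    conv (dil R K) f x = ∫ z, f (x - R⁻¹ • z) • K z := by
  have h1 := Measure.integral_comp_smul_of_nonneg (volume : Measure (Sp N))
    (fun z => f (x - R⁻¹ • z) • K z) R (hR := hR.le)
  simp only [finrank_euclideanSpace, Fintype.card_fin, smul_smul, inv_mul_cancel₀ hR.ne',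
    one_smul] at h1
  have h2 : conv (dil R K) f x = ∫ z, R ^ N • (f (x - z) • K (R • z)) := by
    rw [conv, ← integral_sub_left_eq_self _ _ x]
    refine integral_congr_ae (Eventually.of_forall fun z => ?_)
    simp only [dil, sub_sub_cancel]
    rw [smul_comm]
  rw [h2, integral_smul, h1, smul_smul, mul_inv_cancel₀ (by positivity), one_smul]

theorem fderiv_dil_eq {K : Sp N → ℂ} (hK : ContDiff ℝ 1 K) (R : ℝ) :
    fderiv ℝ (dil R K) = fun x => R • dil R (fderiv ℝ K) x := by
  ext1 x
  rw [(hasFDerivAt_dil hK R x).fderiv, dil, smul_smul, mul_comm]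

theorem norm_dil_le' {K : Sp N → V} {A : ℝ} (hK : ∀ x, ‖K x‖ ≤ A * wt x) {R : ℝ}
    (hR : 0 ≤ R) (x : Sp N) : ‖dil R K x‖ ≤ A * dwt R x := by
  rw [dil, norm_smul, Real.norm_of_nonneg (by positivity), dwt]
  calc _ ≤ R ^ N * (A * wt (R • x)) := by gcongr; exact hK _
    _ = _ := by ring

end BesovMorrey

end

noncomputable section

namespace BesovMorrey

open MeasureTheory Set Filter Metric
open scoped ENNReal SchwartzMap FourierTransform Topology ContDiff

variable {N : ℕ}

/-! ### Distributions represented by functions -/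

/-- A bump function equal to 1 near x is an admissible test function. -/
theorem Represents.locallyIntegrable {v : 𝓢'(Sp N, ℂ)} {f : Sp N → ℂ} (h : Represents v f) :
    LocallyIntegrable f := by
  intro x
  let b : ContDiffBump x := ⟨1, 2, one_pos, one_lt_two⟩
  have hc : HasCompactSupport fun y => ((b y : ℝ) : ℂ) :=
    b.hasCompactSupport.comp_left (g := fun r : ℝ => (r : ℂ)) Complex.ofReal_zero
  have hs : ContDiff ℝ ∞ fun y => ((b y : ℝ) : ℂ) := Complex.ofRealCLM.contDiff.comp b.contDiff
  have h1 := (h (hc.toSchwartzMap hs)).1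
  refine ⟨closedBall x 1, closedBall_mem_nhds x one_pos, ?_⟩
  refine (h1.integrableOn (s := closedBall x 1)).congr_fun (fun y hy => ?_)
    measurableSet_closedBall
  change ((b y : ℝ) : ℂ) * f y = f y
  rw [b.one_of_mem_closedBall hy]
  simp

theorem Represents.integral_smul {v : 𝓢'(Sp N, ℂ)} {f : Sp N → ℂ} (h : Represents v f)
    {g : Sp N → ℝ} (hg : ContDiff ℝ ∞ g) (hc : HasCompactSupport g) :
    ∃ ψ : 𝓢(Sp N, ℂ), (∀ x, ψ x = (g x : ℂ)) ∧ ∫ x, g x • f x = v ψ := by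
  have hc' : HasCompactSupport fun y => ((g y : ℝ) : ℂ) :=
    hc.comp_left (g := fun r : ℝ => (r : ℂ)) Complex.ofReal_zero
  have hs : ContDiff ℝ ∞ fun y => ((g y : ℝ) : ℂ) := Complex.ofRealCLM.contDiff.comp hg
  refine ⟨hc'.toSchwartzMap hs, fun x => rfl, ?_⟩
  rw [(h _).2]
  exact integral_congr_ae (Eventually.of_forall fun x => by simp)

theorem Represents.ae_eq {v : 𝓢'(Sp N, ℂ)} {f g : Sp N → ℂ} (hf : Represents v f)
    (hg : Represents v g) : f =ᵐ[volume] g := by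
  refine ae_eq_of_integral_contDiff_smul_eq hf.locallyIntegrable hg.locallyIntegrable
    fun u hu hc => ?_
  obtain ⟨ψ, h1, h2⟩ := hf.integral_smul hu hc
  obtain ⟨ψ', h1', h2'⟩ := hg.integral_smul hu hc
  have : ψ = ψ' := by ext x; rw [h1, h1']
  rw [h2, h2', this]

theorem Represents.congr {v : 𝓢'(Sp N, ℂ)} {f g : Sp N → ℂ} (hf : Represents v f)
    (hfg : f =ᵐ[volume] g) : Represents v g := by
  intro ψ
  have : (fun x => ψ x * f x) =ᵐ[volume] fun x => ψ x * g x := by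
    filter_upwards [hfg] with x hx
    rw [hx]
  exact ⟨(hf ψ).1.congr this, (hf ψ).2.trans (integral_congr_ae this)⟩

theorem Represents.im_ae_eq_zero {v : 𝓢'(Sp N, ℂ)} {f : Sp N → ℂ} (hf : Represents v f)
    (hv : IsRealDist v) : ∀ᵐ x, (f x).im = 0 := by
  have hl : LocallyIntegrable fun x => (f x).im := fun x => by
    obtain ⟨s, hs, h⟩ := hf.locallyIntegrable x
    exact ⟨s, hs, h.im⟩
  refine ae_eq_zero_of_integral_contDiff_smul_eq_zero hl fun g hg hc => ?_
  obtain ⟨ψ, h1, h2⟩ := hf.integral_smul hg hc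
  have h3 := hv ψ fun x => by rw [h1, Complex.ofReal_im]
  have h4 : Integrable fun x => g x • f x := by
    have := (hf ψ).1
    refine this.congr (Eventually.of_forall fun x => ?_)
    simp [h1]
  rw [← h2] at h3
  have h5 := integral_im h4
  change ∫ x, (g x • f x).im = (∫ x, g x • f x).im at h5
  rw [h3] at h5
  rw [← h5]
  exact integral_congr_ae (Eventually.of_forall fun x => by simp)

/-! ### Fourier multipliers and convolutions -/

/-- The multiplication formula, which moves the transform from one factor to the other, with the
translation by y absorbed into a character. -/
theorem fourier_mul_fourierInv_apply {m ψ : Sp N → ℂ} (hm : Integrable m) (hψ : Integrable ψ)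
    (y : Sp N) : 𝓕 (fun ξ => m ξ * 𝓕⁻ ψ ξ) y = ∫ x, ψ x * 𝓕⁻ m (x - y) := by
  have hm' : Integrable fun v => Real.fourierChar (-inner ℝ v y) • m v := by
    simpa [inner_neg_right] using integrable_fourierChar_smul hm (-y)
  -- With the sign of the pairing reversed, the general Fourier integral becomes the inverse
  -- transform.
  have h := VectorFourier.integral_fourierIntegral_smul_eq_flip (L := -innerₗ (Sp N))
    (μ := volume) (ν := volume) Real.continuous_fourierChar
    (by exact continuous_inner.neg) hψ hm'
  rw [Real.fourier_eq]
  refine Eq.trans (integral_congr_ae (Eventually.of_forall fun ξ => ?_)) (h.trans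
    (integral_congr_ae (Eventually.of_forall fun x => ?_)))
  · simp only [smul_eq_mul, Circle.smul_def, VectorFourier.fourierIntegral, Real.fourierInv_eq]
    simp only [innerₗ_apply_apply, LinearMap.neg_apply, neg_neg]
    ring
  · simp only [VectorFourier.fourierIntegral, Real.fourierInv_eq, smul_eq_mul]
    congr 1
    refine integral_congr_ae (Eventually.of_forall fun ξ => ?_)
    have hx : inner ℝ ξ (x - y) = inner ℝ ξ x + -inner ℝ ξ y := by
      rw [inner_sub_right, sub_eq_add_neg]
    simp only [LinearMap.flip_apply, LinearMap.neg_apply, innerₗ_apply_apply, neg_neg,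
      hx, AddChar.map_add_eq_mul, Circle.smul_def, Circle.coe_mul, smul_eq_mul,
      real_inner_comm ξ x]
    ring

theorem wt_sub_le_mul (x y : Sp N) : wt (x - y) ≤ (1 + ‖x‖) ^ (N + 1) * wt (0 - y) := by
  unfold wt
  rw [← div_eq_mul_inv, le_div_iff₀ (by positivity), inv_mul_le_iff₀ (by positivity), ← mul_pow]
  gcongr
  have : ‖0 - y‖ ≤ ‖x - y‖ + ‖x‖ := by
    calc ‖0 - y‖ = ‖(x - y) - x‖ := by congr 1; abel
      _ ≤ _ := norm_sub_le _ _
  nlinarith [norm_nonneg (x - y), norm_nonneg x]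

theorem integrable_schwartz_mul_pow (ψ : 𝓢(Sp N, ℂ)) (n : ℕ) :
    Integrable fun x => (1 + ‖x‖) ^ n * ‖ψ x‖ := by
  have h1 := ψ.integrable_pow_mul volume 0
  have h2 := ψ.integrable_pow_mul volume n
  refine ((h1.add h2).const_mul (2 ^ n)).mono' (by fun_prop)
    (Eventually.of_forall fun x => ?_)
  rw [Real.norm_of_nonneg (by positivity)]
  have := one_add_pow_le ‖x‖ (norm_nonneg x) n
  simp only [Pi.add_apply, pow_zero, one_mul]
  calc _ ≤ 2 ^ n * (1 + ‖x‖ ^ n) * ‖ψ x‖ := by gcongr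
    _ = _ := by ring

theorem integrable_prod_mul_conv (ψ : 𝓢(Sp N, ℂ)) {f K : Sp N → ℂ} (hf : Tame f) {A : ℝ}
    (hc : Continuous K) (hK : ∀ x, ‖K x‖ ≤ A * wt x) :
    Integrable (fun z : Sp N × Sp N => ψ z.1 * K (z.1 - z.2) * f z.2)
      (volume.prod volume) := by
  have hA : 0 ≤ A := nonneg_of_mul_nonneg_left ((norm_nonneg _).trans (hK 0)) (wt_pos 0)
  have h := ((integrable_schwartz_mul_pow ψ (N + 1)).const_mul A).mul_prod (hf.integrable 0)
  have c1 : Continuous fun z : Sp N × Sp N => ψ z.1 * K (z.1 - z.2) :=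
    (ψ.continuous.comp continuous_fst).mul (hc.comp (continuous_fst.sub continuous_snd))
  refine h.mono' (c1.aestronglyMeasurable.mul hf.aesm.comp_snd)
    (Eventually.of_forall fun z => ?_)
  rw [norm_mul, norm_mul]
  calc _ ≤ ‖ψ z.1‖ * (A * ((1 + ‖z.1‖) ^ (N + 1) * wt (0 - z.2))) * ‖f z.2‖ := by
        gcongr
        exact (hK _).trans (by gcongr; exact wt_sub_le_mul _ _)
    _ = _ := by ring

/-- Tested against ψ, the multiplier acts on ψ by the transposed convolution. Fubini's theorem,
justified by the decay of ψ against the weight, moves it onto f. -/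
theorem Represents.fourierMultiplier {v : 𝓢'(Sp N, ℂ)} {f m : Sp N → ℂ} (h : Represents v f)
    (hf : Tame f) (hm : m.HasTemperateGrowth) (hi : Integrable m) {A : ℝ}
    (hK : IsKernel A (𝓕⁻ m)) :
    Represents (TemperedDistribution.fourierMultiplierCLM ℂ m v) (conv (𝓕⁻ m) f) := by
  intro ψ
  have hp := integrable_prod_mul_conv ψ hf hK.contDiff.continuous hK.norm_le
  have e1 : (fun x => ψ x * conv (𝓕⁻ m) f x) =
      fun x => ∫ y, ψ x * 𝓕⁻ m (x - y) * f y := by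
    ext x
    rw [conv, ← integral_const_mul]
    refine integral_congr_ae (Eventually.of_forall fun y => ?_)
    simp only [smul_eq_mul]
    ring
  rw [e1]
  refine ⟨hp.integral_prod_left, ?_⟩
  rw [TemperedDistribution.fourierMultiplierCLM_apply_apply, (h _).2,
    integral_integral_swap hp]
  refine integral_congr_ae (Eventually.of_forall fun y => ?_)
  simp only [SchwartzMap.fourier_coe]
  have e2 : (SchwartzMap.smulLeftCLM ℂ m (𝓕⁻ ψ) : Sp N → ℂ) =
      fun ξ => m ξ * 𝓕⁻ (ψ : Sp N → ℂ) ξ := by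
    ext ξ
    rw [SchwartzMap.smulLeftCLM_apply_apply hm, SchwartzMap.fourierInv_coe, smul_eq_mul]
  rw [e2, fourier_mul_fourierInv_apply hi ψ.integrable, integral_mul_const]

theorem fourierInv_conj_neg {ψ : Sp N → ℂ} (hψ : ∀ x, (ψ x).im = 0) (ξ : Sp N) :
    𝓕⁻ ψ (-ξ) = (starRingEnd ℂ) (𝓕⁻ ψ ξ) := by
  rw [Real.fourierInv_eq, Real.fourierInv_eq, ← integral_conj]
  refine integral_congr_ae (Eventually.of_forall fun x => ?_)
  have : (starRingEnd ℂ) (ψ x) = ψ x := Complex.conj_eq_iff_im.2 (hψ x)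
  simp only [Circle.smul_def, smul_eq_mul, map_mul, this, inner_neg_right,
    AddChar.map_neg_eq_inv, Circle.coe_inv_eq_conj]

theorem im_fourier_eq_zero {f : Sp N → ℂ} (hf : ∀ ξ, f (-ξ) = (starRingEnd ℂ) (f ξ))
    (y : Sp N) : (𝓕 f y).im = 0 := by
  rw [← Complex.conj_eq_iff_im, Real.fourier_eq, ← integral_conj, ← integral_neg_eq_self]
  refine integral_congr_ae (Eventually.of_forall fun x => ?_)
  simp only [Circle.smul_def, smul_eq_mul, map_mul, hf, inner_neg_left, neg_neg, Complex.conj_conj,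
    AddChar.map_neg_eq_inv, Circle.coe_inv_eq_conj]

/-- The inverse transform of a real function has Hermitian symmetry, a real even symbol preserves
it, and the transform of such a function is real. -/
theorem IsRealDist.fourierMultiplier {v : 𝓢'(Sp N, ℂ)} (hv : IsRealDist v) {m : Sp N → ℝ}
    (hm : (fun ξ => (m ξ : ℂ)).HasTemperateGrowth) (he : ∀ ξ, m (-ξ) = m ξ) :
    IsRealDist (TemperedDistribution.fourierMultiplierCLM ℂ (fun ξ => (m ξ : ℂ)) v) := by
  intro ψ hψ
  rw [TemperedDistribution.fourierMultiplierCLM_apply_apply]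
  refine hv _ fun x => ?_
  rw [SchwartzMap.fourier_coe]
  refine im_fourier_eq_zero (fun ξ => ?_) x
  rw [SchwartzMap.smulLeftCLM_apply_apply hm, SchwartzMap.smulLeftCLM_apply_apply hm,
    SchwartzMap.fourierInv_coe, fourierInv_conj_neg hψ, he]
  simp

theorem heatKernel_im (θ t : ℝ) (x : Sp N) : (heatKernel θ t x).im = 0 := by
  rw [heatKernel, Real.fourierInv_eq_fourier_neg]
  refine im_fourier_eq_zero (fun ξ => ?_) _
  rw [Complex.conj_ofReal, heatSymbol, heatSymbol, smul_neg, norm_neg]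

theorem conv_im {K f : Sp N → ℂ} (hK : ∀ x, (K x).im = 0) (hf : ∀ᵐ x, (f x).im = 0)
    (x : Sp N) : (conv K f x).im = 0 := by
  rw [← Complex.conj_eq_iff_im, conv, ← integral_conj]
  refine integral_congr_ae ?_
  filter_upwards [hf] with y hy
  rw [Complex.conj_eq_iff_im, smul_eq_mul, Complex.mul_im, hK, hy]
  simp

/-! ### Cut-offs of Schwartz functions -/

/-- Where g(εx) does not vanish, 1 ≤ ε|x|/c. One extra power of |x| in the Schwartz seminorm
therefore pays for a factor ε. -/
theorem exists_seminorm_smul_le {g : Sp N → ℂ} (hg : ContDiff ℝ ∞ g) {c : ℝ} (hc : 0 < c)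
    (h0 : ∀ ξ, ‖ξ‖ < c → g ξ = 0)
    (hb : ∀ n, ∃ C, ∀ ξ, ‖iteratedFDeriv ℝ n g ξ‖ ≤ C)
    (ht : ∀ ε : ℝ, (fun ξ => g (ε • ξ)).HasTemperateGrowth) (η : 𝓢(Sp N, ℂ)) (k n : ℕ) :
    ∃ C : ℝ, 0 ≤ C ∧ ∀ ε : ℝ, 0 < ε → ε ≤ 1 →
      SchwartzMap.seminorm ℂ k n (SchwartzMap.smulLeftCLM ℂ (fun ξ => g (ε • ξ)) η) ≤ C * ε := by
  choose B hB using hb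
  have hB0 : ∀ i, 0 ≤ B i := fun i => (norm_nonneg _).trans (hB i 0)
  have hvan : ∀ i ξ, ‖ξ‖ < c → iteratedFDeriv ℝ i g ξ = 0 := fun i ξ hξ => by
    have : g =ᶠ[𝓝 ξ] fun _ => 0 := by
      filter_upwards [continuous_norm.continuousAt.eventually_lt continuousAt_const hξ] with z hz
      exact h0 z hz
    rw [(this.iteratedFDeriv ℝ i).eq_of_nhds]
    rcases i with _ | i
    · ext; simp
    · rw [iteratedFDeriv_const_of_ne (by omega)]; rfl
  refine ⟨∑ i ∈ Finset.range (n + 1), (n.choose i : ℝ) * B i * c⁻¹ *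
    SchwartzMap.seminorm ℂ (k + 1) (n - i) η, by
      refine Finset.sum_nonneg fun i _ => ?_
      have := hB0 i
      positivity, fun ε hε hε1 => ?_⟩
  have hgε : ContDiff ℝ ∞ fun ξ => g (ε • ξ) := hg.comp (contDiff_id.const_smul ε)
  refine SchwartzMap.seminorm_le_bound ℂ k n _ (mul_nonneg (Finset.sum_nonneg fun i _ => by
      have := hB0 i
      positivity) hε.le) fun x => ?_
  rw [SchwartzMap.smulLeftCLM_apply (ht ε)]
  refine (mul_le_mul_of_nonneg_left (norm_iteratedFDeriv_smul_le (𝕜 := ℝ)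
    (f := fun ξ => g (ε • ξ)) (g := η) (N := ∞) hgε η.smooth' x (n := n)
    (mod_cast le_top)) (by positivity)).trans ?_
  rw [Finset.mul_sum, Finset.sum_mul]
  refine Finset.sum_le_sum fun i hi => ?_
  have e : iteratedFDeriv ℝ i (fun ξ => g (ε • ξ)) x = ε ^ i • iteratedFDeriv ℝ i g (ε • x) :=
    congrFun (iteratedFDeriv_comp_const_smul ε (hg.of_le (mod_cast le_top))) x
  have h1 : ‖iteratedFDeriv ℝ i (fun ξ => g (ε • ξ)) x‖ ≤ B i * (c⁻¹ * (ε * ‖x‖)) := by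
    rw [e, norm_smul, norm_pow, Real.norm_of_nonneg hε.le]
    rcases lt_or_ge ‖ε • x‖ c with h | h
    · rw [hvan i _ h, norm_zero, mul_zero]
      have := hB0 i
      positivity
    · rw [norm_smul, Real.norm_of_nonneg hε.le] at h
      have h2 : 1 ≤ c⁻¹ * (ε * ‖x‖) := by rwa [← div_eq_inv_mul, one_le_div₀ hc]
      calc _ ≤ 1 * B i := by
            gcongr
            · exact pow_le_one₀ hε.le hε1
            · exact hB i _
        _ = B i * 1 := by ring
        _ ≤ _ := mul_le_mul_of_nonneg_left h2 (hB0 i)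
  have h3 := SchwartzMap.le_seminorm ℂ (k + 1) (n - i) η x
  calc _ ≤ ‖x‖ ^ k * ((n.choose i : ℝ) * (B i * (c⁻¹ * (ε * ‖x‖))) *
        ‖iteratedFDeriv ℝ (n - i) η x‖) := by gcongr
    _ = (n.choose i : ℝ) * B i * c⁻¹ * (‖x‖ ^ (k + 1) * ‖iteratedFDeriv ℝ (n - i) η x‖) * ε := by
        ring
    _ ≤ _ := by
        have := hB0 i
        gcongr

theorem tendsto_smulLeftCLM_of_vanish {g : Sp N → ℂ} (hg : ContDiff ℝ ∞ g) {c : ℝ} (hc : 0 < c)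
    (h0 : ∀ ξ, ‖ξ‖ < c → g ξ = 0)
    (hb : ∀ n, ∃ C, ∀ ξ, ‖iteratedFDeriv ℝ n g ξ‖ ≤ C)
    (ht : ∀ ε : ℝ, (fun ξ => g (ε • ξ)).HasTemperateGrowth) (η : 𝓢(Sp N, ℂ)) {ε : ℕ → ℝ}
    (hε0 : ∀ j, 0 < ε j) (hε1 : ∀ j, ε j ≤ 1) (hε : Tendsto ε atTop (𝓝 0)) :
    Tendsto (fun j => SchwartzMap.smulLeftCLM ℂ (fun ξ => g (ε j • ξ)) η) atTop (𝓝 0) := by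
  rw [(schwartz_withSeminorms ℂ (Sp N) ℂ).tendsto_nhds _ 0]
  rintro ⟨k, n⟩ e he
  obtain ⟨C, hC, h⟩ := exists_seminorm_smul_le hg hc h0 hb ht η k n
  have h2 : Tendsto (fun j => C * ε j) atTop (𝓝 0) := by simpa using hε.const_mul C
  filter_upwards [h2.eventually_lt_const he] with j hj
  rw [sub_zero]
  exact (h _ (hε0 j) (hε1 j)).trans_lt hj

section Cut

variable {ζ : ℝ → ℝ} (hζ : IsCutoff ζ)
include hζ

theorem hasTemperateGrowth_cut {r : ℝ} (hr : 0 < r) :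
    (fun ξ : Sp N => ((cut ζ r ξ : ℝ) : ℂ)).HasTemperateGrowth :=
  ((hasCompactSupport_cut hζ hr).comp_left (g := fun r : ℝ => (r : ℂ))
    Complex.ofReal_zero).hasTemperateGrowth (Complex.ofRealCLM.contDiff.comp (contDiff_cut hζ hr))

/-- The function 1 - `cut` vanishes near the origin, so its dilates tend to 0 as multipliers of a
Schwartz function; the cutoffs at radius of order 2^J tend to the identity. -/
theorem tendsto_cut_smul (η : 𝓢(Sp N, ℂ)) {r : ℝ} (hr : 0 < r) :
    Tendsto (fun J : ℕ => SchwartzMap.smulLeftCLM ℂ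
      (fun ξ => ((cut ζ (r * ((2 : ℝ) ^ J)⁻¹) ξ : ℝ) : ℂ)) η) atTop (𝓝 η) := by
  have hcs : ContDiff ℝ ∞ fun ξ : Sp N => ((cut ζ r ξ : ℝ) : ℂ) :=
    Complex.ofRealCLM.contDiff.comp (contDiff_cut hζ hr)
  have hcc : HasCompactSupport fun ξ : Sp N => ((cut ζ r ξ : ℝ) : ℂ) :=
    (hasCompactSupport_cut hζ hr).comp_left (g := fun r : ℝ => (r : ℂ)) Complex.ofReal_zero
  set g : Sp N → ℂ := fun ξ => 1 - ((cut ζ r ξ : ℝ) : ℂ) with hg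
  have hgs : ContDiff ℝ ∞ g := contDiff_const.sub hcs
  have htg : ∀ ε : ℝ, (fun ξ => g (ε • ξ)).HasTemperateGrowth := fun ε => by
    have h1 : g.HasTemperateGrowth :=
      (Function.HasTemperateGrowth.const 1).sub (hasTemperateGrowth_cut hζ hr)
    exact h1.comp (ε • ContinuousLinearMap.id ℝ (Sp N)).hasTemperateGrowth
  have hb : ∀ n, ∃ C, ∀ ξ, ‖iteratedFDeriv ℝ n g ξ‖ ≤ C := fun n => by
    obtain ⟨C, hC⟩ := (hcc.iteratedFDeriv (𝕜 := ℝ) n).exists_bound_of_continuous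
      (hcs.continuous_iteratedFDeriv (mod_cast le_top))
    refine ⟨1 + C, fun ξ => ?_⟩
    have e : iteratedFDeriv ℝ n g ξ = iteratedFDeriv ℝ n (fun _ => (1 : ℂ)) ξ -
        iteratedFDeriv ℝ n (fun ξ : Sp N => ((cut ζ r ξ : ℝ) : ℂ)) ξ :=
      iteratedFDeriv_sub_apply contDiff_const.contDiffAt
        (hcs.of_le (mod_cast le_top)).contDiffAt
    rw [e]
    refine (norm_sub_le _ _).trans (add_le_add ?_ (hC ξ))
    rcases n with _ | n
    · simp
    · rw [iteratedFDeriv_const_of_ne (by omega)]; simp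
  have h := tendsto_smulLeftCLM_of_vanish hgs (c := 3 / 2 / r) (by positivity)
    (fun ξ hξ => by
      rw [lt_div_iff₀ hr] at hξ
      rw [hg]
      simp only
      rw [cut_eq_one hζ hr.le (by linarith)]
      simp) hb htg η (ε := fun j => ((2 : ℝ) ^ j)⁻¹) (fun j => by positivity)
      (fun j => inv_le_one_of_one_le₀ (one_le_pow₀ one_le_two))
      (by
        simp only [← inv_pow]
        exact tendsto_pow_atTop_nhds_zero_of_lt_one (by norm_num) (by norm_num))
  have h' := (tendsto_const_nhds (x := η)).sub h
  rw [sub_zero] at h'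
  refine h'.congr fun j => ?_
  ext ξ
  rw [sub_apply, SchwartzMap.smulLeftCLM_apply_apply (htg _),
    SchwartzMap.smulLeftCLM_apply_apply (hasTemperateGrowth_cut hζ (by positivity)), hg]
  simp only [cut_smul (ζ := ζ) (show (0 : ℝ) ≤ ((2 : ℝ) ^ j)⁻¹ by positivity), smul_eq_mul]
  ring

/-! ### The high-frequency part of the heat evolution -/

omit hζ in
/-- The symbol of the heat flow localized to the frequency `2 ^ i`. -/
def blockSymbol (ζ : ℝ → ℝ) (θ t : ℝ) (i : ℕ) (ξ : Sp N) : ℝ :=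
  ann ζ (Real.pi * ((2 : ℝ) ^ i)⁻¹) (8 * Real.pi * ((2 : ℝ) ^ i)⁻¹) ξ * Real.exp (-t * nrm θ ξ)

/-- The kernel of the heat flow localized to the frequency `2 ^ i`. -/
def blockKernel (ζ : ℝ → ℝ) (θ t : ℝ) (i : ℕ) : Sp N → ℂ :=
  𝓕⁻ fun ξ : Sp N => ((blockSymbol ζ θ t i ξ : ℝ) : ℂ)

theorem contDiff_blockSymbol (θ t : ℝ) (i : ℕ) :
    ContDiff ℝ ∞ fun ξ : Sp N => ((blockSymbol ζ θ t i ξ : ℝ) : ℂ) := by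
  have h2 : Real.pi * ((2 : ℝ) ^ i)⁻¹ ≤ 8 * Real.pi * ((2 : ℝ) ^ i)⁻¹ := by
    gcongr; linarith [Real.pi_pos]
  obtain ⟨h, h1, -, h3⟩ := exists_temperate_ann (N := N) hζ θ
    (show 0 < Real.pi * ((2 : ℝ) ^ i)⁻¹ by positivity) h2
  have e : (fun ξ : Sp N => ((blockSymbol ζ θ t i ξ : ℝ) : ℂ)) = fun ξ =>
      ((ann ζ (Real.pi * ((2 : ℝ) ^ i)⁻¹) (8 * Real.pi * ((2 : ℝ) ^ i)⁻¹) ξ *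
        Real.exp (-t * h ξ) : ℝ) : ℂ) := by
    ext ξ
    rw [blockSymbol, h3 ξ fun r => Real.exp (-t * r)]
  rw [e]
  exact contDiff_mul_comp_ofReal (g := fun r => Real.exp (-t * r))
    (contDiff_ann hζ (by positivity) (by positivity)) h1.1 (Real.contDiff_exp.comp (contDiff_const.mul contDiff_id))

theorem hasCompactSupport_blockSymbol (θ t : ℝ) (i : ℕ) :
    HasCompactSupport fun ξ : Sp N => ((blockSymbol ζ θ t i ξ : ℝ) : ℂ) :=
  HasCompactSupport.comp_left (g := fun r : ℝ => (r : ℂ))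
    (hasCompactSupport_ann hζ (by positivity) (by positivity)).mul_right Complex.ofReal_zero

/-- The wider annulus equals 1 on the dyadic shell and can be inserted freely. It gives the heat
factor a compactly supported smooth carrier that reproduces the block. -/
theorem ann_mul_dyadic {r : ℝ} (hr : 0 < r) (ξ : Sp N) :
    (cut ζ (2 * r) ξ - cut ζ (4 * r) ξ) * ann ζ r (8 * r) ξ =
      cut ζ (2 * r) ξ - cut ζ (4 * r) ξ := by
  rcases le_or_gt (4 * r * ‖ξ‖) (3 / 2) with h | h
  · rw [cut_eq_one hζ (by positivity) h, cut_eq_one hζ (by positivity) (by nlinarith [norm_nonneg ξ])]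
    simp
  · rcases le_or_gt (5 / 3) (2 * r * ‖ξ‖) with h' | h'
    · rw [cut_eq_zero hζ h', cut_eq_zero hζ (by nlinarith [norm_nonneg ξ])]
      simp
    · rw [ann, cut_eq_one hζ (r := r) hr.le (by nlinarith [norm_nonneg ξ]),
        cut_eq_zero hζ (r := 8 * r) (by nlinarith [norm_nonneg ξ])]
      ring

omit hζ in
theorem dyadicSymbol_succ_two_pi_smul (i : ℕ) (ξ : Sp N) :
    dyadicSymbol ζ ((i + 1 : ℕ) : ℤ) ((2 * Real.pi) • ξ) =
      cut ζ (2 * Real.pi * ((2 : ℝ) ^ (i + 1))⁻¹) ξ - cut ζ (2 * Real.pi * ((2 : ℝ) ^ i)⁻¹) ξ := by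
  rw [dyadicSymbol_two_pi_smul]
  congr 2
  · rw [zpow_neg, zpow_natCast, mul_comm]
  · have : (1 : ℤ) - ((i + 1 : ℕ) : ℤ) = -(i : ℤ) := by push_cast; ring
    rw [this, zpow_neg, zpow_natCast, mul_comm]

theorem dyadicSymbol_mul_blockSymbol (θ t : ℝ) (i : ℕ) (ξ : Sp N) :
    dyadicSymbol ζ ((i + 1 : ℕ) : ℤ) ((2 * Real.pi) • ξ) * blockSymbol ζ θ t (i + 1) ξ =
      dyadicSymbol ζ ((i + 1 : ℕ) : ℤ) ((2 * Real.pi) • ξ) * Real.exp (-t * nrm θ ξ) := by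
  rw [dyadicSymbol_succ_two_pi_smul, blockSymbol, ← mul_assoc]
  congr 1
  have := ann_mul_dyadic hζ (r := Real.pi * ((2 : ℝ) ^ (i + 1))⁻¹) (by positivity) ξ
  have e1 : 2 * Real.pi * ((2 : ℝ) ^ (i + 1))⁻¹ = 2 * (Real.pi * ((2 : ℝ) ^ (i + 1))⁻¹) := by ring
  have e2 : 2 * Real.pi * ((2 : ℝ) ^ i)⁻¹ = 4 * (Real.pi * ((2 : ℝ) ^ (i + 1))⁻¹) := by
    rw [pow_succ]; field_simp; ring
  rw [e1, e2, mul_assoc 8, this]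

/-- The symbol of the high-frequency part of the heat flow. -/
def highSymbol (ζ : ℝ → ℝ) (θ t : ℝ) (ξ : Sp N) : ℝ :=
  (1 - cut ζ (2 * Real.pi) ξ) * Real.exp (-t * nrm θ ξ)

theorem hasTemperateGrowth_highSymbol (θ : ℝ) {t : ℝ} (ht : 0 ≤ t) :
    (fun ξ : Sp N => ((highSymbol ζ θ t ξ : ℝ) : ℂ)).HasTemperateGrowth := by
  obtain ⟨h, h1, h2, h3⟩ := exists_temperate_norm_rpow N θ (c := 3 / 2 / (2 * Real.pi))
    (by positivity)
  have e : (fun ξ : Sp N => ((highSymbol ζ θ t ξ : ℝ) : ℂ)) = fun ξ =>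
      (1 - ((cut ζ (2 * Real.pi) ξ : ℝ) : ℂ)) * ((Real.exp (-t * h ξ) : ℝ) : ℂ) := by
    ext ξ
    rw [highSymbol]
    rcases le_or_gt (3 / 2 / (2 * Real.pi)) ‖ξ‖ with hξ | hξ
    · rw [h3 ξ hξ, nrm]; push_cast; rfl
    · rw [lt_div_iff₀ (by positivity)] at hξ
      rw [cut_eq_one hζ (by positivity) (by linarith)]
      simp
  rw [e]
  refine ((Function.HasTemperateGrowth.const 1).sub
    (hasTemperateGrowth_cut hζ (by positivity))).mul ?_
  exact Complex.ofRealCLM.hasTemperateGrowth.comp (hasTemperateGrowth_exp_neg h1 h2 ht)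

/-- From J = 1 on, the wide cutoff is 1 wherever the narrow one is nonzero; for J = 0 the two
coincide and the identity fails. -/
theorem cut_sub_cut_eq {J : ℕ} (hJ : 1 ≤ J) (ξ : Sp N) :
    cut ζ (2 * Real.pi * ((2 : ℝ) ^ J)⁻¹) ξ - cut ζ (2 * Real.pi) ξ =
      cut ζ (2 * Real.pi * ((2 : ℝ) ^ J)⁻¹) ξ * (1 - cut ζ (2 * Real.pi) ξ) := by
  rcases le_or_gt (5 / 3) (2 * Real.pi * ‖ξ‖) with h | h
  · rw [cut_eq_zero hζ (r := 2 * Real.pi) h]; ring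
  · have h2 : ((2 : ℝ) ^ J)⁻¹ ≤ 1 / 2 := by
      rw [one_div]
      refine inv_anti₀ two_pos ?_
      calc (2 : ℝ) = 2 ^ 1 := by norm_num
        _ ≤ _ := pow_le_pow_right₀ one_le_two hJ
    rw [cut_eq_one hζ (r := 2 * Real.pi * ((2 : ℝ) ^ J)⁻¹) (by positivity)]
    · ring
    · have : 0 ≤ 2 * Real.pi * ‖ξ‖ := by positivity
      calc _ = 2 * Real.pi * ‖ξ‖ * ((2 : ℝ) ^ J)⁻¹ := by ring
        _ ≤ 2 * Real.pi * ‖ξ‖ * (1 / 2) := by gcongr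
        _ ≤ _ := by linarith

/-- The dyadic symbols telescope to a difference of two cutoffs, and in every block the localized
heat symbol agrees with exp(-t|2πξ|^θ). -/
theorem sum_fourierMultiplier_eq (θ t : ℝ) (φ : 𝓢'(Sp N, ℂ)) {J : ℕ} (hJ : 1 ≤ J) :
    ∑ i ∈ Finset.range J, TemperedDistribution.fourierMultiplierCLM ℂ
        (fun ξ => ((blockSymbol ζ θ t (i + 1) ξ : ℝ) : ℂ))
        (multiplier (dyadicSymbol ζ ((i + 1 : ℕ) : ℤ)) φ) =
      TemperedDistribution.fourierMultiplierCLM ℂ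
        ((fun ξ => ((cut ζ (2 * Real.pi * ((2 : ℝ) ^ J)⁻¹) ξ : ℝ) : ℂ)) *
          fun ξ => ((highSymbol ζ θ t ξ : ℝ) : ℂ)) φ := by
  have hd : ∀ i : ℕ, (fun ξ : Sp N => ((dyadicSymbol ζ ((i + 1 : ℕ) : ℤ)
      ((2 * Real.pi) • ξ) : ℝ) : ℂ)).HasTemperateGrowth := fun i => by
    simp only [dyadicSymbol_succ_two_pi_smul, Complex.ofReal_sub]
    exact (hasTemperateGrowth_cut hζ (by positivity)).sub
      (hasTemperateGrowth_cut hζ (by positivity))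
  have hb : ∀ i : ℕ, (fun ξ : Sp N =>
      ((blockSymbol ζ θ t (i + 1) ξ : ℝ) : ℂ)).HasTemperateGrowth := fun i =>
    (hasCompactSupport_blockSymbol hζ θ t _).hasTemperateGrowth (contDiff_blockSymbol hζ θ t _)
  simp only [multiplier]
  rw [Finset.sum_congr rfl fun i _ =>
    TemperedDistribution.fourierMultiplierCLM_fourierMultiplierCLM_apply (hd i) (hb i) φ,
    ← sum_apply, ← TemperedDistribution.fourierMultiplierCLM_sum ℂ fun i _ => (hd i).mul (hb i)]
  congr 2
  ext ξ
  simp only [Pi.mul_apply, ← Complex.ofReal_mul, dyadicSymbol_mul_blockSymbol hζ]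
  simp only [dyadicSymbol_succ_two_pi_smul]
  rw [← Complex.ofReal_sum, ← Finset.sum_mul,
    Finset.sum_range_sub (fun i => cut ζ (2 * Real.pi * ((2 : ℝ) ^ i)⁻¹) ξ)]
  simp only [pow_zero, inv_one, mul_one]
  rw [cut_sub_cut_eq hζ hJ, highSymbol, mul_assoc]

/-- Partial sums of the blocks are the full multiplier with an additional cutoff at frequency 2^J.
On the distribution side the cutoff tends to the identity on Schwartz functions; on the function
side the summable bounds b allow termwise integration. The two limits coincide. -/
theorem represents_highSymbol {θ t : ℝ} (ht : 0 ≤ t) {φ : 𝓢'(Sp N, ℂ)} {f : ℕ → Sp N → ℂ}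
    (hf : ∀ i : ℕ, Tame (f i))
    (hrep : ∀ i : ℕ, Represents (multiplier (dyadicSymbol ζ ((i + 1 : ℕ) : ℤ)) φ) (f i))
    {A b : ℕ → ℝ} (hK : ∀ i, IsKernel (A i) (blockKernel ζ θ t (i + 1) : Sp N → ℂ))
    (hb : Summable b) (hle : ∀ i x, ‖conv (blockKernel ζ θ t (i + 1)) (f i) x‖ ≤ b i) :
    Represents (multiplier (fun ξ => (1 - lowSymbol ζ ξ) * heatSymbol θ t ξ) φ)
      (fun x => ∑' i, conv (blockKernel ζ θ t (i + 1)) (f i) x) := by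
  have hr : ∀ i, Represents (TemperedDistribution.fourierMultiplierCLM ℂ
      (fun ξ => ((blockSymbol ζ θ t (i + 1) ξ : ℝ) : ℂ))
      (multiplier (dyadicSymbol ζ ((i + 1 : ℕ) : ℤ)) φ))
      (conv (blockKernel ζ θ t (i + 1)) (f i)) := fun i =>
    (hrep i).fourierMultiplier (hf i)
      ((hasCompactSupport_blockSymbol hζ θ t _).hasTemperateGrowth (contDiff_blockSymbol hζ θ t _))
      ((contDiff_blockSymbol hζ θ t _).continuous.integrable_of_hasCompactSupport
        (hasCompactSupport_blockSymbol hζ θ t _)) (hK i)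
  have hcont : Continuous fun x => ∑' i, conv (blockKernel ζ θ t (i + 1)) (f i) x :=
    continuous_tsum (fun i => continuous_conv (hf i) (hK i).contDiff.continuous (hK i).nonneg
      (hK i).norm_le) hb hle
  intro ψ
  have hint : Integrable fun x => ψ x * ∑' i, conv (blockKernel ζ θ t (i + 1)) (f i) x := by
    refine (ψ.integrable.norm.mul_const (∑' i, b i)).mono'
      (ψ.continuous.mul hcont).aestronglyMeasurable (Eventually.of_forall fun x => ?_)
    rw [norm_mul]
    gcongr
    exact tsum_of_norm_bounded hb.hasSum fun i => hle i x
  refine ⟨hint, ?_⟩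
  have hs : HasSum (fun i => ∫ x, ψ x * conv (blockKernel ζ θ t (i + 1)) (f i) x)
      (∫ x, ψ x * ∑' i, conv (blockKernel ζ θ t (i + 1)) (f i) x) := by
    have := hasSum_integral_of_summable_integral_norm (fun i => (hr i ψ).1)
      (Summable.of_nonneg_of_le (fun i => by positivity) (fun i => ?_)
        (hb.mul_left (∫ x, ‖ψ x‖)))
    · simpa only [tsum_mul_left] using this
    · rw [← integral_mul_const]
      refine integral_mono (hr i ψ).1.norm (ψ.integrable.norm.mul_const _) fun x => ?_
      simp only [norm_mul]
      gcongr
      exact hle i x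
  have h1 := hs.tendsto_sum_nat
  have hsym : multiplier (fun ξ => (1 - lowSymbol ζ ξ) * heatSymbol θ t ξ) φ =
      TemperedDistribution.fourierMultiplierCLM ℂ
        (fun ξ => ((highSymbol ζ θ t ξ : ℝ) : ℂ)) φ := by
    simp only [multiplier, lowSymbol_two_pi_smul, heatSymbol_two_pi_smul, highSymbol]
  rw [hsym, TemperedDistribution.fourierMultiplierCLM_apply_apply]
  refine tendsto_nhds_unique ?_ h1
  have h2 := tendsto_cut_smul hζ (r := 2 * Real.pi) (SchwartzMap.smulLeftCLM ℂ
    (fun ξ => ((highSymbol ζ θ t ξ : ℝ) : ℂ)) (𝓕⁻ ψ)) (by positivity)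
  have h3 := ((φ.continuous.comp
    (FourierTransform.fourierCLM ℂ 𝓢(Sp N, ℂ)).continuous).tendsto _).comp h2
  refine h3.congr' ?_
  filter_upwards [eventually_ge_atTop 1] with J hJ
  rw [Finset.sum_congr rfl fun i _ => ((hr i ψ).2).symm]
  have h4 := congrArg (fun v : 𝓢'(Sp N, ℂ) => v ψ) (sum_fourierMultiplier_eq hζ θ t φ hJ)
  simp only [sum_apply] at h4
  rw [h4, TemperedDistribution.fourierMultiplierCLM_apply_apply,
    ← SchwartzMap.smulLeftCLM_smulLeftCLM_apply (hasTemperateGrowth_cut hζ (by positivity))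
      (hasTemperateGrowth_highSymbol hζ θ ht)]
  rfl

end Cut

end BesovMorrey

end

noncomputable section

namespace BesovMorrey

open MeasureTheory Set Filter Metric
open scoped ENNReal SchwartzMap FourierTransform Topology ContDiff

variable {N : ℕ}

/-! ### Dyadic sums -/

theorem summable_pow_natAbs {r : ℝ} (h0 : 0 ≤ r) (h1 : r < 1) :
    Summable fun k : ℤ => r ^ k.natAbs := by
  refine Summable.of_nat_of_neg ?_ ?_
  · simpa using summable_geometric_of_lt_one h0 h1
  · simpa using summable_geometric_of_lt_one h0 h1

/-- If 2^n ≤ x < 2^{n+1}, the i-th term is at most a constant times 2^{-c|i+n|} with c = min α β. A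
two-sided geometric series bounds the sum independently of x. -/
theorem exists_min_rpow_le {α β : ℝ} (hα : 0 < α) (hβ : 0 < β) :
    ∃ C : ℝ, 0 < C ∧ ∀ x : ℝ, 0 < x →
      Summable (fun i : ℕ => min ((x * 2 ^ i) ^ α) ((x * 2 ^ i) ^ (-β))) ∧
      ∑' i : ℕ, min ((x * 2 ^ i) ^ α) ((x * 2 ^ i) ^ (-β)) ≤ C := by
  set c := min α β with hc
  have hc0 : 0 < c := lt_min hα hβ
  set r : ℝ := 2 ^ (-c) with hr
  have hr0 : 0 < r := by positivity
  have hr1 : r < 1 := Real.rpow_lt_one_of_one_lt_of_neg one_lt_two (by linarith)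
  have hs := summable_pow_natAbs hr0.le hr1
  have hs2 : Summable fun k : ℤ => 2 ^ α * r ^ k.natAbs := hs.mul_left _
  refine ⟨∑' k : ℤ, 2 ^ α * r ^ k.natAbs,
    hs2.tsum_pos (fun k => by positivity) 0 (by positivity), fun x hx => ?_⟩
  obtain ⟨n, hn1, hn2⟩ := exists_mem_Ico_zpow hx one_lt_two
  have hinj : Function.Injective fun i : ℕ => (i : ℤ) + n := fun i j h => by
    simpa using h
  have key : ∀ i : ℕ, min ((x * 2 ^ i) ^ α) ((x * 2 ^ i) ^ (-β)) ≤
      2 ^ α * r ^ ((i : ℤ) + n).natAbs := by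
    intro i
    have h1 : (2 : ℝ) ^ ((i : ℤ) + n) ≤ x * 2 ^ i := by
      rw [zpow_add₀ two_ne_zero, zpow_natCast, mul_comm]
      gcongr
    have h2 : x * 2 ^ i ≤ (2 : ℝ) ^ ((i : ℤ) + n) * 2 := by
      rw [zpow_add₀ two_ne_zero, zpow_natCast, mul_assoc, ← zpow_add_one₀ two_ne_zero, mul_comm]
      gcongr
    have h3 : 0 < (2 : ℝ) ^ ((i : ℤ) + n) := by positivity
    rcases le_or_gt 0 ((i : ℤ) + n) with h | h
    · obtain ⟨k, hk⟩ := Int.eq_ofNat_of_zero_le h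
      rw [hk] at h1 h3 ⊢
      rw [zpow_natCast] at h1 h3
      refine (min_le_right _ _).trans ?_
      calc (x * 2 ^ i) ^ (-β) ≤ ((2 : ℝ) ^ k) ^ (-β) :=
            Real.rpow_le_rpow_of_nonpos h3 h1 (by linarith)
        _ ≤ ((2 : ℝ) ^ k) ^ (-c) := by
            refine Real.rpow_le_rpow_of_exponent_le (one_le_pow₀ one_le_two) ?_
            linarith [min_le_right α β]
        _ = r ^ k := by
            rw [hr, ← Real.rpow_natCast, ← Real.rpow_natCast, ← Real.rpow_mul two_pos.le,
              ← Real.rpow_mul two_pos.le, mul_comm]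
        _ = 1 * r ^ k := (one_mul _).symm
        _ ≤ _ := by
            rw [Int.natAbs_natCast]
            gcongr
            exact Real.one_le_rpow one_le_two hα.le
    · obtain ⟨k, hk⟩ := Int.eq_ofNat_of_zero_le (neg_nonneg.2 h.le)
      have hk' : (i : ℤ) + n = -(k : ℤ) := by rw [← hk]; ring
      rw [hk'] at h2 ⊢
      refine (min_le_left _ _).trans ?_
      rw [zpow_neg, zpow_natCast] at h2
      have h4 : ((2 : ℝ) ^ k)⁻¹ ≤ 1 := inv_le_one_of_one_le₀ (one_le_pow₀ one_le_two)
      calc (x * 2 ^ i) ^ α ≤ (((2 : ℝ) ^ k)⁻¹ * 2) ^ α := by gcongr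
        _ = 2 ^ α * (((2 : ℝ) ^ k)⁻¹) ^ α := by
            rw [Real.mul_rpow (by positivity) (by positivity), mul_comm]
        _ ≤ 2 ^ α * (((2 : ℝ) ^ k)⁻¹) ^ c := by
            gcongr 2 ^ α * ?_
            exact Real.rpow_le_rpow_of_exponent_ge (by positivity) h4 (min_le_left _ _)
        _ = _ := by
            rw [Int.natAbs_neg, Int.natAbs_natCast, hr, Real.inv_rpow (by positivity),
              ← Real.rpow_neg (by positivity), ← Real.rpow_natCast, ← Real.rpow_natCast,
              ← Real.rpow_mul two_pos.le, ← Real.rpow_mul two_pos.le, mul_comm (-c)]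
  have hs3 := hs2.comp_injective hinj
  have hs4 := Summable.of_nonneg_of_le (fun i : ℕ => by positivity) key hs3
  refine ⟨hs4, (hs4.tsum_le_tsum key hs3).trans ?_⟩
  exact tsum_comp_le_tsum_of_inj hs2 (fun k => by positivity) hinj

/-- Apart from the factor t^{-α/θ}, the sum depends on t and i only through t^{1/θ} 2^i. The
condition α < Lθ makes the terms decay beyond the frequency t^{-1/θ}. -/
theorem exists_dyadic_sum_le {α θ : ℝ} (hα : 0 < α) (hθ : 0 < θ) {L : ℕ} (hL : α < L * θ) :
    ∃ C : ℝ, 0 < C ∧ ∀ t : ℝ, 0 < t →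
      Summable (fun i : ℕ => ((2 : ℝ) ^ i) ^ α * ((1 + t * ((2 : ℝ) ^ i) ^ θ) ^ L)⁻¹) ∧
      ∑' i : ℕ, ((2 : ℝ) ^ i) ^ α * ((1 + t * ((2 : ℝ) ^ i) ^ θ) ^ L)⁻¹ ≤ C * t ^ (-α / θ) := by
  obtain ⟨C, hC, h⟩ := exists_min_rpow_le hα (β := L * θ - α) (by linarith)
  refine ⟨C, hC, fun t ht => ?_⟩
  obtain ⟨h1, h2⟩ := h (t ^ (1 / θ)) (by positivity)
  have key : ∀ i : ℕ, ((2 : ℝ) ^ i) ^ α * ((1 + t * ((2 : ℝ) ^ i) ^ θ) ^ L)⁻¹ ≤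
      t ^ (-α / θ) * min ((t ^ (1 / θ) * 2 ^ i) ^ α) ((t ^ (1 / θ) * 2 ^ i) ^ (-(L * θ - α))) := by
    intro i
    set R : ℝ := 2 ^ i with hR
    have hR0 : 0 < R := by positivity
    have e1 : t ^ (-α / θ) * (t ^ (1 / θ) * R) ^ α = R ^ α := by
      rw [Real.mul_rpow (by positivity) hR0.le, ← Real.rpow_mul ht.le, ← mul_assoc,
        ← Real.rpow_add ht]
      have : -α / θ + 1 / θ * α = 0 := by ring
      rw [this, Real.rpow_zero, one_mul]
    have e2 : (t ^ (1 / θ) * R) ^ (-(L * θ - α)) = (t ^ (1 / θ) * R) ^ α * ((t * R ^ θ) ^ L)⁻¹ := by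
      have : (t * R ^ θ) ^ L = (t ^ (1 / θ) * R) ^ (L * θ) := by
        rw [mul_comm (L : ℝ) θ, Real.rpow_mul (by positivity), Real.rpow_natCast,
          Real.mul_rpow (by positivity) hR0.le, ← Real.rpow_mul ht.le, one_div_mul_cancel hθ.ne',
          Real.rpow_one]
      rw [this, ← Real.rpow_neg (by positivity), ← Real.rpow_add (by positivity)]
      congr 1
      ring
    rw [mul_min_of_nonneg _ _ (by positivity), e1, e2, ← mul_assoc, e1]
    have h3 : 0 < t * R ^ θ := by positivity
    refine le_min (mul_le_of_le_one_right (by positivity) ?_) ?_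
    · exact inv_le_one_of_one_le₀ (one_le_pow₀ (by linarith))
    · gcongr
      linarith
  have hs := Summable.of_nonneg_of_le (fun i : ℕ => by positivity) key (h1.mul_left _)
  refine ⟨hs, (hs.tsum_le_tsum key (h1.mul_left _)).trans ?_⟩
  rw [tsum_mul_left, mul_comm]
  gcongr

end BesovMorrey

end

noncomputable section

namespace BesovMorrey

open MeasureTheory Set Filter Metric
open scoped ENNReal SchwartzMap FourierTransform Topology ContDiff

variable {N : ℕ}

/-! ### Kernels of the localized heat flow -/

/-- The mean value inequality in l. It yields Lipschitz dependence of the block kernels on time. -/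
theorem abs_pow_mul_exp_sub_le (i n : ℕ) (hi : i ≤ n) {M H z l l' : ℝ} (hz0 : 0 ≤ z)
    (hz : z ≤ H) (hl : l ∈ Icc 0 M) (hl' : l' ∈ Icc 0 M) :
    |(-l) ^ i * Real.exp (-l * z) - (-l') ^ i * Real.exp (-l' * z)| ≤
      (n + H) * (1 + M) ^ n * |l - l'| := by
  have hM : 0 ≤ M := hl.1.trans hl.2
  have hd : ∀ x ∈ Icc 0 M, HasDerivWithinAt (fun l : ℝ => (-l) ^ i * Real.exp (-l * z))
      ((i * (-x) ^ (i - 1) * (-1)) * Real.exp (-x * z) +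
        (-x) ^ i * (Real.exp (-x * z) * (-1 * z))) (Icc 0 M) x := fun x _ => by
    refine HasDerivAt.hasDerivWithinAt ?_
    exact ((hasDerivAt_neg x).pow i).mul
      (((hasDerivAt_neg x).mul_const z).exp)
  refine (convex_Icc 0 M).norm_image_sub_le_of_norm_hasDerivWithin_le hd (fun x hx => ?_) hl' hl
  have he : Real.exp (-x * z) ≤ 1 := by
    rw [Real.exp_le_one_iff]; nlinarith [hx.1]
  have hp : ∀ k ≤ n, |(-x) ^ k| ≤ (1 + M) ^ n := fun k hk => by
    rw [abs_pow, abs_neg, abs_of_nonneg hx.1]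
    calc x ^ k ≤ (1 + M) ^ k := pow_le_pow_left₀ hx.1 (by linarith [hx.2]) k
      _ ≤ _ := pow_le_pow_right₀ (by linarith) hk
  have hi' : (i : ℝ) ≤ n := by exact_mod_cast hi
  rw [Real.norm_eq_abs]
  refine (abs_add_le _ _).trans ?_
  rw [abs_mul, abs_mul, abs_mul, abs_mul, abs_mul, abs_mul, abs_neg, abs_one, abs_of_nonneg hz0,
    Real.abs_exp, Nat.abs_cast]
  calc _ ≤ n * (1 + M) ^ n * 1 * 1 + (1 + M) ^ n * (1 * (1 * H)) := by
        gcongr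
        · exact hp _ (by omega)
        · exact hp _ hi
    _ = _ := by ring

theorem exists_isKernel_block_sub {ψ h : Sp N → ℝ} (hψ : ContDiff ℝ ∞ ψ)
    (hcs : HasCompactSupport ψ) (hh : ContDiff ℝ ∞ h) (h0 : ∀ ξ ∈ tsupport ψ, 0 ≤ h ξ) (M : ℝ) :
    ∃ A : ℝ, ∀ l ∈ Icc 0 M, ∀ l' ∈ Icc 0 M, IsKernel (A * |l - l'|)
      (𝓕⁻ fun ξ => ((ψ ξ * (Real.exp (-l * h ξ) - Real.exp (-l' * h ξ)) : ℝ) : ℂ)) := by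
  obtain ⟨A, hA, h1⟩ := exists_isKernel_mul_comp hψ hcs hh
  obtain ⟨H, hH⟩ := hcs.exists_bound_of_continuousOn hh.continuous.continuousOn
  refine ⟨A * (((N + 1 : ℕ) + |H|) * (1 + M) ^ (N + 1)), fun l hl l' hl' => ?_⟩
  have hM : 0 ≤ M := hl.1.trans hl.2
  rw [mul_assoc]
  have hs : ∀ l : ℝ, ContDiff ℝ ∞ fun z : ℝ => Real.exp (-l * z) := fun l =>
    Real.contDiff_exp.comp (contDiff_const.mul contDiff_id)
  refine h1 (fun z => Real.exp (-l * z) - Real.exp (-l' * z)) _ (by positivity)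
    ((hs l).sub (hs l')) fun i hi ξ hξ => ?_
  have e : iteratedDeriv i (fun z => Real.exp (-l * z) - Real.exp (-l' * z)) (h ξ) =
      (-l) ^ i * Real.exp (-l * h ξ) - (-l') ^ i * Real.exp (-l' * h ξ) := by
    rw [← iteratedDeriv_exp_neg_mul, ← iteratedDeriv_exp_neg_mul]
    exact iteratedDeriv_fun_sub ((hs l).of_le (mod_cast le_top)).contDiffAt
      ((hs l').of_le (mod_cast le_top)).contDiffAt
  rw [e]
  refine abs_pow_mul_exp_sub_le i (N + 1) hi (h0 ξ hξ) ?_ hl hl'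
  have := hH ξ hξ
  rw [Real.norm_of_nonneg (h0 ξ hξ)] at this
  exact this.trans (le_abs_self H)

theorem continuousAt_of_lipschitz {E : Type*} [NormedAddCommGroup E] {K : ℝ → Sp N → E} {t₀ A : ℝ}
    (hc : Continuous (K t₀)) (hA : ∀ᶠ t in 𝓝 t₀, ∀ x, ‖K t x - K t₀ x‖ ≤ A * |t - t₀|)
    (z : Sp N) : ContinuousAt (fun w : ℝ × Sp N => K w.1 w.2) (t₀, z) := by
  have h1 : Tendsto (fun w : ℝ × Sp N => K w.1 w.2 - K t₀ w.2) (𝓝 (t₀, z)) (𝓝 0) := by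
    refine squeeze_zero_norm' (a := fun w : ℝ × Sp N => A * |w.1 - t₀|) ?_ ?_
    · rw [nhds_prod_eq]
      exact (hA.prod_inl _).mono fun w hw => hw w.2
    · have : ContinuousAt (fun w : ℝ × Sp N => A * |w.1 - t₀|) (t₀, z) := by fun_prop
      simpa [ContinuousAt] using this
  have h2 : Tendsto (fun w : ℝ × Sp N => K t₀ w.2) (𝓝 (t₀, z)) (𝓝 (K t₀ z)) :=
    (hc.comp continuous_snd).continuousAt
  have := h1.add h2
  simpa [ContinuousAt] using this

section Block

variable {ζ : ℝ → ℝ} (hζ : IsCutoff ζ)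
include hζ

omit hζ in
theorem blockKernel_eq_dil (θ t : ℝ) (i : ℕ) :
    (blockKernel ζ θ t i : Sp N → ℂ) = dil ((2 : ℝ) ^ i) (𝓕⁻ fun ξ : Sp N =>
      ((ann ζ Real.pi (8 * Real.pi) ξ * Real.exp (-(t * ((2 : ℝ) ^ i) ^ θ) * nrm θ ξ) : ℝ) : ℂ)) := by
  rw [blockKernel]
  simp only [blockSymbol]
  rw [fourierInv_ann_dil θ Real.pi (8 * Real.pi) (fun r => Real.exp (-t * r)) (by positivity)]
  congr 2
  ext ξ
  have : -t * (((2 : ℝ) ^ i) ^ θ * nrm θ ξ) = -(t * ((2 : ℝ) ^ i) ^ θ) * nrm θ ξ := by ring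
  rw [this]

theorem exists_blockKernel_le (θ : ℝ) (L : ℕ) :
    ∃ A : ℝ, 0 < A ∧ ∀ t : ℝ, 0 ≤ t → ∀ i : ℕ,
      ContDiff ℝ 1 (blockKernel ζ θ t i : Sp N → ℂ) ∧
      (∀ x : Sp N, ‖blockKernel ζ θ t i x‖ ≤
        A * ((1 + t * ((2 : ℝ) ^ i) ^ θ) ^ L)⁻¹ * dwt (2 ^ i) x) ∧
      ∀ x : Sp N, ‖fderiv ℝ (blockKernel ζ θ t i) x‖ ≤
        A * ((1 + t * ((2 : ℝ) ^ i) ^ θ) ^ L)⁻¹ * 2 ^ i * dwt (2 ^ i) x := by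
  obtain ⟨A, hA, h⟩ := exists_isKernel_ann (N := N) hζ θ Real.pi_pos
    (show Real.pi ≤ 8 * Real.pi by linarith [Real.pi_pos]) L
  refine ⟨A, hA, fun t ht i => ?_⟩
  have hk := h (t * ((2 : ℝ) ^ i) ^ θ) (by positivity)
  rw [blockKernel_eq_dil]
  exact ⟨contDiff_dil hk.contDiff _, norm_dil_le hk (by positivity),
    norm_fderiv_dil_le hk (by positivity)⟩

theorem exists_isKernel_blockKernel (θ : ℝ) {t : ℝ} (ht : 0 ≤ t) (i : ℕ) :
    ∃ A : ℝ, IsKernel A (blockKernel ζ θ t i : Sp N → ℂ) := by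
  obtain ⟨A, hA, h⟩ := exists_isKernel_ann (N := N) hζ θ Real.pi_pos
    (show Real.pi ≤ 8 * Real.pi by linarith [Real.pi_pos]) 0
  have hk := h (t * ((2 : ℝ) ^ i) ^ θ) (by positivity)
  rw [blockKernel_eq_dil]
  exact ⟨_, hk.dil_of_one_le (one_le_pow₀ one_le_two)⟩

theorem exists_blockKernel_sub_le (θ M : ℝ) (i : ℕ) :
    ∃ A : ℝ, ∀ l ∈ Icc 0 M, ∀ l' ∈ Icc 0 M, IsKernel (A * |l - l'|)
      (fun x : Sp N => blockKernel ζ θ l i x - blockKernel ζ θ l' i x) := by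
  have h2 : Real.pi * ((2 : ℝ) ^ i)⁻¹ ≤ 8 * Real.pi * ((2 : ℝ) ^ i)⁻¹ := by
    gcongr; linarith [Real.pi_pos]
  obtain ⟨h, h1, ⟨c, hc, h3⟩, h4⟩ := exists_temperate_ann (N := N) hζ θ
    (show 0 < Real.pi * ((2 : ℝ) ^ i)⁻¹ by positivity) h2
  obtain ⟨A, hA⟩ := exists_isKernel_block_sub (contDiff_ann hζ (by positivity) (by positivity))
    (hasCompactSupport_ann hζ (by positivity) (by positivity)) h1.1
    (fun ξ hξ => hc.le.trans (h3 ξ hξ)) M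
  refine ⟨A, fun l hl l' hl' => ?_⟩
  have hk := hA l hl l' hl'
  have hint : ∀ l, Integrable fun ξ : Sp N => ((blockSymbol ζ θ l i ξ : ℝ) : ℂ) := fun l =>
    (contDiff_blockSymbol hζ θ l i).continuous.integrable_of_hasCompactSupport
      (hasCompactSupport_blockSymbol hζ θ l i)
  have e : (fun x : Sp N => blockKernel ζ θ l i x - blockKernel ζ θ l' i x) =
      𝓕⁻ fun ξ : Sp N => ((ann ζ (Real.pi * ((2 : ℝ) ^ i)⁻¹) (8 * Real.pi * ((2 : ℝ) ^ i)⁻¹) ξ *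
        (Real.exp (-l * h ξ) - Real.exp (-l' * h ξ)) : ℝ) : ℂ) := by
    ext x
    rw [blockKernel, blockKernel, ← fourierInv_sub_apply (hint l) (hint l')]
    refine congrArg (fun m : Sp N → ℂ => 𝓕⁻ m x) ?_
    ext ξ
    rw [h4 ξ fun r => Real.exp (-l * r) - Real.exp (-l' * r), blockSymbol, blockSymbol]
    push_cast
    ring
  rw [e]
  exact hk

/-- Near t₀ the kernels are Lipschitz in time uniformly in x; together with continuity in x this
gives joint continuity. -/
theorem continuousAt_blockKernel (θ : ℝ) {t₀ : ℝ} (ht : 0 < t₀) (i : ℕ) (z : Sp N) :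
    ContinuousAt (fun w : ℝ × Sp N => blockKernel ζ θ w.1 i w.2) (t₀, z) ∧
    ContinuousAt (fun w : ℝ × Sp N => fderiv ℝ (blockKernel ζ θ w.1 i) w.2) (t₀, z) := by
  obtain ⟨A, hA⟩ := exists_blockKernel_sub_le (N := N) hζ θ (t₀ + 1) i
  have hev : ∀ᶠ t in 𝓝 t₀, t ∈ Icc 0 (t₀ + 1) := Icc_mem_nhds ht (by linarith)
  obtain ⟨B, hB⟩ := exists_isKernel_blockKernel (N := N) hζ θ ht.le i
  have hle : ∀ t x, A * |t - t₀| * wt (x : Sp N) ≤ |A| * |t - t₀| := fun t x => by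
    calc _ ≤ |A| * |t - t₀| * 1 := by
          gcongr
          · exact (wt_pos x).le
          · exact le_abs_self A
          · exact wt_le_one x
      _ = _ := mul_one _
  constructor
  · refine continuousAt_of_lipschitz (K := fun t => blockKernel ζ θ t i) (A := |A|)
      hB.contDiff.continuous ?_ z
    filter_upwards [hev] with t ht' x
    exact ((hA t ht' t₀ ⟨ht.le, by linarith⟩).norm_le x).trans (hle t x)
  · refine continuousAt_of_lipschitz (K := fun t => fderiv ℝ (blockKernel ζ θ t i)) (A := |A|)
      (hB.contDiff.continuous_fderiv one_ne_zero) ?_ z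
    filter_upwards [hev] with t ht' x
    have h1 := (hA t ht' t₀ ⟨ht.le, by linarith⟩).norm_fderiv_le x
    obtain ⟨B', hB'⟩ := exists_isKernel_blockKernel (N := N) hζ θ ht'.1 i
    rw [fderiv_fun_sub (hB'.contDiff.differentiable one_ne_zero x)
      (hB.contDiff.differentiable one_ne_zero x)] at h1
    exact h1.trans (hle t x)

end Block

/-! ### Convolution bounds in Morrey spaces -/

/-- The two linear estimates, M^p_q to itself and M^p_q to L^∞. The values of K lie in an arbitrary
space so as to cover gradients of kernels. -/
theorem exists_conv_le (N : ℕ) (V : Type*) [NormedAddCommGroup V] [NormedSpace ℂ V] {p q : ℝ}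
    (hq : 1 ≤ q) :
    ∃ C : ℝ, 0 < C ∧ ∀ (K : Sp N → V) (f : Sp N → ℂ) (A R m : ℝ), 0 ≤ A → 1 ≤ R → 0 ≤ m →
      (∀ x, ‖K x‖ ≤ A * dwt R x) → Measurable f →
      mor p q (fun x => ‖f x‖ₑ) ≤ ENNReal.ofReal m →
      mor p q (fun x => ‖conv K f x‖ₑ) ≤ ENNReal.ofReal (C * (A * m)) ∧
      ∀ x, ‖conv K f x‖ ≤ C * (A * R ^ ((N : ℝ) / p) * m) := by
  obtain ⟨C, hC, h⟩ := exists_wconv_le N (p := p) hq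
  set W := (wtMass N).toReal with hW
  have hWe : wtMass N = ENNReal.ofReal W := (ENNReal.ofReal_toReal wtMass_lt_top.ne).symm
  have hW0 : 0 ≤ W := ENNReal.toReal_nonneg
  refine ⟨C + W, by positivity, fun K f A R m hA hR hm hK hf hfm => ⟨?_, fun x => ?_⟩⟩
  · calc _ ≤ mor p q (fun x => ENNReal.ofReal A * wconv R (fun y => ‖f y‖ₑ) x) :=
          mor_mono (by linarith) fun x => enorm_conv_le hA hK f x
      _ ≤ ENNReal.ofReal A * mor p q (wconv R fun y => ‖f y‖ₑ) :=
          mor_const_mul_le (by linarith) ENNReal.ofReal_ne_top _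
      _ ≤ ENNReal.ofReal A * (ENNReal.ofReal W * ENNReal.ofReal m) := by
          gcongr
          rw [← hWe]
          exact (mor_wconv_le hq (by linarith) hf.enorm).trans (by gcongr)
      _ = ENNReal.ofReal (A * (W * m)) := by
          rw [ENNReal.ofReal_mul hA, ENNReal.ofReal_mul hW0]
      _ ≤ _ := by
          refine ENNReal.ofReal_le_ofReal ?_
          nlinarith [mul_nonneg hC.le (mul_nonneg hA hm)]
  · have h1 : ‖conv K f x‖ₑ ≤ ENNReal.ofReal (A * (C * R ^ ((N : ℝ) / p) * m)) := by
      refine (enorm_conv_le hA hK f x).trans ?_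
      rw [ENNReal.ofReal_mul hA, ENNReal.ofReal_mul (by positivity), ENNReal.ofReal_mul hC.le]
      gcongr
      exact (h R hR _ hf.enorm x).trans (by gcongr)
    rw [← ofReal_norm, ENNReal.ofReal_le_ofReal_iff (by positivity)] at h1
    refine h1.trans ?_
    have : 0 ≤ W * (A * R ^ ((N : ℝ) / p) * m) := by positivity
    nlinarith

end BesovMorrey

end

noncomputable section

namespace BesovMorrey

open MeasureTheory Set Filter Metric
open scoped ENNReal SchwartzMap FourierTransform Topology ContDiff

variable {N : ℕ}

/-! ### The high-frequency part of the linear evolution -/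

/-- The decay factor of the heat flow at frequency `2 ^ (i + 1)`. -/
def decayFactor (θ : ℝ) (L : ℕ) (t : ℝ) (i : ℕ) : ℝ :=
  ((1 + t * ((2 : ℝ) ^ (i + 1)) ^ θ) ^ L)⁻¹

theorem decayFactor_pos {θ : ℝ} {L : ℕ} {t : ℝ} (ht : 0 ≤ t) (i : ℕ) :
    0 < decayFactor θ L t i := by
  unfold decayFactor; positivity

theorem decayFactor_anti {θ : ℝ} {L : ℕ} {t t' : ℝ} (ht : 0 ≤ t) (h : t ≤ t') (i : ℕ) :
    decayFactor θ L t' i ≤ decayFactor θ L t i := by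
  unfold decayFactor; gcongr

/-- After scaling, the blocks with i ≥ J contribute at most Cδ at every time. The finitely many
others contribute a fixed multiple of t^{α/θ}, small for short times. This is how a limsup condition
controls the evolution. -/
theorem exists_weighted_sum_le {α θ : ℝ} (hα : 0 < α) (hθ : 0 < θ) {L : ℕ} (hL : α < L * θ) :
    ∃ C : ℝ, 0 < C ∧ ∀ (d : ℕ → ℝ) (D δ : ℝ) (J : ℕ), (∀ i, 0 ≤ d i) → (∀ i, d i ≤ D) →
      0 ≤ δ → (∀ i, J ≤ i → d i ≤ δ) → ∀ t : ℝ, 0 < t →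
      Summable (fun i : ℕ => ((2 : ℝ) ^ (i + 1)) ^ α * decayFactor θ L t i * d i) ∧
      t ^ (α / θ) * ∑' i : ℕ, ((2 : ℝ) ^ (i + 1)) ^ α * decayFactor θ L t i * d i ≤
        C * δ + t ^ (α / θ) * (J * ((2 : ℝ) ^ J) ^ α * D) := by
  obtain ⟨C, hC, h⟩ := exists_dyadic_sum_le hα hθ hL
  refine ⟨C, hC, fun d D δ J hd0 hdD hδ hdδ t ht => ?_⟩
  obtain ⟨h1, h2⟩ := h t ht
  have hD : 0 ≤ D := (hd0 0).trans (hdD 0)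
  have hinj : Function.Injective fun i : ℕ => i + 1 := add_left_injective 1
  set w : ℕ → ℝ := fun i => ((2 : ℝ) ^ (i + 1)) ^ α * decayFactor θ L t i with hw
  have hw0 : ∀ i, 0 ≤ w i := fun i => by
    have := decayFactor_pos (θ := θ) (L := L) ht.le i
    positivity
  have hws : Summable w := h1.comp_injective hinj
  have hwC : ∑' i, w i ≤ C * t ^ (-α / θ) :=
    (tsum_comp_le_tsum_of_inj h1 (fun i => by positivity) hinj).trans h2
  -- e bounds the terms with i < J: the decay factor is at most 1 and i + 1 ≤ J, so the weight is at
  -- most (2^J)^α.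
  set e : ℕ → ℝ := fun i => if i ∈ Finset.range J then ((2 : ℝ) ^ J) ^ α * D else 0 with he
  have hes : HasSum e (∑ i ∈ Finset.range J, e i) :=
    hasSum_sum_of_ne_finset_zero fun i hi => if_neg hi
  have hesum : ∑ i ∈ Finset.range J, e i = J * ((2 : ℝ) ^ J) ^ α * D := by
    rw [Finset.sum_congr rfl fun i hi => if_pos hi, Finset.sum_const, Finset.card_range,
      nsmul_eq_mul, mul_assoc]
  have key : ∀ i, w i * d i ≤ w i * δ + e i := by
    intro i
    rcases lt_or_ge i J with hi | hi
    · have : e i = ((2 : ℝ) ^ J) ^ α * D := if_pos (Finset.mem_range.2 hi)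
      rw [this]
      have h3 : w i ≤ ((2 : ℝ) ^ J) ^ α := by
        have h4 : decayFactor θ L t i ≤ 1 := by
          unfold decayFactor
          refine inv_le_one_of_one_le₀ (one_le_pow₀ ?_)
          have : 0 < t * ((2 : ℝ) ^ (i + 1)) ^ θ := by positivity
          linarith
        calc w i ≤ ((2 : ℝ) ^ (i + 1)) ^ α * 1 := by
              simp only [hw]
              gcongr
          _ ≤ _ := by
              rw [mul_one]
              gcongr
              · exact one_le_two
              · omega
      have := mul_nonneg (hw0 i) hδ
      have := mul_le_mul h3 (hdD i) (hd0 i) (by positivity)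
      linarith
    · have : e i = 0 := if_neg (by simpa using hi)
      rw [this, add_zero]
      exact mul_le_mul_of_nonneg_left (hdδ i hi) (hw0 i)
  have hks : Summable fun i => w i * δ + e i := (hws.mul_right δ).add hes.summable
  have hs : Summable fun i => w i * d i :=
    Summable.of_nonneg_of_le (fun i => mul_nonneg (hw0 i) (hd0 i)) key hks
  refine ⟨hs, ?_⟩
  have h5 : ∑' i, w i * d i ≤ C * t ^ (-α / θ) * δ + J * ((2 : ℝ) ^ J) ^ α * D := by
    refine (hs.tsum_le_tsum key hks).trans ?_
    rw [(hws.mul_right δ).tsum_add hes.summable, tsum_mul_right, hes.tsum_eq, hesum]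
    gcongr
  calc _ ≤ t ^ (α / θ) * (C * t ^ (-α / θ) * δ + J * ((2 : ℝ) ^ J) ^ α * D) := by gcongr
    _ = C * (t ^ (α / θ) * t ^ (-α / θ)) * δ + t ^ (α / θ) * (J * ((2 : ℝ) ^ J) ^ α * D) := by
        ring
    _ = _ := by
        rw [← Real.rpow_add ht, neg_div, add_neg_cancel, Real.rpow_zero, mul_one]

theorem mor_tsum_norm_le {V : Type*} [NormedAddCommGroup V] [CompleteSpace V] {p q : ℝ}
    (hq : 1 ≤ q) {F : ℕ → Sp N → V} (hF : ∀ i, Continuous (F i)) {b : ℕ → ℝ} (hb0 : ∀ i, 0 ≤ b i)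
    (hb : Summable b) (h : ∀ i, mor p q (fun x => ‖F i x‖ₑ) ≤ ENNReal.ofReal (b i)) :
    mor p q (fun x => ‖∑' i, F i x‖ₑ) ≤ ENNReal.ofReal (∑' i, b i) := by
  calc _ ≤ mor p q (fun x => ∑' i, ‖F i x‖ₑ) :=
        mor_mono (by linarith) fun x => enorm_tsum_le_tsum_enorm
    _ ≤ ∑' i, mor p q (fun x => ‖F i x‖ₑ) := mor_tsum_le hq fun i => (hF i).enorm.measurable
    _ ≤ ∑' i, ENNReal.ofReal (b i) := ENNReal.tsum_le_tsum h
    _ = _ := (ENNReal.ofReal_tsum_of_nonneg hb0 hb).symm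

/-- The functions `f i` are measurable, with Morrey norm at most `d i * 2 ^ (-s * (i + 1))`. -/
structure IsBlocks (p q s : ℝ) (f : ℕ → Sp N → ℂ) (d : ℕ → ℝ) : Prop where
  measurable : ∀ i, Measurable (f i)
  nonneg : ∀ i, 0 ≤ d i
  mor_le : ∀ i, mor p q (fun x => ‖f i x‖ₑ) ≤
    ENNReal.ofReal (((2 : ℝ) ^ (i + 1)) ^ (-s) * d i)

theorem IsBlocks.tame {p q s : ℝ} {f : ℕ → Sp N → ℂ} {d : ℕ → ℝ} (h : IsBlocks p q s f d)
    (hq : 1 ≤ q) (i : ℕ) : Tame (f i) :=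
  Tame.of_mor (h.measurable i) hq ((h.mor_le i).trans_lt ENNReal.ofReal_lt_top)

/-- The high-frequency part of the linear evolution. -/
def highFun (ζ : ℝ → ℝ) (θ : ℝ) (f : ℕ → Sp N → ℂ) (t : ℝ) (x : Sp N) : ℂ :=
  ∑' i, conv (blockKernel ζ θ t (i + 1)) (f i) x

section High

variable {ζ : ℝ → ℝ} (hζ : IsCutoff ζ)
include hζ

/-- Bounds for the blocks of the linear evolution and their derivatives. -/
theorem exists_block_conv_le {p q s : ℝ} (hq : 1 ≤ q) (θ : ℝ) (L : ℕ) :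
    ∃ C : ℝ, 0 < C ∧ ∀ (f : ℕ → Sp N → ℂ) (d : ℕ → ℝ), IsBlocks p q s f d →
      ∀ t : ℝ, 0 ≤ t → ∀ i,
      (mor p q (fun x => ‖conv (blockKernel ζ θ t (i + 1)) (f i) x‖ₑ) ≤ ENNReal.ofReal
        (C * (((2 : ℝ) ^ (i + 1)) ^ (-s) * decayFactor θ L t i * d i))) ∧
      (∀ x, ‖conv (blockKernel ζ θ t (i + 1)) (f i) x‖ ≤
        C * (((2 : ℝ) ^ (i + 1)) ^ (-s + N / p) * decayFactor θ L t i * d i)) ∧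
      (mor p q (fun x => ‖conv (fderiv ℝ (blockKernel ζ θ t (i + 1))) (f i) x‖ₑ) ≤ ENNReal.ofReal
        (C * (((2 : ℝ) ^ (i + 1)) ^ (1 - s) * decayFactor θ L t i * d i))) ∧
      (∀ x, ‖conv (fderiv ℝ (blockKernel ζ θ t (i + 1))) (f i) x‖ ≤
        C * (((2 : ℝ) ^ (i + 1)) ^ (1 - s + N / p) * decayFactor θ L t i * d i)) := by
  obtain ⟨A, hA, hk⟩ := exists_blockKernel_le (N := N) hζ θ L
  obtain ⟨C₁, hC₁, h₁⟩ := exists_conv_le N ℂ (p := p) hq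
  obtain ⟨C₂, hC₂, h₂⟩ := exists_conv_le N (Sp N →L[ℝ] ℂ) (p := p) hq
  refine ⟨(C₁ + C₂) * A, by positivity, fun f d hf t ht i => ?_⟩
  obtain ⟨-, hk1, hk2⟩ := hk t ht (i + 1)
  have hl := decayFactor_pos (θ := θ) (L := L) ht i
  have hd := hf.nonneg i
  set R : ℝ := 2 ^ (i + 1) with hR
  have hR1 : 1 ≤ R := one_le_pow₀ one_le_two
  have hR0 : 0 < R := by positivity
  change ∀ x, _ ≤ A * decayFactor θ L t i * dwt R x at hk1
  change ∀ x, _ ≤ A * decayFactor θ L t i * R * dwt R x at hk2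
  set l := decayFactor θ L t i with hl'
  obtain ⟨a1, a2⟩ := h₁ _ _ (A * l) R (R ^ (-s) * d i) (by positivity) hR1 (by positivity) hk1
    (hf.measurable i) (hf.mor_le i)
  obtain ⟨a3, a4⟩ := h₂ _ _ (A * l * R) R (R ^ (-s) * d i) (by positivity) hR1 (by positivity)
    hk2 (hf.measurable i) (hf.mor_le i)
  have e1 : R ^ (1 - s) = R * R ^ (-s) := by
    rw [sub_eq_add_neg, Real.rpow_add hR0, Real.rpow_one]
  have e2 : R ^ (-s + N / p) = R ^ (-s) * R ^ ((N : ℝ) / p) := Real.rpow_add hR0 _ _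
  have e3 : R ^ (1 - s + N / p) = R * R ^ (-s) * R ^ ((N : ℝ) / p) := by
    rw [Real.rpow_add hR0, e1]
  refine ⟨a1.trans (ENNReal.ofReal_le_ofReal ?_), fun x => (a2 x).trans ?_,
    a3.trans (ENNReal.ofReal_le_ofReal ?_), fun x => (a4 x).trans ?_⟩
  · have : 0 ≤ C₂ * A * (R ^ (-s) * l * d i) := by positivity
    linarith
  · rw [e2]
    have : 0 ≤ C₂ * A * (R ^ (-s) * R ^ ((N : ℝ) / p) * l * d i) := by positivity
    linarith
  · rw [e1]
    have : 0 ≤ C₁ * A * (R * R ^ (-s) * l * d i) := by positivity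
    linarith
  · rw [e3]
    have : 0 ≤ C₁ * A * (R * R ^ (-s) * R ^ ((N : ℝ) / p) * l * d i) := by positivity
    linarith

theorem continuousOn_block_conv {f : Sp N → ℂ} (hf : Tame f) (θ : ℝ) (i : ℕ) :
    ContinuousOn (fun z : ℝ × Sp N => conv (blockKernel ζ θ z.1 i) f z.2) (Ioi 0 ×ˢ univ) ∧
    ContinuousOn (fun z : ℝ × Sp N => conv (fderiv ℝ (blockKernel ζ θ z.1 i)) f z.2)
      (Ioi 0 ×ˢ univ) := by
  obtain ⟨A, hA, hk⟩ := exists_blockKernel_le (N := N) hζ θ 0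
  have hdw : ∀ x : Sp N, dwt ((2 : ℝ) ^ i) x ≤ ((2 : ℝ) ^ i) ^ N * wt x := fun x => by
    unfold dwt
    gcongr
    exact wt_smul_le_of_one_le (one_le_pow₀ one_le_two) x
  constructor
  · rintro ⟨t, x⟩ ⟨ht, -⟩
    refine ContinuousAt.continuousWithinAt ?_
    refine continuousAt_conv (K := fun t => blockKernel ζ θ t i) hf
      (A := A * ((2 : ℝ) ^ i) ^ N) (by positivity)
      (fun z => (continuousAt_blockKernel hζ θ ht i z).1) ?_ x
    filter_upwards [Ioi_mem_nhds (show (0 : ℝ) < t from ht)] with r hr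
    refine ⟨(hk r (le_of_lt hr) i).1.continuous, fun y => ?_⟩
    refine ((hk r (le_of_lt hr) i).2.1 y).trans ?_
    simp only [pow_zero, inv_one, mul_one]
    rw [mul_assoc]
    exact mul_le_mul_of_nonneg_left (hdw y) hA.le
  · rintro ⟨t, x⟩ ⟨ht, -⟩
    refine ContinuousAt.continuousWithinAt ?_
    refine continuousAt_conv (K := fun t => fderiv ℝ (blockKernel ζ θ t i)) hf
      (A := A * 2 ^ i * ((2 : ℝ) ^ i) ^ N) (by positivity)
      (fun z => (continuousAt_blockKernel hζ θ ht i z).2) ?_ x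
    filter_upwards [Ioi_mem_nhds (show (0 : ℝ) < t from ht)] with r hr
    refine ⟨(hk r (le_of_lt hr) i).1.continuous_fderiv one_ne_zero, fun y => ?_⟩
    refine ((hk r (le_of_lt hr) i).2.2 y).trans ?_
    simp only [pow_zero, inv_one, mul_one]
    rw [mul_assoc (A * 2 ^ i)]
    exact mul_le_mul_of_nonneg_left (hdw y) (by positivity)

/-- Bounds and regularity of the high-frequency part of the linear evolution. -/
theorem exists_highFun_bounds {p q s θ : ℝ} (hq : 1 ≤ q) (hp : 0 < p) (hθ : 0 < θ) (hs : s < 0) :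
    ∃ C : ℝ, 0 < C ∧ ∀ (f : ℕ → Sp N → ℂ) (d : ℕ → ℝ), IsBlocks p q s f d →
      ∀ (D δ : ℝ) (J : ℕ), (∀ i, d i ≤ D) → 0 ≤ δ → (∀ i, J ≤ i → d i ≤ δ) →
      (∀ t : ℝ, 0 < t → ∃ b : ℕ → ℝ, Summable b ∧
        ∀ i x, ‖conv (blockKernel ζ θ t (i + 1)) (f i) x‖ ≤ b i) ∧
      ContinuousOn (fun z : ℝ × Sp N => highFun ζ θ f z.1 z.2) (Ioi 0 ×ˢ univ) ∧
      (∀ t : ℝ, 0 < t → Differentiable ℝ (highFun ζ θ f t)) ∧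
      ContinuousOn (fun z : ℝ × Sp N => fderiv ℝ (highFun ζ θ f z.1) z.2) (Ioi 0 ×ˢ univ) ∧
      (∀ τ : ℝ, 0 < τ → ∃ B : ℝ, ∀ t, τ ≤ t → ∀ x, ‖highFun ζ θ f t x‖ ≤ B) ∧
      ∃ E : ℝ, 0 ≤ E ∧ ∀ t : ℝ, 0 < t → t ≤ 1 →
        ENNReal.ofReal (t ^ (-s / θ)) * mor p q (fun x => ‖highFun ζ θ f t x‖ₑ) ≤
          ENNReal.ofReal (C * δ + t ^ (-s / θ) * E) ∧
        ENNReal.ofReal (t ^ ((1 - s) / θ)) *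
          mor p q (fun x => ‖fderiv ℝ (highFun ζ θ f t) x‖ₑ) ≤
          ENNReal.ofReal (C * δ + t ^ (-s / θ) * E) ∧
        ∀ x, t ^ ((1 - s + N / p) / θ) * ‖fderiv ℝ (highFun ζ θ f t) x‖ ≤
          C * δ + t ^ (-s / θ) * E := by
  have hNp : 0 ≤ (N : ℝ) / p := by positivity
  -- L is chosen for the largest of the exponents -s, -s + N/p, 1 - s and 1 - s + N/p, so one decay
  -- rate serves all four sums.
  obtain ⟨L, hL⟩ := exists_nat_gt ((1 - s + N / p) / θ)
  rw [div_lt_iff₀ hθ] at hL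
  obtain ⟨C₀, hC₀, h₀⟩ := exists_block_conv_le (N := N) (p := p) (s := s) hζ hq θ L
  obtain ⟨C₁, hC₁, h₁⟩ := exists_weighted_sum_le (α := -s) (L := L) (by linarith) hθ (by linarith)
  obtain ⟨C₂, hC₂, h₂⟩ := exists_weighted_sum_le (α := -s + N / p) (L := L) (by linarith) hθ
    (by linarith)
  obtain ⟨C₃, hC₃, h₃⟩ := exists_weighted_sum_le (α := 1 - s) (L := L) (by linarith) hθ
    (by linarith)
  obtain ⟨C₄, hC₄, h₄⟩ := exists_weighted_sum_le (α := 1 - s + N / p) (L := L) (by linarith) hθ hL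
  refine ⟨C₀ * (C₁ + C₃ + C₄), by positivity, fun f d hf D δ J hdD hδ hdδ => ?_⟩
  have hD : 0 ≤ D := (hf.nonneg 0).trans (hdD 0)
  have g₀ := h₀ f d hf
  have g₁ := h₁ d D δ J hf.nonneg hdD hδ hdδ
  have g₂ := h₂ d D δ J hf.nonneg hdD hδ hdδ
  have g₃ := h₃ d D δ J hf.nonneg hdD hδ hdδ
  have g₄ := h₄ d D δ J hf.nonneg hdD hδ hdδ
  -- Term bounds at time τ dominate those at all later times, so the series converge uniformly on
  -- [τ, ∞).
  have hmono : ∀ (α τ t : ℝ), 0 < τ → τ ≤ t → ∀ i,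
      C₀ * (((2 : ℝ) ^ (i + 1)) ^ α * decayFactor θ L t i * d i) ≤
      C₀ * (((2 : ℝ) ^ (i + 1)) ^ α * decayFactor θ L τ i * d i) := fun α τ t hτ hτt i => by
    have := decayFactor_anti (θ := θ) (L := L) hτ.le hτt i
    have := hf.nonneg i
    gcongr
  have hfd : ∀ t : ℝ, 0 < t → ∀ x, HasFDerivAt (highFun ζ θ f t)
      (∑' i, conv (fderiv ℝ (blockKernel ζ θ t (i + 1))) (f i) x) x := fun t ht x => by
    refine hasFDerivAt_tsum (𝕜 := ℝ) ((g₄ t ht).1.mul_left C₀) (fun i y => ?_)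
      (fun i y => (g₀ t ht.le i).2.2.2 y) (x₀ := x)
      (Summable.of_norm_bounded ((g₂ t ht).1.mul_left C₀) fun i => (g₀ t ht.le i).2.1 x) x
    obtain ⟨A, hA⟩ := exists_isKernel_blockKernel (N := N) hζ θ ht.le (i + 1)
    exact hasFDerivAt_conv (hf.tame hq i) hA y
  have hcts : ∀ t : ℝ, 0 < t → ∀ i, Continuous (conv (blockKernel ζ θ t (i + 1)) (f i)) ∧
      Continuous (conv (fderiv ℝ (blockKernel ζ θ t (i + 1))) (f i)) := fun t ht i => by
    obtain ⟨A, hA⟩ := exists_isKernel_blockKernel (N := N) hζ θ ht.le (i + 1)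
    exact ⟨continuous_conv (hf.tame hq i) hA.contDiff.continuous hA.nonneg hA.norm_le,
      continuous_conv (hf.tame hq i) (hA.contDiff.continuous_fderiv one_ne_zero) hA.nonneg
        hA.norm_fderiv_le⟩
  have hloc : ∀ {E : Type} [TopologicalSpace E] (F : ℝ × Sp N → E),
      (∀ τ : ℝ, 0 < τ → ContinuousOn F (Ioi τ ×ˢ univ)) → ContinuousOn F (Ioi 0 ×ˢ univ) := by
    rintro E _ F hF ⟨t, x⟩ ⟨ht, -⟩
    have ht' : (0 : ℝ) < t := ht
    refine ((hF (t / 2) (by positivity)).continuousAt ?_).continuousWithinAt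
    exact prod_mem_nhds (Ioi_mem_nhds (by linarith)) univ_mem
  refine ⟨fun t ht => ⟨_, (g₂ t ht).1.mul_left C₀, fun i x => (g₀ t ht.le i).2.1 x⟩, ?_,
    fun t ht x => (hfd t ht x).differentiableAt, ?_, fun τ hτ => ?_, ?_⟩
  · refine hloc _ fun τ hτ => ?_
    refine continuousOn_tsum (fun i => ((continuousOn_block_conv hζ (hf.tame hq i) θ (i + 1)).1).mono
      (prod_mono (Ioi_subset_Ioi hτ.le) subset_rfl)) ((g₂ τ hτ).1.mul_left C₀) ?_
    rintro i ⟨t, x⟩ ⟨ht, -⟩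
    have ht' : τ < t := ht
    exact ((g₀ t (hτ.trans ht').le i).2.1 x).trans (hmono _ τ t hτ ht'.le i)
  · refine ContinuousOn.congr (f := fun z : ℝ × Sp N =>
      ∑' i, conv (fderiv ℝ (blockKernel ζ θ z.1 (i + 1))) (f i) z.2) ?_
      (fun z hz => (hfd z.1 hz.1 z.2).fderiv)
    refine hloc _ fun τ hτ => ?_
    refine continuousOn_tsum (fun i => ((continuousOn_block_conv hζ (hf.tame hq i) θ (i + 1)).2).mono
      (prod_mono (Ioi_subset_Ioi hτ.le) subset_rfl)) ((g₄ τ hτ).1.mul_left C₀) ?_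
    rintro i ⟨t, x⟩ ⟨ht, -⟩
    have ht' : τ < t := ht
    exact ((g₀ t (hτ.trans ht').le i).2.2.2 x).trans (hmono _ τ t hτ ht'.le i)
  · refine ⟨∑' i, C₀ * (((2 : ℝ) ^ (i + 1)) ^ (-s + N / p) * decayFactor θ L τ i * d i),
      fun t ht x => tsum_of_norm_bounded ((g₂ τ hτ).1.mul_left C₀).hasSum fun i => ?_⟩
    exact ((g₀ t (hτ.le.trans ht) i).2.1 x).trans (hmono _ τ t hτ ht i)
  -- Since t ≤ 1 and -s is the smallest exponent, the low blocks fit into a single term t^{-s/θ} P,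
  -- where P contains the largest power of 2^J.
  · set P : ℝ := J * ((2 : ℝ) ^ J) ^ (1 - s + N / p) * D with hP
    refine ⟨C₀ * P, by positivity, fun t ht ht1 => ?_⟩
    have hP' : ∀ α : ℝ, -s ≤ α → α ≤ 1 - s + N / p →
        t ^ (α / θ) * (J * ((2 : ℝ) ^ J) ^ α * D) ≤ t ^ (-s / θ) * P := fun α hα1 hα2 => by
      rw [hP]
      have e1 : t ^ (α / θ) ≤ t ^ (-s / θ) :=
        Real.rpow_le_rpow_of_exponent_ge ht ht1 (by gcongr)
      have e2 : ((2 : ℝ) ^ J) ^ α ≤ ((2 : ℝ) ^ J) ^ (1 - s + N / p) :=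
        Real.rpow_le_rpow_of_exponent_le (one_le_pow₀ one_le_two) hα2
      gcongr
    have hfin : ∀ (α C' S : ℝ), -s ≤ α → α ≤ 1 - s + N / p → C' ≤ C₁ + C₃ + C₄ →
        t ^ (α / θ) * S ≤ C' * δ + t ^ (α / θ) * (J * ((2 : ℝ) ^ J) ^ α * D) →
        t ^ (α / θ) * (C₀ * S) ≤ C₀ * (C₁ + C₃ + C₄) * δ + t ^ (-s / θ) * (C₀ * P) := by
      intro α C' S hα1 hα2 hC' hS
      have := hP' α hα1 hα2
      have h6 : C' * δ ≤ (C₁ + C₃ + C₄) * δ := by gcongr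
      calc _ = C₀ * (t ^ (α / θ) * S) := by ring
        _ ≤ C₀ * ((C₁ + C₃ + C₄) * δ + t ^ (-s / θ) * P) := by
            gcongr
            linarith
        _ = _ := by ring
    have hnn : ∀ (α : ℝ) (i : ℕ), 0 ≤ C₀ * (((2 : ℝ) ^ (i + 1)) ^ α * decayFactor θ L t i * d i) :=
      fun α i => by
        have := decayFactor_pos (θ := θ) (L := L) ht.le i
        have := hf.nonneg i
        positivity
    refine ⟨?_, ?_, fun x => ?_⟩
    · have := mor_tsum_norm_le (p := p) hq (fun i => (hcts t ht i).1) (hnn (-s))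
        ((g₁ t ht).1.mul_left C₀) (fun i => (g₀ t ht.le i).1)
      refine (mul_le_mul_right this _).trans ?_
      rw [← ENNReal.ofReal_mul (by positivity), tsum_mul_left]
      exact ENNReal.ofReal_le_ofReal (hfin (-s) C₁ _ le_rfl (by linarith) (by linarith) (g₁ t ht).2)
    · have := mor_tsum_norm_le (p := p) hq (fun i => (hcts t ht i).2) (hnn (1 - s))
        ((g₃ t ht).1.mul_left C₀) (fun i => (g₀ t ht.le i).2.2.1)
      simp only [(hfd t ht _).fderiv]
      refine (mul_le_mul_right this _).trans ?_
      rw [← ENNReal.ofReal_mul (by positivity), tsum_mul_left]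
      exact ENNReal.ofReal_le_ofReal (hfin (1 - s) C₃ _ (by linarith) (by linarith) (by linarith)
        (g₃ t ht).2)
    · rw [(hfd t ht x).fderiv]
      have := tsum_of_norm_bounded ((g₄ t ht).1.mul_left C₀).hasSum
        fun i => (g₀ t ht.le i).2.2.2 x
      refine (mul_le_mul_of_nonneg_left this (by positivity)).trans ?_
      rw [tsum_mul_left]
      exact hfin (1 - s + N / p) C₄ _ (by linarith) le_rfl (by linarith) (g₄ t ht).2

end High

end BesovMorrey

end

noncomputable section

namespace BesovMorrey

open MeasureTheory Set Filter Metric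
open scoped ENNReal SchwartzMap FourierTransform Topology ContDiff

variable {N : ℕ}

/-! ### Convolution with the heat kernel -/

theorem dwt_le {R : ℝ} (hR : 0 < R) (x : Sp N) : dwt R x ≤ (R ^ N + R⁻¹) * wt x := by
  have hw := wt_pos x
  unfold dwt
  rcases le_or_gt 1 R with h | h
  · calc _ ≤ R ^ N * wt x := by gcongr; exact wt_smul_le_of_one_le h x
      _ ≤ _ := by
        gcongr
        have : 0 < R⁻¹ := by positivity
        linarith
  · calc _ ≤ R ^ N * ((R ^ (N + 1))⁻¹ * wt x) := by
          gcongr; exact wt_smul_le_of_le_one hR h.le x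
      _ = R⁻¹ * wt x := by
          rw [pow_succ]; field_simp
      _ ≤ _ := by
        gcongr
        have : 0 < R ^ N := by positivity
        linarith

theorem continuousAt_conv_dil {V : Type*} [NormedAddCommGroup V] [NormedSpace ℂ V] {K : Sp N → V}
    (hc : Continuous K) {A : ℝ} (hA : 0 ≤ A) (hK : ∀ x, ‖K x‖ ≤ A * wt x) {f : Sp N → ℂ}
    (hf : Tame f) {R₀ : ℝ} (hR : 0 < R₀) (x₀ : Sp N) :
    ContinuousAt (fun w : ℝ × Sp N => conv (dil w.1 K) f w.2) (R₀, x₀) := by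
  set M : ℝ := (R₀ ^ N + R₀⁻¹) + 1 with hM
  have hM0 : 0 ≤ M := by positivity
  refine continuousAt_conv (K := fun R => dil R K) hf (A := A * M) (by positivity)
    (fun z => ?_) ?_ x₀
  · have : Continuous fun w : ℝ × Sp N => dil w.1 K w.2 := by
      unfold dil
      exact (continuous_fst.pow N).smul (hc.comp (continuous_fst.smul continuous_snd))
    exact this.continuousAt
  · have h1 : ContinuousAt (fun R : ℝ => R ^ N + R⁻¹) R₀ :=
      (continuousAt_id.pow N).add (continuousAt_inv₀ hR.ne')
    filter_upwards [h1.eventually_lt_const (show R₀ ^ N + R₀⁻¹ < M by linarith),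
      Ioi_mem_nhds hR] with R hR1 hR2
    have hR2' : 0 < R := hR2
    refine ⟨(hc.comp (continuous_const_smul R)).const_smul _, fun x => ?_⟩
    refine (norm_dil_le' hK hR2'.le x).trans ?_
    rw [mul_assoc]
    refine mul_le_mul_of_nonneg_left ((dwt_le hR2' x).trans ?_) hA
    exact mul_le_mul_of_nonneg_right hR1.le (wt_pos x).le

section Heat

variable {θ : ℝ} {A : ℝ} (hθ : 0 < θ) (hG : IsKernel A (heatKernel θ 1 : Sp N → ℂ))
include hθ

theorem heatFun_eq_conv_dil {t : ℝ} (ht : 0 < t) (f : Sp N → ℂ) (x : Sp N) :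
    heatFun θ t f x = conv (dil (t ^ (-1 / θ)) (heatKernel θ 1)) f x := by
  rw [heatFun_eq_conv, heatKernel_eq_dil θ hθ.ne' ht]

include hG

theorem isKernel_heatKernel {t : ℝ} (ht : 0 < t) :
    ∃ B : ℝ, IsKernel B (heatKernel θ t : Sp N → ℂ) := by
  rw [heatKernel_eq_dil θ hθ.ne' ht]
  rcases le_or_gt 1 (t ^ (-1 / θ)) with h | h
  · exact ⟨_, hG.dil_of_one_le h⟩
  · exact ⟨_, hG.dil_of_le_one (by positivity) h.le⟩

theorem hasFDerivAt_heatFun {f : Sp N → ℂ} (hf : Tame f) {t : ℝ} (ht : 0 < t) (x : Sp N) :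
    HasFDerivAt (heatFun θ t f)
      (t ^ (-1 / θ) • conv (dil (t ^ (-1 / θ)) (fderiv ℝ (heatKernel θ 1))) f x) x := by
  obtain ⟨B, hB⟩ := isKernel_heatKernel hθ hG ht
  have h := hasFDerivAt_conv hf hB x
  have e : heatFun θ t f = conv (heatKernel θ t) f := funext fun y => heatFun_eq_conv θ t f y
  rw [e]
  refine h.congr_fderiv ?_
  rw [heatKernel_eq_dil θ hθ.ne' ht, fderiv_dil_eq hG.contDiff]
  simp only [conv]
  rw [← integral_smul]
  refine integral_congr_ae (Eventually.of_forall fun y => ?_)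
  exact smul_comm _ _ _

theorem continuousOn_heatFun {f : Sp N → ℂ} (hf : Tame f) :
    ContinuousOn (fun z : ℝ × Sp N => heatFun θ z.1 f z.2) (Ioi 0 ×ˢ univ) ∧
    ContinuousOn (fun z : ℝ × Sp N => fderiv ℝ (heatFun θ z.1 f) z.2) (Ioi 0 ×ˢ univ) := by
  have hp : ∀ t : ℝ, 0 < t → ∀ x : Sp N,
      ContinuousAt (fun z : ℝ × Sp N => (z.1 ^ (-1 / θ), z.2)) (t, x) := fun t ht x => by
    refine ContinuousAt.prodMk ?_ continuousAt_snd
    exact continuousAt_fst.rpow_const (Or.inl ht.ne')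
  constructor
  · refine ContinuousOn.congr (f := fun z : ℝ × Sp N =>
      conv (dil (z.1 ^ (-1 / θ)) (heatKernel θ 1)) f z.2) ?_
      (fun z hz => heatFun_eq_conv_dil hθ hz.1 f z.2)
    rintro ⟨t, x⟩ ⟨ht, -⟩
    have ht' : 0 < t := ht
    refine ContinuousAt.continuousWithinAt ?_
    exact ContinuousAt.comp (f := fun z : ℝ × Sp N => (z.1 ^ (-1 / θ), z.2))
      (g := fun w : ℝ × Sp N => conv (dil w.1 (heatKernel θ 1)) f w.2)
      (continuousAt_conv_dil hG.contDiff.continuous hG.nonneg hG.norm_le hf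
        (Real.rpow_pos_of_pos ht' _) x) (hp t ht' x)
  · refine ContinuousOn.congr (f := fun z : ℝ × Sp N => z.1 ^ (-1 / θ) •
      conv (dil (z.1 ^ (-1 / θ)) (fderiv ℝ (heatKernel θ 1))) f z.2) ?_
      (fun z hz => (hasFDerivAt_heatFun hθ hG hf hz.1 z.2).fderiv)
    rintro ⟨t, x⟩ ⟨ht, -⟩
    have ht' : 0 < t := ht
    refine ContinuousAt.continuousWithinAt ?_
    refine ContinuousAt.smul (f := fun z : ℝ × Sp N => z.1 ^ (-1 / θ))
      (continuousAt_fst.rpow_const (Or.inl ht'.ne')) ?_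
    exact ContinuousAt.comp (f := fun z : ℝ × Sp N => (z.1 ^ (-1 / θ), z.2))
      (g := fun w : ℝ × Sp N => conv (dil w.1 (fderiv ℝ (heatKernel θ 1))) f w.2)
      (continuousAt_conv_dil (hG.contDiff.continuous_fderiv one_ne_zero) hG.nonneg
        hG.norm_fderiv_le hf (Real.rpow_pos_of_pos ht' _) x) (hp t ht' x)

/-- The low-frequency part of the datum lies in M^p_q itself, which is better than regularity s < 0.
All the weighted norms therefore gain the vanishing factor t^{-s/θ}. -/
theorem exists_heatFun_le {p q s : ℝ} (hq : 1 ≤ q) (hp : 0 < p) :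
    ∃ C : ℝ, 0 < C ∧ ∀ (f : Sp N → ℂ) (m : ℝ), 0 ≤ m → Measurable f →
      mor p q (fun x => ‖f x‖ₑ) ≤ ENNReal.ofReal m →
      (∀ τ : ℝ, 0 < τ → ∃ B : ℝ, ∀ t, τ ≤ t → t ≤ 1 → ∀ x, ‖heatFun θ t f x‖ ≤ B) ∧
      ∀ t : ℝ, 0 < t → t ≤ 1 →
        ENNReal.ofReal (t ^ (-s / θ)) * mor p q (fun x => ‖heatFun θ t f x‖ₑ) ≤
          ENNReal.ofReal (t ^ (-s / θ) * (C * m)) ∧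
        ENNReal.ofReal (t ^ ((1 - s) / θ)) * mor p q (fun x => ‖fderiv ℝ (heatFun θ t f) x‖ₑ) ≤
          ENNReal.ofReal (t ^ (-s / θ) * (C * m)) ∧
        ∀ x, t ^ ((1 - s + N / p) / θ) * ‖fderiv ℝ (heatFun θ t f) x‖ ≤
          t ^ (-s / θ) * (C * m) := by
  obtain ⟨C₁, hC₁, h₁⟩ := exists_conv_le N ℂ (p := p) hq
  obtain ⟨C₂, hC₂, h₂⟩ := exists_conv_le N (Sp N →L[ℝ] ℂ) (p := p) hq
  have hA := hG.nonneg
  refine ⟨(C₁ + C₂) * (A + 1), by positivity, fun f m hm hfm hf => ?_⟩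
  have htame : Tame f := Tame.of_mor hfm hq (hf.trans_lt ENNReal.ofReal_lt_top)
  have hR1 : ∀ t : ℝ, 0 < t → t ≤ 1 → 1 ≤ t ^ (-1 / θ) := fun t ht ht1 =>
    Real.one_le_rpow_of_pos_of_le_one_of_nonpos ht ht1
      (div_nonpos_of_nonpos_of_nonneg (by norm_num) hθ.le)
  have g₁ := fun (t : ℝ) (ht : 0 < t) (ht1 : t ≤ 1) =>
    h₁ (dil (t ^ (-1 / θ)) (heatKernel θ 1)) f A (t ^ (-1 / θ)) m hA (hR1 t ht ht1) hm
      (norm_dil_le' hG.norm_le (by positivity)) hfm hf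
  have g₂ := fun (t : ℝ) (ht : 0 < t) (ht1 : t ≤ 1) =>
    h₂ (t ^ (-1 / θ) • dil (t ^ (-1 / θ)) (fderiv ℝ (heatKernel θ 1))) f (A * t ^ (-1 / θ))
      (t ^ (-1 / θ)) m (by positivity) (hR1 t ht ht1) hm
      (fun x => by
        rw [Pi.smul_apply, norm_smul, Real.norm_of_nonneg (by positivity), mul_comm A, mul_assoc]
        gcongr
        exact norm_dil_le' hG.norm_fderiv_le (by positivity) x) hfm hf
  have e₂ : ∀ (t : ℝ), 0 < t → ∀ x, fderiv ℝ (heatFun θ t f) x =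
      conv (t ^ (-1 / θ) • dil (t ^ (-1 / θ)) (fderiv ℝ (heatKernel θ 1))) f x :=
    fun t ht x => by
      rw [(hasFDerivAt_heatFun hθ hG htame ht x).fderiv, conv, conv, ← integral_smul]
      exact integral_congr_ae (Eventually.of_forall fun y => smul_comm _ _ _)
  have c₁ : C₁ * (A * m) ≤ (C₁ + C₂) * (A + 1) * m := by
    rw [← mul_assoc]; gcongr <;> linarith
  have c₂ : C₂ * (A * m) ≤ (C₁ + C₂) * (A + 1) * m := by
    rw [← mul_assoc]; gcongr <;> linarith
  refine ⟨fun τ hτ => ⟨C₁ * (A * (τ ^ (-1 / θ)) ^ ((N : ℝ) / p) * m), fun t ht ht1 x => ?_⟩,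
    fun t ht ht1 => ⟨?_, ?_, fun x => ?_⟩⟩
  · have ht0 := hτ.trans_le ht
    rw [heatFun_eq_conv_dil hθ ht0]
    refine ((g₁ t ht0 ht1).2 x).trans ?_
    have : t ^ (-1 / θ) ≤ τ ^ (-1 / θ) := Real.rpow_le_rpow_of_nonpos hτ ht
      (div_nonpos_of_nonpos_of_nonneg (by norm_num) hθ.le)
    gcongr
  · simp only [heatFun_eq_conv_dil hθ ht]
    rw [ENNReal.ofReal_mul (by positivity)]
    gcongr
    exact (g₁ t ht ht1).1.trans (ENNReal.ofReal_le_ofReal c₁)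
  · simp only [e₂ t ht]
    refine (mul_le_mul_right (g₂ t ht ht1).1 _).trans ?_
    rw [← ENNReal.ofReal_mul (by positivity)]
    refine ENNReal.ofReal_le_ofReal ?_
    calc _ = (t ^ ((1 - s) / θ) * t ^ (-1 / θ)) * (C₂ * (A * m)) := by ring
      _ = t ^ (-s / θ) * (C₂ * (A * m)) := by
        rw [← Real.rpow_add ht]
        congr 2
        ring
      _ ≤ _ := by gcongr
  · rw [e₂ t ht]
    refine (mul_le_mul_of_nonneg_left ((g₂ t ht ht1).2 x) (by positivity)).trans ?_
    calc _ = (t ^ ((1 - s + N / p) / θ) * t ^ (-1 / θ) * (t ^ (-1 / θ)) ^ ((N : ℝ) / p)) *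
          (C₂ * (A * m)) := by ring
      _ = t ^ (-s / θ) * (C₂ * (A * m)) := by
        rw [← Real.rpow_mul ht.le, ← Real.rpow_add ht, ← Real.rpow_add ht]
        congr 2
        field_simp
        ring
      _ ≤ _ := by gcongr

end Heat

/-! ### Uniqueness and reality of the linear evolution -/

theorem heatFun_congr_ae {θ t : ℝ} {f g : Sp N → ℂ} (h : f =ᵐ[volume] g) :
    heatFun θ t f = heatFun θ t g := by
  ext x
  rw [heatFun_eq_conv, heatFun_eq_conv, conv_congr_ae _ h]

/-- Representing functions are unique almost everywhere and the evolution is continuous, so the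
choice of f₀ leaves no freedom. -/
theorem IsHeatEvolution.unique {ζ : ℝ → ℝ} {θ t : ℝ} {φ : 𝓢'(Sp N, ℂ)} {g g' : Sp N → ℂ}
    (h : IsHeatEvolution ζ θ t φ g) (h' : IsHeatEvolution ζ θ t φ g') : g = g' := by
  obtain ⟨hc, f, hf, -, hr⟩ := h
  obtain ⟨hc', f', hf', -, hr'⟩ := h'
  rw [heatFun_congr_ae (hf.ae_eq hf')] at hr
  rw [← Continuous.ae_eq_iff_eq volume hc hc']
  filter_upwards [hr.ae_eq hr'] with x hx
  simpa using hx

/-- Both multipliers in the splitting are real and even, and the heat kernel is real. -/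
theorem IsHeatEvolution.im_eq_zero {ζ : ℝ → ℝ} (hζ : IsCutoff ζ) {θ t : ℝ} (ht : 0 ≤ t)
    {φ : 𝓢'(Sp N, ℂ)} {g : Sp N → ℂ} (h : IsHeatEvolution ζ θ t φ g) (hφ : IsRealDist φ)
    (x : Sp N) : (g x).im = 0 := by
  obtain ⟨hc, f, hf, -, hr⟩ := h
  have h1 : IsRealDist (multiplier (lowSymbol ζ) φ) := by
    simp only [multiplier, lowSymbol_two_pi_smul]
    exact hφ.fourierMultiplier (hasTemperateGrowth_cut hζ (by positivity))
      fun ξ => by simp [cut]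
  have h2 : IsRealDist (multiplier (fun ξ => (1 - lowSymbol ζ ξ) * heatSymbol θ t ξ) φ) := by
    simp only [multiplier, lowSymbol_two_pi_smul, heatSymbol_two_pi_smul]
    exact hφ.fourierMultiplier (hasTemperateGrowth_highSymbol hζ θ ht)
      fun ξ => by simp [cut, nrm]
  have h3 := hr.im_ae_eq_zero h2
  have h4 : (fun x => (g x).im) =ᵐ[volume] fun _ => 0 := by
    filter_upwards [h3] with y hy
    rw [heatFun_eq_conv, Complex.sub_im,
      conv_im (heatKernel_im θ t) (hf.im_ae_eq_zero h1), sub_zero] at hy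
    exact hy
  exact congrFun ((Continuous.ae_eq_iff_eq volume (Complex.continuous_im.comp hc)
    continuous_const).1 h4) x

/-! ### Functions representing the Littlewood–Paley blocks -/

/-- The norm of a distribution is an infimum, hence the strict inequality for picking a
representative, which is then replaced by a measurable version. -/
theorem exists_represents_of_lt {p q : ℝ} (hq : 0 < q) {v : 𝓢'(Sp N, ℂ)} {B : ℝ≥0∞}
    (h : distMorreyNorm p q v < B) :
    ∃ f : Sp N → ℂ, Measurable f ∧ Represents v f ∧ mor p q (fun x => ‖f x‖ₑ) ≤ B := by
  simp only [distMorreyNorm, iInf_lt_iff] at h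
  obtain ⟨f, hf, hr, hlt⟩ := h
  refine ⟨hf.mk f, hf.stronglyMeasurable_mk.measurable, hr.congr hf.ae_eq_mk, ?_⟩
  rw [morreyNorm_eq_mor hq] at hlt
  refine le_of_eq_of_le (mor_congr_ae ?_) hlt.le
  filter_upwards [hf.ae_eq_mk] with x hx
  rw [hx]

theorem exists_represents_of_weightedBlock_lt {ζ : ℝ → ℝ} {p q s : ℝ} (hq : 0 < q)
    {φ : 𝓢'(Sp N, ℂ)} {j : ℕ} {e : ℝ} (h : weightedBlock ζ p q s φ j < ENNReal.ofReal e) :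
    ∃ f : Sp N → ℂ, Measurable f ∧ Represents (multiplier (dyadicSymbol ζ (j : ℤ)) φ) f ∧
      mor p q (fun x => ‖f x‖ₑ) ≤ ENNReal.ofReal (((2 : ℝ) ^ j) ^ (-s) * e) := by
  refine exists_represents_of_lt hq ?_
  have e1 : (2 : ℝ) ^ (s * j) = ((2 : ℝ) ^ j) ^ s := by
    rw [mul_comm, Real.rpow_mul two_pos.le, Real.rpow_natCast]
  have hR : (0 : ℝ) < 2 ^ j := by positivity
  rw [weightedBlock, e1] at h
  have hpos : 0 < ((2 : ℝ) ^ j) ^ s := by positivity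
  rw [Real.rpow_neg hR.le, ENNReal.ofReal_mul (by positivity), ENNReal.ofReal_inv_of_pos hpos,
    mul_comm, ← div_eq_mul_inv]
  rw [ENNReal.lt_div_iff_mul_lt (Or.inl (by simpa using hpos)) (Or.inl ENNReal.ofReal_ne_top),
    mul_comm]
  exact h

theorem exists_blocks {ζ : ℝ → ℝ} {p q s δ : ℝ} (hq : 0 < q) (hδ : 0 < δ) {φ : 𝓢'(Sp N, ℂ)}
    (hφ : MemBesovMorrey ζ p q s φ)
    (hlim : limsup (fun j : ℕ => weightedBlock ζ p q s φ j) atTop < ENNReal.ofReal δ) :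
    ∃ (f₀ : Sp N → ℂ) (m : ℝ) (f : ℕ → Sp N → ℂ) (d : ℕ → ℝ) (D : ℝ) (J : ℕ),
      Measurable f₀ ∧ 0 ≤ m ∧ mor p q (fun x => ‖f₀ x‖ₑ) ≤ ENNReal.ofReal m ∧
      Represents (multiplier (lowSymbol ζ) φ) f₀ ∧ IsBlocks p q s f d ∧
      (∀ i : ℕ, Represents (multiplier (dyadicSymbol ζ ((i + 1 : ℕ) : ℤ)) φ) (f i)) ∧
      (∀ i, d i ≤ D) ∧ ∀ i, J ≤ i → d i ≤ δ := by
  rw [MemBesovMorrey, besovMorreyNorm, ENNReal.add_lt_top] at hφ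
  obtain ⟨f₀, h1, h2, h3⟩ := exists_represents_of_lt hq
    (ENNReal.lt_add_right hφ.1.ne one_ne_zero)
  set S := ⨆ (j : ℕ) (_ : 1 ≤ j), weightedBlock ζ p q s φ j with hS
  have hev := eventually_lt_of_limsup_lt hlim
  obtain ⟨J, hJ⟩ := eventually_atTop.1 hev
  classical
  -- From J on the limsup hypothesis provides δ. Before J only the supremum S is available; 1 is
  -- added to obtain the strict inequality that selects a representative.
  set d : ℕ → ℝ := fun i => if J ≤ i then δ else S.toReal + 1 with hd
  have hblock : ∀ i, weightedBlock ζ p q s φ (i + 1) < ENNReal.ofReal (d i) := fun i => by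
    by_cases hi : J ≤ i
    · simp only [hd, if_pos hi]
      exact hJ _ (by omega)
    · simp only [hd, if_neg hi]
      rw [ENNReal.ofReal_add ENNReal.toReal_nonneg zero_le_one, ENNReal.ofReal_toReal hφ.2.ne]
      refine lt_of_le_of_lt ?_ (ENNReal.lt_add_right hφ.2.ne (by simp))
      exact le_iSup₂ (f := fun (j : ℕ) (_ : 1 ≤ j) => weightedBlock ζ p q s φ j) (i + 1) (by omega)
  choose f hf1 hf2 hf3 using fun i => exists_represents_of_weightedBlock_lt hq (hblock i)
  refine ⟨f₀, _, f, d, max δ (S.toReal + 1), J, h1, ENNReal.toReal_nonneg,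
    h3.trans (ENNReal.ofReal_toReal (ENNReal.add_lt_top.2 ⟨hφ.1, ENNReal.one_lt_top⟩).ne).ge, h2,
    ⟨hf1, fun i => ?_, hf3⟩, hf2, fun i => ?_, fun i hi => ?_⟩
  · simp only [hd]
    split_ifs
    · exact hδ.le
    · have : 0 ≤ S.toReal := ENNReal.toReal_nonneg
      linarith
  · simp only [hd]
    split_ifs
    · exact le_max_left _ _
    · exact le_max_right _ _
  · simp only [hd, if_pos hi]
    exact le_rfl

end BesovMorrey

end

noncomputable section

namespace BesovMorrey

open MeasureTheory Set Filter Metric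
open scoped ENNReal SchwartzMap FourierTransform Topology ContDiff

variable {N : ℕ}

/-! ### The linear evolution -/

theorem exists_rpow_mul_le {r E δ : ℝ} (hr : 0 < r) (hE : 0 ≤ E) (hδ : 0 < δ) :
    ∃ T : ℝ, 0 < T ∧ T ≤ 1 ∧ ∀ t : ℝ, 0 < t → t ≤ T → t ^ r * E ≤ δ := by
  refine ⟨min 1 ((δ / (E + 1)) ^ (1 / r)), lt_min one_pos (by positivity), min_le_left _ _,
    fun t ht htT => ?_⟩
  have h1 : t ^ r ≤ δ / (E + 1) := by
    calc t ^ r ≤ ((δ / (E + 1)) ^ (1 / r)) ^ r := by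
          gcongr
          exact htT.trans (min_le_right _ _)
      _ = _ := by
          rw [← Real.rpow_mul (by positivity), one_div_mul_cancel hr.ne', Real.rpow_one]
  calc t ^ r * E ≤ δ / (E + 1) * E := by gcongr
    _ ≤ δ / (E + 1) * (E + 1) := by gcongr; linarith
    _ = δ := div_mul_cancel₀ _ (by positivity)

/-- The linear evolution `g` of `φ` is smooth for positive times and its weighted norms are
at most `η` on `(0, T)`. -/
structure IsLinearEvolution (ζ : ℝ → ℝ) (θ p q s T η : ℝ) (φ : 𝓢'(Sp N, ℂ))
    (g : ℝ → Sp N → ℂ) : Prop where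
  evolution : ∀ t : ℝ, 0 < t → IsHeatEvolution ζ θ t φ (g t)
  continuousOn : ContinuousOn (fun z : ℝ × Sp N => g z.1 z.2) (Ioi 0 ×ˢ univ)
  differentiable : ∀ t : ℝ, 0 < t → Differentiable ℝ (g t)
  continuousOn_fderiv : ContinuousOn (fun z : ℝ × Sp N => fderiv ℝ (g z.1) z.2) (Ioi 0 ×ˢ univ)
  bounded : ∀ τ : ℝ, 0 < τ → ∃ B : ℝ, ∀ t, τ ≤ t → t ≤ 1 → ∀ x, ‖g t x‖ ≤ B
  mor_le : ∀ t : ℝ, 0 < t → t ≤ T →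
    ENNReal.ofReal (t ^ (-s / θ)) * mor p q (fun x => ‖g t x‖ₑ) ≤ ENNReal.ofReal η
  mor_fderiv_le : ∀ t : ℝ, 0 < t → t ≤ T → ENNReal.ofReal (t ^ ((1 - s) / θ)) *
    mor p q (fun x => ‖fderiv ℝ (g t) x‖ₑ) ≤ ENNReal.ofReal η
  norm_fderiv_le : ∀ t : ℝ, 0 < t → t ≤ T → ∀ x,
    t ^ ((1 - s + N / p) / θ) * ‖fderiv ℝ (g t) x‖ ≤ η

theorem mor_norm_add_le {V : Type*} [NormedAddCommGroup V] {p q : ℝ} (hq : 1 ≤ q)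
    {f g : Sp N → V} (hf : Continuous f) (hg : Continuous g) :
    mor p q (fun x => ‖f x + g x‖ₑ) ≤ mor p q (fun x => ‖f x‖ₑ) + mor p q (fun x => ‖g x‖ₑ) :=
  (mor_mono (by linarith) fun x => enorm_add_le (f x) (g x)).trans
    (mor_add_le hq hf.enorm.measurable hg.enorm.measurable)

theorem continuous_slice {E : Type*} [TopologicalSpace E] {F : ℝ → Sp N → E} {s : Set ℝ}
    (h : ContinuousOn (fun z : ℝ × Sp N => F z.1 z.2) (s ×ˢ univ)) {t : ℝ} (ht : t ∈ s) :
    Continuous (F t) :=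
  h.comp_continuous (f := fun x : Sp N => (t, x)) (by fun_prop) fun x => ⟨ht, mem_univ _⟩

/-- The high blocks give C₁δ. Every other contribution carries t^{-s/θ} and is brought below δ by
the choice of T, hence the constant C₁ + 1. Only T depends on φ. -/
theorem exists_linearEvolution (N : ℕ) {ζ : ℝ → ℝ} (hζ : IsCutoff ζ) {θ p q s : ℝ} (hθ : 1 < θ)
    (hq : 1 ≤ q) (hp : 0 < p) (hs : s < 0) :
    ∃ C : ℝ, 0 < C ∧ ∀ δ : ℝ, 0 < δ → ∀ φ : 𝓢'(Sp N, ℂ), MemBesovMorrey ζ p q s φ →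
      limsup (fun j : ℕ => weightedBlock ζ p q s φ j) atTop < ENNReal.ofReal δ →
      ∃ T : ℝ, 0 < T ∧ T ≤ 1 ∧ ∃ g : ℝ → Sp N → ℂ,
        IsLinearEvolution ζ θ p q s T (C * δ) φ g := by
  have hθ0 : 0 < θ := by linarith
  obtain ⟨A, hA, hG⟩ := exists_isKernel_heatKernel (N := N) hζ hθ
  obtain ⟨C₁, hC₁, h₁⟩ := exists_highFun_bounds (N := N) hζ hq hp hθ0 hs
  obtain ⟨C₂, hC₂, h₂⟩ := exists_heatFun_le (N := N) (s := s) hθ0 hG hq hp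
  refine ⟨C₁ + 1, by positivity, fun δ hδ φ hφ hlim => ?_⟩
  obtain ⟨f₀, m, f, d, D, J, hf₀, hm, hf₀m, hrep₀, hf, hrep, hdD, hdδ⟩ :=
    exists_blocks (by linarith) hδ hφ hlim
  obtain ⟨k1, k2, k3, k4, k5, E, hE, k6⟩ := h₁ f d hf D δ J hdD hδ.le hdδ
  obtain ⟨l1, l2⟩ := h₂ f₀ m hm hf₀ hf₀m
  have htame : Tame f₀ := Tame.of_mor hf₀ hq (hf₀m.trans_lt ENNReal.ofReal_lt_top)
  obtain ⟨l3, l4⟩ := continuousOn_heatFun hθ0 hG htame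
  have hlow : ∀ t : ℝ, 0 < t → Differentiable ℝ (heatFun θ t f₀) := fun t ht x =>
    (hasFDerivAt_heatFun hθ0 hG htame ht x).differentiableAt
  obtain ⟨T, hT, hT1, hTE⟩ := exists_rpow_mul_le (r := -s / θ) (E := C₂ * m + E)
    (div_pos (by linarith) hθ0) (by positivity) hδ
  set g : ℝ → Sp N → ℂ := fun t x => heatFun θ t f₀ x + highFun ζ θ f t x with hg
  have hfd : ∀ t : ℝ, 0 < t → ∀ x, fderiv ℝ (g t) x =
      fderiv ℝ (heatFun θ t f₀) x + fderiv ℝ (highFun ζ θ f t) x := fun t ht x =>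
    fderiv_fun_add (hlow t ht x) (k3 t ht x)
  have hcont : ContinuousOn (fun z : ℝ × Sp N => g z.1 z.2) (Ioi 0 ×ˢ univ) := l3.add k2
  have hfin : ∀ t : ℝ, 0 < t → t ≤ T →
      t ^ (-s / θ) * (C₂ * m) + (C₁ * δ + t ^ (-s / θ) * E) ≤ (C₁ + 1) * δ := fun t ht htT => by
    have := hTE t ht htT
    linarith
  refine ⟨T, hT, hT1, g, fun t ht => ?_, hcont, fun t ht => (hlow t ht).add (k3 t ht), ?_,
    fun τ hτ => ?_, fun t ht htT => ?_, fun t ht htT => ?_, fun t ht htT x => ?_⟩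
  · obtain ⟨B, hB⟩ := isKernel_heatKernel hθ0 hG ht
    obtain ⟨b, hb, hle⟩ := k1 t ht
    refine ⟨continuous_slice hcont (mem_Ioi.2 ht), f₀, hrep₀, fun x => ?_, ?_⟩
    · have := htame.integrable_conv hB.contDiff.continuous hB.norm_le x
      simpa only [smul_eq_mul, mul_comm] using this
    · choose K hK using fun i : ℕ => exists_isKernel_blockKernel (N := N) hζ θ ht.le (i + 1)
      have := represents_highSymbol hζ ht.le (fun i => hf.tame hq i) hrep hK hb hle
      simp only [hg, add_sub_cancel_left]
      exact this
  · exact (l4.add k4).congr fun z hz => hfd z.1 hz.1 z.2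
  · obtain ⟨B₁, hB₁⟩ := l1 τ hτ
    obtain ⟨B₂, hB₂⟩ := k5 τ hτ
    exact ⟨B₁ + B₂, fun t ht ht1 x =>
      (norm_add_le _ _).trans (add_le_add (hB₁ t ht ht1 x) (hB₂ t ht x))⟩
  · have := mor_norm_add_le (p := p) hq (continuous_slice (F := fun t => heatFun θ t f₀) l3
      (mem_Ioi.2 ht)) (continuous_slice (F := highFun ζ θ f) k2 (mem_Ioi.2 ht))
    refine (mul_le_mul_right this _).trans ?_
    rw [mul_add]
    refine (add_le_add (l2 t ht (htT.trans hT1)).1 (k6 t ht (htT.trans hT1)).1).trans ?_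
    rw [← ENNReal.ofReal_add (by positivity) (by positivity)]
    exact ENNReal.ofReal_le_ofReal (hfin t ht htT)
  · have := mor_norm_add_le (p := p) hq (continuous_slice (F := fun t => fderiv ℝ (heatFun θ t f₀)) l4
      (mem_Ioi.2 ht)) (continuous_slice (F := fun t => fderiv ℝ (highFun ζ θ f t)) k4
      (mem_Ioi.2 ht))
    simp only [hfd t ht]
    refine (mul_le_mul_right this _).trans ?_
    rw [mul_add]
    refine (add_le_add (l2 t ht (htT.trans hT1)).2.1 (k6 t ht (htT.trans hT1)).2.1).trans ?_
    rw [← ENNReal.ofReal_add (by positivity) (by positivity)]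
    exact ENNReal.ofReal_le_ofReal (hfin t ht htT)
  · rw [hfd t ht]
    refine (mul_le_mul_of_nonneg_left (norm_add_le _ _) (by positivity)).trans ?_
    rw [mul_add]
    exact (add_le_add ((l2 t ht (htT.trans hT1)).2.2 x) ((k6 t ht (htT.trans hT1)).2.2 x)).trans
      (hfin t ht htT)

end BesovMorrey

end

noncomputable section

namespace BesovMorrey

open MeasureTheory Set Filter Metric
open scoped ENNReal SchwartzMap FourierTransform Topology ContDiff

variable {N : ℕ} {V : Type*} [NormedAddCommGroup V] [NormedSpace ℂ V]

/-! ### The Duhamel integrand -/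

/-- Continuous functions on `(0, T) × ℝ^N`, bounded away from `t = 0`, whose Morrey norm is at most
`M * t ^ (-β)`. -/
structure IsForcing {E : Type*} [NormedAddCommGroup E] (p q β T M : ℝ) (F : ℝ → Sp N → E) :
    Prop where
  nonneg : 0 ≤ M
  continuousOn : ContinuousOn (fun z : ℝ × Sp N => F z.1 z.2) (Ioo 0 T ×ˢ univ)
  bounded : ∀ τ : ℝ, 0 < τ → ∃ B : ℝ, 0 ≤ B ∧ ∀ t ∈ Ioo τ T, ∀ x, ‖F t x‖ ≤ B
  mor_le : ∀ t ∈ Ioo 0 T, mor p q (fun x => ‖F t x‖ₑ) ≤ ENNReal.ofReal (M * t ^ (-β))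

theorem IsForcing.continuous {E : Type*} [NormedAddCommGroup E] {p q β T M : ℝ}
    {F : ℝ → Sp N → E} (h : IsForcing p q β T M F)
    {t : ℝ} (ht : t ∈ Ioo 0 T) : Continuous (F t) :=
  continuous_slice h.continuousOn ht

theorem IsForcing.tame {p q β T M : ℝ} {F : ℝ → Sp N → ℂ} (h : IsForcing p q β T M F) {t : ℝ}
    (ht : t ∈ Ioo 0 T) : Tame (F t) := by
  obtain ⟨B, -, hB⟩ := h.bounded (t / 2) (half_pos ht.1)
  exact Tame.of_bounded (h.continuous ht).aestronglyMeasurable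
    (hB t ⟨by linarith [ht.1], ht.2⟩)

theorem norm_conv_dil_le_of_bounded {k : Sp N → V} {A : ℝ} (hA : 0 ≤ A)
    (hk : ∀ x, ‖k x‖ ≤ A * wt x) {R : ℝ} (hR : 0 < R) {f : Sp N → ℂ} {B : ℝ} (hB : 0 ≤ B)
    (hf : ∀ x, ‖f x‖ ≤ B) (x : Sp N) :
    ‖conv (dil R k) f x‖ ≤ A * (wtMass N).toReal * B := by
  have h1 : ‖conv (dil R k) f x‖ₑ ≤ ENNReal.ofReal (A * (wtMass N).toReal * B) := by
    refine (enorm_conv_le hA (norm_dil_le' hk hR.le) f x).trans ?_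
    rw [ENNReal.ofReal_mul (by positivity), ENNReal.ofReal_mul hA,
      ENNReal.ofReal_toReal wtMass_lt_top.ne, mul_assoc]
    gcongr
    refine wconv_const_le hR (fun y => ?_) x
    rw [← ofReal_norm]
    exact ENNReal.ofReal_le_ofReal (hf y)
  rwa [← ofReal_norm, ENNReal.ofReal_le_ofReal_iff (by positivity)] at h1

/-- Smoothing bounds for the convolution with a dilated kernel. -/
theorem exists_conv_dil_le {k : Sp N → V} {A : ℝ} (hA : 0 ≤ A) (hk : ∀ x, ‖k x‖ ≤ A * wt x)
    {θ γ p q : ℝ} (hθ : 0 < θ) (hγ : 1 < γ) (hq : γ ≤ q) (hp : 0 < p) :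
    ∃ C : ℝ, 0 < C ∧ ∀ (r : ℝ) (f : Sp N → ℂ), 0 < r →
      (∀ B : ℝ, 0 ≤ B → (∀ x, ‖f x‖ ≤ B) →
        ∀ x, ‖conv (dil (r ^ (-1 / θ)) k) f x‖ ≤ C * B) ∧
      (r ≤ 1 → Measurable f → ∀ m : ℝ, 0 ≤ m →
        mor (p / γ) (q / γ) (fun x => ‖f x‖ₑ) ≤ ENNReal.ofReal m →
        (∀ x, ‖conv (dil (r ^ (-1 / θ)) k) f x‖ ≤ C * (r ^ (-(N * γ / (p * θ))) * m)) ∧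
        mor p q (fun x => ‖conv (dil (r ^ (-1 / θ)) k) f x‖ₑ) ≤
          ENNReal.ofReal (C * (r ^ (-(N * (γ - 1) / (p * θ))) * m))) := by
  have hγ0 : 0 < γ := by linarith
  obtain ⟨C₁, hC₁, h₁⟩ := exists_wconv_le N (p := p / γ) (q := q / γ) (by rwa [one_le_div hγ0])
  obtain ⟨C₂, hC₂, h₂⟩ := exists_mor_wconv_le N hγ hq hp
  set W := (wtMass N).toReal
  have hW : 0 ≤ W := ENNReal.toReal_nonneg
  refine ⟨(A + 1) * (W + C₁ + C₂), by positivity, fun r f hr => ⟨fun B hB hf x => ?_,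
    fun hr1 hfm m hm hf => ⟨fun x => ?_, ?_⟩⟩⟩
  · refine (norm_conv_dil_le_of_bounded hA hk (by positivity) hB hf x).trans ?_
    gcongr <;> linarith
  · have hR1 : 1 ≤ r ^ (-1 / θ) := Real.one_le_rpow_of_pos_of_le_one_of_nonpos hr hr1
      (div_nonpos_of_nonpos_of_nonneg (by norm_num) hθ.le)
    have e : (r ^ (-1 / θ)) ^ ((N : ℝ) / (p / γ)) = r ^ (-(N * γ / (p * θ))) := by
      rw [← Real.rpow_mul hr.le]
      congr 1
      field_simp
    have h : ‖conv (dil (r ^ (-1 / θ)) k) f x‖ₑ ≤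
        ENNReal.ofReal (A * (C₁ * r ^ (-(N * γ / (p * θ))) * m)) := by
      refine (enorm_conv_le hA (norm_dil_le' hk (by positivity)) f x).trans ?_
      rw [ENNReal.ofReal_mul hA, ENNReal.ofReal_mul (by positivity), ENNReal.ofReal_mul hC₁.le,
        ← e]
      gcongr
      exact (h₁ _ hR1 _ hfm.enorm x).trans (by gcongr)
    rw [← ofReal_norm, ENNReal.ofReal_le_ofReal_iff (by positivity)] at h
    refine h.trans ?_
    rw [mul_assoc C₁, ← mul_assoc]
    gcongr <;> linarith
  · have hR1 : 1 ≤ r ^ (-1 / θ) := Real.one_le_rpow_of_pos_of_le_one_of_nonpos hr hr1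
      (div_nonpos_of_nonpos_of_nonneg (by norm_num) hθ.le)
    have e : (r ^ (-1 / θ)) ^ ((N : ℝ) * (γ - 1) / p) = r ^ (-(N * (γ - 1) / (p * θ))) := by
      rw [← Real.rpow_mul hr.le]
      congr 1
      field_simp
    calc _ ≤ mor p q (fun x => ENNReal.ofReal A * wconv (r ^ (-1 / θ)) (fun y => ‖f y‖ₑ) x) :=
          mor_mono (by linarith) fun x =>
            enorm_conv_le hA (norm_dil_le' hk (by positivity)) f x
      _ ≤ ENNReal.ofReal A * mor p q (wconv (r ^ (-1 / θ)) fun y => ‖f y‖ₑ) :=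
          mor_const_mul_le (by linarith) ENNReal.ofReal_ne_top _
      _ ≤ ENNReal.ofReal A * (ENNReal.ofReal C₂ *
            ENNReal.ofReal (r ^ (-(N * (γ - 1) / (p * θ)))) * ENNReal.ofReal m) := by
          gcongr
          rw [← e]
          exact (h₂ _ hR1 _ hfm.enorm).trans (by gcongr)
      _ = ENNReal.ofReal (A * C₂ * (r ^ (-(N * (γ - 1) / (p * θ))) * m)) := by
          rw [ENNReal.ofReal_mul (by positivity), ENNReal.ofReal_mul hA,
            ENNReal.ofReal_mul (by positivity)]
          ring
      _ ≤ _ := by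
          refine ENNReal.ofReal_le_ofReal ?_
          gcongr <;> linarith

/-- After the change of variables all dependence on (r, τ, x) sits in the continuous, locally
bounded F, and the fixed weight dominates. -/
theorem continuousAt_conv_dil_forcing {k : Sp N → V} {A : ℝ} (hc : Continuous k)
    (hk : ∀ x, ‖k x‖ ≤ A * wt x) {θ p q β T M : ℝ} {F : ℝ → Sp N → ℂ}
    (hF : IsForcing p q β T M F) {r τ : ℝ} (hr : 0 < r) (hτ : τ ∈ Ioo 0 T) (x : Sp N) :
    ContinuousAt (fun w : ℝ × ℝ × Sp N => conv (dil (w.1 ^ (-1 / θ)) k) (F w.2.1) w.2.2)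
      (r, τ, x) := by
  obtain ⟨B, hB0, hB⟩ := hF.bounded (τ / 2) (half_pos hτ.1)
  have hnhds : Ioi (0 : ℝ) ×ˢ Ioo (τ / 2) T ×ˢ (univ : Set (Sp N)) ∈ 𝓝 (r, τ, x) :=
    prod_mem_nhds (Ioi_mem_nhds hr)
      (prod_mem_nhds (Ioo_mem_nhds (by linarith [hτ.1]) hτ.2) univ_mem)
  have hin : ∀ t ∈ Ioo (τ / 2) T, t ∈ Ioo 0 T := fun t ht =>
    ⟨(half_pos hτ.1).trans ht.1, ht.2⟩
  have h : ContinuousAt (fun w : ℝ × ℝ × Sp N =>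
      ∫ z, F w.2.1 (w.2.2 - (w.1 ^ (-1 / θ))⁻¹ • z) • k z) (r, τ, x) := by
    refine continuousAt_of_dominated (bound := fun z => B * (A * wt z)) ?_ ?_
      ((integrable_wt.const_mul A).const_mul B) ?_
    · filter_upwards [hnhds] with w hw
      refine Continuous.aestronglyMeasurable (Continuous.smul ?_ hc)
      exact (hF.continuous (hin _ hw.2.1)).comp (f := fun z : Sp N =>
        w.2.2 - (w.1 ^ (-1 / θ))⁻¹ • z) (by fun_prop)
    · filter_upwards [hnhds] with w hw
      refine Eventually.of_forall fun z => ?_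
      rw [norm_smul]
      exact mul_le_mul (hB _ hw.2.1 _) (hk z) (norm_nonneg _) hB0
    · refine Eventually.of_forall fun z => ContinuousAt.smul ?_ continuousAt_const
      have h1 : ContinuousAt (fun w : ℝ × ℝ × Sp N =>
          (w.2.1, w.2.2 - (w.1 ^ (-1 / θ))⁻¹ • z)) (r, τ, x) := by
        have h2 : ContinuousAt (fun w : ℝ × ℝ × Sp N => w.1 ^ (-1 / θ)) (r, τ, x) :=
          continuousAt_fst.rpow_const (Or.inl hr.ne')
        have h3 : (r : ℝ) ^ (-1 / θ) ≠ 0 := by positivity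
        refine ContinuousAt.prodMk (by fun_prop) (ContinuousAt.sub (by fun_prop) ?_)
        exact (h2.inv₀ h3).smul continuousAt_const
      refine ContinuousAt.comp (f := fun w : ℝ × ℝ × Sp N =>
          (w.2.1, w.2.2 - (w.1 ^ (-1 / θ))⁻¹ • z))
        (g := fun z : ℝ × Sp N => F z.1 z.2) ?_ h1
      exact hF.continuousOn.continuousAt (prod_mem_nhds (Ioo_mem_nhds hτ.1 hτ.2) univ_mem)
  refine h.congr ?_
  filter_upwards [hnhds] with w hw
  exact (conv_dil (Real.rpow_pos_of_pos hw.1 _) _).symm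

/-- The integrand of the Duhamel integral with kernel `k` and weight `(t - τ) ^ (-c)`. -/
def duhamelIntegrand (θ c : ℝ) (k : Sp N → V) (F : ℝ → Sp N → ℂ) (t τ : ℝ) (x : Sp N) : V :=
  (t - τ) ^ (-c) • conv (dil ((t - τ) ^ (-1 / θ)) k) (F τ) x

/-- The Duhamel integral with kernel `k` and weight `(t - τ) ^ (-c)`. -/
def duhamel (θ c : ℝ) (k : Sp N → V) (F : ℝ → Sp N → ℂ) (t : ℝ) (x : Sp N) : V :=
  ∫ τ in (0 : ℝ)..t, duhamelIntegrand θ c k F t τ x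

theorem continuousAt_duhamelIntegrand {k : Sp N → V} {A : ℝ} (hc : Continuous k)
    (hk : ∀ x, ‖k x‖ ≤ A * wt x) {θ c p q β T M : ℝ} {F : ℝ → Sp N → ℂ}
    (hF : IsForcing p q β T M F) {t τ : ℝ} (hτt : τ < t) (hτ : τ ∈ Ioo 0 T) (x : Sp N) :
    ContinuousAt (fun w : ℝ × ℝ × Sp N => duhamelIntegrand θ c k F w.1 w.2.1 w.2.2)
      (t, τ, x) := by
  have hr : 0 < t - τ := by linarith
  unfold duhamelIntegrand
  refine ContinuousAt.smul (f := fun w : ℝ × ℝ × Sp N => (w.1 - w.2.1) ^ (-c)) ?_ ?_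
  · exact ContinuousAt.rpow_const (f := fun w : ℝ × ℝ × Sp N => w.1 - w.2.1) (by fun_prop)
      (Or.inl hr.ne')
  · exact ContinuousAt.comp (f := fun w : ℝ × ℝ × Sp N => (w.1 - w.2.1, w.2.1, w.2.2))
      (g := fun w : ℝ × ℝ × Sp N => conv (dil (w.1 ^ (-1 / θ)) k) (F w.2.1) w.2.2)
      (continuousAt_conv_dil_forcing hc hk hF hr hτ x) (by fun_prop)

end BesovMorrey

end

noncomputable section

namespace BesovMorrey

open MeasureTheory Set Filter Metric
open scoped ENNReal SchwartzMap FourierTransform Topology ContDiff Interval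

variable {N : ℕ} {V : Type*} [NormedAddCommGroup V] [NormedSpace ℂ V]

/-! ### Singular integrals in time -/

theorem intervalIntegrable_rpow_neg {β : ℝ} (hβ : β < 1) (a b : ℝ) :
    IntervalIntegrable (fun τ : ℝ => τ ^ (-β)) volume a b :=
  intervalIntegral.intervalIntegrable_rpow' (by linarith)

theorem intervalIntegrable_sub_rpow_neg {c : ℝ} (hc : c < 1) (t : ℝ) :
    IntervalIntegrable (fun τ : ℝ => (t - τ) ^ (-c)) volume 0 t := by
  have := (intervalIntegrable_rpow_neg hc 0 t).comp_sub_left t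
  simpa using this.symm

theorem integral_rpow_neg {β t : ℝ} (hβ : β < 1) :
    ∫ τ in (0 : ℝ)..t, τ ^ (-β) = t ^ (1 - β) / (1 - β) := by
  rw [integral_rpow (Or.inl (by linarith)), Real.zero_rpow (by linarith), sub_zero]
  congr 1 <;> ring_nf

theorem integral_sub_rpow_neg {c t : ℝ} (hc : c < 1) :
    ∫ τ in (0 : ℝ)..t, (t - τ) ^ (-c) = t ^ (1 - c) / (1 - c) := by
  rw [intervalIntegral.integral_comp_sub_left (fun τ => τ ^ (-c)) t, sub_self, sub_zero,
    integral_rpow_neg hc]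

/-- On each half of (0, t) one of the two factors is at most its value at t/2. -/
theorem rpow_neg_mul_rpow_neg_le {α β t τ : ℝ} (hα : 0 ≤ α) (hβ : 0 ≤ β) (hτ : 0 < τ)
    (hτt : τ < t) : (t - τ) ^ (-α) * τ ^ (-β) ≤
      (t / 2) ^ (-α) * τ ^ (-β) + (t / 2) ^ (-β) * (t - τ) ^ (-α) := by
  have h1 : 0 < t - τ := by linarith
  have h2 : 0 < t / 2 := by linarith
  rcases le_or_gt τ (t / 2) with h | h
  · have : (t - τ) ^ (-α) ≤ (t / 2) ^ (-α) :=
      Real.rpow_le_rpow_of_nonpos h2 (by linarith) (by linarith)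
    have h3 : 0 ≤ (t / 2) ^ (-β) * (t - τ) ^ (-α) := by positivity
    have := mul_le_mul_of_nonneg_right this (Real.rpow_nonneg hτ.le (-β))
    linarith
  · have : τ ^ (-β) ≤ (t / 2) ^ (-β) := Real.rpow_le_rpow_of_nonpos h2 h.le (by linarith)
    have h3 : 0 ≤ (t / 2) ^ (-α) * τ ^ (-β) := by positivity
    have := mul_le_mul_of_nonneg_right this (Real.rpow_nonneg h1.le (-α))
    linarith

theorem integral_add_rpow_neg {β c t : ℝ} (hβ : β < 1) (hc : c < 1) (a b : ℝ) :
    IntervalIntegrable (fun τ : ℝ => a * τ ^ (-β) + b * (t - τ) ^ (-c)) volume 0 t ∧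
    ∫ τ in (0 : ℝ)..t, (a * τ ^ (-β) + b * (t - τ) ^ (-c)) =
      a * (t ^ (1 - β) / (1 - β)) + b * (t ^ (1 - c) / (1 - c)) := by
  have h1 := (intervalIntegrable_rpow_neg hβ 0 t).const_mul a
  have h2 := (intervalIntegrable_sub_rpow_neg hc t).const_mul b
  refine ⟨h1.add h2, ?_⟩
  rw [intervalIntegral.integral_add h1 h2, intervalIntegral.integral_const_mul,
    intervalIntegral.integral_const_mul, integral_rpow_neg hβ, integral_sub_rpow_neg hc]

theorem exists_lintegral_rpow_le {α β : ℝ} (hα0 : 0 ≤ α) (hα : α < 1) (hβ0 : 0 ≤ β) (hβ : β < 1) :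
    ∃ C : ℝ, 0 < C ∧ ∀ t : ℝ, 0 < t →
      ∫⁻ τ in Ioo 0 t, ENNReal.ofReal ((t - τ) ^ (-α) * τ ^ (-β)) ≤
        ENNReal.ofReal (C * t ^ (1 - α - β)) := by
  refine ⟨2 ^ α / (1 - β) + 2 ^ β / (1 - α), by
    have : 0 < 1 - β := by linarith
    have : 0 < 1 - α := by linarith
    positivity, fun t ht => ?_⟩
  obtain ⟨h1, h2⟩ := integral_add_rpow_neg (t := t) hβ hα ((t / 2) ^ (-α)) ((t / 2) ^ (-β))
  have hg : IntegrableOn (fun τ : ℝ => (t / 2) ^ (-α) * τ ^ (-β) + (t / 2) ^ (-β) *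
      (t - τ) ^ (-α)) (Ioo 0 t) :=
    (intervalIntegrable_iff_integrableOn_Ioo_of_le ht.le).1 h1
  calc _ ≤ ∫⁻ τ in Ioo 0 t, ENNReal.ofReal ((t / 2) ^ (-α) * τ ^ (-β) + (t / 2) ^ (-β) *
        (t - τ) ^ (-α)) :=
        setLIntegral_mono' measurableSet_Ioo fun τ hτ =>
          ENNReal.ofReal_le_ofReal (rpow_neg_mul_rpow_neg_le hα0 hβ0 hτ.1 hτ.2)
    _ = ENNReal.ofReal (∫ τ in Ioo 0 t, ((t / 2) ^ (-α) * τ ^ (-β) + (t / 2) ^ (-β) *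
        (t - τ) ^ (-α))) := by
        rw [ofReal_integral_eq_lintegral_ofReal hg]
        filter_upwards [ae_restrict_mem measurableSet_Ioo] with τ hτ
        have : 0 < t - τ := by linarith [hτ.2]
        have := hτ.1
        positivity
    _ = _ := by
        rw [← integral_Ioc_eq_integral_Ioo, ← intervalIntegral.integral_of_le ht.le, h2]
        congr 1
        rw [Real.div_rpow ht.le zero_le_two, Real.div_rpow ht.le zero_le_two,
          Real.rpow_neg zero_le_two, Real.rpow_neg zero_le_two]
        have e1 : t ^ (1 - α - β) = t ^ (-α) * t ^ (1 - β) := by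
          rw [← Real.rpow_add ht]; congr 1; ring
        have e2 : t ^ (1 - α - β) = t ^ (-β) * t ^ (1 - α) := by
          rw [← Real.rpow_add ht]; congr 1; ring
        rw [add_mul]
        nth_rewrite 1 [e1]
        rw [e2]
        field_simp

/-! ### Properties of the Duhamel integral -/

section Duhamel

variable {k : Sp N → V} {A : ℝ} (hA : 0 ≤ A) (hc : Continuous k) (hk : ∀ x, ‖k x‖ ≤ A * wt x)
  {θ c γ p q β T : ℝ} (hθ : 0 < θ) (hc0 : 0 ≤ c) (hc1 : c < 1) (hγ : 1 < γ) (hq : γ ≤ q)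
  (hp : 0 < p) (hβ0 : 0 ≤ β) (hβ : β < 1) (hT : T ≤ 1)

include hA hk hθ hc0 hγ hq hp hT in
-- For τ ≤ t/2 the Morrey norm of F suffices, since t - τ stays away from 0. For later τ the plain
-- supremum of F is used, because the exponent c + Nγ/(pθ) of smoothing from M^{p/γ}_{q/γ} to L^∞
-- may exceed 1.
theorem exists_duhamelIntegrand_le_add {M : ℝ} {F : ℝ → Sp N → ℂ}
    (hF : IsForcing (p / γ) (q / γ) β T M F) {t₁ : ℝ} (ht₁ : 0 < t₁) :
    ∃ C₁ C₂ : ℝ, 0 ≤ C₁ ∧ 0 ≤ C₂ ∧ ∀ t ∈ Ico t₁ T, ∀ τ ∈ Ioo 0 t, ∀ x,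
      ‖duhamelIntegrand θ c k F t τ x‖ ≤ C₁ * τ ^ (-β) + C₂ * (t - τ) ^ (-c) := by
  obtain ⟨C, hC, h⟩ := exists_conv_dil_le hA hk hθ hγ hq hp
  obtain ⟨B, hB0, hB⟩ := hF.bounded (t₁ / 2) (half_pos ht₁)
  have hM := hF.nonneg
  refine ⟨(t₁ / 2) ^ (-c) * (C * ((t₁ / 2) ^ (-(N * γ / (p * θ))) * M)), C * B, by positivity,
    by positivity, fun t ht τ hτ x => ?_⟩
  have hr : 0 < t - τ := by linarith [hτ.2]
  have hτ0 := hτ.1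
  have hτT : τ ∈ Ioo 0 T := ⟨hτ.1, hτ.2.trans ht.2⟩
  rw [duhamelIntegrand, norm_smul, Real.norm_of_nonneg (by positivity)]
  rcases le_or_gt τ (t / 2) with hle | hle
  · have h1 := ((h (t - τ) (F τ) hr).2 (by linarith [ht.2]) (hF.continuous hτT).measurable
      (M * τ ^ (-β)) (by positivity) (hF.mor_le τ hτT)).1 x
    have hν : 0 ≤ N * γ / (p * θ) := by positivity
    have h2 : ∀ a : ℝ, 0 ≤ a → (t - τ) ^ (-a) ≤ (t₁ / 2) ^ (-a) := fun a ha =>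
      Real.rpow_le_rpow_of_nonpos (by linarith) (by linarith [ht.1]) (by linarith)
    have h3 : 0 ≤ C * B * (t - τ) ^ (-c) := by positivity
    calc _ ≤ (t₁ / 2) ^ (-c) * (C * ((t₁ / 2) ^ (-(N * γ / (p * θ))) * (M * τ ^ (-β)))) := by
          have h4 := h2 c hc0
          have h5 := h2 _ hν
          refine mul_le_mul h4 (h1.trans ?_) (norm_nonneg _) (by positivity)
          gcongr C * (?_ * _)
      _ ≤ _ := by
          rw [← mul_assoc _ M, ← mul_assoc C, ← mul_assoc ((t₁ / 2) ^ (-c))]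
          linarith
  · have h1 := (h (t - τ) (F τ) hr).1 B hB0
      (hB τ ⟨by linarith [ht.1], hτT.2⟩) x
    have h3 : 0 ≤ (t₁ / 2) ^ (-c) * (C * ((t₁ / 2) ^ (-(N * γ / (p * θ))) * M)) * τ ^ (-β) := by
      positivity
    calc _ ≤ (t - τ) ^ (-c) * (C * B) := by gcongr
      _ ≤ _ := by linarith

include hc hk in
theorem aestronglyMeasurable_duhamelIntegrand {M : ℝ} {F : ℝ → Sp N → ℂ}
    (hF : IsForcing (p / γ) (q / γ) β T M F) {t : ℝ} (ht : t ∈ Ioo 0 T) (x : Sp N) :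
    AEStronglyMeasurable (fun τ => duhamelIntegrand θ c k F t τ x) (volume.restrict (Ι 0 t)) := by
  rw [uIoc_of_le ht.1.le, ← restrict_Ioo_eq_restrict_Ioc]
  refine ContinuousOn.aestronglyMeasurable (fun τ hτ => ContinuousAt.continuousWithinAt ?_)
    measurableSet_Ioo
  exact ContinuousAt.comp (f := fun τ : ℝ => (t, τ, x))
    (g := fun w : ℝ × ℝ × Sp N => duhamelIntegrand θ c k F w.1 w.2.1 w.2.2)
    (continuousAt_duhamelIntegrand hc hk hF hτ.2 ⟨hτ.1, hτ.2.trans ht.2⟩ x) (by fun_prop)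

theorem ae_mem_Ioo_of_mem_uIoc {t : ℝ} (ht : 0 < t) :
    ∀ᵐ τ : ℝ, τ ∈ Ι 0 t → τ ∈ Ioo 0 t := by
  have : ∀ᵐ τ : ℝ, τ ≠ t := by simp [ae_iff, measure_singleton]
  filter_upwards [this] with τ hτ h
  rw [uIoc_of_le ht.le] at h
  exact ⟨h.1, lt_of_le_of_ne h.2 hτ⟩

include hA hc hk hθ hc0 hc1 hγ hq hp hβ hT in
theorem intervalIntegrable_duhamelIntegrand {M : ℝ} {F : ℝ → Sp N → ℂ}
    (hF : IsForcing (p / γ) (q / γ) β T M F) {t : ℝ} (ht : t ∈ Ioo 0 T) (x : Sp N) :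
    IntervalIntegrable (fun τ => duhamelIntegrand θ c k F t τ x) volume 0 t := by
  obtain ⟨C₁, C₂, -, -, h⟩ := exists_duhamelIntegrand_le_add hA hk hθ hc0 hγ hq hp hT hF ht.1
  refine (integral_add_rpow_neg (t := t) hβ hc1 C₁ C₂).1.mono_fun'
    (aestronglyMeasurable_duhamelIntegrand hc hk hF ht x) ?_
  rw [EventuallyLE, ae_restrict_iff' measurableSet_uIoc]
  filter_upwards [ae_mem_Ioo_of_mem_uIoc ht.1] with τ hτ h'
  exact h t ⟨le_rfl, ht.2⟩ τ (hτ h') x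

/-- The substitution τ = tσ fixes the interval of integration, so that continuity in t becomes
dominated convergence. -/
theorem duhamel_eq_integral_unit (θ c : ℝ) (k : Sp N → V) (F : ℝ → Sp N → ℂ) (t : ℝ) (x : Sp N) :
    duhamel θ c k F t x = t • ∫ σ in (0 : ℝ)..1, duhamelIntegrand θ c k F t (t * σ) x := by
  rw [duhamel, intervalIntegral.smul_integral_comp_mul_left
    (fun τ => duhamelIntegrand θ c k F t τ x) t, mul_zero, mul_one]

include hA hc hk hθ hc0 hc1 hγ hq hp hβ0 hβ hT in
theorem continuousOn_duhamel {M : ℝ} {F : ℝ → Sp N → ℂ}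
    (hF : IsForcing (p / γ) (q / γ) β T M F) :
    ContinuousOn (fun z : ℝ × Sp N => duhamel θ c k F z.1 z.2) (Ioo 0 T ×ˢ univ) := by
  rintro ⟨t₀, x₀⟩ ⟨ht₀, -⟩
  refine ContinuousAt.continuousWithinAt ?_
  simp only [duhamel_eq_integral_unit]
  have ht₀' : 0 < t₀ := ht₀.1
  have ht₀T : t₀ < T := ht₀.2
  set t₁ : ℝ := t₀ / 2 with ht₁
  have ht₁0 : 0 < t₁ := half_pos ht₀'
  obtain ⟨C₁, C₂, hC₁, hC₂, h⟩ :=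
    exists_duhamelIntegrand_le_add hA hk hθ hc0 hγ hq hp hT hF ht₁0
  have hev : ∀ᶠ z : ℝ × Sp N in 𝓝 (t₀, x₀), z.1 ∈ Ico t₁ T :=
    continuous_fst.continuousAt.eventually (Ico_mem_nhds (by linarith) ht₀T)
  have hmem : ∀ t ∈ Ico t₁ T, ∀ σ ∈ Ioo (0 : ℝ) 1, t * σ ∈ Ioo 0 t := fun t ht σ hσ => by
    have : 0 < t := ht₁0.trans_le ht.1
    exact ⟨mul_pos this hσ.1, mul_lt_of_lt_one_right this hσ.2⟩
  have hcts : ∀ t ∈ Ico t₁ T, ∀ x, ∀ σ ∈ Ioo (0 : ℝ) 1, ContinuousAt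
      (fun w : ℝ × ℝ × Sp N => duhamelIntegrand θ c k F w.1 w.2.1 w.2.2) (t, t * σ, x) :=
    fun t ht x σ hσ => by
      have := hmem t ht σ hσ
      exact continuousAt_duhamelIntegrand hc hk hF this.2 ⟨this.1, this.2.trans ht.2⟩ x
  refine ContinuousAt.smul (f := fun z : ℝ × Sp N => z.1) continuous_fst.continuousAt ?_
  refine intervalIntegral.continuousAt_of_dominated_interval
    (bound := fun σ => C₁ * t₁ ^ (-β) * σ ^ (-β) + C₂ * t₁ ^ (-c) * (1 - σ) ^ (-c)) ?_ ?_
    (integral_add_rpow_neg (t := 1) hβ hc1 _ _).1 ?_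
  · filter_upwards [hev] with z hz
    rw [uIoc_of_le zero_le_one, ← restrict_Ioo_eq_restrict_Ioc]
    refine ContinuousOn.aestronglyMeasurable (fun σ hσ => ContinuousAt.continuousWithinAt ?_)
      measurableSet_Ioo
    exact ContinuousAt.comp (f := fun σ : ℝ => (z.1, z.1 * σ, z.2))
      (g := fun w : ℝ × ℝ × Sp N => duhamelIntegrand θ c k F w.1 w.2.1 w.2.2)
      (hcts z.1 hz z.2 σ hσ) (by fun_prop)
  · filter_upwards [hev] with z hz
    filter_upwards [ae_mem_Ioo_of_mem_uIoc one_pos] with σ hσ' h'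
    have hσ := hσ' h'
    have hσ0 := hσ.1
    have hz0 : 0 < z.1 := ht₁0.trans_le hz.1
    refine (h z.1 hz _ (hmem z.1 hz σ hσ) z.2).trans ?_
    have e : z.1 - z.1 * σ = z.1 * (1 - σ) := by ring
    have h1σ : 0 < 1 - σ := by linarith [hσ.2]
    rw [e, Real.mul_rpow hz0.le hσ.1.le, Real.mul_rpow hz0.le h1σ.le, mul_assoc, mul_assoc]
    gcongr C₁ * (?_ * _) + C₂ * (?_ * _)
    · exact Real.rpow_le_rpow_of_nonpos ht₁0 hz.1 (by linarith)
    · exact Real.rpow_le_rpow_of_nonpos ht₁0 hz.1 (by linarith)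
  · filter_upwards [ae_mem_Ioo_of_mem_uIoc one_pos] with σ hσ' h'
    exact ContinuousAt.comp (f := fun z : ℝ × Sp N => (z.1, z.1 * σ, z.2))
      (g := fun w : ℝ × ℝ × Sp N => duhamelIntegrand θ c k F w.1 w.2.1 w.2.2)
      (hcts t₀ ⟨by linarith, ht₀T⟩ x₀ σ (hσ' h')) (by fun_prop)

include hA hc hk hθ hc0 hγ hq hp hβ0 hβ in
/-- The Morrey bound of the Duhamel integral. -/
theorem exists_mor_duhamel_le (hα : c + N * (γ - 1) / (p * θ) < 1) :
    ∃ C : ℝ, 0 < C ∧ ∀ (T M : ℝ) (F : ℝ → Sp N → ℂ), T ≤ 1 →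
      IsForcing (p / γ) (q / γ) β T M F → ∀ t ∈ Ioo 0 T, mor p q (fun x => ‖duhamel θ c k F t x‖ₑ) ≤
        ENNReal.ofReal (C * M * t ^ (1 - (c + N * (γ - 1) / (p * θ)) - β)) := by
  obtain ⟨C, hC, h⟩ := exists_conv_dil_le hA hk hθ hγ hq hp
  set ν := N * (γ - 1) / (p * θ) with hν
  have hν0 : 0 ≤ ν := by
    have : 0 < γ - 1 := by linarith
    positivity
  obtain ⟨D, hD, hI⟩ := exists_lintegral_rpow_le (add_nonneg hc0 hν0) hα hβ0 hβ
  refine ⟨C * D, by positivity, fun T M F hT hF t ht => ?_⟩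
  have hM := hF.nonneg
  have ht0 := ht.1
  classical
  -- Extension by zero outside 0 < τ < t makes the integrand jointly measurable, as Minkowski's
  -- inequality requires.
  set I : ℝ → Sp N → ℝ≥0∞ := fun τ x =>
    (Ioo 0 t ×ˢ (univ : Set (Sp N))).piecewise
      (fun w : ℝ × Sp N => ‖duhamelIntegrand θ c k F t w.1 w.2‖ₑ) 0 (τ, x) with hIdef
  have hIeq : ∀ τ ∈ Ioo 0 t, ∀ x, I τ x = ‖duhamelIntegrand θ c k F t τ x‖ₑ := fun τ hτ x =>
    piecewise_eq_of_mem _ _ _ ⟨hτ, mem_univ _⟩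
  have hmeas : Measurable (Function.uncurry I) := by
    refine ContinuousOn.measurable_piecewise ?_ continuousOn_const
      (measurableSet_Ioo.prod MeasurableSet.univ)
    rintro ⟨τ, x⟩ ⟨hτ, -⟩
    refine ContinuousAt.continuousWithinAt (ContinuousAt.enorm ?_)
    exact ContinuousAt.comp (f := fun w : ℝ × Sp N => (t, w.1, w.2))
      (g := fun w : ℝ × ℝ × Sp N => duhamelIntegrand θ c k F w.1 w.2.1 w.2.2)
      (continuousAt_duhamelIntegrand hc hk hF hτ.2 ⟨hτ.1, hτ.2.trans ht.2⟩ x) (by fun_prop)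
  have h1 : ∀ x, ‖duhamel θ c k F t x‖ₑ ≤ ∫⁻ τ in Ioo 0 t, I τ x := fun x => by
    rw [duhamel, intervalIntegral.integral_of_le ht0.le, integral_Ioc_eq_integral_Ioo]
    refine (enorm_integral_le_lintegral_enorm _).trans (le_of_eq ?_)
    exact setLIntegral_congr_fun measurableSet_Ioo fun τ hτ => (hIeq τ hτ x).symm
  have hq1 : 1 ≤ q := by linarith
  calc _ ≤ mor p q (fun x => ∫⁻ τ in Ioo 0 t, I τ x) := mor_mono (by linarith) h1
    _ ≤ ∫⁻ τ in Ioo 0 t, mor p q (I τ) := mor_lintegral_le hq1 hmeas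
    _ ≤ ∫⁻ τ in Ioo 0 t, ENNReal.ofReal (C * M) *
          ENNReal.ofReal ((t - τ) ^ (-(c + ν)) * τ ^ (-β)) := by
        refine setLIntegral_mono' measurableSet_Ioo fun τ hτ => ?_
        have hr : 0 < t - τ := by linarith [hτ.2]
        have hτ0 := hτ.1
        have hτT : τ ∈ Ioo 0 T := ⟨hτ.1, hτ.2.trans ht.2⟩
        have e : I τ = fun x => ENNReal.ofReal ((t - τ) ^ (-c)) *
            ‖conv (dil ((t - τ) ^ (-1 / θ)) k) (F τ) x‖ₑ := by
          ext x
          rw [hIeq τ hτ, duhamelIntegrand, enorm_smul, Real.enorm_of_nonneg (by positivity)]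
        rw [e]
        have h2 := ((h (t - τ) (F τ) hr).2 (by linarith [ht.2]) (hF.continuous hτT).measurable
          (M * τ ^ (-β)) (by positivity) (hF.mor_le τ hτT)).2
        refine (mor_const_mul_le (by linarith) ENNReal.ofReal_ne_top _).trans ?_
        refine (mul_le_mul_right h2 _).trans (le_of_eq ?_)
        rw [← ENNReal.ofReal_mul (by positivity), ← ENNReal.ofReal_mul (by positivity), neg_add,
          Real.rpow_add hr]
        congr 1
        ring
    _ = ENNReal.ofReal (C * M) *
          ∫⁻ τ in Ioo 0 t, ENNReal.ofReal ((t - τ) ^ (-(c + ν)) * τ ^ (-β)) :=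
        lintegral_const_mul' _ _ ENNReal.ofReal_ne_top
    _ ≤ ENNReal.ofReal (C * M) * ENNReal.ofReal (D * t ^ (1 - (c + ν) - β)) := by
        gcongr
        exact hI t ht0
    _ = _ := by
        rw [← ENNReal.ofReal_mul (by positivity)]
        congr 1
        ring

include hA hk hθ hc0 hc1 hγ hq hp hβ in
/-- The supremum bound of the Duhamel integral. -/
theorem exists_norm_duhamel_le {b : ℝ} (hb : 0 ≤ b) :
    ∃ C : ℝ, 0 < C ∧ ∀ (T M M' : ℝ) (F : ℝ → Sp N → ℂ), T ≤ 1 →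
      IsForcing (p / γ) (q / γ) β T M F → 0 ≤ M' → (∀ t ∈ Ioo 0 T, ∀ x, ‖F t x‖ ≤ M' * t ^ (-b)) →
      ∀ t ∈ Ioo 0 T, ∀ x, ‖duhamel θ c k F t x‖ ≤
        C * (M * t ^ (1 - (c + N * γ / (p * θ)) - β) + M' * t ^ (1 - c - b)) := by
  obtain ⟨C, hC, h⟩ := exists_conv_dil_le hA hk hθ hγ hq hp
  set ν := N * γ / (p * θ) with hν
  have hν0 : 0 ≤ ν := by positivity
  have h1β : 0 < 1 - β := by linarith
  have h1c : 0 < 1 - c := by linarith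
  refine ⟨C * (2 ^ (c + ν) / (1 - β) + 2 ^ b / (1 - c)), by positivity,
    fun T M M' F hT hF hM' hFb t ht x => ?_⟩
  have hM := hF.nonneg
  have ht0 := ht.1
  obtain ⟨g1, g2⟩ := integral_add_rpow_neg (t := t) hβ hc1
    (C * ((t / 2) ^ (-(c + ν)) * M)) (C * (M' * (t / 2) ^ (-b)))
  -- Early times use Morrey smoothing with (t - τ)^{-(c+ν)} frozen at t/2; late times use the
  -- weighted supremum of F with τ^{-b} frozen at t/2. Thus neither c + ν < 1 nor b < 1 is needed.
  have key : ∀ τ ∈ Ioo 0 t, ‖duhamelIntegrand θ c k F t τ x‖ ≤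
      C * ((t / 2) ^ (-(c + ν)) * M) * τ ^ (-β) + C * (M' * (t / 2) ^ (-b)) * (t - τ) ^ (-c) := by
    intro τ hτ
    have hr : 0 < t - τ := by linarith [hτ.2]
    have hτ0 := hτ.1
    have hτT : τ ∈ Ioo 0 T := ⟨hτ.1, hτ.2.trans ht.2⟩
    rw [duhamelIntegrand, norm_smul, Real.norm_of_nonneg (by positivity)]
    rcases le_or_gt τ (t / 2) with hle | hle
    · have h1 := ((h (t - τ) (F τ) hr).2 (by linarith [ht.2]) (hF.continuous hτT).measurable
        (M * τ ^ (-β)) (by positivity) (hF.mor_le τ hτT)).1 x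
      have h3 : 0 ≤ C * (M' * (t / 2) ^ (-b)) * (t - τ) ^ (-c) := by positivity
      have h4 : (t - τ) ^ (-(c + ν)) ≤ (t / 2) ^ (-(c + ν)) :=
        Real.rpow_le_rpow_of_nonpos (by linarith) (by linarith) (by linarith)
      calc _ ≤ (t - τ) ^ (-c) * (C * ((t - τ) ^ (-ν) * (M * τ ^ (-β)))) := by gcongr
        _ = C * ((t - τ) ^ (-(c + ν)) * M) * τ ^ (-β) := by
            rw [neg_add, Real.rpow_add hr]; ring
        _ ≤ C * ((t / 2) ^ (-(c + ν)) * M) * τ ^ (-β) := by gcongr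
        _ ≤ _ := by linarith
    · have h1 := (h (t - τ) (F τ) hr).1 (M' * (t / 2) ^ (-b)) (by positivity) (fun y =>
        (hFb τ hτT y).trans (by
          gcongr ?_ * ?_
          exact Real.rpow_le_rpow_of_nonpos (by linarith) hle.le (by linarith))) x
      have h3 : 0 ≤ C * ((t / 2) ^ (-(c + ν)) * M) * τ ^ (-β) := by positivity
      calc _ ≤ (t - τ) ^ (-c) * (C * (M' * (t / 2) ^ (-b))) := by gcongr
        _ ≤ _ := by linarith
  have h5 : ‖duhamel θ c k F t x‖ ≤ ∫ τ in (0 : ℝ)..t, (C * ((t / 2) ^ (-(c + ν)) * M) * τ ^ (-β) +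
      C * (M' * (t / 2) ^ (-b)) * (t - τ) ^ (-c)) := by
    refine intervalIntegral.norm_integral_le_of_norm_le ht0.le ?_ g1
    filter_upwards [ae_mem_Ioo_of_mem_uIoc ht0] with τ hτ h'
    exact key τ (hτ (by rwa [uIoc_of_le ht0.le]))
  refine h5.trans ?_
  rw [g2, Real.div_rpow ht0.le zero_le_two, Real.div_rpow ht0.le zero_le_two,
    Real.rpow_neg zero_le_two, Real.rpow_neg zero_le_two]
  have e1 : t ^ (1 - (c + ν) - β) = t ^ (-(c + ν)) * t ^ (1 - β) := by
    rw [← Real.rpow_add ht0]; congr 1; ring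
  have e2 : t ^ (1 - c - b) = t ^ (-b) * t ^ (1 - c) := by
    rw [← Real.rpow_add ht0]; congr 1; ring
  have p1 : 0 ≤ C * (2 ^ (c + ν) / (1 - β)) * (M' * t ^ (1 - c - b)) := by positivity
  have p2 : 0 ≤ C * (2 ^ b / (1 - c)) * (M * t ^ (1 - (c + ν) - β)) := by positivity
  have e3 : C * (t ^ (-(c + ν)) / (2 ^ (c + ν))⁻¹ * M) * (t ^ (1 - β) / (1 - β)) =
      C * (2 ^ (c + ν) / (1 - β)) * (M * t ^ (1 - (c + ν) - β)) := by
    rw [e1]; field_simp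
  have e4 : C * (M' * (t ^ (-b) / (2 ^ b)⁻¹)) * (t ^ (1 - c) / (1 - c)) =
      C * (2 ^ b / (1 - c)) * (M' * t ^ (1 - c - b)) := by
    rw [e2]; field_simp
  rw [e3, e4]
  nlinarith

end Duhamel

end BesovMorrey

end

noncomputable section

namespace BesovMorrey

open MeasureTheory Set Filter Metric
open scoped ENNReal SchwartzMap FourierTransform Topology ContDiff Interval

variable {N : ℕ}

/-! ### Linearity and differentiability of the Duhamel integral -/

section Linear

variable {V : Type*} [NormedAddCommGroup V] [NormedSpace ℂ V]

theorem conv_dil_sub {k : Sp N → V} {A : ℝ} (hc : Continuous k) (hA : 0 ≤ A)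
    (hk : ∀ x, ‖k x‖ ≤ A * wt x) {f g : Sp N → ℂ} (hf : Tame f) (hg : Tame g) {R : ℝ}
    (hR : 0 < R) (x : Sp N) :
    conv (dil R k) (fun y => f y - g y) x = conv (dil R k) f x - conv (dil R k) g x := by
  have h1 : Continuous (dil R k) := (hc.comp (continuous_const_smul R)).const_smul _
  have h2 : ∀ x, ‖dil R k x‖ ≤ A * (R ^ N + R⁻¹) * wt x := fun x => by
    rw [mul_assoc]
    exact (norm_dil_le' hk hR.le x).trans (mul_le_mul_of_nonneg_left (dwt_le hR x) hA)
  simp only [conv, sub_smul]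
  exact integral_sub (hf.integrable_conv h1 h2 x) (hg.integrable_conv h1 h2 x)

variable {k : Sp N → V} {A : ℝ} (hA : 0 ≤ A) (hc : Continuous k) (hk : ∀ x, ‖k x‖ ≤ A * wt x)
  {θ c γ p q β T : ℝ} (hθ : 0 < θ) (hc0 : 0 ≤ c) (hc1 : c < 1) (hγ : 1 < γ) (hq : γ ≤ q)
  (hp : 0 < p) (hβ : β < 1) (hT : T ≤ 1)

include hA hc hk hθ hc0 hc1 hγ hq hp hβ hT in
theorem duhamel_sub {M₁ M₂ : ℝ} {F₁ F₂ : ℝ → Sp N → ℂ}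
    (h₁ : IsForcing (p / γ) (q / γ) β T M₁ F₁) (h₂ : IsForcing (p / γ) (q / γ) β T M₂ F₂)
    {t : ℝ} (ht : t ∈ Ioo 0 T) (x : Sp N) :
    duhamel θ c k (fun t y => F₁ t y - F₂ t y) t x =
      duhamel θ c k F₁ t x - duhamel θ c k F₂ t x := by
  rw [duhamel, duhamel, duhamel, ← intervalIntegral.integral_sub
    (intervalIntegrable_duhamelIntegrand hA hc hk hθ hc0 hc1 hγ hq hp hβ hT h₁ ht x)
    (intervalIntegrable_duhamelIntegrand hA hc hk hθ hc0 hc1 hγ hq hp hβ hT h₂ ht x)]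
  refine intervalIntegral.integral_congr_ae ?_
  filter_upwards [ae_mem_Ioo_of_mem_uIoc ht.1] with τ hτ' h'
  have hτ := hτ' h'
  have hr : 0 < t - τ := by linarith [hτ.2]
  have hτT : τ ∈ Ioo 0 T := ⟨hτ.1, hτ.2.trans ht.2⟩
  simp only [duhamelIntegrand]
  rw [conv_dil_sub hc hA hk (h₁.tame hτT) (h₂.tame hτT) (by positivity), smul_sub]

end Linear

section Heat

variable {θ A : ℝ} (hθ : 1 < θ) (hG : IsKernel A (heatKernel θ 1 : Sp N → ℂ))
  {γ p q β T : ℝ} (hγ : 1 < γ) (hq : γ ≤ q) (hp : 0 < p) (hβ : β < 1) (hT : T ≤ 1)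

include hθ in
theorem duhamelIntegrand_zero_eq {F : ℝ → Sp N → ℂ} {t τ : ℝ} (h : τ < t) (x : Sp N) :
    duhamelIntegrand θ 0 (heatKernel θ 1) F t τ x = heatFun θ (t - τ) (F τ) x := by
  rw [duhamelIntegrand, neg_zero, Real.rpow_zero, one_smul,
    heatFun_eq_conv_dil (by linarith) (by linarith)]

include hθ hG hγ hq hp hβ hT in
-- Differentiation under the integral costs (t - τ)^{-1/θ}, which is still integrable because θ > 1.
theorem hasFDerivAt_duhamel {M : ℝ} {F : ℝ → Sp N → ℂ}
    (hF : IsForcing (p / γ) (q / γ) β T M F) {t : ℝ} (ht : t ∈ Ioo 0 T) (x : Sp N) :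
    HasFDerivAt (duhamel θ 0 (heatKernel θ 1) F t)
      (duhamel θ (1 / θ) (fderiv ℝ (heatKernel θ 1)) F t x) x := by
  have hθ0 : 0 < θ := by linarith
  have hc1 : 1 / θ < 1 := by rwa [div_lt_one hθ0]
  have hA := hG.nonneg
  have hcD := hG.contDiff.continuous_fderiv one_ne_zero
  obtain ⟨C₁, C₂, -, -, h⟩ := exists_duhamelIntegrand_le_add hA hG.norm_fderiv_le hθ0
    (c := 1 / θ) (by positivity) hγ hq hp hT hF ht.1
  refine intervalIntegral.hasFDerivAt_integral_of_dominated_of_fderiv_le (𝕜 := ℝ) (s := univ)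
    (F := fun x τ => duhamelIntegrand θ 0 (heatKernel θ 1) F t τ x)
    (F' := fun x τ => duhamelIntegrand θ (1 / θ) (fderiv ℝ (heatKernel θ 1)) F t τ x)
    (bound := fun τ => C₁ * τ ^ (-β) + C₂ * (t - τ) ^ (-(1 / θ))) univ_mem
    (Eventually.of_forall fun y => aestronglyMeasurable_duhamelIntegrand
      hG.contDiff.continuous hG.norm_le hF ht y)
    (intervalIntegrable_duhamelIntegrand hA hG.contDiff.continuous hG.norm_le hθ0 le_rfl
      zero_lt_one hγ hq hp hβ hT hF ht x)
    (aestronglyMeasurable_duhamelIntegrand hcD hG.norm_fderiv_le hF ht x) ?_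
    (integral_add_rpow_neg hβ hc1 C₁ C₂).1 ?_
  · filter_upwards [ae_mem_Ioo_of_mem_uIoc ht.1] with τ hτ h' y _
    exact h t ⟨le_rfl, ht.2⟩ τ (hτ h') y
  · filter_upwards [ae_mem_Ioo_of_mem_uIoc ht.1] with τ hτ' h' y _
    have hτ := hτ' h'
    have hr : 0 < t - τ := by linarith [hτ.2]
    have hτT : τ ∈ Ioo 0 T := ⟨hτ.1, hτ.2.trans ht.2⟩
    have h1 := hasFDerivAt_heatFun hθ0 hG (hF.tame hτT) hr y
    have e : (fun y => duhamelIntegrand θ 0 (heatKernel θ 1) F t τ y) =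
        heatFun θ (t - τ) (F τ) := funext fun y => duhamelIntegrand_zero_eq hθ hτ.2 y
    rw [e, duhamelIntegrand, ← neg_div]
    exact h1

include hθ in
theorem integral_heatFun_eq_duhamel {F : ℝ → Sp N → ℂ} {t : ℝ} (ht : 0 < t) (x : Sp N) :
    ∫ τ in (0 : ℝ)..t, heatFun θ (t - τ) (F τ) x = duhamel θ 0 (heatKernel θ 1) F t x := by
  refine intervalIntegral.integral_congr_ae ?_
  filter_upwards [ae_mem_Ioo_of_mem_uIoc ht] with τ hτ h'
  exact (duhamelIntegrand_zero_eq hθ (hτ h').2 x).symm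

include hθ hG hγ hq hp hβ hT in
theorem intervalIntegrable_heatFun {M : ℝ} {F : ℝ → Sp N → ℂ}
    (hF : IsForcing (p / γ) (q / γ) β T M F) {t : ℝ} (ht : t ∈ Ioo 0 T) (x : Sp N) :
    IntervalIntegrable (fun τ => heatFun θ (t - τ) (F τ) x) volume 0 t := by
  have hθ0 : 0 < θ := by linarith
  refine (intervalIntegrable_duhamelIntegrand hG.nonneg hG.contDiff.continuous hG.norm_le
    hθ0 le_rfl zero_lt_one hγ hq hp hβ hT hF ht x).congr_ae ?_
  rw [EventuallyEq, ae_restrict_iff' measurableSet_uIoc]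
  filter_upwards [ae_mem_Ioo_of_mem_uIoc ht.1] with τ hτ h'
  exact duhamelIntegrand_zero_eq hθ (hτ h').2 x

theorem duhamel_im {F : ℝ → Sp N → ℂ} (hF : ∀ t x, (F t x).im = 0) (t : ℝ) (x : Sp N) :
    (duhamel θ 0 (heatKernel θ 1) F t x).im = 0 := by
  suffices h : ∀ τ, (starRingEnd ℂ) (duhamelIntegrand θ 0 (heatKernel θ 1) F t τ x) =
      duhamelIntegrand θ 0 (heatKernel θ 1) F t τ x by
    simp only [← Complex.conj_eq_iff_im, duhamel, intervalIntegral, map_sub, ← integral_conj, h]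
  intro τ
  simp only [Complex.conj_eq_iff_im, duhamelIntegrand, neg_zero, Real.rpow_zero, one_smul]
  refine conv_im (fun y => ?_) (Eventually.of_forall (hF τ)) x
  simp [dil, heatKernel_im, -Complex.ofReal_pow]

end Heat

/-! ### The nonlinearity -/

section Nonlinear

variable {E : Type*} [NormedAddCommGroup E]

/-- The forcing term `|w|^γ`. -/
def powNorm (γ : ℝ) (w : ℝ → Sp N → E) (t : ℝ) (x : Sp N) : ℂ := ((‖w t x‖ ^ γ : ℝ) : ℂ)

theorem norm_powNorm (γ : ℝ) (w : ℝ → Sp N → E) (t : ℝ) (x : Sp N) :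
    ‖powNorm γ w t x‖ = ‖w t x‖ ^ γ := by
  rw [powNorm, Complex.norm_real, Real.norm_of_nonneg (by positivity)]

theorem abs_rpow_sub_rpow_le {γ x y : ℝ} (hγ : 1 < γ) (hx : 0 ≤ x) (hy : 0 ≤ y) :
    |x ^ γ - y ^ γ| ≤ γ * (x ^ (γ - 1) + y ^ (γ - 1)) * |x - y| := by
  have hm : 0 ≤ max x y := le_max_of_le_left hx
  have hd : ∀ z ∈ Icc 0 (max x y), HasDerivWithinAt (fun z : ℝ => z ^ γ) (γ * z ^ (γ - 1))
      (Icc 0 (max x y)) z := fun z _ =>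
    (Real.hasDerivAt_rpow_const (Or.inr hγ.le)).hasDerivWithinAt
  have h := (convex_Icc 0 (max x y)).norm_image_sub_le_of_norm_hasDerivWithin_le
    (C := γ * (max x y) ^ (γ - 1)) hd (fun z hz => by
      rw [Real.norm_of_nonneg (mul_nonneg (by linarith) (Real.rpow_nonneg hz.1 _))]
      have : 0 ≤ γ - 1 := by linarith
      gcongr
      · exact hz.1
      · exact hz.2) ⟨hy, le_max_right _ _⟩ ⟨hx, le_max_left _ _⟩
  refine h.trans ?_
  rw [Real.norm_eq_abs]
  gcongr
  rcases max_choice x y with e | e <;> rw [e]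
  · have := Real.rpow_nonneg hy (γ - 1); linarith
  · have := Real.rpow_nonneg hx (γ - 1); linarith

theorem norm_powNorm_sub_le {γ : ℝ} (hγ : 1 < γ) (w₁ w₂ : ℝ → Sp N → E) (t : ℝ) (x : Sp N) :
    ‖powNorm γ w₁ t x - powNorm γ w₂ t x‖ ≤
      γ * (‖w₁ t x‖ ^ (γ - 1) + ‖w₂ t x‖ ^ (γ - 1)) * ‖w₁ t x - w₂ t x‖ := by
  rw [powNorm, powNorm, ← Complex.ofReal_sub, Complex.norm_real, Real.norm_eq_abs]
  refine (abs_rpow_sub_rpow_le hγ (norm_nonneg _) (norm_nonneg _)).trans ?_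
  gcongr
  exact abs_norm_sub_norm_le _ _

theorem continuousOn_powNorm {γ : ℝ} (hγ : 0 ≤ γ) {w : ℝ → Sp N → E} {s : Set (ℝ × Sp N)}
    (h : ContinuousOn (fun z : ℝ × Sp N => w z.1 z.2) s) :
    ContinuousOn (fun z : ℝ × Sp N => powNorm γ w z.1 z.2) s :=
  Complex.continuous_ofReal.comp_continuousOn (h.norm.rpow_const fun _ _ => Or.inr hγ)

theorem IsForcing.powNorm {p q a T M γ : ℝ} (hγ : 1 < γ) (hq : 0 < q) {w : ℝ → Sp N → E}
    (h : IsForcing p q a T M w) :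
    IsForcing (p / γ) (q / γ) (a * γ) T (M ^ γ) (powNorm γ w) := by
  have hM := h.nonneg
  refine ⟨by positivity, continuousOn_powNorm (by linarith) h.continuousOn, fun τ hτ => ?_,
    fun t ht => ?_⟩
  · obtain ⟨B, hB0, hB⟩ := h.bounded τ hτ
    refine ⟨B ^ γ, by positivity, fun t ht x => ?_⟩
    rw [norm_powNorm]
    exact Real.rpow_le_rpow (norm_nonneg _) (hB t ht x) (by linarith)
  · have ht0 := ht.1
    have e : (fun x => ‖BesovMorrey.powNorm γ w t x‖ₑ) = fun x => ‖w t x‖ₑ ^ γ := by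
      ext x
      rw [← ofReal_norm, norm_powNorm, ← ofReal_norm, ENNReal.ofReal_rpow_of_nonneg
        (norm_nonneg _) (by linarith)]
    rw [e]
    refine (mor_rpow_le hγ hq (h.continuous ht).enorm.measurable).trans ?_
    refine (ENNReal.rpow_le_rpow (h.mor_le t ht) (by linarith)).trans (le_of_eq ?_)
    rw [ENNReal.ofReal_rpow_of_nonneg (by positivity) (by linarith),
      Real.mul_rpow hM (by positivity), ← Real.rpow_mul ht0.le, neg_mul]

/-- The difference of the powers is at most γ(|w₁|^{γ-1} + |w₂|^{γ-1})|w₁ - w₂|, and Hölder's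
inequality in Morrey spaces applies to each product. The bound is linear in D, which is the
Lipschitz estimate behind the contraction. -/
theorem IsForcing.powNorm_sub {p q a T M D γ : ℝ} (hγ : 1 < γ) (hq : γ ≤ q)
    {w₁ w₂ : ℝ → Sp N → E} (h₁ : IsForcing p q a T M w₁) (h₂ : IsForcing p q a T M w₂)
    (h : IsForcing p q a T D fun t x => w₁ t x - w₂ t x) :
    IsForcing (p / γ) (q / γ) (a * γ) T (2 * γ * M ^ (γ - 1) * D)
      fun t x => BesovMorrey.powNorm γ w₁ t x - BesovMorrey.powNorm γ w₂ t x := by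
  have hM := h₁.nonneg
  have hD := h.nonneg
  have hγ0 : 0 < γ := by linarith
  have hγ1 : 0 ≤ γ - 1 := by linarith
  have hq0 : 0 < q := by linarith
  refine ⟨by positivity, (continuousOn_powNorm hγ0.le h₁.continuousOn).sub
    (continuousOn_powNorm hγ0.le h₂.continuousOn), fun τ hτ => ?_, fun t ht => ?_⟩
  · obtain ⟨B₁, hB₁0, hB₁⟩ := (h₁.powNorm hγ hq0).bounded τ hτ
    obtain ⟨B₂, hB₂0, hB₂⟩ := (h₂.powNorm hγ hq0).bounded τ hτ
    exact ⟨B₁ + B₂, by positivity, fun t ht x =>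
      (norm_sub_le _ _).trans (add_le_add (hB₁ t ht x) (hB₂ t ht x))⟩
  · have ht0 := ht.1
    have m₁ := (h₁.continuous ht).enorm.measurable
    have m₂ := (h₂.continuous ht).enorm.measurable
    have m := (h.continuous ht).enorm.measurable
    have e : ∀ x, ‖BesovMorrey.powNorm γ w₁ t x - BesovMorrey.powNorm γ w₂ t x‖ₑ ≤
        ENNReal.ofReal γ * (‖w₁ t x‖ₑ ^ (γ - 1) * ‖w₁ t x - w₂ t x‖ₑ +
          ‖w₂ t x‖ₑ ^ (γ - 1) * ‖w₁ t x - w₂ t x‖ₑ) := fun x => by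
      rw [← add_mul, ← mul_assoc, ← ofReal_norm, ← ofReal_norm, ← ofReal_norm, ← ofReal_norm,
        ENNReal.ofReal_rpow_of_nonneg (norm_nonneg _) hγ1,
        ENNReal.ofReal_rpow_of_nonneg (norm_nonneg _) hγ1,
        ← ENNReal.ofReal_add (by positivity) (by positivity), ← ENNReal.ofReal_mul hγ0.le,
        ← ENNReal.ofReal_mul (by positivity)]
      exact ENNReal.ofReal_le_ofReal (norm_powNorm_sub_le hγ w₁ w₂ t x)
    have key : ∀ w : ℝ → Sp N → E, IsForcing p q a T M w →
        mor (p / γ) (q / γ) (fun x => ‖w t x‖ₑ ^ (γ - 1) * ‖w₁ t x - w₂ t x‖ₑ) ≤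
          ENNReal.ofReal (M ^ (γ - 1) * D * t ^ (-(a * γ))) := fun w hw => by
      refine (mor_rpow_mul_le hγ hq0 (hw.continuous ht).enorm.measurable m).trans ?_
      refine (mul_le_mul' (ENNReal.rpow_le_rpow (hw.mor_le t ht) hγ1) (h.mor_le t ht)).trans
        (le_of_eq ?_)
      rw [ENNReal.ofReal_rpow_of_nonneg (by positivity) hγ1, ← ENNReal.ofReal_mul (by positivity),
        Real.mul_rpow hM (by positivity), ← Real.rpow_mul ht0.le]
      congr 1
      have : t ^ (-(a * γ)) = t ^ (-a * (γ - 1)) * t ^ (-a) := by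
        rw [← Real.rpow_add ht0]; congr 1; ring
      rw [this]
      ring
    have mm : ∀ w : ℝ → Sp N → E, IsForcing p q a T M w →
        Measurable fun x => ‖w t x‖ₑ ^ (γ - 1) * ‖w₁ t x - w₂ t x‖ₑ := fun w hw =>
      ((hw.continuous ht).enorm.measurable.pow_const _).mul m
    calc _ ≤ _ := mor_mono (by positivity) e
      _ ≤ ENNReal.ofReal γ * mor (p / γ) (q / γ) (fun x =>
            ‖w₁ t x‖ₑ ^ (γ - 1) * ‖w₁ t x - w₂ t x‖ₑ +
              ‖w₂ t x‖ₑ ^ (γ - 1) * ‖w₁ t x - w₂ t x‖ₑ) :=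
          mor_const_mul_le (by positivity) ENNReal.ofReal_ne_top _
      _ ≤ ENNReal.ofReal γ * (ENNReal.ofReal (M ^ (γ - 1) * D * t ^ (-(a * γ))) +
            ENNReal.ofReal (M ^ (γ - 1) * D * t ^ (-(a * γ)))) := by
          gcongr
          exact (mor_add_le (by rwa [one_le_div hγ0]) (mm _ h₁) (mm _ h₂)).trans
            (add_le_add (key _ h₁) (key _ h₂))
      _ = _ := by
          rw [← ENNReal.ofReal_add (by positivity) (by positivity), ← ENNReal.ofReal_mul hγ0.le]
          congr 1
          ring

end Nonlinear

end BesovMorrey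

end

noncomputable section

namespace BesovMorrey

open MeasureTheory Set Filter Metric
open scoped ENNReal SchwartzMap FourierTransform Topology ContDiff Interval

variable {N : ℕ}

/-! ### The gradient of the Duhamel integral -/

/-- The coordinates of a derivative. -/
def gradMap (N : ℕ) : (Sp N →L[ℝ] ℂ) →L[ℝ] EuclideanSpace ℂ (Fin N) :=
  LinearMap.toContinuousLinearMap
    { toFun := fun X => WithLp.toLp 2 fun j => X (EuclideanSpace.single j 1)
      map_add' := fun _ _ => rfl
      map_smul' := fun _ _ => rfl }

theorem grad_eq_gradMap (f : Sp N → ℂ) (x : Sp N) : grad f x = gradMap N (fderiv ℝ f x) := rfl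

theorem enorm_gradMap_le (X : Sp N →L[ℝ] ℂ) :
    ‖gradMap N X‖ₑ ≤ ENNReal.ofReal ‖gradMap N‖ * ‖X‖ₑ := by
  rw [← ofReal_norm, ← ofReal_norm, ← ENNReal.ofReal_mul (norm_nonneg (gradMap N))]
  exact ENNReal.ofReal_le_ofReal ((gradMap N).le_opNorm X)

/-- The gradient of `∫_0^t S(t - τ) |w(τ)|^γ dτ`. -/
def gradDuhamel (θ γ : ℝ) (w : ℝ → Sp N → EuclideanSpace ℂ (Fin N)) (t : ℝ) (x : Sp N) :
    EuclideanSpace ℂ (Fin N) :=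
  gradMap N (duhamel θ (1 / θ) (fderiv ℝ (heatKernel θ 1)) (powNorm γ w) t x)

theorem gradDuhamel_zero {θ γ : ℝ} (hγ : 0 < γ) (t : ℝ) (x : Sp N) :
    gradDuhamel θ γ (fun _ _ => 0) t x = 0 := by
  have h : ∀ v : Sp N →L[ℝ] ℂ, (0 : ℂ) • v = 0 := fun v => by ext; simp
  simp [gradDuhamel, duhamel, duhamelIntegrand, conv, powNorm, Real.zero_rpow hγ.ne', h]

/-- The gradient fields in which the equation is solved. -/
structure IsField {E : Type*} [NormedAddCommGroup E] (p q a b T M : ℝ) (w : ℝ → Sp N → E) :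
    Prop where
  nonneg : 0 ≤ M
  continuousOn : ContinuousOn (fun z : ℝ × Sp N => w z.1 z.2) (Ioo 0 T ×ˢ univ)
  norm_le : ∀ t ∈ Ioo 0 T, ∀ x, ‖w t x‖ ≤ M * t ^ (-b)
  mor_le : ∀ t ∈ Ioo 0 T, mor p q (fun x => ‖w t x‖ₑ) ≤ ENNReal.ofReal (M * t ^ (-a))

section Field

variable {E : Type*} [NormedAddCommGroup E] {p q a b T M : ℝ} {w : ℝ → Sp N → E}

theorem IsField.continuous (h : IsField p q a b T M w) {t : ℝ} (ht : t ∈ Ioo 0 T) :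
    Continuous (w t) :=
  continuous_slice h.continuousOn ht

theorem IsField.isForcing (h : IsField p q a b T M w) (hb : 0 ≤ b) : IsForcing p q a T M w := by
  have hM := h.nonneg
  refine ⟨hM, h.continuousOn, fun τ hτ => ⟨M * τ ^ (-b), by positivity, fun t ht x => ?_⟩,
    h.mor_le⟩
  refine (h.norm_le t ⟨hτ.trans ht.1, ht.2⟩ x).trans (mul_le_mul_of_nonneg_left ?_ hM)
  exact Real.rpow_le_rpow_of_nonpos hτ ht.1.le (by linarith)

theorem IsField.congr (h : IsField p q a b T M w) {w' : ℝ → Sp N → E}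
    (e : ∀ t ∈ Ioo 0 T, ∀ x, w' t x = w t x) : IsField p q a b T M w' := by
  refine ⟨h.nonneg, h.continuousOn.congr fun z hz => e z.1 hz.1 z.2, fun t ht x => ?_,
    fun t ht => ?_⟩
  · rw [e t ht]; exact h.norm_le t ht x
  · simp only [e t ht]; exact h.mor_le t ht

theorem IsField.mono (h : IsField p q a b T M w) {M' : ℝ} (hM : M ≤ M') :
    IsField p q a b T M' w := by
  refine ⟨h.nonneg.trans hM, h.continuousOn, fun t ht x => (h.norm_le t ht x).trans ?_,
    fun t ht => (h.mor_le t ht).trans (ENNReal.ofReal_le_ofReal ?_)⟩ <;>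
  · have := ht.1
    gcongr

theorem IsField.add (hq : 1 ≤ q) {M₁ M₂ : ℝ} {w₁ w₂ : ℝ → Sp N → E}
    (h₁ : IsField p q a b T M₁ w₁) (h₂ : IsField p q a b T M₂ w₂) :
    IsField p q a b T (M₁ + M₂) fun t x => w₁ t x + w₂ t x := by
  have := h₁.nonneg
  have := h₂.nonneg
  refine ⟨by positivity, h₁.continuousOn.add h₂.continuousOn, fun t ht x => ?_, fun t ht => ?_⟩
  · rw [add_mul]
    exact (norm_add_le _ _).trans (add_le_add (h₁.norm_le t ht x) (h₂.norm_le t ht x))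
  · have := ht.1
    refine (mor_norm_add_le hq (h₁.continuous ht) (h₂.continuous ht)).trans ?_
    rw [add_mul, ENNReal.ofReal_add (by positivity) (by positivity)]
    exact add_le_add (h₁.mor_le t ht) (h₂.mor_le t ht)

theorem isField_zero (hq : 0 < q) : IsField p q a b T 0 fun (_ : ℝ) (_ : Sp N) => (0 : E) := by
  refine ⟨le_rfl, continuousOn_const, fun t _ x => by simp, fun t _ => ?_⟩
  have := mor_const_mul_le (N := N) (p := p) hq (c := 0) (by simp) fun _ => 0
  simpa using this

theorem IsForcing.sub (hq : 1 ≤ q) {M₁ M₂ : ℝ} {w₁ w₂ : ℝ → Sp N → E}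
    (h₁ : IsForcing p q a T M₁ w₁) (h₂ : IsForcing p q a T M₂ w₂) :
    IsForcing p q a T (M₁ + M₂) fun t x => w₁ t x - w₂ t x := by
  have := h₁.nonneg
  have := h₂.nonneg
  refine ⟨by positivity, h₁.continuousOn.sub h₂.continuousOn, fun τ hτ => ?_, fun t ht => ?_⟩
  · obtain ⟨B₁, hB₁0, hB₁⟩ := h₁.bounded τ hτ
    obtain ⟨B₂, hB₂0, hB₂⟩ := h₂.bounded τ hτ
    exact ⟨B₁ + B₂, by positivity, fun t ht x =>
      (norm_sub_le _ _).trans (add_le_add (hB₁ t ht x) (hB₂ t ht x))⟩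
  · have := ht.1
    have e := mor_norm_add_le (p := p) hq (h₁.continuous ht) (h₂.continuous ht).neg
    simp only [Pi.neg_apply, ← sub_eq_add_neg, enorm_neg] at e
    refine e.trans ?_
    rw [add_mul, ENNReal.ofReal_add (by positivity) (by positivity)]
    exact add_le_add (h₁.mor_le t ht) (h₂.mor_le t ht)

/-- Completeness of the space of fields: summable bounds give uniform convergence away from t = 0,
hence a continuous limit. -/
theorem IsField.tsum [CompleteSpace E] (hq : 1 ≤ q) (hb : 0 ≤ b) {D : ℕ → ℝ} (hD : Summable D)
    {d : ℕ → ℝ → Sp N → E} (h : ∀ n, IsField p q a b T (D n) (d n)) :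
    (∀ t ∈ Ioo 0 T, ∀ x, Summable fun n => d n t x) ∧
      IsField p q a b T (∑' n, D n) fun t x => ∑' n, d n t x := by
  have hD0 : ∀ n, 0 ≤ D n := fun n => (h n).nonneg
  have hs : ∀ t : ℝ, Summable fun n => D n * t ^ (-b) := fun t => hD.mul_right _
  have hn : ∀ t ∈ Ioo 0 T, ∀ x, Summable fun n => ‖d n t x‖ := fun t ht x =>
    (hs t).of_nonneg_of_le (fun _ => norm_nonneg _) fun n => (h n).norm_le t ht x
  refine ⟨fun t ht x => (hn t ht x).of_norm, tsum_nonneg hD0, ?_, fun t ht x => ?_,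
    fun t ht => ?_⟩
  · rintro ⟨t, x⟩ ⟨ht, -⟩
    have ht0 : 0 < t := ht.1
    have hc : ContinuousOn (fun z : ℝ × Sp N => ∑' n, d n z.1 z.2) (Ioo (t / 2) T ×ˢ univ) := by
      refine continuousOn_tsum (u := fun n => D n * (t / 2) ^ (-b))
        (fun n => (h n).continuousOn.mono
          (prod_mono (Ioo_subset_Ioo_left (by positivity)) subset_rfl)) (hs _) ?_
      rintro n ⟨t', x'⟩ ⟨ht', -⟩
      have ht'0 : 0 < t' := (half_pos ht0).trans ht'.1
      refine ((h n).norm_le t' ⟨ht'0, ht'.2⟩ x').trans (mul_le_mul_of_nonneg_left ?_ (hD0 n))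
      exact Real.rpow_le_rpow_of_nonpos (half_pos ht0) ht'.1.le (by linarith)
    exact (hc.continuousAt (prod_mem_nhds (Ioo_mem_nhds (by simp only; linarith) ht.2)
      univ_mem)).continuousWithinAt
  · rw [← tsum_mul_right]
    exact tsum_of_norm_bounded (hs t).hasSum fun n => (h n).norm_le t ht x
  · have ht0 := ht.1
    calc _ ≤ mor p q (fun x => ∑' n, ‖d n t x‖ₑ) :=
          mor_mono (by linarith) fun x => enorm_tsum_le_tsum_enorm
      _ ≤ ∑' n, mor p q (fun x => ‖d n t x‖ₑ) :=
          mor_tsum_le hq fun n => ((h n).continuous ht).enorm.measurable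
      _ ≤ ∑' n, ENNReal.ofReal (D n * t ^ (-a)) := ENNReal.tsum_le_tsum fun n => (h n).mor_le t ht
      _ = _ := by
          rw [← tsum_mul_right, ENNReal.ofReal_tsum_of_nonneg
            (fun n => mul_nonneg (hD0 n) (by positivity)) (hD.mul_right _)]

/-- The Morrey norm controls integrals over unit balls, and continuity upgrades vanishing almost
everywhere to vanishing. -/
theorem eq_zero_of_mor_eq_zero {f : Sp N → E} (hf : Continuous f) (hq : 1 ≤ q)
    (h : mor p q (fun x => ‖f x‖ₑ) = 0) (x : Sp N) : f x = 0 := by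
  have h1 := setLIntegral_ball_le_mor (p := p) hq hf.enorm.measurable x one_pos le_rfl
  rw [h, mul_zero, nonpos_iff_eq_zero, lintegral_eq_zero_iff hf.enorm.measurable] at h1
  have h2 : f =ᵐ[volume.restrict (ball x 1)] fun _ => 0 := by
    filter_upwards [h1] with y hy
    simpa using hy
  exact Measure.eqOn_open_of_ae_eq h2 isOpen_ball hf.continuousOn continuousOn_const
    (mem_ball_self one_pos)

end Field

/-! ### The contraction -/

/-- The relations between the exponents that make the Duhamel map a contraction. -/
structure IsScaling (N : ℕ) (θ γ p q a b : ℝ) : Prop where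
  one_lt_θ : 1 < θ
  one_lt_γ : 1 < γ
  γ_le_q : γ ≤ q
  p_pos : 0 < p
  a_nonneg : 0 ≤ a
  b_nonneg : 0 ≤ b
  mul_lt : a * γ < 1
  lt_one : 1 / θ + N * (γ - 1) / (p * θ) < 1
  le_mor : -a ≤ 1 - (1 / θ + N * (γ - 1) / (p * θ)) - a * γ
  le_norm : -b ≤ 1 - (1 / θ + N * γ / (p * θ)) - a * γ
  le_norm' : -b ≤ 1 - 1 / θ - b * γ

section Contraction

variable {θ γ p q a b A : ℝ} (hS : IsScaling N θ γ p q a b)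
  (hG : IsKernel A (heatKernel θ 1 : Sp N → ℂ))

include hS hG in
theorem gradDuhamel_sub {T M D : ℝ} (hT : T ≤ 1) {w₁ w₂ : ℝ → Sp N → EuclideanSpace ℂ (Fin N)}
    (h₁ : IsForcing p q a T M w₁) (h₂ : IsForcing p q a T D w₂) {t : ℝ} (ht : t ∈ Ioo 0 T)
    (x : Sp N) :
    gradDuhamel θ γ w₁ t x - gradDuhamel θ γ w₂ t x =
      gradMap N (duhamel θ (1 / θ) (fderiv ℝ (heatKernel θ 1))
        (fun t x => powNorm γ w₁ t x - powNorm γ w₂ t x) t x) := by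
  obtain ⟨hθ, hγ, hq, hp, ha, hb, haγ, hα, -, -, -⟩ := hS
  have hθ0 : 0 < θ := by linarith
  rw [gradDuhamel, gradDuhamel, ← map_sub,
    duhamel_sub hG.nonneg (hG.contDiff.continuous_fderiv one_ne_zero) hG.norm_fderiv_le hθ0
      (by positivity) (by rwa [div_lt_one hθ0]) hγ hq hp haγ hT (h₁.powNorm hγ (by linarith))
      (h₂.powNorm hγ (by linarith)) ht]

include hS hG in
theorem continuousOn_gradDuhamel {T M : ℝ} (hT : T ≤ 1)
    {w : ℝ → Sp N → EuclideanSpace ℂ (Fin N)} (h : IsForcing p q a T M w) :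
    ContinuousOn (fun z : ℝ × Sp N => gradDuhamel θ γ w z.1 z.2) (Ioo 0 T ×ˢ univ) := by
  obtain ⟨hθ, hγ, hq, hp, ha, hb, haγ, hα, -, -, -⟩ := hS
  have hθ0 : 0 < θ := by linarith
  exact (gradMap N).continuous.comp_continuousOn
    (continuousOn_duhamel hG.nonneg (hG.contDiff.continuous_fderiv one_ne_zero) hG.norm_fderiv_le
      hθ0 (by positivity) (by rwa [div_lt_one hθ0]) hγ hq hp (by positivity) haγ hT
      (h.powNorm hγ (by linarith)))

theorem rpow_le_rpow_of_le_one {t x y : ℝ} (ht : 0 < t) (ht1 : t ≤ 1) (h : x ≤ y) :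
    t ^ y ≤ t ^ x :=
  Real.rpow_le_rpow_of_exponent_ge ht ht1 h

include hS hG in
-- The first estimate needs no rate for the supremum as t → 0, so it applies to every solution in
-- the uniqueness class. The second carries the weighted supremum along, which keeps the iterates
-- bounded at positive times. The exponent relations and t ≤ 1 turn the powers of t into t^{-a} and
-- t^{-b}.
theorem exists_gradDuhamel_bounds :
    ∃ K : ℝ, 0 < K ∧ ∀ (T M D : ℝ) (w₁ w₂ : ℝ → Sp N → EuclideanSpace ℂ (Fin N)), T ≤ 1 →
      (IsForcing p q a T M w₁ → IsForcing p q a T M w₂ →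
        IsForcing p q a T D (fun t x => w₁ t x - w₂ t x) → ∀ t ∈ Ioo 0 T,
        mor p q (fun x => ‖gradDuhamel θ γ w₁ t x - gradDuhamel θ γ w₂ t x‖ₑ) ≤
          ENNReal.ofReal (K * M ^ (γ - 1) * D * t ^ (-a))) ∧
      (IsField p q a b T M w₁ → IsField p q a b T M w₂ →
        IsField p q a b T D (fun t x => w₁ t x - w₂ t x) →
        IsField p q a b T (K * M ^ (γ - 1) * D)
          fun t x => gradDuhamel θ γ w₁ t x - gradDuhamel θ γ w₂ t x) := by
  have hS' := hS
  obtain ⟨hθ, hγ, hq, hp, ha, hb, haγ, hα, e₁, e₂, e₃⟩ := hS'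
  have hθ0 : 0 < θ := by linarith
  have hγ0 : 0 < γ := by linarith
  have hc1 : 1 / θ < 1 := by rwa [div_lt_one hθ0]
  obtain ⟨C₁, hC₁, h₁⟩ := exists_mor_duhamel_le hG.nonneg
    (hG.contDiff.continuous_fderiv one_ne_zero) hG.norm_fderiv_le hθ0 (c := 1 / θ) (by positivity)
    hγ hq hp (mul_nonneg ha hγ0.le) haγ hα
  obtain ⟨C₂, hC₂, h₂⟩ := exists_norm_duhamel_le hG.nonneg hG.norm_fderiv_le hθ0 (c := 1 / θ)
    (by positivity) hc1 hγ hq hp haγ (mul_nonneg hb hγ0.le)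
  set c := ‖gradMap N‖ with hcdef
  have hc0 : 0 ≤ c := norm_nonneg (gradMap N)
  -- The summand 1 only ensures K > 0, since the norm of `gradMap` is merely known to be
  -- nonnegative.
  refine ⟨c * ((C₁ + 2 * C₂) * (2 * γ)) + 1, by positivity, fun T M D w₁ w₂ hT => ?_⟩
  have key : IsForcing p q a T M w₁ → IsForcing p q a T M w₂ →
      IsForcing p q a T D (fun t x => w₁ t x - w₂ t x) → ∀ t ∈ Ioo 0 T,
      mor p q (fun x => ‖gradDuhamel θ γ w₁ t x - gradDuhamel θ γ w₂ t x‖ₑ) ≤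
        ENNReal.ofReal ((c * ((C₁ + 2 * C₂) * (2 * γ)) + 1) * M ^ (γ - 1) * D * t ^ (-a)) := by
    intro hw₁ hw₂ hw t ht
    have hM := hw₁.nonneg
    have hD := hw.nonneg
    have ht0 := ht.1
    have ht1 : t ≤ 1 := ht.2.le.trans hT
    simp only [gradDuhamel_sub hS hG hT hw₁ hw₂ ht]
    refine (mor_mono (by linarith) fun x => enorm_gradMap_le _).trans ?_
    refine (mor_const_mul_le (by linarith) ENNReal.ofReal_ne_top _).trans ?_
    refine (mul_le_mul_right (h₁ T _ _ hT (hw₁.powNorm_sub hγ hq hw₂ hw) t ht) _).trans ?_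
    rw [← ENNReal.ofReal_mul hc0]
    refine ENNReal.ofReal_le_ofReal ?_
    have e := rpow_le_rpow_of_le_one ht0 ht1 e₁
    have p1 : 0 ≤ c * C₂ * γ * M ^ (γ - 1) * D * t ^ (-a) := by positivity
    have p2 : 0 ≤ M ^ (γ - 1) * D * t ^ (-a) := by positivity
    calc _ ≤ c * (C₁ * (2 * γ * M ^ (γ - 1) * D) * t ^ (-a)) := by gcongr
      _ ≤ _ := by linarith
  refine ⟨key, fun hw₁ hw₂ hw => ?_⟩
  have f₁ := hw₁.isForcing hb
  have f₂ := hw₂.isForcing hb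
  have f := hw.isForcing hb
  have hM := hw₁.nonneg
  have hD := hw.nonneg
  refine ⟨by positivity, (continuousOn_gradDuhamel hS hG hT f₁).sub
    (continuousOn_gradDuhamel hS hG hT f₂), fun t ht x => ?_, key f₁ f₂ f⟩
  have ht0 := ht.1
  have ht1 : t ≤ 1 := ht.2.le.trans hT
  rw [gradDuhamel_sub hS hG hT f₁ f₂ ht]
  refine ((gradMap N).le_opNorm _).trans ?_
  have h3 := h₂ T _ (2 * γ * M ^ (γ - 1) * D) _ hT (f₁.powNorm_sub hγ hq f₂ f) (by positivity)
    (fun σ hσ y => ?_) t ht x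
  · have e := rpow_le_rpow_of_le_one ht0 ht1 e₂
    have e' := rpow_le_rpow_of_le_one ht0 ht1 e₃
    have p1 : 0 ≤ c * C₁ * γ * M ^ (γ - 1) * D * t ^ (-b) := by positivity
    have p2 : 0 ≤ M ^ (γ - 1) * D * t ^ (-b) := by positivity
    calc _ ≤ c * (C₂ * (2 * γ * M ^ (γ - 1) * D * t ^ (-b) +
          2 * γ * M ^ (γ - 1) * D * t ^ (-b))) := by
          refine mul_le_mul_of_nonneg_left (h3.trans ?_) hc0
          gcongr
      _ ≤ _ := by linarith
  · have hσ0 := hσ.1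
    have hγ1 : 0 ≤ γ - 1 := by linarith
    have hb' : ∀ w : ℝ → Sp N → EuclideanSpace ℂ (Fin N), IsField p q a b T M w →
        ‖w σ y‖ ^ (γ - 1) ≤ M ^ (γ - 1) * σ ^ (-b * (γ - 1)) := fun w hw => by
      rw [Real.rpow_mul hσ0.le, ← Real.mul_rpow hM (by positivity)]
      exact Real.rpow_le_rpow (norm_nonneg _) (hw.norm_le σ hσ y) hγ1
    have e : σ ^ (-(b * γ)) = σ ^ (-b * (γ - 1)) * σ ^ (-b) := by
      rw [← Real.rpow_add hσ0]; congr 1; ring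
    calc _ ≤ γ * (‖w₁ σ y‖ ^ (γ - 1) + ‖w₂ σ y‖ ^ (γ - 1)) * ‖w₁ σ y - w₂ σ y‖ :=
          norm_powNorm_sub_le hγ w₁ w₂ σ y
      _ ≤ γ * (M ^ (γ - 1) * σ ^ (-b * (γ - 1)) + M ^ (γ - 1) * σ ^ (-b * (γ - 1))) *
          (D * σ ^ (-b)) := by
          gcongr
          · exact hb' w₁ hw₁
          · exact hb' w₂ hw₂
          · exact hw.norm_le σ hσ y
      _ = _ := by rw [e]; ring

end Contraction

end BesovMorrey

end

noncomputable section

namespace BesovMorrey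

open MeasureTheory Set Filter Metric
open scoped ENNReal SchwartzMap FourierTransform Topology ContDiff Interval

variable {N : ℕ}

/-! ### Picard iteration -/

/-- The Picard iterates of `w = ℓ + ∇ ∫_0^t S(t - τ) |w(τ)|^γ dτ`. -/
def picard (θ γ : ℝ) (l : ℝ → Sp N → EuclideanSpace ℂ (Fin N)) :
    ℕ → ℝ → Sp N → EuclideanSpace ℂ (Fin N)
  | 0 => fun _ _ => 0
  | n + 1 => fun t x => l t x + gradDuhamel θ γ (picard θ γ l n) t x

section Fixed

variable {θ γ p q a b A K M T : ℝ} (hS : IsScaling N θ γ p q a b)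
  (hG : IsKernel A (heatKernel θ 1 : Sp N → ℂ)) (hT : T ≤ 1)
  (hK : K * M ^ (γ - 1) ≤ 1 / 2)
  (hF : ∀ (D : ℝ) (w₁ w₂ : ℝ → Sp N → EuclideanSpace ℂ (Fin N)),
    IsField p q a b T M w₁ → IsField p q a b T M w₂ →
      IsField p q a b T D (fun t x => w₁ t x - w₂ t x) →
      IsField p q a b T (K * M ^ (γ - 1) * D)
        fun t x => gradDuhamel θ γ w₁ t x - gradDuhamel θ γ w₂ t x)
  {l : ℝ → Sp N → EuclideanSpace ℂ (Fin N)} (hl : IsField p q a b T (M / 2) l)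

include hS hK hF hl in
-- The datum and the Duhamel term contribute at most M/2 each, so the ball of radius M is preserved,
-- and differences of iterates halve at each step.
theorem isField_picard (n : ℕ) :
    IsField p q a b T M (picard θ γ l n) ∧ IsField p q a b T (M / 2 * (1 / 2) ^ n)
      fun t x => picard θ γ l (n + 1) t x - picard θ γ l n t x := by
  obtain ⟨-, hγ, hq, -⟩ := hS
  have hM : 0 ≤ M := by linarith [hl.nonneg]
  have h0 : IsField p q a b T M (picard θ γ l 0) := (isField_zero (by linarith)).mono hM
  have hstep : ∀ n, IsField p q a b T M (picard θ γ l n) →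
      IsField p q a b T M (picard θ γ l (n + 1)) := fun n hn => by
    -- The iterate is compared with the zero field, whose Duhamel term vanishes.
    have h1 := hF M _ _ hn h0 (hn.congr fun t _ x => by simp [picard])
    refine ((hl.add (by linarith) h1).mono ?_).congr fun t _ x => ?_
    · have := mul_le_mul_of_nonneg_right hK hM
      linarith
    · simp [picard, gradDuhamel_zero (show 0 < γ by linarith)]
  induction n with
  | zero =>
    refine ⟨h0, (hl.mono (by simp)).congr fun t _ x => ?_⟩
    simp [picard, gradDuhamel_zero (show 0 < γ by linarith)]
  | succ n ih =>
    have hn := hstep n ih.1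
    refine ⟨hn, ((hF _ _ _ hn ih.1 ih.2).mono ?_).congr fun t _ x => ?_⟩
    · have hp : 0 ≤ M / 2 * (1 / 2) ^ n := by positivity
      have := mul_le_mul_of_nonneg_right hK hp
      rw [pow_succ]
      linarith
    · simp [picard]

include hS hK hF hl in
-- The limit is the telescoping series of differences. Its tail after n steps has size at most M
-- 2^{-n}, and the Lipschitz estimate bounds the defect in the fixed-point equation by a multiple of
-- 2^{-n} for every n.
theorem exists_fixed :
    ∃ w, IsField p q a b T M w ∧ ∀ t ∈ Ioo 0 T, ∀ x, w t x = l t x + gradDuhamel θ γ w t x := by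
  have hP := isField_picard hS hK hF hl
  obtain ⟨-, hγ, hq, -, -, hb, -⟩ := hS
  have hq1 : 1 ≤ q := by linarith
  have hM : 0 ≤ M := by linarith [hl.nonneg]
  set v := picard θ γ l with hv
  have hgeo : ∀ n, HasSum (fun k : ℕ => M / 2 * (1 / 2 : ℝ) ^ (k + n))
      (M * (1 / 2) ^ n) := fun n => by
    have e : (fun k : ℕ => M / 2 * (1 / 2 : ℝ) ^ (k + n)) =
        fun k : ℕ => M / 2 * (1 / 2 : ℝ) ^ k * (1 / 2) ^ n := by
      ext k; rw [pow_add]; ring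
    rw [e, show M * (1 / 2) ^ n = M / 2 * 2 * (1 / 2) ^ n by ring]
    exact (hasSum_geometric_two.mul_left (M / 2)).mul_right _
  have hsum : ∀ n, (∀ t ∈ Ioo 0 T, ∀ x, Summable fun k => v (k + n + 1) t x - v (k + n) t x) ∧
      IsField p q a b T (M * (1 / 2) ^ n)
        fun t x => ∑' k, (v (k + n + 1) t x - v (k + n) t x) := fun n => by
    have := IsField.tsum hq1 hb (hgeo n).summable fun k => (hP (k + n)).2
    rwa [(hgeo n).tsum_eq] at this
  set w : ℝ → Sp N → EuclideanSpace ℂ (Fin N) := fun t x => ∑' k, (v (k + 1) t x - v k t x) with hw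
  have hwF : IsField p q a b T M w := by simpa using (hsum 0).2
  have hwn : ∀ n, IsField p q a b T (M * (1 / 2) ^ n) fun t x => w t x - v n t x := fun n => by
    refine (hsum n).2.congr fun t ht x => ?_
    have h1 := ((hsum 0).1 t ht x).sum_add_tsum_nat_add n
    simp only [add_zero] at h1
    have h2 : ∑ k ∈ Finset.range n, (v (k + 1) t x - v k t x) = v n t x := by
      rw [Finset.sum_range_sub fun k => v k t x]
      simp [hv, picard]
    rw [h2] at h1
    change (∑' k, (v (k + 1) t x - v k t x)) - v n t x = _
    rw [← h1, add_sub_cancel_left]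
  refine ⟨w, hwF, fun t ht x => ?_⟩
  have ht0 := ht.1
  have key : ∀ n, ‖w t x - (l t x + gradDuhamel θ γ w t x)‖ ≤
      M * t ^ (-b) * (1 / 2) ^ n := fun n => by
    have h1 := (hwn (n + 1)).norm_le t ht x
    have h2 := (hF _ _ _ hwF (hP n).1 (hwn n)).norm_le t ht x
    have e : w t x - (l t x + gradDuhamel θ γ w t x) =
        (w t x - v (n + 1) t x) - (gradDuhamel θ γ w t x - gradDuhamel θ γ (v n) t x) := by
      have : v (n + 1) t x = l t x + gradDuhamel θ γ (v n) t x := rfl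
      rw [this]
      abel
    rw [e]
    refine (norm_sub_le _ _).trans ((add_le_add h1 h2).trans ?_)
    have hp : 0 ≤ M * (1 / 2) ^ n * t ^ (-b) := by positivity
    have := mul_le_mul_of_nonneg_right hK hp
    rw [pow_succ]
    linarith
  have hlim : Tendsto (fun n : ℕ => M * t ^ (-b) * (1 / 2 : ℝ) ^ n) atTop (𝓝 0) := by
    simpa using (tendsto_pow_atTop_nhds_zero_of_lt_one (r := (1 / 2 : ℝ)) (by norm_num)
      (by norm_num)).const_mul (M * t ^ (-b))
  exact sub_eq_zero.1 (norm_le_zero_iff.1 (ge_of_tendsto' hlim key))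

include hS hK in
-- The difference of two fixed points starts with the bound 2M, and feeding a bound D into the
-- Lipschitz estimate returns D/2. Its Morrey norm is therefore 0.
theorem eq_of_fixed (hF : ∀ (D : ℝ) (w₁ w₂ : ℝ → Sp N → EuclideanSpace ℂ (Fin N)),
      IsForcing p q a T M w₁ → IsForcing p q a T M w₂ →
        IsForcing p q a T D (fun t x => w₁ t x - w₂ t x) → ∀ t ∈ Ioo 0 T,
        mor p q (fun x => ‖gradDuhamel θ γ w₁ t x - gradDuhamel θ γ w₂ t x‖ₑ) ≤
          ENNReal.ofReal (K * M ^ (γ - 1) * D * t ^ (-a)))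
    {l w₁ w₂ : ℝ → Sp N → EuclideanSpace ℂ (Fin N)} (h₁ : IsForcing p q a T M w₁)
    (h₂ : IsForcing p q a T M w₂) (e₁ : ∀ t ∈ Ioo 0 T, ∀ x, w₁ t x = l t x + gradDuhamel θ γ w₁ t x)
    (e₂ : ∀ t ∈ Ioo 0 T, ∀ x, w₂ t x = l t x + gradDuhamel θ γ w₂ t x) {t : ℝ} (ht : t ∈ Ioo 0 T)
    (x : Sp N) : w₁ t x = w₂ t x := by
  obtain ⟨-, hγ, hq, -⟩ := hS
  have hM := h₁.nonneg
  have key : ∀ n : ℕ, IsForcing p q a T ((M + M) * (1 / 2) ^ n) fun t x => w₁ t x - w₂ t x := by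
    intro n
    induction n with
    | zero => simpa using h₁.sub (by linarith) h₂
    | succ n ih =>
      refine ⟨by positivity, ih.continuousOn, ih.bounded, fun t ht => ?_⟩
      have ht0 := ht.1
      have e : (fun x => ‖w₁ t x - w₂ t x‖ₑ) =
          fun x => ‖gradDuhamel θ γ w₁ t x - gradDuhamel θ γ w₂ t x‖ₑ := by
        ext x
        rw [e₁ t ht x, e₂ t ht x, add_sub_add_left_eq_sub]
      rw [e]
      refine (hF _ _ _ h₁ h₂ ih t ht).trans (ENNReal.ofReal_le_ofReal ?_)
      have hp : 0 ≤ (M + M) * (1 / 2) ^ n * t ^ (-a) := by positivity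
      have := mul_le_mul_of_nonneg_right hK hp
      rw [pow_succ]
      linarith
  have ht0 := ht.1
  have h0 : mor p q (fun x => ‖w₁ t x - w₂ t x‖ₑ) = 0 := by
    have hlim : Tendsto (fun n : ℕ => ENNReal.ofReal ((M + M) * (1 / 2) ^ n * t ^ (-a))) atTop
        (𝓝 0) := by
      rw [← ENNReal.ofReal_zero]
      refine (ENNReal.continuous_ofReal.tendsto _).comp ?_
      simpa using ((tendsto_pow_atTop_nhds_zero_of_lt_one (r := (1 / 2 : ℝ)) (by norm_num)
        (by norm_num)).const_mul (M + M)).mul_const (t ^ (-a))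
    exact le_antisymm (ge_of_tendsto' hlim fun n => (key n).mor_le t ht) bot_le
  exact sub_eq_zero.1 (eq_zero_of_mor_eq_zero (f := fun x => w₁ t x - w₂ t x)
    ((key 0).continuous ht) (by linarith) h0 x)

end Fixed

end BesovMorrey

end

noncomputable section

namespace BesovMorrey

open MeasureTheory Set Filter Metric
open scoped ENNReal SchwartzMap FourierTransform Topology ContDiff Interval

variable {N : ℕ}

/-! ### Solutions and fixed points -/

theorem ofReal_rpow_mul_le_iff {t a M : ℝ} (ht : 0 < t) {m : ℝ≥0∞} :
    ENNReal.ofReal (t ^ a) * m ≤ ENNReal.ofReal M ↔ m ≤ ENNReal.ofReal (M * t ^ (-a)) := by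
  have h : 0 < t ^ a := Real.rpow_pos_of_pos ht a
  rw [Real.rpow_neg ht.le, ← div_eq_mul_inv, ENNReal.ofReal_div_of_pos h,
    ENNReal.le_div_iff_mul_le (Or.inl (by simpa using h)) (Or.inl ENNReal.ofReal_ne_top), mul_comm]

section Solution

variable {ζ : ℝ → ℝ} {θ γ p q s T M : ℝ} {φ : 𝓢'(Sp N, ℂ)} {u : ℝ → Sp N → ℂ}

/-- The Morrey bound supplies the size; the definition of a solution supplies the boundedness away
from t = 0, without any rate. -/
theorem IsSolution.isForcing (hu : IsSolution ζ θ γ T φ u) (hb : MorreyBound θ p q s T M u)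
    (hq : 0 < q) (hM : 0 ≤ M) : IsForcing p q ((1 - s) / θ) T M fun t => grad (u t) := by
  refine ⟨hM, ?_, fun τ hτ => ?_, fun t ht => ?_⟩
  · rintro ⟨t, x⟩ ⟨ht, -⟩
    have ht0 : 0 < t := ht.1
    have h := (hu.bc_grad (t / 2) ⟨half_pos ht0, (half_lt_self ht0).trans ht.2⟩).1
    exact (h.continuousAt (prod_mem_nhds (Ioo_mem_nhds (by simp only; linarith) ht.2)
      univ_mem)).continuousWithinAt
  · rcases lt_or_ge τ T with h | h
    · obtain ⟨C, hC⟩ := (hu.bc_grad τ ⟨hτ, h⟩).2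
      exact ⟨max C 0, le_max_right _ _, fun t ht x => (hC t ht x).trans (le_max_left _ _)⟩
    · exact ⟨0, le_rfl, fun t ht => absurd (ht.1.trans ht.2) (not_lt.2 h)⟩
  · rw [← morreyNorm_eq_mor hq, ← ofReal_rpow_mul_le_iff ht.1]
    exact (hb t ht).2

/-- By uniqueness of the linear evolution, the one hidden in the definition of a solution is the one
already constructed. -/
theorem IsSolution.eq_add_duhamel (hθ : 1 < θ) {η T' : ℝ} {g : ℝ → Sp N → ℂ}
    (hg : IsLinearEvolution ζ θ p q s T' η φ g) (hu : IsSolution ζ θ γ T φ u) {t : ℝ}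
    (ht : t ∈ Ioo 0 T) (x : Sp N) :
    u t x = g t x +
      BesovMorrey.duhamel θ 0 (heatKernel θ 1) (powNorm γ fun t => grad (u t)) t x := by
  obtain ⟨g', hg', h⟩ := hu.duhamel t ht
  rw [(h x).2, hg'.unique (hg.evolution t ht.1), ← integral_heatFun_eq_duhamel hθ ht.1]
  rfl

variable {a b A η : ℝ} (hS : IsScaling N θ γ p q a b)
  (hG : IsKernel A (heatKernel θ 1 : Sp N → ℂ)) (hT : T ≤ 1) {g : ℝ → Sp N → ℂ}
  (hg : IsLinearEvolution ζ θ p q s T η φ g) {w : ℝ → Sp N → EuclideanSpace ℂ (Fin N)}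
  (hw : IsForcing p q a T M w)

include hS hG hT hg hw in
-- Passage from Duhamel's formula for u to the closed equation for its gradient.
theorem grad_add_duhamel {t : ℝ} (ht : t ∈ Ioo 0 T)
    (h : ∀ x, u t x = g t x + duhamel θ 0 (heatKernel θ 1) (powNorm γ w) t x) :
    Differentiable ℝ (u t) ∧
      ∀ x, grad (u t) x = gradMap N (fderiv ℝ (g t) x) + gradDuhamel θ γ w t x := by
  obtain ⟨hθ, hγ, hq, hp, -, -, hβ, -, -, -, -⟩ := hS
  have hd : ∀ x, HasFDerivAt (u t) (fderiv ℝ (g t) x +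
      duhamel θ (1 / θ) (fderiv ℝ (heatKernel θ 1)) (powNorm γ w) t x) x := fun x => by
    rw [funext h]
    exact (hg.differentiable t ht.1 x).hasFDerivAt.add
      (hasFDerivAt_duhamel hθ hG hγ hq hp hβ hT (hw.powNorm hγ (by linarith)) ht x)
  refine ⟨fun x => (hd x).differentiableAt, fun x => ?_⟩
  rw [grad_eq_gradMap, (hd x).fderiv, map_add, gradDuhamel]

include hS hG hT hw in
theorem exists_norm_duhamel_zero_le {τ : ℝ} (hτ : 0 < τ) :
    ∃ B : ℝ, ∀ t ∈ Ioo τ T, ∀ x,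
      ‖duhamel θ 0 (heatKernel θ 1) (powNorm γ w) t x‖ ≤ B := by
  obtain ⟨hθ, hγ, hq, hp, ha, -, hβ, -, -, -, -⟩ := hS
  have hθ0 : 0 < θ := by linarith
  obtain ⟨C₁, C₂, h₁, h₂, h⟩ := exists_duhamelIntegrand_le_add hG.nonneg hG.norm_le hθ0 le_rfl
    hγ hq hp hT (hw.powNorm hγ (by linarith)) hτ
  refine ⟨C₁ * (1 / (1 - a * γ)) + C₂ * (1 / (1 - 0)), fun t ht x => ?_⟩
  have ht0 : 0 < t := hτ.trans ht.1
  have ht1 : t ≤ 1 := ht.2.le.trans hT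
  have hβ' : 0 < 1 - a * γ := by linarith
  obtain ⟨i₁, i₂⟩ := integral_add_rpow_neg (t := t) hβ zero_lt_one C₁ C₂
  refine (intervalIntegral.norm_integral_le_of_norm_le ht0.le ?_ i₁).trans (i₂.trans_le ?_)
  · filter_upwards [ae_mem_Ioo_of_mem_uIoc ht0] with σ hσ h'
    exact h t ⟨ht.1.le, ht.2⟩ σ (hσ (by rwa [uIoc_of_le ht0.le])) x
  · have e₁ : t ^ (1 - a * γ) ≤ 1 := Real.rpow_le_one ht0.le ht1 hβ'.le
    have e₂ : t ^ (1 - (0 : ℝ)) ≤ 1 := Real.rpow_le_one ht0.le ht1 (by norm_num)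
    gcongr

include hS hG hT hg in
-- A fixed point w of the gradient equation is the gradient of the function that Duhamel's formula
-- builds from it, so |w|^γ there may be read as |∇u|^γ.
theorem isSolution_of_fixed (hw : IsField p q a b T M w)
    (e : ∀ t ∈ Ioo 0 T, ∀ x, w t x = gradMap N (fderiv ℝ (g t) x) + gradDuhamel θ γ w t x) :
    IsSolution ζ θ γ T φ
      (fun t x => g t x + duhamel θ 0 (heatKernel θ 1) (powNorm γ w) t x) ∧
    ∀ t ∈ Ioo 0 T,
      grad (fun x => g t x + duhamel θ 0 (heatKernel θ 1) (powNorm γ w) t x) = w t := by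
  have hwF := hw.isForcing hS.b_nonneg
  have hgrad : ∀ t ∈ Ioo 0 T,
      grad (fun x => g t x + duhamel θ 0 (heatKernel θ 1) (powNorm γ w) t x) = w t :=
    fun t ht => funext fun x => by
      rw [e t ht x]
      exact (grad_add_duhamel (u := fun t x => g t x +
        duhamel θ 0 (heatKernel θ 1) (powNorm γ w) t x) hS hG hT hg hwF ht fun _ => rfl).2 x
  refine ⟨⟨fun t ht => ?_, fun τ hτ => ⟨?_, ?_⟩, fun τ hτ => ⟨?_, ?_⟩, fun t ht => ?_⟩, hgrad⟩
  · exact (grad_add_duhamel (u := fun t x => g t x +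
      duhamel θ 0 (heatKernel θ 1) (powNorm γ w) t x) hS hG hT hg hwF ht fun _ => rfl).1
  · obtain ⟨hθ, hγ, hq, hp, ha, -, hβ, -, -, -, -⟩ := hS
    have hθ0 : 0 < θ := by linarith
    have h1 := continuousOn_duhamel hG.nonneg hG.contDiff.continuous hG.norm_le hθ0 le_rfl
      zero_lt_one hγ hq hp (by positivity) hβ hT (hwF.powNorm hγ (by linarith))
    exact (hg.continuousOn.mono (prod_mono (fun t ht => hτ.1.trans ht.1) subset_rfl)).add
      (h1.mono (prod_mono (Ioo_subset_Ioo_left hτ.1.le) subset_rfl))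
  · obtain ⟨B₁, hB₁⟩ := hg.bounded τ hτ.1
    obtain ⟨B₂, hB₂⟩ := exists_norm_duhamel_zero_le hS hG hT hwF hτ.1
    exact ⟨B₁ + B₂, fun t ht x => (norm_add_le _ _).trans
      (add_le_add (hB₁ t ht.1.le (ht.2.le.trans hT) x) (hB₂ t ht x))⟩
  · refine (hw.continuousOn.mono (prod_mono (Ioo_subset_Ioo_left hτ.1.le) subset_rfl)).congr ?_
    rintro ⟨t, x⟩ ⟨ht, -⟩
    exact congrFun (hgrad t ⟨hτ.1.trans ht.1, ht.2⟩) x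
  · obtain ⟨B, -, hB⟩ := hwF.bounded τ hτ.1
    exact ⟨B, fun t ht x => by
      simp only [hgrad t ⟨hτ.1.trans ht.1, ht.2⟩]
      exact hB t ht x⟩
  · obtain ⟨hθ, hγ, hq, hp, ha, -, hβ, -, -, -, -⟩ := hS
    have hP := hwF.powNorm hγ (by linarith)
    have hcongr : ∀ x, ∀ᵐ τ : ℝ, τ ∈ Ι 0 t → heatFun θ (t - τ) (powNorm γ w τ) x =
        heatFun θ (t - τ) (fun y => ((‖grad (fun x => g τ x +
          duhamel θ 0 (heatKernel θ 1) (powNorm γ w) τ x) y‖ ^ γ : ℝ) : ℂ)) x := fun x => by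
      filter_upwards [ae_mem_Ioo_of_mem_uIoc ht.1] with τ hτ h'
      rw [hgrad τ ⟨(hτ h').1, (hτ h').2.trans ht.2⟩]
      rfl
    refine ⟨g t, hg.evolution t ht.1, fun x => ⟨?_, ?_⟩⟩
    · refine (intervalIntegrable_heatFun hθ hG hγ hq hp hβ hT hP ht x).congr_ae ?_
      rw [EventuallyEq, ae_restrict_iff' measurableSet_uIoc]
      exact hcongr x
    · rw [← intervalIntegral.integral_congr_ae (hcongr x), integral_heatFun_eq_duhamel hθ ht.1]

end Solution

/-! ### The exponents -/

/-- With n = N/p the hypotheses become three inequalities. (1-s)γ < θ gives integrability at τ = 0.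
n(γ-1) < θ - 1 gives integrability at τ = t, with a gradient to spare. The relations between powers
of t all reduce to (n+1-s)(γ-1) ≤ θ - 1, the scaling condition. -/
theorem isScaling {θ γ p q s : ℝ} (hγ : 1 < γ) (hγθ : γ < θ) (hγq : γ ≤ q) (hqp : q ≤ p)
    (hp : (N : ℝ) * (γ - 1) / (θ - 1) < p) (hs₁ : 1 - θ / γ < s) (hs₂ : s < 0)
    (hs₃ : (N : ℝ) / p + (γ - θ) / (γ - 1) ≤ s) :
    IsScaling N θ γ p q ((1 - s) / θ) ((1 - s + N / p) / θ) ∧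
      s / θ ≤ 1 - (0 + N * (γ - 1) / (p * θ)) - (1 - s) / θ * γ ∧
      0 + N * (γ - 1) / (p * θ) < 1 := by
  have hp0 : 0 < p := by linarith
  have hθ0 : 0 < θ := by linarith
  have hγ0 : 0 < γ := by linarith
  have hγ1 : 0 < γ - 1 := by linarith
  set n : ℝ := N / p with hn
  have hn0 : 0 ≤ n := by positivity
  have H : n * (γ - 1) + (1 - s) * (γ - 1) ≤ θ - 1 := by
    have h := mul_le_mul_of_nonneg_right hs₃ hγ1.le
    rw [add_mul, div_mul_cancel₀ _ hγ1.ne'] at h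
    linarith
  have H₁ : (1 - s) * γ < θ := by
    have h := mul_lt_mul_of_pos_right hs₁ hγ0
    rw [sub_mul, div_mul_cancel₀ _ hγ0.ne'] at h
    linarith
  have H₂ : n * (γ - 1) < θ - 1 := by
    rw [div_lt_iff₀ (by linarith)] at hp
    rw [hn, div_mul_eq_mul_div, div_lt_iff₀ hp0]
    linarith
  have e₁ : (N : ℝ) * (γ - 1) / (p * θ) = n * (γ - 1) / θ := by rw [hn]; field_simp
  have e₂ : (N : ℝ) * γ / (p * θ) = n * γ / θ := by rw [hn]; field_simp
  have key : ∀ x y : ℝ, x * θ ≤ y * θ → x ≤ y := fun x y h => le_of_mul_le_mul_right h hθ0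
  have key' : ∀ x y : ℝ, x * θ < y * θ → x < y := fun x y h => lt_of_mul_lt_mul_right h hθ0.le
  refine ⟨⟨by linarith, hγ, hγq, hp0, div_nonneg (by linarith) hθ0.le,
    div_nonneg (by linarith) hθ0.le, ?_, ?_, ?_, ?_, ?_⟩, ?_, ?_⟩
  · refine key' _ _ ?_
    field_simp
    linarith
  · rw [e₁]
    refine key' _ _ ?_
    field_simp
    linarith
  · rw [e₁]
    refine key _ _ ?_
    field_simp
    linarith
  · rw [e₂]
    refine key _ _ ?_
    field_simp
    linarith
  · refine key _ _ ?_
    field_simp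
    linarith
  · rw [e₁]
    refine key _ _ ?_
    field_simp
    linarith
  · rw [e₁]
    refine key' _ _ ?_
    field_simp
    linarith

theorem IsLinearEvolution.isField {ζ : ℝ → ℝ} {θ p q s T η M : ℝ} {φ : 𝓢'(Sp N, ℂ)}
    {g : ℝ → Sp N → ℂ} (hg : IsLinearEvolution ζ θ p q s T η φ g) (hq : 0 < q) (hM0 : 0 ≤ M)
    (hM : ‖gradMap N‖ * η ≤ M) :
    IsField p q ((1 - s) / θ) ((1 - s + N / p) / θ) T M
      fun t x => gradMap N (fderiv ℝ (g t) x) := by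
  have hc0 : 0 ≤ ‖gradMap N‖ := norm_nonneg (gradMap N)
  refine ⟨hM0, (gradMap N).continuous.comp_continuousOn
    (hg.continuousOn_fderiv.mono (prod_mono (fun t ht => ht.1) subset_rfl)), fun t ht x => ?_,
    fun t ht => ?_⟩
  · have ht0 := ht.1
    have h := hg.norm_fderiv_le t ht.1 ht.2.le x
    have hp : 0 < t ^ ((1 - s + N / p) / θ) := by positivity
    rw [Real.rpow_neg ht0.le, ← div_eq_mul_inv, le_div_iff₀ hp]
    calc _ ≤ ‖gradMap N‖ * ‖fderiv ℝ (g t) x‖ * t ^ ((1 - s + N / p) / θ) := by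
          gcongr
          exact (gradMap N).le_opNorm _
      _ = ‖gradMap N‖ * (t ^ ((1 - s + N / p) / θ) * ‖fderiv ℝ (g t) x‖) := by ring
      _ ≤ ‖gradMap N‖ * η := by gcongr
      _ ≤ M := hM
  · have ht0 := ht.1
    have h := (ofReal_rpow_mul_le_iff ht0).1 (hg.mor_fderiv_le t ht.1 ht.2.le)
    refine (mor_mono hq.le fun x => enorm_gradMap_le _).trans ?_
    refine (mor_const_mul_le hq ENNReal.ofReal_ne_top _).trans ?_
    refine (mul_le_mul_right h _).trans ?_
    rw [← ENNReal.ofReal_mul hc0, ← mul_assoc]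
    refine ENNReal.ofReal_le_ofReal ?_
    gcongr

end BesovMorrey

end

/-! ### The main theorem: choice of constants, existence, uniqueness and reality -/

theorem theorem1p2 (N : ℕ) (hN : 1 ≤ N) (ζ : ℝ → ℝ) (hζ : BesovMorrey.IsCutoff ζ)
    (θ γ p q s : ℝ) (hγ : 1 < γ) (hγθ : γ < θ) (hγq : γ ≤ q) (hqp : q ≤ p)
    (hp : (N : ℝ) * (γ - 1) / (θ - 1) < p)
    (hs₁ : 1 - θ / γ < s) (hs₂ : s < 0)
    (hs₃ : (N : ℝ) / p + (γ - θ) / (γ - 1) ≤ s) :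
    ∃ δ : ℝ, 0 < δ ∧ ∃ M : ℝ, 0 < M ∧
      ∀ φ : TemperedDistribution (BesovMorrey.Sp N) ℂ,
        BesovMorrey.MemBesovMorrey ζ p q s φ →
        Filter.limsup (fun j : ℕ => BesovMorrey.weightedBlock ζ p q s φ j) Filter.atTop
          < ENNReal.ofReal δ →
        ∃ T : ℝ, 0 < T ∧ ∃ u : ℝ → BesovMorrey.Sp N → ℂ,
          BesovMorrey.IsSolution ζ θ γ T φ u ∧
          BesovMorrey.MorreyBound θ p q s T M u ∧
          (∀ v : ℝ → BesovMorrey.Sp N → ℂ,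
            BesovMorrey.IsSolution ζ θ γ T φ v →
            BesovMorrey.MorreyBound θ p q s T M v →
            ∀ t ∈ Set.Ioo 0 T, ∀ x, v t x = u t x) ∧
          (BesovMorrey.IsRealDist φ → ∀ t ∈ Set.Ioo 0 T, ∀ x, (u t x).im = 0) := by
  obtain ⟨hS, e₀, e₁⟩ := BesovMorrey.isScaling hγ hγθ hγq hqp hp hs₁ hs₂ hs₃
  have hθ : 1 < θ := hS.one_lt_θ
  have hp0 : 0 < p := hS.p_pos
  have hθ0 : 0 < θ := by linarith
  have hq1 : 1 ≤ q := by linarith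
  have hγ0 : 0 < γ := by linarith
  have hγ1 : 0 < γ - 1 := by linarith
  obtain ⟨A, -, hG⟩ := BesovMorrey.exists_isKernel_heatKernel (N := N) hζ hθ
  obtain ⟨C, hC, hlin⟩ := BesovMorrey.exists_linearEvolution N hζ hθ hq1 hp0 hs₂
  obtain ⟨K, hK0, hK⟩ := BesovMorrey.exists_gradDuhamel_bounds hS hG
  obtain ⟨C₀, hC₀, h₀⟩ := BesovMorrey.exists_mor_duhamel_le hG.nonneg hG.contDiff.continuous
    hG.norm_le hθ0 le_rfl hγ hγq hp0 (mul_nonneg hS.a_nonneg hγ0.le) hS.mul_lt e₁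
  -- M solves (K + C₀) M^{γ-1} = 1/2. This yields the contraction factor K M^{γ-1} ≤ 1/2 and also C₀
  -- M^γ ≤ M/2, the Morrey bound for the Duhamel term of u itself.
  set M : ℝ := (1 / (2 * (K + C₀))) ^ (1 / (γ - 1)) with hM
  have hM0 : 0 < M := by positivity
  have hMpow : M ^ (γ - 1) = 1 / (2 * (K + C₀)) := by
    rw [hM, ← Real.rpow_mul (by positivity), one_div_mul_cancel hγ1.ne', Real.rpow_one]
  have hKM : K * M ^ (γ - 1) ≤ 1 / 2 := by
    rw [hMpow, mul_one_div, div_le_div_iff₀ (by positivity) (by positivity)]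
    linarith
  have hCM : C₀ * M ^ γ ≤ M / 2 := by
    have h1 : C₀ * M ^ (γ - 1) ≤ 1 / 2 := by
      rw [hMpow, mul_one_div, div_le_div_iff₀ (by positivity) (by positivity)]
      linarith
    calc C₀ * M ^ γ = C₀ * M ^ (γ - 1) * M := by
          rw [mul_assoc, ← Real.rpow_add_one hM0.ne', sub_add_cancel]
      _ ≤ 1 / 2 * M := by gcongr
      _ = M / 2 := by ring
  set c : ℝ := ‖BesovMorrey.gradMap N‖ with hc
  have hc0 : 0 ≤ c := norm_nonneg (BesovMorrey.gradMap N)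
  -- With this δ the linear evolution has weighted norm at most Cδ = M/(2(c+1)), so both it and its
  -- multiple by c, the norm of `gradMap`, are at most M/2.
  refine ⟨M / (2 * (c + 1) * C), by positivity, M, hM0, fun φ hφ hlim => ?_⟩
  obtain ⟨T, hT0, hT1, g, hg⟩ := hlin _ (by positivity) φ hφ hlim
  set η : ℝ := C * (M / (2 * (c + 1) * C)) with hη
  have hη' : η = M / (2 * (c + 1)) := by rw [hη]; field_simp
  have hη₁ : η ≤ M / 2 := by
    rw [hη']
    gcongr
    linarith
  have hη₂ : c * η ≤ M / 2 := by
    rw [hη', mul_div_assoc', div_le_div_iff₀ (by positivity) (by positivity)]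
    nlinarith
  have hl := hg.isField (by linarith) (by positivity) hη₂
  obtain ⟨w, hw, hfix⟩ := BesovMorrey.exists_fixed hS hKM
    (fun D w₁ w₂ => (hK T M D w₁ w₂ hT1).2) hl
  obtain ⟨hsol, hgrad⟩ := BesovMorrey.isSolution_of_fixed hS hG hT1 hg hw hfix
  have hwF := hw.isForcing hS.b_nonneg
  have hP := hwF.powNorm hγ (by linarith)
  set u : ℝ → BesovMorrey.Sp N → ℂ := fun t x => g t x +
    BesovMorrey.duhamel θ 0 (BesovMorrey.heatKernel θ 1) (BesovMorrey.powNorm γ w) t x with hu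
  have hbound : BesovMorrey.MorreyBound θ p q s T M u := by
    intro t ht
    have ht0 := ht.1
    rw [BesovMorrey.morreyNorm_eq_mor (by linarith), BesovMorrey.morreyNorm_eq_mor (by linarith),
      BesovMorrey.ofReal_rpow_mul_le_iff ht0, BesovMorrey.ofReal_rpow_mul_le_iff ht0]
    refine ⟨?_, ?_⟩
    · have h1 := (BesovMorrey.ofReal_rpow_mul_le_iff ht0).1 (hg.mor_le t ht0 ht.2.le)
      have h2 := h₀ T _ _ hT1 hP t ht
      have hcont : Continuous (BesovMorrey.duhamel θ 0 (BesovMorrey.heatKernel θ 1)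
          (BesovMorrey.powNorm γ w) t) :=
        BesovMorrey.continuous_slice (F := BesovMorrey.duhamel θ 0 (BesovMorrey.heatKernel θ 1)
          (BesovMorrey.powNorm γ w)) (BesovMorrey.continuousOn_duhamel hG.nonneg
          hG.contDiff.continuous hG.norm_le hθ0 le_rfl zero_lt_one hγ hγq hp0
          (mul_nonneg hS.a_nonneg hγ0.le) hS.mul_lt hT1 hP) ht
      refine (BesovMorrey.mor_norm_add_le hq1 (hg.evolution t ht0).1 hcont).trans ?_
      refine (add_le_add h1 h2).trans ?_
      rw [← ENNReal.ofReal_add (by positivity) (by positivity)]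
      refine ENNReal.ofReal_le_ofReal ?_
      have h3 := BesovMorrey.rpow_le_rpow_of_le_one ht0 (ht.2.le.trans hT1) e₀
      have e : -(-s / θ) = s / θ := by ring
      rw [e]
      calc _ ≤ M / 2 * t ^ (s / θ) + M / 2 * t ^ (s / θ) := by gcongr
        _ = _ := by ring
    · rw [hgrad t ht]
      exact hw.mor_le t ht
  refine ⟨T, hT0, u, hsol, hbound, fun v hv hvb t ht x => ?_, fun hreal t ht x => ?_⟩
  -- Gradients of two solutions in the class are fixed points of the same map and agree; Duhamel's
  -- formula then forces the solutions themselves to agree.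
  · have hfixed : ∀ v : ℝ → BesovMorrey.Sp N → ℂ, BesovMorrey.IsSolution ζ θ γ T φ v →
        BesovMorrey.MorreyBound θ p q s T M v → ∀ t ∈ Set.Ioo 0 T, ∀ x,
        BesovMorrey.grad (v t) x = BesovMorrey.gradMap N (fderiv ℝ (g t) x) +
          BesovMorrey.gradDuhamel θ γ (fun t => BesovMorrey.grad (v t)) t x :=
      fun v hv hvb t ht => (BesovMorrey.grad_add_duhamel hS hG hT1 hg
        (hv.isForcing hvb (by linarith) hM0.le) ht (hv.eq_add_duhamel hθ hg ht)).2
    have heq : ∀ t ∈ Set.Ioo 0 T, ∀ x, BesovMorrey.grad (v t) x = BesovMorrey.grad (u t) x :=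
      fun t ht x => BesovMorrey.eq_of_fixed hS hKM (fun D w₁ w₂ => (hK T M D w₁ w₂ hT1).1)
        (hv.isForcing hvb (by linarith) hM0.le) (hsol.isForcing hbound (by linarith) hM0.le)
        (hfixed v hv hvb) (hfixed u hsol hbound) ht x
    rw [hv.eq_add_duhamel hθ hg ht, hsol.eq_add_duhamel hθ hg ht,
      ← BesovMorrey.integral_heatFun_eq_duhamel hθ ht.1,
      ← BesovMorrey.integral_heatFun_eq_duhamel hθ ht.1]
    congr 1
    refine intervalIntegral.integral_congr_ae ?_
    filter_upwards [BesovMorrey.ae_mem_Ioo_of_mem_uIoc ht.1] with τ hτ h'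
    have h := funext (heq τ ⟨(hτ h').1, (hτ h').2.trans ht.2⟩)
    simp only [BesovMorrey.heatFun, BesovMorrey.powNorm, h]
  · rw [hu]
    simp only [Complex.add_im]
    rw [(hg.evolution t ht.1).im_eq_zero hζ ht.1.le hreal x,
      BesovMorrey.duhamel_im (F := BesovMorrey.powNorm γ w) (fun t x => Complex.ofReal_im _), add_zero]
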